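/- Let $k$ be a commutative ring and let $\mathcal H=(\mathcal H_l,\mathcal H_r,S)$ be a Hopf algebroid over $k$ with involutive antipode, $S^2=\mathrm{id}$: a $k$-algebra $\mathcal H$ with a left bialgebroid structure $(s_l,t_l,\Delta_l,\epsilon_l)$ over a $k$-algebra $A_l$, a right bialgebroid structure $(s_r,t_r,\Delta_r,\epsilon_r)$ over a $k$-algebra $A_r$, and a bijective $k$-linear map $S:\mathcal H\to\mathcal H$ such that $s_l\epsilon_lt_r=t_r$, $t_l\epsilon_ls_r=s_r$, $s_r\epsilon_rt_l=t_l$, $t_r\epsilon_rs_l=s_l$; $(\Delta_l\otimes\mathrm{id})\Delta_r=(\mathrm{id}\otimes\Delta_r)\Delta_l$ and $(\Delta_r\otimes\mathrm{id})\Delta_l=(\mathrm{id}\otimes\Delta_l)\Delta_r$; $S(t_l(a)ht_r(b))=s_r(b)S(h)s_l(a)$; $S(h_{(1)})h_{(2)}=s_r\epsilon_r(h)$ and $h^{(1)}S(h^{(2)})=s_l\epsilon_l(h)$, where $\Delta_l(h)=h_{(1)}\otimes h_{(2)}$ and $\Delta_r(h)=h^{(1)}\otimes h^{(2)}$. *Hopf-cyclic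 cohomology.* Let $C^n=\mathcal H^{\otimes_{A_l}n}$ for the bimodule structure $a\cdot h\cdot b=s_l(a)t_l(b)h$, with $C^0=A_l$. It is a cocyclic $k$-module with cofaces $\delta_0(x)=1\otimes x$, $\delta_i$ ($1\le i\le n$) applying $\Delta_l$ to the $i$-th factor, $\delta_{n+1}(x)=x\otimes1$ (and $\delta_0=t_l$, $\delta_1=s_l$ for $n=0$), codegeneracies $\sigma_i$ applying $\epsilon_l$ to the $(i+1)$-st factor, and cyclic operator $\tau_n(h^1\otimes\cdots\otimes h^n)=S(h^1)\cdot(h^2\otimes\cdots\otimes h^n\otimes1)$, where $\mathcal H$ acts diagonally through $\Delta_l$. $HH^\bullet(\mathcal H)$ and $HC^\bullet(\mathcal H)$ denote its Hochschild cohomology and the cyclic cohomology of its mixed complex $(C^\bullet,b,B)$. *Dual Hopf-cyclic homology.* Let $C_n=\mathcal H^{\otimes_{A_r}n}$ for the bimodule structure $a\cdot h\cdot b=s_r(a)hs_r(b)$, with $C_0=A_r$. It is a cyclic $k$-module with faces $d_0(h^1\otimes\cdots\otimes h^n)=\epsilon_r(h^1)\cdot h^2\otimes\cdots\otimes h^n$,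 $d_i$ ($1\le i\le n-1$) multiplying $h^i$ and $h^{i+1}$, $d_n(h^1\otimes\cdots\otimes h^n)=h^1\otimes\cdots\otimes h^{n-1}\cdot\epsilon_r(S^{-1}h^n)$ (so $d_0=\epsilon_r$, $d_1=\epsilon_rS^{-1}$ for $n=1$), degeneracies $s_i$ inserting $1$ after the $i$-th factor ($s_0=s_r$ on $C_0$), and cyclic operator $t_n(h^1\otimes\cdots\otimes h^n)=S^{-1}(h^1_{(2)}\cdots h^{n-1}_{(2)}h^n)\otimes h^1_{(1)}\otimes\cdots\otimes h^{n-1}_{(1)}$. $HH_\bullet(\mathcal H)$ and $HC_\bullet(\mathcal H)$ denote its Hochschild homology and the cyclic homology of its mixed complex $(C_\bullet,b,B)$. **Theorem.** (i) Suppose that $\mathcal H$ is commutative with $A_l=A_r$, $s_l=t_r$, $t_l=s_r$, $\Delta_l=\Delta_r$, $\epsilon_l=\epsilon_r$, and that $\mathcal H$ is flat as a right $A_l$-module ($h\cdot a=t_l(a)h$). Then for every $n\ge0$ there is an isomorphism of $k$-modules $$HC^n(\mathcal H)\cong\bigoplus_{0\le i\le n/2}HH^{n-2i}(\mathcal H).$$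 (ii) Suppose that $\mathcal H$ is cocommutative, i.e. $s_l=t_l$, $s_r=t_r$ (so that $A_l$ and $A_r$ are commutative) and $h_{(1)}\otimes h_{(2)}=h_{(2)}\otimes h_{(1)}$ for all $h$, and that $\mathcal H$ is projective as a left $A_r$-module ($a\cdot h=s_r(a)h$). Then for every $n\ge0$ there is an isomorphism of $k$-modules $$HC_n(\mathcal H)\cong\bigoplus_{0\le i\le n/2}HH_{n-2i}(\mathcal H),$$ natural with respect to morphisms of Hopf algebroids, i.e. triples of $k$-algebra maps $A_l\to A_l'$, $A_r\to A_r'$, $\mathcal H\to\mathcal H'$ that are compatible with all structure maps. -/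

import Mathlib

open scoped TensorProduct DirectSum
open MulOpposite (op)

universe v u

namespace HopfAlgd

section Balanced

variable {k : Type v} [CommRing k] {A B : Type*}
  {N M P N' M' : Type*} [AddCommGroup N] [Module k N] [AddCommGroup M] [Module k M]
  [AddCommGroup P] [Module k P] [AddCommGroup N'] [Module k N'] [AddCommGroup M'] [Module k M']

/-- The relations `n·a ⊗ m = n ⊗ a·m`, for a right action `ρ` on `N` and a left action `l` on `M`. -/
def balRel (ρ : A → N →ₗ[k] N) (l : A → M →ₗ[k] M) : Submodule k (N ⊗[k] M) :=
  Submodule.span k {z | ∃ a n m, z = ρ a n ⊗ₜ[k] m - n ⊗ₜ[k] l a m}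

/-- The balanced tensor product `N ⊗_A M` over a (possibly noncommutative) `k`-algebra `A`,
as a quotient of `N ⊗[k] M`. -/
abbrev BalTensor (ρ : A → N →ₗ[k] N) (l : A → M →ₗ[k] M) : Type _ :=
  (N ⊗[k] M) ⧸ balRel ρ l

theorem balRel_le_ker {ρ : A → N →ₗ[k] N} {l : A → M →ₗ[k] M} {f : N ⊗[k] M →ₗ[k] P}
    (h : ∀ a n m, f (ρ a n ⊗ₜ m) = f (n ⊗ₜ l a m)) : balRel ρ l ≤ LinearMap.ker f := by
  refine Submodule.span_le.2 ?_
  rintro _ ⟨a, n, m, rfl⟩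
  simp [h]

/-- A balanced map descends to the balanced tensor product. -/
def balLift (ρ : A → N →ₗ[k] N) (l : A → M →ₗ[k] M) (f : N ⊗[k] M →ₗ[k] P)
    (h : ∀ a n m, f (ρ a n ⊗ₜ m) = f (n ⊗ₜ l a m)) : BalTensor ρ l →ₗ[k] P :=
  (balRel ρ l).liftQ f (balRel_le_ker h)

theorem bal_rel {ρ : A → N →ₗ[k] N} {l : A → M →ₗ[k] M} (a : A) (n : N) (m : M) :
    (balRel ρ l).mkQ (ρ a n ⊗ₜ m) = (balRel ρ l).mkQ (n ⊗ₜ l a m) := by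
  rw [Submodule.mkQ_apply, Submodule.mkQ_apply, Submodule.Quotient.eq]
  exact Submodule.subset_span ⟨a, n, m, rfl⟩

theorem bal_ext {ρ : A → N →ₗ[k] N} {l : A → M →ₗ[k] M} {f g : BalTensor ρ l →ₗ[k] P}
    (h : ∀ n m, f ((balRel ρ l).mkQ (n ⊗ₜ m)) = g ((balRel ρ l).mkQ (n ⊗ₜ m))) : f = g := by
  apply Submodule.linearMap_qext
  apply TensorProduct.ext'
  exact h

/-- The triple tensor product `N ⊗_A M ⊗_B P`. -/
def tripleRel (ρ : A → N →ₗ[k] N) (l : A → M →ₗ[k] M) (ρ' : B → M →ₗ[k] M) (l' : B → P →ₗ[k] P) :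
    Submodule k (N ⊗[k] (M ⊗[k] P)) :=
  Submodule.span k
    ({z | ∃ a n m p, z = ρ a n ⊗ₜ[k] (m ⊗ₜ[k] p) - n ⊗ₜ[k] (l a m ⊗ₜ[k] p)} ∪
     {z | ∃ b n m p, z = n ⊗ₜ[k] (ρ' b m ⊗ₜ[k] p) - n ⊗ₜ[k] (m ⊗ₜ[k] l' b p)})

abbrev Triple (ρ : A → N →ₗ[k] N) (l : A → M →ₗ[k] M) (ρ' : B → M →ₗ[k] M)
    (l' : B → P →ₗ[k] P) : Type _ :=
  (N ⊗[k] (M ⊗[k] P)) ⧸ tripleRel ρ l ρ' l'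

variable (ρ : A → N →ₗ[k] N) (l : A → M →ₗ[k] M) (ρ' : B → M →ₗ[k] M) (l' : B → P →ₗ[k] P)

/-- `n, (m ⊗ p) ↦ n ⊗ m ⊗ p`. -/
def triplePre : N →ₗ[k] BalTensor ρ' l' →ₗ[k] Triple ρ l ρ' l' :=
  (balLift ρ' l'
    (LinearMap.flip ((TensorProduct.mk k N (M ⊗[k] P)).compr₂ (tripleRel ρ l ρ' l').mkQ))
    (by
      intro b m p
      ext n
      simp only [LinearMap.flip_apply, LinearMap.compr₂_apply, TensorProduct.mk_apply]
      rw [Submodule.mkQ_apply, Submodule.mkQ_apply, Submodule.Quotient.eq]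
      exact Submodule.subset_span (Or.inr ⟨b, n, m, p, rfl⟩))).flip

/-- `(n ⊗ m), p ↦ n ⊗ m ⊗ p`. -/
def triplePost : BalTensor ρ l →ₗ[k] P →ₗ[k] Triple ρ l ρ' l' :=
  balLift ρ l
    (TensorProduct.curry ((tripleRel ρ l ρ' l').mkQ ∘ₗ (TensorProduct.assoc k N M P).toLinearMap))
    (by
      intro a n m
      ext p
      simp only [TensorProduct.curry_apply, LinearMap.comp_apply, LinearEquiv.coe_coe,
        TensorProduct.assoc_tmul]
      rw [Submodule.mkQ_apply, Submodule.mkQ_apply, Submodule.Quotient.eq]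
      exact Submodule.subset_span (Or.inl ⟨a, n, m, p, rfl⟩))

/-- `id ⊗ D` for `D : Q → M ⊗_B P`. -/
def idTensor {Q : Type*} [AddCommGroup Q] [Module k Q] (D : Q →ₗ[k] BalTensor ρ' l') :
    N ⊗[k] Q →ₗ[k] Triple ρ l ρ' l' :=
  TensorProduct.lift ((triplePre ρ l ρ' l').compl₂ D)

/-- `D ⊗ id` for `D : Q → N ⊗_A M`. -/
def tensorId {Q : Type*} [AddCommGroup Q] [Module k Q] (D : Q →ₗ[k] BalTensor ρ l) :
    Q ⊗[k] P →ₗ[k] Triple ρ l ρ' l' :=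
  TensorProduct.lift (triplePost ρ l ρ' l' ∘ₗ D)

end Balanced

section Bialgebroids

variable (k : Type v) [CommRing k]

/-- An `(s,t)`-ring over `A`: homomorphisms `s : A → H` and `t : Aᵒᵖ → H` with commuting images. -/
structure STRing (A H : Type u) [Ring A] [Algebra k A] [Ring H] [Algebra k H] where
  s : A →ₐ[k] H
  t : Aᵐᵒᵖ →ₐ[k] H
  comm : ∀ a b, s a * t (op b) = t (op b) * s a

variable {k} {A H : Type u} [Ring A] [Algebra k A] [Ring H] [Algebra k H]

namespace STRing

variable (R : STRing k A H)

/-- `h ↦ s(a)h` -/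
def sL (a : A) : H →ₗ[k] H := LinearMap.mulLeft k (R.s a)
/-- `h ↦ t(a)h` -/
def tL (a : A) : H →ₗ[k] H := LinearMap.mulLeft k (R.t (op a))
/-- `h ↦ h s(a)` -/
def sR (a : A) : H →ₗ[k] H := LinearMap.mulRight k (R.s a)
/-- `h ↦ h t(a)` -/
def tR (a : A) : H →ₗ[k] H := LinearMap.mulRight k (R.t (op a))

@[simp] theorem sL_apply (a : A) (h : H) : R.sL a h = R.s a * h := rfl
@[simp] theorem tL_apply (a : A) (h : H) : R.tL a h = R.t (op a) * h := rfl
@[simp] theorem sR_apply (a : A) (h : H) : R.sR a h = h * R.s a := rfl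
@[simp] theorem tR_apply (a : A) (h : H) : R.tR a h = h * R.t (op a) := rfl

/-- The source map as a linear map. -/
def sLin : A →ₗ[k] H := R.s.toLinearMap
/-- The target map as a linear map. -/
def tLin : A →ₗ[k] H := R.t.toLinearMap ∘ₗ (MulOpposite.opLinearEquiv k).toLinearMap

@[simp] theorem sLin_apply (a : A) : R.sLin a = R.s a := rfl
@[simp] theorem tLin_apply (a : A) : R.tLin a = R.t (op a) := rfl

/-- `H ⊗_A H` for the bimodule structure `a₁·h·a₂ = s(a₁)t(a₂)h`. -/
abbrev TensL : Type _ := BalTensor R.tL R.sL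
/-- `H ⊗_A H` for the bimodule structure `a₁·h·a₂ = h t(a₁)s(a₂)`. -/
abbrev TensR : Type _ := BalTensor R.sR R.tR

/-- The class in `H ⊗_A H` (left version) of an element of `H ⊗_k H`. -/
def mkL : H ⊗[k] H →ₗ[k] R.TensL := (balRel R.tL R.sL).mkQ
/-- The class in `H ⊗_A H` (right version) of an element of `H ⊗_k H`. -/
def mkR : H ⊗[k] H →ₗ[k] R.TensR := (balRel R.sR R.tR).mkQ

theorem mkL_surjective (y : R.TensL) : ∃ X, R.mkL X = y := Submodule.mkQ_surjective _ y
theorem mkR_surjective (y : R.TensR) : ∃ X, R.mkR X = y := Submodule.mkQ_surjective _ y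

end STRing

/-- `x ⊗ y ↦ f(x) g(y)`. -/
def mulMap (f g : H →ₗ[k] H) : H ⊗[k] H →ₗ[k] H :=
  LinearMap.mul' k H ∘ₗ TensorProduct.map f g

/-- `x ⊗ y ↦ g(y) f(x)`. -/
def mulOpMap (f g : H →ₗ[k] H) : H ⊗[k] H →ₗ[k] H :=
  LinearMap.mul' k H ∘ₗ TensorProduct.map g f ∘ₗ (TensorProduct.comm k H H).toLinearMap

@[simp] theorem mulMap_tmul (f g : H →ₗ[k] H) (x y : H) : mulMap f g (x ⊗ₜ y) = f x * g y := rfl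
@[simp] theorem mulOpMap_tmul (f g : H →ₗ[k] H) (x y : H) :
    mulOpMap f g (x ⊗ₜ y) = g y * f x := rfl

variable (k A H)

/-- A left bialgebroid over `A`. An identity in Sweedler notation is stated for every representative
`X ∈ H ⊗_k H` of the coproduct, `mkL X = Δ h`. -/
structure LeftBialgebroid extends STRing k A H where
  Δ : H →ₗ[k] toSTRing.TensL
  ε : H →ₗ[k] A
  Δ_s : ∀ a h X, toSTRing.mkL X = Δ h → Δ (s a * h) = toSTRing.mkL ((s a ⊗ₜ 1) * X)
  Δ_t : ∀ a h X, toSTRing.mkL X = Δ h → Δ (t (op a) * h) = toSTRing.mkL ((1 ⊗ₜ t (op a)) * X)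
  ε_s : ∀ a h, ε (s a * h) = a * ε h
  ε_t : ∀ a h, ε (t (op a) * h) = ε h * a
  /-- coassociativity -/
  coassoc : ∀ h X, toSTRing.mkL X = Δ h →
    tensorId toSTRing.tL toSTRing.sL toSTRing.tL toSTRing.sL Δ X =
      idTensor toSTRing.tL toSTRing.sL toSTRing.tL toSTRing.sL Δ X
  /-- `s(ε(h₁)) h₂ = h` -/
  counit_left : ∀ h X, toSTRing.mkL X = Δ h →
    mulMap (toSTRing.sLin ∘ₗ ε) LinearMap.id X = h
  /-- `t(ε(h₂)) h₁ = h` -/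
  counit_right : ∀ h X, toSTRing.mkL X = Δ h →
    mulOpMap LinearMap.id (toSTRing.tLin ∘ₗ ε) X = h
  /-- `h₁ t(a) ⊗ h₂ = h₁ ⊗ h₂ s(a)`: the coproduct has values in the Takeuchi product -/
  takeuchi : ∀ h X, toSTRing.mkL X = Δ h →
    ∀ a, toSTRing.mkL (X * (t (op a) ⊗ₜ 1)) = toSTRing.mkL (X * (1 ⊗ₜ s a))
  Δ_one : Δ 1 = toSTRing.mkL (1 ⊗ₜ 1)
  Δ_mul : ∀ g h X Y, toSTRing.mkL X = Δ g → toSTRing.mkL Y = Δ h →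
    Δ (g * h) = toSTRing.mkL (X * Y)
  ε_one : ε 1 = 1
  ε_mul_s : ∀ g h, ε (g * h) = ε (g * s (ε h))
  ε_mul_t : ∀ g h, ε (g * h) = ε (g * t (op (ε h)))

/-- A right bialgebroid over `A`. -/
structure RightBialgebroid extends STRing k A H where
  Δ : H →ₗ[k] toSTRing.TensR
  ε : H →ₗ[k] A
  Δ_s : ∀ a h X, toSTRing.mkR X = Δ h → Δ (h * s a) = toSTRing.mkR (X * (1 ⊗ₜ s a))
  Δ_t : ∀ a h X, toSTRing.mkR X = Δ h → Δ (h * t (op a)) = toSTRing.mkR (X * (t (op a) ⊗ₜ 1))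
  ε_s : ∀ a h, ε (h * s a) = ε h * a
  ε_t : ∀ a h, ε (h * t (op a)) = a * ε h
  /-- coassociativity -/
  coassoc : ∀ h X, toSTRing.mkR X = Δ h →
    tensorId toSTRing.sR toSTRing.tR toSTRing.sR toSTRing.tR Δ X =
      idTensor toSTRing.sR toSTRing.tR toSTRing.sR toSTRing.tR Δ X
  /-- `h² t(ε(h¹)) = h` -/
  counit_left : ∀ h X, toSTRing.mkR X = Δ h →
    mulOpMap (toSTRing.tLin ∘ₗ ε) LinearMap.id X = h
  /-- `h¹ s(ε(h²)) = h` -/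
  counit_right : ∀ h X, toSTRing.mkR X = Δ h →
    mulMap LinearMap.id (toSTRing.sLin ∘ₗ ε) X = h
  /-- `s(a) h¹ ⊗ h² = h¹ ⊗ t(a) h²`: the coproduct has values in the Takeuchi product -/
  takeuchi : ∀ h X, toSTRing.mkR X = Δ h →
    ∀ a, toSTRing.mkR ((s a ⊗ₜ 1) * X) = toSTRing.mkR ((1 ⊗ₜ t (op a)) * X)
  Δ_one : Δ 1 = toSTRing.mkR (1 ⊗ₜ 1)
  Δ_mul : ∀ g h X Y, toSTRing.mkR X = Δ g → toSTRing.mkR Y = Δ h →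
    Δ (g * h) = toSTRing.mkR (X * Y)
  ε_one : ε 1 = 1
  ε_mul_s : ∀ g h, ε (g * h) = ε (s (ε g) * h)
  ε_mul_t : ∀ g h, ε (g * h) = ε (t (op (ε g)) * h)

end Bialgebroids

section HopfAlgebroids

variable (k : Type v) [CommRing k] (Al Ar H : Type u) [Ring Al] [Algebra k Al]
  [Ring Ar] [Algebra k Ar] [Ring H] [Algebra k H]

/-- A Hopf algebroid `(H_l, H_r, S)` with invertible antipode. -/
structure HopfAlgebroid where
  lft : LeftBialgebroid k Al H
  rgt : RightBialgebroid k Ar H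
  S : H ≃ₗ[k] H
  slεl_tr : ∀ a, lft.s (lft.ε (rgt.t (op a))) = rgt.t (op a)
  tlεl_sr : ∀ a, lft.t (op (lft.ε (rgt.s a))) = rgt.s a
  srεr_tl : ∀ a, rgt.s (rgt.ε (lft.t (op a))) = lft.t (op a)
  trεr_sl : ∀ a, rgt.t (op (rgt.ε (lft.s a))) = lft.s a
  /-- `(Δ_l ⊗ id) Δ_r = (id ⊗ Δ_r) Δ_l` in `H ⊗_{A_l} H ⊗_{A_r} H` -/
  twisted_lr : ∀ h X Y, lft.mkL X = lft.Δ h → rgt.mkR Y = rgt.Δ h →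
    tensorId lft.tL lft.sL rgt.sR rgt.tR lft.Δ Y = idTensor lft.tL lft.sL rgt.sR rgt.tR rgt.Δ X
  /-- `(Δ_r ⊗ id) Δ_l = (id ⊗ Δ_l) Δ_r` in `H ⊗_{A_r} H ⊗_{A_l} H` -/
  twisted_rl : ∀ h X Y, lft.mkL X = lft.Δ h → rgt.mkR Y = rgt.Δ h →
    tensorId rgt.sR rgt.tR lft.tL lft.sL rgt.Δ X = idTensor rgt.sR rgt.tR lft.tL lft.sL lft.Δ Y
  S_bimod : ∀ a b h, S (lft.t (op a) * h * rgt.t (op b)) = rgt.s b * S h * lft.s a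
  /-- `S(h₁) h₂ = s_r(ε_r(h))` -/
  antipode_left : ∀ h X, lft.mkL X = lft.Δ h →
    mulMap S.toLinearMap LinearMap.id X = rgt.s (rgt.ε h)
  /-- `h¹ S(h²) = s_l(ε_l(h))` -/
  antipode_right : ∀ h X, rgt.mkR X = rgt.Δ h →
    mulMap LinearMap.id S.toLinearMap X = lft.s (lft.ε h)

end HopfAlgebroids

namespace HopfAlgebroid

variable {k : Type v} [CommRing k] {Al Ar H : Type u} [Ring Al] [Algebra k Al]
  [Ring Ar] [Algebra k Ar] [Ring H] [Algebra k H] (𝓗 : HopfAlgebroid k Al Ar H)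

theorem S_tl_mul (a : Al) (h : H) : 𝓗.S (𝓗.lft.t (op a) * h) = 𝓗.S h * 𝓗.lft.s a := by
  simpa using 𝓗.S_bimod a 1 h

theorem S_mul_tr (b : Ar) (h : H) : 𝓗.S (h * 𝓗.rgt.t (op b)) = 𝓗.rgt.s b * 𝓗.S h := by
  simpa using 𝓗.S_bimod 1 b h

theorem S_sr_mul (b : Ar) (h : H) :
    𝓗.S (𝓗.rgt.s b * h) = 𝓗.S h * 𝓗.lft.s (𝓗.lft.ε (𝓗.rgt.s b)) := by
  rw [← 𝓗.S_tl_mul, 𝓗.tlεl_sr]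

theorem tl_tr_comm (a : Al) (b : Ar) :
    𝓗.lft.t (op a) * 𝓗.rgt.t (op b) = 𝓗.rgt.t (op b) * 𝓗.lft.t (op a) := by
  rw [← 𝓗.slεl_tr b, 𝓗.lft.comm]

theorem sl_sr_comm (a : Al) (b : Ar) :
    𝓗.lft.s a * 𝓗.rgt.s b = 𝓗.rgt.s b * 𝓗.lft.s a := by
  rw [← 𝓗.tlεl_sr b, 𝓗.lft.comm]

/-- Two maps on `H ⊗_k (H ⊗_k H)` that are balanced over `A_l` in the first and over `A_r` in the
second place agree on iterated coproducts by twisted coassociativity. -/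
theorem twisted_aux (f : H ⊗[k] (H ⊗[k] H) →ₗ[k] H)
    (h1 : ∀ a x y z, f ((𝓗.lft.t (op a) * x) ⊗ₜ (y ⊗ₜ z)) = f (x ⊗ₜ ((𝓗.lft.s a * y) ⊗ₜ z)))
    (h2 : ∀ b x y z, f (x ⊗ₜ ((y * 𝓗.rgt.s b) ⊗ₜ z)) = f (x ⊗ₜ (y ⊗ₜ (z * 𝓗.rgt.t (op b)))))
    (p q : H ⊗[k] H →ₗ[k] H)
    (hp : ∀ x z Z, 𝓗.lft.mkL Z = 𝓗.lft.Δ x →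
      f (TensorProduct.assoc k H H H (Z ⊗ₜ z)) = p (x ⊗ₜ z))
    (hq : ∀ x y Z, 𝓗.rgt.mkR Z = 𝓗.rgt.Δ y → f (x ⊗ₜ Z) = q (x ⊗ₜ y))
    (h : H) (X Y : H ⊗[k] H) (hX : 𝓗.lft.mkL X = 𝓗.lft.Δ h) (hY : 𝓗.rgt.mkR Y = 𝓗.rgt.Δ h) :
    p Y = q X := by
  have hker : tripleRel 𝓗.lft.tL 𝓗.lft.sL 𝓗.rgt.sR 𝓗.rgt.tR ≤ LinearMap.ker f := by
    refine Submodule.span_le.2 ?_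
    rintro _ (⟨a, x, y, z, rfl⟩ | ⟨a, x, y, z, rfl⟩)
    · simp [h1]
    · simp [h2]
  have key := congrArg ((tripleRel 𝓗.lft.tL 𝓗.lft.sL 𝓗.rgt.sR 𝓗.rgt.tR).liftQ f hker)
    (𝓗.twisted_lr h X Y hX hY)
  have e1 : ((tripleRel 𝓗.lft.tL 𝓗.lft.sL 𝓗.rgt.sR 𝓗.rgt.tR).liftQ f hker) ∘ₗ
      tensorId 𝓗.lft.tL 𝓗.lft.sL 𝓗.rgt.sR 𝓗.rgt.tR 𝓗.lft.Δ = p := by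
    apply TensorProduct.ext'
    intro x z
    obtain ⟨Z, hZ⟩ := 𝓗.lft.mkL_surjective (𝓗.lft.Δ x)
    rw [← hp x z Z hZ]
    simp only [LinearMap.comp_apply, tensorId, TensorProduct.lift.tmul]
    rw [← hZ]
    rfl
  have e2 : ((tripleRel 𝓗.lft.tL 𝓗.lft.sL 𝓗.rgt.sR 𝓗.rgt.tR).liftQ f hker) ∘ₗ
      idTensor 𝓗.lft.tL 𝓗.lft.sL 𝓗.rgt.sR 𝓗.rgt.tR 𝓗.rgt.Δ = q := by
    apply TensorProduct.ext'
    intro x y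
    obtain ⟨Z, hZ⟩ := 𝓗.rgt.mkR_surjective (𝓗.rgt.Δ y)
    rw [← hq x y Z hZ]
    simp only [LinearMap.comp_apply, idTensor, TensorProduct.lift.tmul, LinearMap.compl₂_apply]
    rw [← hZ]
    rfl
  rw [← e1, ← e2]
  exact key

/-- `x ⊗ (y ⊗ z) ↦ f(x) (y g(z))`. -/
def tripleMul (f g : H →ₗ[k] H) : H ⊗[k] (H ⊗[k] H) →ₗ[k] H :=
  LinearMap.mul' k H ∘ₗ TensorProduct.map f (mulMap LinearMap.id g)

theorem tripleMul_tmul (f g : H →ₗ[k] H) (x y z : H) :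
    tripleMul f g (x ⊗ₜ (y ⊗ₜ z)) = f x * (y * g z) := rfl

theorem tripleMul_tmul' (f g : H →ₗ[k] H) (x : H) (Z : H ⊗[k] H) :
    tripleMul f g (x ⊗ₜ Z) = f x * mulMap LinearMap.id g Z := rfl

theorem tripleMul_assoc (f g : H →ₗ[k] H) (Z : H ⊗[k] H) (z : H) :
    tripleMul f g (TensorProduct.assoc k H H H (Z ⊗ₜ z)) = mulMap f LinearMap.id Z * g z := by
  induction Z with
  | zero => simp
  | add a b ha hb => simp only [TensorProduct.add_tmul, map_add, ha, hb, add_mul]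
  | tmul x y => simp [tripleMul_tmul, mul_assoc]

theorem tensor_map_eq {f g : H ⊗[k] H →ₗ[k] H} (h : ∀ x y, f (x ⊗ₜ y) = g (x ⊗ₜ y))
    (X : H ⊗[k] H) : f X = g X := by
  rw [TensorProduct.ext' h]

theorem ε_tl_sl (a : Al) (h : H) :
    𝓗.lft.ε (h * 𝓗.lft.t (op a)) = 𝓗.lft.ε (h * 𝓗.lft.s a) := by
  rw [𝓗.lft.ε_mul_s h (𝓗.lft.t (op a))]
  have : 𝓗.lft.ε (𝓗.lft.t (op a)) = a := by
    have := 𝓗.lft.ε_t a 1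
    simpa [𝓗.lft.ε_one] using this
  rw [this]

theorem ε_tr_sr (a : Ar) (h : H) :
    𝓗.rgt.ε (𝓗.rgt.t (op a) * h) = 𝓗.rgt.ε (𝓗.rgt.s a * h) := by
  rw [𝓗.rgt.ε_mul_s (𝓗.rgt.t (op a)) h]
  have : 𝓗.rgt.ε (𝓗.rgt.t (op a)) = a := by
    have := 𝓗.rgt.ε_t a 1
    simpa [𝓗.rgt.ε_one] using this
  rw [this]

theorem S_mul_tl (b : Al) (g : H) : 𝓗.S (g * 𝓗.lft.t (op b)) = 𝓗.lft.s b * 𝓗.S g := by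
  obtain ⟨X, hX⟩ := 𝓗.lft.mkL_surjective (𝓗.lft.Δ g)
  obtain ⟨Y, hY⟩ := 𝓗.rgt.mkR_surjective (𝓗.rgt.Δ g)
  have I1 := 𝓗.twisted_aux
    (tripleMul 𝓗.S.toLinearMap (𝓗.S.toLinearMap ∘ₗ LinearMap.mulRight k (𝓗.lft.t (op b))))
    (by intro a x y z; simp [tripleMul_tmul, S_tl_mul, mul_assoc])
    (by
      intro a x y z
      simp only [tripleMul_tmul, LinearMap.comp_apply, LinearEquiv.coe_coe,
        LinearMap.mulRight_apply]
      rw [mul_assoc z, ← tl_tr_comm, ← mul_assoc z, S_mul_tr]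
      simp [mul_assoc])
    (mulOpMap (𝓗.rgt.tLin ∘ₗ 𝓗.rgt.ε) LinearMap.id |> fun m =>
      𝓗.S.toLinearMap ∘ₗ LinearMap.mulRight k (𝓗.lft.t (op b)) ∘ₗ m)
    (mulMap 𝓗.S.toLinearMap (𝓗.lft.sLin ∘ₗ 𝓗.lft.ε ∘ₗ LinearMap.mulRight k (𝓗.lft.t (op b))))
    (by
      intro x z Z hZ
      rw [tripleMul_assoc, 𝓗.antipode_left x Z hZ]
      simp only [LinearMap.comp_apply, LinearEquiv.coe_coe,
        LinearMap.mulRight_apply, mulOpMap_tmul, STRing.tLin_apply, LinearMap.id_apply]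
      rw [mul_assoc z, ← tl_tr_comm, ← mul_assoc z, S_mul_tr])
    (by
      intro x y Z hZ
      rw [tripleMul_tmul']
      simp only [LinearMap.comp_apply, LinearEquiv.coe_coe,
        LinearMap.mulRight_apply, mulMap_tmul, STRing.sLin_apply]
      congr 1
      have hd := 𝓗.rgt.Δ_s (𝓗.rgt.ε (𝓗.lft.t (op b))) y Z hZ
      have := 𝓗.antipode_right _ _ hd.symm
      rw [𝓗.srεr_tl] at this
      rw [← this]
      apply tensor_map_eq (g := mulMap LinearMap.id 𝓗.S.toLinearMap ∘ₗ
        LinearMap.mulRight k (1 ⊗ₜ[k] 𝓗.lft.t (op b)))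
      intro x y
      simp)
    g X Y hX hY
  have I2 := 𝓗.twisted_aux
    (tripleMul 𝓗.S.toLinearMap (LinearMap.mulLeft k (𝓗.lft.s b) ∘ₗ 𝓗.S.toLinearMap))
    (by intro a x y z; simp [tripleMul_tmul, S_tl_mul, mul_assoc])
    (by
      intro a x y z
      simp only [tripleMul_tmul, LinearMap.comp_apply, LinearEquiv.coe_coe,
        LinearMap.mulLeft_apply]
      rw [S_mul_tr, ← mul_assoc (𝓗.lft.s b), sl_sr_comm]
      simp [mul_assoc])
    (mulOpMap (𝓗.rgt.tLin ∘ₗ 𝓗.rgt.ε) LinearMap.id |> fun m =>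
      LinearMap.mulLeft k (𝓗.lft.s b) ∘ₗ 𝓗.S.toLinearMap ∘ₗ m)
    (mulMap 𝓗.S.toLinearMap (𝓗.lft.sLin ∘ₗ 𝓗.lft.ε ∘ₗ LinearMap.mulRight k (𝓗.lft.t (op b))))
    (by
      intro x z Z hZ
      rw [tripleMul_assoc, 𝓗.antipode_left x Z hZ]
      simp only [LinearMap.comp_apply, LinearEquiv.coe_coe,
        LinearMap.mulLeft_apply, mulOpMap_tmul, STRing.tLin_apply, LinearMap.id_apply]
      rw [S_mul_tr, ← mul_assoc, ← mul_assoc, sl_sr_comm])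
    (by
      intro x y Z hZ
      rw [tripleMul_tmul']
      simp only [LinearMap.comp_apply, LinearEquiv.coe_coe,
        LinearMap.mulRight_apply, mulMap_tmul, STRing.sLin_apply]
      congr 1
      have hd := 𝓗.rgt.Δ_t (𝓗.rgt.ε (𝓗.lft.s b)) y Z hZ
      have := 𝓗.antipode_right _ _ hd.symm
      rw [𝓗.trεr_sl, ← ε_tl_sl] at this
      rw [← this]
      apply tensor_map_eq (g := mulMap LinearMap.id 𝓗.S.toLinearMap ∘ₗ
        LinearMap.mulRight k (𝓗.lft.s b ⊗ₜ[k] 1))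
      intro x y
      simp [mul_assoc])
    g X Y hX hY
  have c := 𝓗.rgt.counit_left g Y hY
  simp only [LinearMap.comp_apply, c, LinearEquiv.coe_coe, LinearMap.mulLeft_apply,
    LinearMap.mulRight_apply] at I1 I2
  rw [I1, I2]

theorem S_tr_mul (b : Ar) (g : H) : 𝓗.S (𝓗.rgt.t (op b) * g) = 𝓗.S g * 𝓗.rgt.s b := by
  obtain ⟨X, hX⟩ := 𝓗.lft.mkL_surjective (𝓗.lft.Δ g)
  obtain ⟨Y, hY⟩ := 𝓗.rgt.mkR_surjective (𝓗.rgt.Δ g)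
  have I1 := 𝓗.twisted_aux
    (tripleMul (𝓗.S.toLinearMap ∘ₗ LinearMap.mulLeft k (𝓗.rgt.t (op b))) 𝓗.S.toLinearMap)
    (by
      intro a x y z
      simp only [tripleMul_tmul, LinearMap.comp_apply, LinearEquiv.coe_coe,
        LinearMap.mulLeft_apply]
      rw [← mul_assoc (𝓗.rgt.t (op b)), ← tl_tr_comm, mul_assoc (𝓗.lft.t (op a)), S_tl_mul]
      simp [mul_assoc])
    (by intro a x y z; simp [tripleMul_tmul, S_mul_tr, mul_assoc])
    (mulMap (𝓗.rgt.sLin ∘ₗ 𝓗.rgt.ε ∘ₗ LinearMap.mulLeft k (𝓗.rgt.t (op b))) 𝓗.S.toLinearMap)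
    (𝓗.S.toLinearMap ∘ₗ LinearMap.mulLeft k (𝓗.rgt.t (op b)) ∘ₗ
      mulOpMap LinearMap.id (𝓗.lft.tLin ∘ₗ 𝓗.lft.ε))
    (by
      intro x z Z hZ
      rw [tripleMul_assoc]
      simp only [LinearMap.comp_apply, LinearEquiv.coe_coe,
        LinearMap.mulLeft_apply, mulMap_tmul, STRing.sLin_apply]
      congr 1
      have hd := 𝓗.lft.Δ_s (𝓗.lft.ε (𝓗.rgt.t (op b))) x Z hZ
      have := 𝓗.antipode_left _ _ hd.symm
      rw [𝓗.slεl_tr] at this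
      rw [← this]
      apply tensor_map_eq (g := mulMap 𝓗.S.toLinearMap LinearMap.id ∘ₗ
        LinearMap.mulLeft k (𝓗.rgt.t (op b) ⊗ₜ[k] 1))
      intro x y
      simp)
    (by
      intro x y Z hZ
      rw [tripleMul_tmul', 𝓗.antipode_right y Z hZ]
      simp only [LinearMap.comp_apply, LinearEquiv.coe_coe,
        LinearMap.mulLeft_apply, mulOpMap_tmul, STRing.tLin_apply, LinearMap.id_apply]
      rw [← mul_assoc, ← tl_tr_comm, mul_assoc, S_tl_mul])
    g X Y hX hY
  have I2 := 𝓗.twisted_aux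
    (tripleMul (LinearMap.mulRight k (𝓗.rgt.s b) ∘ₗ 𝓗.S.toLinearMap) 𝓗.S.toLinearMap)
    (by
      intro a x y z
      simp only [tripleMul_tmul, LinearMap.comp_apply, LinearEquiv.coe_coe,
        LinearMap.mulRight_apply]
      rw [S_tl_mul, mul_assoc (𝓗.S x), sl_sr_comm]
      simp [mul_assoc])
    (by intro a x y z; simp [tripleMul_tmul, S_mul_tr, mul_assoc])
    (mulMap (𝓗.rgt.sLin ∘ₗ 𝓗.rgt.ε ∘ₗ LinearMap.mulLeft k (𝓗.rgt.t (op b))) 𝓗.S.toLinearMap)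
    (LinearMap.mulRight k (𝓗.rgt.s b) ∘ₗ 𝓗.S.toLinearMap ∘ₗ
      mulOpMap LinearMap.id (𝓗.lft.tLin ∘ₗ 𝓗.lft.ε))
    (by
      intro x z Z hZ
      rw [tripleMul_assoc]
      simp only [LinearMap.comp_apply, LinearEquiv.coe_coe,
        LinearMap.mulLeft_apply, mulMap_tmul, STRing.sLin_apply]
      congr 1
      have hd := 𝓗.lft.Δ_t (𝓗.lft.ε (𝓗.rgt.s b)) x Z hZ
      have := 𝓗.antipode_left _ _ hd.symm
      rw [𝓗.tlεl_sr, ← ε_tr_sr] at this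
      rw [← this]
      apply tensor_map_eq (g := mulMap 𝓗.S.toLinearMap LinearMap.id ∘ₗ
        LinearMap.mulLeft k (1 ⊗ₜ[k] 𝓗.rgt.s b))
      intro x y
      simp [mul_assoc])
    (by
      intro x y Z hZ
      rw [tripleMul_tmul', 𝓗.antipode_right y Z hZ]
      simp only [LinearMap.comp_apply, LinearEquiv.coe_coe,
        LinearMap.mulRight_apply, mulOpMap_tmul, STRing.tLin_apply, LinearMap.id_apply]
      rw [S_tl_mul, mul_assoc, mul_assoc, sl_sr_comm])
    g X Y hX hY
  have c := 𝓗.lft.counit_right g X hX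
  simp only [LinearMap.comp_apply, c, LinearEquiv.coe_coe, LinearMap.mulLeft_apply,
    LinearMap.mulRight_apply] at I1 I2
  rw [← I1, ← I2]

/-- The inverse of the antipode. -/
def Si : H →ₗ[k] H := 𝓗.S.symm.toLinearMap

theorem Si_sl_mul (b : Al) (h : H) : 𝓗.Si (𝓗.lft.s b * h) = 𝓗.Si h * 𝓗.lft.t (op b) := by
  apply 𝓗.S.injective
  simp [Si, S_mul_tl]

theorem Si_mul_sl (b : Al) (h : H) : 𝓗.Si (h * 𝓗.lft.s b) = 𝓗.lft.t (op b) * 𝓗.Si h := by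
  apply 𝓗.S.injective
  simp [Si, S_tl_mul]

theorem Si_sr_mul (b : Ar) (h : H) : 𝓗.Si (𝓗.rgt.s b * h) = 𝓗.Si h * 𝓗.rgt.t (op b) := by
  apply 𝓗.S.injective
  simp [Si, S_mul_tr]

theorem Si_mul_sr (b : Ar) (h : H) : 𝓗.Si (h * 𝓗.rgt.s b) = 𝓗.rgt.t (op b) * 𝓗.Si h := by
  apply 𝓗.S.injective
  simp [Si, S_tr_mul]

end HopfAlgebroid

/-- A left module over a `k`-algebra `A`, as a representation on a `k`-module. -/
structure LMod (k : Type v) [CommRing k] (A : Type u) [Ring A] [Algebra k A] where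
  carrier : Type u
  [grp : AddCommGroup carrier]
  [mod : Module k carrier]
  act : A →ₐ[k] Module.End k carrier

attribute [instance] LMod.grp LMod.mod

/-- `x ⊗ y ↦ (z ⊗ m ↦ [f(x)(z) ⊗ g(y)(m)])`. -/
def pairing {k : Type v} [CommRing k] {H N M N' M' Q : Type*} [AddCommGroup H] [Module k H]
    [AddCommGroup N] [Module k N] [AddCommGroup M] [Module k M]
    [AddCommGroup N'] [Module k N'] [AddCommGroup M'] [Module k M'] [AddCommGroup Q] [Module k Q]
    (f : H →ₗ[k] N →ₗ[k] N') (g : H →ₗ[k] M →ₗ[k] M') (q : N' ⊗[k] M' →ₗ[k] Q) :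
    H ⊗[k] H →ₗ[k] N ⊗[k] M →ₗ[k] Q :=
  LinearMap.llcomp k (N ⊗[k] M) (N' ⊗[k] M') Q q ∘ₗ
    TensorProduct.homTensorHomMap (RingHom.id k) N M N' M' ∘ₗ TensorProduct.map f g

theorem pairing_tmul {k : Type v} [CommRing k] {H N M N' M' Q : Type*} [AddCommGroup H]
    [Module k H]
    [AddCommGroup N] [Module k N] [AddCommGroup M] [Module k M]
    [AddCommGroup N'] [Module k N'] [AddCommGroup M'] [Module k M'] [AddCommGroup Q] [Module k Q]
    (f : H →ₗ[k] N →ₗ[k] N') (g : H →ₗ[k] M →ₗ[k] M') (q : N' ⊗[k] M' →ₗ[k] Q)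
    (x y : H) (z : N) (m : M) :
    pairing f g q (x ⊗ₜ y) (z ⊗ₜ m) = q (f x z ⊗ₜ g y m) := rfl

namespace LeftBialgebroid

variable {k : Type v} [CommRing k] {A H : Type u} [Ring A] [Algebra k A] [Ring H] [Algebra k H]
  (B : LeftBialgebroid k A H)

theorem Δ_sa (a : A) : B.Δ (B.s a) = B.mkL (B.s a ⊗ₜ 1) := by
  have := B.Δ_s a 1 (1 ⊗ₜ 1) B.Δ_one.symm
  simpa using this

/-- The unit object of `Mod(H)`: the base algebra with `h · a = ε(h s(a))`. -/
def unit : LMod k H where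
  carrier := A
  act := AlgHom.ofLinearMap
    (LinearMap.mk₂ k (fun (h : H) (a : A) => B.ε (h * B.s a))
      (by intro h h' a; simp [add_mul]) (by intro c h a; simp)
      (by intro h a a'; simp [mul_add]) (by intro c h a; simp))
    (by
      ext a
      have := B.ε_s a 1
      simpa [B.ε_one] using this)
    (by
      intro g h
      ext a
      simp only [LinearMap.mk₂_apply, Module.End.mul_apply]
      rw [mul_assoc, B.ε_mul_s])

/-- The map `x ⊗ y ↦ (z ⊗ m ↦ x z ⊗ y·m)` from `H ⊗_A H`. -/
def preAct (M : LMod k H) : B.TensL →ₗ[k] H ⊗[k] M.carrier →ₗ[k]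
    BalTensor B.tL (fun a => M.act (B.s a)) :=
  balLift _ _ (pairing (LinearMap.mul k H) M.act.toLinearMap (balRel _ _).mkQ)
    (by
      intro a x y
      apply TensorProduct.ext'
      intro z m
      rw [pairing_tmul, pairing_tmul]
      have := bal_rel (ρ := B.tL) (l := fun a => M.act (B.s a)) a (x * z) (M.act y m)
      simpa [mul_assoc] using this)

theorem preAct_mk (M : LMod k H) (x y z : H) (m : M.carrier) :
    B.preAct M (B.mkL (x ⊗ₜ y)) (z ⊗ₜ m) =
      (balRel B.tL (fun a => M.act (B.s a))).mkQ ((x * z) ⊗ₜ M.act y m) := rfl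

theorem preAct_tmul (M : LMod k H) (X : H ⊗[k] H) (z : H) (w : H) (m : M.carrier) :
    B.preAct M (B.mkL X) ((z * w) ⊗ₜ m) = B.preAct M (B.mkL (X * (z ⊗ₜ 1))) (w ⊗ₜ m) := by
  induction X with
  | zero => simp
  | add a b ha hb => simp only [map_add, LinearMap.add_apply, ha, hb, add_mul]
  | tmul x y => simp [preAct_mk, mul_assoc]

theorem preAct_tmul' (M : LMod k H) (X : H ⊗[k] H) (z : H) (w : H) (m : M.carrier) :
    B.preAct M (B.mkL X) (w ⊗ₜ (M.act z m)) = B.preAct M (B.mkL (X * (1 ⊗ₜ z))) (w ⊗ₜ m) := by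
  induction X with
  | zero => simp
  | add a b ha hb => simp only [map_add, LinearMap.add_apply, ha, hb, add_mul]
  | tmul x y => simp [preAct_mk]

/-- The action `h · (z ⊗ m) = h₁ z ⊗ h₂·m` on `H ⊗_A M`. -/
def tensAct (M : LMod k H) (h : H) :
    BalTensor B.tL (fun a => M.act (B.s a)) →ₗ[k] BalTensor B.tL (fun a => M.act (B.s a)) :=
  balLift _ _ (B.preAct M (B.Δ h))
    (by
      intro a z m
      obtain ⟨X, hX⟩ := B.mkL_surjective (B.Δ h)
      rw [← hX]
      have e := B.takeuchi h X hX a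
      rw [STRing.tL_apply, preAct_tmul, e, preAct_tmul'])

theorem tensAct_mk (M : LMod k H) (h z : H) (m : M.carrier) :
    B.tensAct M h ((balRel B.tL (fun a => M.act (B.s a))).mkQ (z ⊗ₜ m)) =
      B.preAct M (B.Δ h) (z ⊗ₜ m) := rfl

theorem tensAct_mul (M : LMod k H) (g h : H) :
    B.tensAct M (g * h) = B.tensAct M g ∘ₗ B.tensAct M h := by
  apply bal_ext
  intro z m
  obtain ⟨X, hX⟩ := B.mkL_surjective (B.Δ g)
  obtain ⟨Y, hY⟩ := B.mkL_surjective (B.Δ h)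
  rw [LinearMap.comp_apply, tensAct_mk, tensAct_mk, B.Δ_mul g h X Y hX hY, ← hY]
  clear hY
  induction Y with
  | zero => simp
  | add a b ha hb => simp only [map_add, LinearMap.add_apply, ha, hb, mul_add]
  | tmul x y =>
    rw [preAct_mk, tensAct_mk, ← hX, preAct_tmul, preAct_tmul', mul_assoc]
    simp

/-- The tensor product `H ⊗_A M` in the monoidal category `Mod(H)`. -/
def tens (M : LMod k H) : LMod k H where
  carrier := BalTensor B.tL (fun a => M.act (B.s a))
  act := AlgHom.ofLinearMap
    { toFun := B.tensAct M
      map_add' := by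
        intro g h
        apply bal_ext
        intro z m
        simp only [LinearMap.add_apply, tensAct_mk, map_add]
      map_smul' := by
        intro c h
        apply bal_ext
        intro z m
        simp only [LinearMap.smul_apply, tensAct_mk, map_smul, RingHom.id_apply] }
    (by
      apply bal_ext
      intro z m
      change B.preAct M (B.Δ 1) (z ⊗ₜ m) = _
      rw [B.Δ_one, preAct_mk]
      simp)
    (B.tensAct_mul M)

/-- The class `h ⊗ m` in `H ⊗_A M`. -/
def tm (M : LMod k H) : H →ₗ[k] M.carrier →ₗ[k] (B.tens M).carrier :=
  (TensorProduct.mk k H M.carrier).compr₂ (balRel B.tL (fun a => M.act (B.s a))).mkQ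

theorem tm_bal (M : LMod k H) (a : A) (h : H) (m : M.carrier) :
    B.tm M (B.t (op a) * h) m = B.tm M h (M.act (B.s a) m) :=
  bal_rel (ρ := B.tL) (l := fun a => M.act (B.s a)) a h m

theorem tens_ext {M : LMod k H} {P : Type*} [AddCommGroup P] [Module k P]
    {f g : (B.tens M).carrier →ₗ[k] P} (h : ∀ x m, f (B.tm M x m) = g (B.tm M x m)) : f = g :=
  bal_ext h

/-- The map on `H ⊗_A M` induced by a balanced bilinear map. -/
def tlift {M : LMod k H} {P : Type*} [AddCommGroup P] [Module k P] (f : H →ₗ[k] M.carrier →ₗ[k] P)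
    (hf : ∀ a h m, f (B.t (op a) * h) m = f h (M.act (B.s a) m)) : (B.tens M).carrier →ₗ[k] P :=
  balLift B.tL (fun a => M.act (B.s a)) (TensorProduct.lift f) (by intro a h m; simpa using hf a h m)

theorem tlift_tm {M : LMod k H} {P : Type*} [AddCommGroup P] [Module k P]
    (f : H →ₗ[k] M.carrier →ₗ[k] P)
    (hf : ∀ a h m, f (B.t (op a) * h) m = f h (M.act (B.s a) m)) (h : H) (m : M.carrier) :
    B.tlift f hf (B.tm M h m) = f h m := rfl

theorem act_s_tm (M : LMod k H) (a : A) (h : H) (m : M.carrier) :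
    (B.tens M).act (B.s a) (B.tm M h m) = B.tm M (B.s a * h) m := by
  change B.preAct M (B.Δ (B.s a)) (h ⊗ₜ m) = _
  rw [Δ_sa, preAct_mk, map_one]
  rfl

/-- `k`-linear maps commuting with the left `A`-actions given by the source map. -/
def AHom (M N : LMod k H) : Type u :=
  {f : M.carrier →ₗ[k] N.carrier // ∀ a x, f (M.act (B.s a) x) = N.act (B.s a) (f x)}

/-- The map on `H ⊗_A M` induced by a balanced bilinear map that commutes with the left
`A`-actions. -/
def mkAHom {M N : LMod k H} (g : H →ₗ[k] M.carrier →ₗ[k] N.carrier)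
    (hg : ∀ a h m, g (B.t (op a) * h) m = g h (M.act (B.s a) m))
    (hs : ∀ a h m, g (B.s a * h) m = N.act (B.s a) (g h m)) : B.AHom (B.tens M) N :=
  ⟨B.tlift g hg, by
    intro a x
    refine LinearMap.congr_fun (f := B.tlift g hg ∘ₗ (B.tens M).act (B.s a))
      (g := N.act (B.s a) ∘ₗ B.tlift g hg) ?_ x
    apply tens_ext
    intro h m
    simp only [LinearMap.comp_apply, act_s_tm, tlift_tm, hs]⟩

/-- `id ⊗ f : h ⊗ m ↦ h ⊗ f(m)`. -/
def idTens {M N : LMod k H} (f : B.AHom M N) : B.AHom (B.tens M) (B.tens N) :=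
  B.mkAHom ((B.tm N).compl₂ f.1) (by intro a h m; simp [tm_bal, f.2])
    (by intro a h m; simp [act_s_tm])

/-- `x ⊗ y ↦ (m ↦ x ⊗ y ⊗ m)` on `H ⊗_A H`. -/
def splice (M : LMod k H) : B.TensL →ₗ[k] M.carrier →ₗ[k] (B.tens (B.tens M)).carrier :=
  balLift B.tL B.sL
    (TensorProduct.lift
      (LinearMap.mk₂ k (fun x y => B.tm (B.tens M) x ∘ₗ B.tm M y)
        (by intro x x' y; ext; simp) (by intro c x y; ext; simp)
        (by intro x y y'; ext; simp) (by intro c x y; ext; simp)))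
    (by
      intro a x y
      ext m
      simp only [TensorProduct.lift.tmul, LinearMap.mk₂_apply, LinearMap.comp_apply,
        STRing.tL_apply, STRing.sL_apply]
      rw [tm_bal, act_s_tm])

theorem splice_mk (M : LMod k H) (x y : H) (m : M.carrier) :
    B.splice M (B.mkL (x ⊗ₜ y)) m = B.tm (B.tens M) x (B.tm M y m) := rfl

/-- `h ⊗ m ↦ h₁ ⊗ h₂ ⊗ m`. -/
def comulTens (M : LMod k H) : B.AHom (B.tens M) (B.tens (B.tens M)) :=
  B.mkAHom (B.splice M ∘ₗ B.Δ)
    (by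
      intro a h m
      obtain ⟨X, hX⟩ := B.mkL_surjective (B.Δ h)
      rw [LinearMap.comp_apply, LinearMap.comp_apply, B.Δ_t a h X hX, ← hX]
      clear hX
      induction X with
      | zero => simp
      | add a b ha hb => simp only [map_add, LinearMap.add_apply, ha, hb, mul_add]
      | tmul x y => simp [splice_mk, tm_bal])
    (by
      intro a h m
      obtain ⟨X, hX⟩ := B.mkL_surjective (B.Δ h)
      rw [LinearMap.comp_apply, LinearMap.comp_apply, B.Δ_s a h X hX, ← hX]
      clear hX
      induction X with
      | zero => simp
      | add a b ha hb => simp only [map_add, LinearMap.add_apply, ha, hb, mul_add]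
      | tmul x y => simp [splice_mk, act_s_tm])

/-- `h ⊗ m ↦ ε(h) · m`. -/
def counitTens (M : LMod k H) : B.AHom (B.tens M) M :=
  B.mkAHom (M.act.toLinearMap ∘ₗ B.sLin ∘ₗ B.ε) (by intro a h m; simp [B.ε_t])
    (by intro a h m; simp [B.ε_s])

/-- `a ↦ s(a)`, as a map from `A` to `H ⊗_A A`. -/
def sUnit : B.AHom B.unit (B.tens B.unit) :=
  ⟨(B.tm B.unit).flip (1 : A) ∘ₗ B.sLin, by
    intro a x
    have e : ∀ y : A, B.s (B.ε (B.s a * B.s y)) = B.s a * B.s y := by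
      intro y
      rw [← map_mul]
      congr 1
      have := B.ε_s (a * y) 1
      rwa [mul_one, B.ε_one, mul_one] at this
    exact (congrArg (fun z => B.tm B.unit z (1 : A)) (e x)).trans
      (B.act_s_tm B.unit a (B.s (show A from x)) (1 : A)).symm⟩

/-- The cochain spaces `C^n(H) = H ⊗_A ⋯ ⊗_A H` (`n` factors) as objects of `Mod(H)`, with
`C^0 = A` the unit object, formed as `C^(n+1) = H ⊗_A C^n`. In particular `C^1 = H ⊗_A A`, which
is identified with `H` through `h ⊗ a = t(a) h ⊗ 1`. -/
def C : ℕ → LMod k H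
  | 0 => B.unit
  | n + 1 => B.tens (C n)

/-- `1 ⊗ x`, the coface `δ_0` (in degree zero this is `a ↦ t(a)`). -/
def δzero (n : ℕ) : (B.C n).carrier →ₗ[k] (B.C (n + 1)).carrier := B.tm (B.C n) 1

/-- The coface `δ_{i+1} : C^n → C^{n+1}`, for `i ≤ n`. -/
def δsucc : ∀ n : ℕ, ℕ → B.AHom (B.C n) (B.C (n + 1))
  | 0, _ => B.sUnit
  | n + 1, 0 => B.comulTens (B.C n)
  | n + 1, i + 1 => B.idTens (δsucc n i)

/-- The cofaces `δ_i : C^n → C^{n+1}`, for `i ≤ n + 1`. -/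
def δ (n : ℕ) : ℕ → (B.C n).carrier →ₗ[k] (B.C (n + 1)).carrier
  | 0 => B.δzero n
  | i + 1 => (B.δsucc n i).1

/-- The codegeneracies `σ_i : C^{n+1} → C^n`, for `i ≤ n`. -/
def σ : ∀ n : ℕ, ℕ → B.AHom (B.C (n + 1)) (B.C n)
  | n, 0 => B.counitTens (B.C n)
  | 0, _ + 1 => B.counitTens (B.C 0)
  | n + 1, i + 1 => B.idTens (σ n i)

/-- The Hochschild differential `b = ∑ (-1)^i δ_i`. -/
def b (n : ℕ) : (B.C n).carrier →ₗ[k] (B.C (n + 1)).carrier :=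
  ∑ i ∈ Finset.range (n + 2), (-1 : k) ^ i • B.δ n i

end LeftBialgebroid

section Homology

variable {k : Type v} [CommRing k]

/-- The quotient `Z / (Z ∩ D)` of submodules of `M` (homology, for `Z` cycles, `D` boundaries). -/
abbrev Subquot {M : Type*} [AddCommGroup M] [Module k M] (Z D : Submodule k M) : Type _ :=
  Z ⧸ D.submoduleOf Z

/-- The map of subquotients induced by a linear map. -/
def subquotMap {M N : Type*} [AddCommGroup M] [Module k M] [AddCommGroup N] [Module k N]
    {Z D : Submodule k M} {Z' D' : Submodule k N} (f : M →ₗ[k] N)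
    (hZ : ∀ x ∈ Z, f x ∈ Z') (hD : ∀ x ∈ D, f x ∈ D') : Subquot Z D →ₗ[k] Subquot Z' D' :=
  Submodule.mapQ _ _ (f.restrict hZ) (fun x hx => hD x.1 hx)

variable {C : ℕ → Type*} [∀ n, AddCommGroup (C n)] [∀ n, Module k (C n)]

/-- Families concentrated in degrees `n, n - 2, n - 4, …`: the total space
`C_n ⊕ C_{n-2} ⊕ C_{n-4} ⊕ ⋯` of degree `n` of the `(b,B)`-double complex. -/
def totDeg (C : ℕ → Type*) [∀ n, AddCommGroup (C n)] [∀ n, Module k (C n)] (n : ℕ) :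
    Submodule k (∀ m, C m) where
  carrier := {x | ∀ m, (¬ ∃ i, m + 2 * i = n) → x m = 0}
  zero_mem' := fun _ _ => rfl
  add_mem' := fun hx hy m hm => by simp [hx m hm, hy m hm]
  smul_mem' := fun c x hx m hm => by simp [hx m hm]

section Cochains

variable (b : ∀ n, C n →ₗ[k] C (n + 1)) (B : ∀ n, C (n + 1) →ₗ[k] C n)

/-- Coboundaries in degree `n`. -/
def cobound : ∀ n, Submodule k (C n)
  | 0 => ⊥
  | n + 1 => LinearMap.range (b n)

/-- The cohomology in degree `n` of a cochain complex `(C^•, b)`. -/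
abbrev CochainHH (n : ℕ) : Type _ := Subquot (LinearMap.ker (b n)) (cobound b n)

/-- The differential `b + B` on families. -/
def totD : (∀ m, C m) →ₗ[k] (∀ m, C m) :=
  LinearMap.pi fun m => match m with
    | 0 => B 0 ∘ₗ LinearMap.proj 1
    | m + 1 => b m ∘ₗ LinearMap.proj m + B (m + 1) ∘ₗ LinearMap.proj (m + 2)

/-- Coboundaries of degree `n` in the total complex. -/
def totCobound : ℕ → Submodule k (∀ m, C m)
  | 0 => ⊥
  | n + 1 => (totDeg C n).map (totD b B)

/-- The cyclic cohomology in degree `n` of a mixed cochain complex `(C^•, b, B)`: the cohomology of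
the total complex `C^n ⊕ C^{n-2} ⊕ ⋯` with differential `b + B`. -/
abbrev CochainHC (n : ℕ) : Type _ :=
  Subquot (totDeg C n ⊓ LinearMap.ker (totD b B)) (totCobound b B n)

end Cochains

section Chains

variable (b : ∀ n, C (n + 1) →ₗ[k] C n) (B : ∀ n, C n →ₗ[k] C (n + 1))

/-- Cycles in degree `n`. -/
def cycles : ∀ n, Submodule k (C n)
  | 0 => ⊤
  | n + 1 => LinearMap.ker (b n)

/-- The homology in degree `n` of a chain complex `(C_•, b)`. -/
abbrev ChainHH (n : ℕ) : Type _ := Subquot (cycles b n) (LinearMap.range (b n))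

/-- The differential `b + B` from total degree `n` to total degree `n - 1`; the component of `B`
that leaves the total space `C_{n-1} ⊕ C_{n-3} ⊕ ⋯` (that is, `B` on the summand `C_n`) is
discarded. -/
def totd (n : ℕ) : (∀ m, C m) →ₗ[k] (∀ m, C m) :=
  LinearMap.pi fun m => if m < n then
    (match m with
      | 0 => b 0 ∘ₗ LinearMap.proj 1
      | m + 1 => b (m + 1) ∘ₗ LinearMap.proj (m + 2) + B m ∘ₗ LinearMap.proj m)
    else 0

/-- The cyclic homology in degree `n` of a mixed complex `(C_•, b, B)`: the homology of
the total complex `C_n ⊕ C_{n-2} ⊕ ⋯` with differential `b + B`. -/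
abbrev ChainHC (n : ℕ) : Type _ :=
  Subquot (totDeg C n ⊓ LinearMap.ker (totd b B n)) ((totDeg C (n + 1)).map (totd b B (n + 1)))

variable {C' : ℕ → Type*} [∀ n, AddCommGroup (C' n)] [∀ n, Module k (C' n)]
  (b' : ∀ n, C' (n + 1) →ₗ[k] C' n) (B' : ∀ n, C' n →ₗ[k] C' (n + 1))
  (f : ∀ n, C n →ₗ[k] C' n)

/-- The map on homology induced by a chain map. -/
def chainHHMap (hb : ∀ n x, f n (b n x) = b' n (f (n + 1) x)) (n : ℕ) :
    ChainHH b n →ₗ[k] ChainHH b' n :=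
  subquotMap (f n)
    (by
      cases n with
      | zero => intro x _; trivial
      | succ n =>
        intro x hx
        change b' n (f (n + 1) x) = 0
        change b n x = 0 at hx
        rw [← hb, hx, map_zero])
    (by
      rintro _ ⟨y, rfl⟩
      exact ⟨f (n + 1) y, (hb n y).symm⟩)

/-- The componentwise map on families. -/
def famMap : (∀ m, C m) →ₗ[k] (∀ m, C' m) := LinearMap.pi fun m => f m ∘ₗ LinearMap.proj m

theorem famMap_totDeg (n : ℕ) (x : ∀ m, C m) (hx : x ∈ totDeg (k := k) C n) :
    famMap f x ∈ totDeg (k := k) C' n := by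
  intro m hm
  change f m (x m) = 0
  rw [hx m hm, map_zero]

variable {b B b' B' f}

theorem famMap_totd (hb : ∀ n x, f n (b n x) = b' n (f (n + 1) x))
    (hB : ∀ n x, f (n + 1) (B n x) = B' n (f n x)) (n : ℕ) (x : ∀ m, C m) :
    famMap f (totd b B n x) = totd b' B' n (famMap f x) := by
  funext m
  change f m (totd b B n x m) = _
  by_cases h : m < n
  · cases m with
    | zero => simp [totd, famMap, h, hb]
    | succ m => simp [totd, famMap, h, hb, hB]
  · simp [totd, h]

/-- The map on cyclic homology induced by a map of mixed complexes. -/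
def chainHCMap (hb : ∀ n x, f n (b n x) = b' n (f (n + 1) x))
    (hB : ∀ n x, f (n + 1) (B n x) = B' n (f n x)) (n : ℕ) :
    ChainHC b B n →ₗ[k] ChainHC b' B' n :=
  subquotMap (famMap f)
    (by
      rintro x ⟨hx, hx'⟩
      refine ⟨famMap_totDeg f n x hx, ?_⟩
      change totd b' B' n (famMap f x) = 0
      rw [← famMap_totd hb hB, show totd b B n x = 0 from hx', map_zero])
    (by
      rintro _ ⟨y, hy, rfl⟩
      exact ⟨famMap f y, famMap_totDeg f (n + 1) y hy, (famMap_totd hb hB _ y).symm⟩)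

end Chains

end Homology

namespace HopfAlgebroid

section Cohomology

variable {k : Type v} [CommRing k] {Al Ar H : Type u} [Ring Al] [Algebra k Al]
  [Ring Ar] [Algebra k Ar] [Ring H] [Algebra k H] (𝓗 : HopfAlgebroid k Al Ar H)

/-- The cyclic operator `τ_n (h¹ ⊗ ⋯ ⊗ hⁿ) = S(h¹) · (h² ⊗ ⋯ ⊗ hⁿ ⊗ 1)`, with `τ_0 = id`. Here
`x ↦ x ⊗ 1` is the last coface. -/
def τ : ∀ n : ℕ, Module.End k (𝓗.lft.C n).carrier
  | 0 => LinearMap.id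
  | n + 1 => 𝓗.lft.tlift
      (((𝓗.lft.C (n + 1)).act.toLinearMap ∘ₗ 𝓗.S.toLinearMap).compl₂ (𝓗.lft.δsucc n n).1)
      (by
        intro a h m
        simp only [LinearMap.compl₂_apply, LinearMap.comp_apply, LinearEquiv.coe_coe,
          AlgHom.toLinearMap_apply, S_tl_mul, map_mul, (𝓗.lft.δsucc n n).2,
          Module.End.mul_apply])

/-- The signed cyclic operator `(-1)^n τ_n`. -/
def signedτ (n : ℕ) : Module.End k (𝓗.lft.C n).carrier := (-1 : k) ^ n • 𝓗.τ n

/-- The operator `B = N σ_{-1} (1 - λ)` on cochains, where `λ = (-1)^n τ_n`, `N = 1 + λ + ⋯ + λ^n`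
and `σ_{-1} = σ_n τ_{n+1}` is the extra codegeneracy. -/
def coB (n : ℕ) : (𝓗.lft.C (n + 1)).carrier →ₗ[k] (𝓗.lft.C n).carrier :=
  (∑ j ∈ Finset.range (n + 1), 𝓗.signedτ n ^ j) ∘ₗ (𝓗.lft.σ n n).1 ∘ₗ 𝓗.τ (n + 1) ∘ₗ
    (LinearMap.id - 𝓗.signedτ (n + 1))

/-- Hochschild cohomology `HH^n(H)`. -/
abbrev HHco (n : ℕ) : Type _ := CochainHH 𝓗.lft.b n

/-- Hopf-cyclic cohomology `HC^n(H)`. -/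
abbrev HCco (n : ℕ) : Type _ := CochainHC 𝓗.lft.b 𝓗.coB n

end Cohomology

end HopfAlgebroid

section Chains

variable {k : Type v} [CommRing k] {A H : Type u} [Ring A] [Algebra k A] [Ring H] [Algebra k H]

/-- Maps of left `A`-modules. -/
def LHom (M N : LMod k A) : Type u :=
  {f : M.carrier →ₗ[k] N.carrier // ∀ a x, f (M.act a x) = N.act a (f x)}

namespace STRing

variable (R : STRing k A H)

/-- Left multiplication by `h` on the first factor of `H ⊗_A M`. -/
def lmulE (M : LMod k A) : H →ₐ[k] Module.End k (BalTensor R.sR (fun a => M.act a)) :=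
  AlgHom.ofLinearMap
    { toFun := fun h => balLift R.sR (fun a => M.act a)
        ((balRel R.sR (fun a => M.act a)).mkQ ∘ₗ
          TensorProduct.map (LinearMap.mulLeft k h) LinearMap.id)
        (by
          intro a x m
          have := bal_rel (ρ := R.sR) (l := fun a => M.act a) a (h * x) m
          simpa [mul_assoc] using this)
      map_add' := by
        intro g h
        apply bal_ext
        intro x m
        change (balRel R.sR (fun a => M.act a)).mkQ (((g + h) * x) ⊗ₜ m) =
          (balRel R.sR (fun a => M.act a)).mkQ ((g * x) ⊗ₜ m) +
            (balRel R.sR (fun a => M.act a)).mkQ ((h * x) ⊗ₜ m)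
        rw [add_mul, TensorProduct.add_tmul, map_add]
      map_smul' := by
        intro c h
        apply bal_ext
        intro x m
        change (balRel R.sR (fun a => M.act a)).mkQ (((c • h) * x) ⊗ₜ m) =
          c • (balRel R.sR (fun a => M.act a)).mkQ ((h * x) ⊗ₜ m)
        rw [smul_mul_assoc, ← TensorProduct.smul_tmul', map_smul] }
    (by
      apply bal_ext
      intro x m
      change (balRel _ _).mkQ (((1 : H) * x) ⊗ₜ m) = (balRel _ _).mkQ (x ⊗ₜ m)
      rw [one_mul])
    (by
      intro g h
      apply bal_ext
      intro x m
      change (balRel _ _).mkQ ((g * h * x) ⊗ₜ m) = (balRel _ _).mkQ ((g * (h * x)) ⊗ₜ m)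
      rw [mul_assoc])

/-- The left `A`-module `H ⊗_A M`, for the bimodule structure `a₁·h·a₂ = s(a₁) h s(a₂)`. -/
def ext (M : LMod k A) : LMod k A where
  carrier := BalTensor R.sR (fun a => M.act a)
  act := (R.lmulE M).comp R.s

/-- The class `h ⊗ m` in `H ⊗_A M`. -/
def em (M : LMod k A) : H →ₗ[k] M.carrier →ₗ[k] (R.ext M).carrier :=
  (TensorProduct.mk k H M.carrier).compr₂ (balRel R.sR (fun a => M.act a)).mkQ

/-- The left action of `H` on `H ⊗_A M`. -/
def lm (M : LMod k A) : H →ₐ[k] Module.End k (R.ext M).carrier := R.lmulE M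

theorem em_bal (M : LMod k A) (a : A) (h : H) (m : M.carrier) :
    R.em M (h * R.s a) m = R.em M h (M.act a m) :=
  bal_rel (ρ := R.sR) (l := fun a => M.act a) a h m

theorem lm_em (M : LMod k A) (g h : H) (m : M.carrier) :
    R.lm M g (R.em M h m) = R.em M (g * h) m := rfl

theorem act_em (M : LMod k A) (a : A) (h : H) (m : M.carrier) :
    (R.ext M).act a (R.em M h m) = R.em M (R.s a * h) m := rfl

theorem act_eq (M : LMod k A) (a : A) (y : (R.ext M).carrier) :
    (R.ext M).act a y = R.lm M (R.s a) y := rfl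

theorem ext_ext {M : LMod k A} {P : Type*} [AddCommGroup P] [Module k P]
    {f g : (R.ext M).carrier →ₗ[k] P} (h : ∀ x m, f (R.em M x m) = g (R.em M x m)) : f = g :=
  bal_ext h

/-- The map on `H ⊗_A M` induced by a balanced bilinear map. -/
def elift {M : LMod k A} {P : Type*} [AddCommGroup P] [Module k P] (f : H →ₗ[k] M.carrier →ₗ[k] P)
    (hf : ∀ a h m, f (h * R.s a) m = f h (M.act a m)) : (R.ext M).carrier →ₗ[k] P :=
  balLift R.sR (fun a => M.act a) (TensorProduct.lift f) (by intro a h m; simpa using hf a h m)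

theorem elift_em {M : LMod k A} {P : Type*} [AddCommGroup P] [Module k P]
    (f : H →ₗ[k] M.carrier →ₗ[k] P) (hf : ∀ a h m, f (h * R.s a) m = f h (M.act a m))
    (h : H) (m : M.carrier) : R.elift f hf (R.em M h m) = f h m := rfl

/-- The map of `A`-modules on `H ⊗_A M` induced by a balanced bilinear map. -/
def mkLHom {M N : LMod k A} (g : H →ₗ[k] M.carrier →ₗ[k] N.carrier)
    (hg : ∀ a h m, g (h * R.s a) m = g h (M.act a m))
    (hs : ∀ a h m, g (R.s a * h) m = N.act a (g h m)) : LHom (R.ext M) N :=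
  ⟨R.elift g hg, by
    intro a x
    refine LinearMap.congr_fun (f := R.elift g hg ∘ₗ (R.ext M).act a)
      (g := N.act a ∘ₗ R.elift g hg) ?_ x
    apply ext_ext
    intro h m
    simp only [LinearMap.comp_apply, act_em, elift_em, hs]⟩

/-- `id ⊗ f : h ⊗ m ↦ h ⊗ f(m)`. -/
def idExt {M N : LMod k A} (f : LHom M N) : LHom (R.ext M) (R.ext N) :=
  R.mkLHom ((R.em N).compl₂ f.1) (by intro a h m; simp [em_bal, f.2])
    (by intro a h m; simp [act_em])

/-- `m ↦ 1 ⊗ m`. -/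
def oneExt (M : LMod k A) : LHom M (R.ext M) :=
  ⟨R.em M 1, by
    intro a x
    rw [act_em, ← em_bal, one_mul, mul_one]⟩

/-- `h ⊗ (h' ⊗ m) ↦ h h' ⊗ m`. -/
def mulExt (M : LMod k A) : LHom (R.ext (R.ext M)) (R.ext M) :=
  R.mkLHom (R.lm M).toLinearMap (by intro a h m; simp [act_eq]) (by intro a h m; simp [act_eq])

variable (k A) in
/-- The base algebra as a left module over itself. -/
def base : LMod k A where
  carrier := A
  act := Algebra.lmul k A

/-- The map `h ⊗ a ↦ φ(h s(a))` on `H ⊗_A A ≅ H`. -/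
def baseLift {P : Type*} [AddCommGroup P] [Module k P] (φ : H →ₗ[k] P) :
    (R.ext (base k A)).carrier →ₗ[k] P :=
  let g : H →ₗ[k] A →ₗ[k] P := ((LinearMap.mul k H).compl₂ R.sLin).compr₂ φ
  have hg : ∀ (a : A) (h : H) (m : A), g (h * R.s a) m = g h (a * m) := by
    intro a h m
    simp [g, mul_assoc]
  R.elift (M := base k A) g hg

theorem baseLift_act {P : Type*} [AddCommGroup P] [Module k P] (φ : H →ₗ[k] P)
    (F : A → Module.End k P) (hF : ∀ a h, φ (R.s a * h) = F a (φ h)) (a : A)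
    (x : (R.ext (base k A)).carrier) :
    R.baseLift φ ((R.ext (base k A)).act a x) = F a (R.baseLift φ x) := by
  refine LinearMap.congr_fun (f := R.baseLift φ ∘ₗ (R.ext (base k A)).act a)
    (g := F a ∘ₗ R.baseLift φ) ?_ x
  apply ext_ext
  intro h m
  exact (congrArg φ (mul_assoc _ _ _)).trans (hF a (h * R.s (show A from m)))

/-- The chain spaces `C_n(H) = H ⊗_A ⋯ ⊗_A H` (`n` factors, bimodule structure
`a₁·h·a₂ = s(a₁) h s(a₂)`) as left `A`-modules, with `C_0 = A`, formed as `C_{n+1} = H ⊗_A C_n`. In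
particular `C_1 = H ⊗_A A`, which is identified with `H` through `h ⊗ a = h s(a) ⊗ 1`. -/
def Ch : ℕ → LMod k A
  | 0 => base k A
  | n + 1 => R.ext (Ch n)

/-- The degeneracies `s_i : C_n → C_{n+1}`, for `i ≤ n`. -/
def dgn : ∀ n : ℕ, ℕ → LHom (R.Ch n) (R.Ch (n + 1))
  | n, 0 => R.oneExt (R.Ch n)
  | 0, _ + 1 => R.oneExt (R.Ch 0)
  | n + 1, i + 1 => R.idExt (dgn n i)

end STRing

namespace HopfAlgebroid

variable {Al Ar : Type u} [Ring Al] [Algebra k Al] [Ring Ar] [Algebra k Ar]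
  (𝓗 : HopfAlgebroid k Al Ar H)

/-- The chain spaces `C_n(H)`. -/
abbrev Ch (n : ℕ) : LMod k Ar := 𝓗.rgt.Ch n

/-- The face `d_0 : h ⊗ x ↦ ε_r(h) · x`. -/
def fzero (n : ℕ) : (𝓗.Ch (n + 1)).carrier →ₗ[k] (𝓗.Ch n).carrier :=
  𝓗.rgt.elift ((𝓗.Ch n).act.toLinearMap ∘ₗ 𝓗.rgt.ε) (by intro a h m; simp [𝓗.rgt.ε_s])

/-- The last face in degree one, `h ↦ ε_r(S⁻¹ h)`. -/
def fone : LHom (𝓗.Ch 1) (𝓗.Ch 0) :=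
  ⟨𝓗.rgt.baseLift (P := Ar) (𝓗.rgt.ε ∘ₗ 𝓗.Si), fun a x =>
    𝓗.rgt.baseLift_act (P := Ar) (𝓗.rgt.ε ∘ₗ 𝓗.Si) (Algebra.lmul k Ar) (by
      intro a h
      simp [Si_sr_mul, 𝓗.rgt.ε_t]) a x⟩

/-- The face `d_{i+1} : C_{n+1} → C_n`, for `i ≤ n`: multiplication of neighbouring factors for
`i < n`, and `hⁿ · ε_r(S⁻¹ hⁿ⁺¹)` in the last place for `i = n`. -/
def fsucc : ∀ n : ℕ, ℕ → LHom (𝓗.Ch (n + 1)) (𝓗.Ch n)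
  | 0, _ => 𝓗.fone
  | n + 1, 0 => 𝓗.rgt.mulExt (𝓗.Ch n)
  | n + 1, i + 1 => 𝓗.rgt.idExt (fsucc n i)

/-- The faces `d_i : C_{n+1} → C_n`, for `i ≤ n + 1`. -/
def face (n : ℕ) : ℕ → (𝓗.Ch (n + 1)).carrier →ₗ[k] (𝓗.Ch n).carrier
  | 0 => 𝓗.fzero n
  | i + 1 => (𝓗.fsucc n i).1

/-- The Hochschild boundary `b = ∑ (-1)^i d_i`. -/
def bd (n : ℕ) : (𝓗.Ch (n + 1)).carrier →ₗ[k] (𝓗.Ch n).carrier :=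
  ∑ i ∈ Finset.range (n + 2), (-1 : k) ^ i • 𝓗.face n i

/-- `u ⊗ m ↦ u t_r(a) ⊗ m`. -/
def rtr (M : LMod k Ar) (a : Ar) : Module.End k (𝓗.rgt.ext M).carrier :=
  𝓗.rgt.elift (𝓗.rgt.em M ∘ₗ LinearMap.mulRight k (𝓗.rgt.t (op a))) (by
    intro b h m
    simp only [LinearMap.comp_apply, LinearMap.mulRight_apply]
    rw [mul_assoc, 𝓗.rgt.comm, ← mul_assoc, STRing.em_bal])

theorem rtr_em (M : LMod k Ar) (a : Ar) (u : H) (m : M.carrier) :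
    𝓗.rtr M a (𝓗.rgt.em M u m) = 𝓗.rgt.em M (u * 𝓗.rgt.t (op a)) m := rfl

/-- `x ⊗ w ↦ (u ⊗ m ↦ u S⁻¹(w) ⊗ x ⊗ m)` on `H ⊗_{A_l} H`. -/
def preRot (M : LMod k Ar) : 𝓗.lft.TensL →ₗ[k] H ⊗[k] M.carrier →ₗ[k]
    (𝓗.rgt.ext (𝓗.rgt.ext M)).carrier :=
  balLift _ _
    (pairing ((LinearMap.mul k H).flip ∘ₗ 𝓗.Si) (𝓗.rgt.em M)
      (balRel 𝓗.rgt.sR (fun a => (𝓗.rgt.ext M).act a)).mkQ ∘ₗ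
        (TensorProduct.comm k H H).toLinearMap)
    (by
      intro a x w
      apply TensorProduct.ext'
      intro u m
      change 𝓗.rgt.em (𝓗.rgt.ext M) (u * 𝓗.Si w) (𝓗.rgt.em M (𝓗.lft.t (op a) * x) m) =
        𝓗.rgt.em (𝓗.rgt.ext M) (u * 𝓗.Si (𝓗.lft.s a * w)) (𝓗.rgt.em M x m)
      rw [Si_sl_mul, ← 𝓗.srεr_tl, ← STRing.act_em, ← STRing.em_bal, mul_assoc])

theorem preRot_mk (M : LMod k Ar) (x w u : H) (m : M.carrier) :
    𝓗.preRot M (𝓗.lft.mkL (x ⊗ₜ w)) (u ⊗ₜ m) =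
      𝓗.rgt.em (𝓗.rgt.ext M) (u * 𝓗.Si w) (𝓗.rgt.em M x m) := rfl

/-- `u ⊗ m ↦ u S⁻¹(h₂) ⊗ h₁ ⊗ m`. -/
def rot (M : LMod k Ar) (h : H) :
    (𝓗.rgt.ext M).carrier →ₗ[k] (𝓗.rgt.ext (𝓗.rgt.ext M)).carrier :=
  balLift _ _ (𝓗.preRot M (𝓗.lft.Δ h)) (by
    intro a u m
    obtain ⟨X, hX⟩ := 𝓗.lft.mkL_surjective (𝓗.lft.Δ h)
    have e := 𝓗.lft.takeuchi h X hX (𝓗.lft.ε (𝓗.rgt.s a))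
    rw [← hX]
    have e1 : 𝓗.preRot M (𝓗.lft.mkL X) (𝓗.rgt.sR a u ⊗ₜ m) =
        𝓗.preRot M (𝓗.lft.mkL (X * (1 ⊗ₜ 𝓗.lft.s (𝓗.lft.ε (𝓗.rgt.s a))))) (u ⊗ₜ m) := by
      clear hX e
      induction X with
      | zero => simp
      | add a b ha hb => simp only [map_add, LinearMap.add_apply, ha, hb, add_mul]
      | tmul x y =>
        rw [Algebra.TensorProduct.tmul_mul_tmul, preRot_mk, preRot_mk, Si_mul_sl, 𝓗.tlεl_sr,
          STRing.sR_apply, mul_one, mul_assoc]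
    have e2 : 𝓗.preRot M (𝓗.lft.mkL X) (u ⊗ₜ M.act a m) =
        𝓗.preRot M (𝓗.lft.mkL (X * (𝓗.lft.t (op (𝓗.lft.ε (𝓗.rgt.s a))) ⊗ₜ 1))) (u ⊗ₜ m) := by
      clear hX e e1
      induction X with
      | zero => simp
      | add a b ha hb => simp only [map_add, LinearMap.add_apply, ha, hb, add_mul]
      | tmul x y =>
        rw [Algebra.TensorProduct.tmul_mul_tmul, preRot_mk, preRot_mk, 𝓗.tlεl_sr, mul_one,
          STRing.em_bal]
    rw [e1, e2, e])

theorem rot_em (M : LMod k Ar) (h u : H) (m : M.carrier) :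
    𝓗.rot M h (𝓗.rgt.em M u m) = 𝓗.preRot M (𝓗.lft.Δ h) (u ⊗ₜ m) := rfl

/-- `rot` as a linear map in `h`. -/
def rotLin (M : LMod k Ar) :
    H →ₗ[k] (𝓗.rgt.ext M).carrier →ₗ[k] (𝓗.rgt.ext (𝓗.rgt.ext M)).carrier where
  toFun := 𝓗.rot M
  map_add' g h := by
    apply STRing.ext_ext
    intro u m
    simp only [LinearMap.add_apply, rot_em, map_add]
  map_smul' c h := by
    apply STRing.ext_ext
    intro u m
    simp only [LinearMap.smul_apply, rot_em, map_smul, RingHom.id_apply]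

theorem Δ_sr_mul (a : Ar) (h : H) (X : H ⊗[k] H) (hX : 𝓗.lft.mkL X = 𝓗.lft.Δ h) :
    𝓗.lft.Δ (𝓗.rgt.s a * h) = 𝓗.lft.mkL ((1 ⊗ₜ 𝓗.rgt.s a) * X) := by
  have := 𝓗.lft.Δ_t (𝓗.lft.ε (𝓗.rgt.s a)) h X hX
  rwa [𝓗.tlεl_sr] at this

theorem Δ_mul_sr (a : Ar) (h : H) (X : H ⊗[k] H) (hX : 𝓗.lft.mkL X = 𝓗.lft.Δ h) :
    𝓗.lft.Δ (h * 𝓗.rgt.s a) = 𝓗.lft.mkL (X * (1 ⊗ₜ 𝓗.rgt.s a)) := by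
  apply 𝓗.lft.Δ_mul _ _ _ _ hX
  have := 𝓗.Δ_sr_mul a 1 (1 ⊗ₜ 1) 𝓗.lft.Δ_one.symm
  simpa using this.symm

theorem rot_mul_sr (M : LMod k Ar) (a : Ar) (h : H) (y : (𝓗.rgt.ext M).carrier) :
    𝓗.rot M (h * 𝓗.rgt.s a) y = 𝓗.rot M h (𝓗.rtr M a y) := by
  refine LinearMap.congr_fun (g := 𝓗.rot M h ∘ₗ 𝓗.rtr M a) ?_ y
  apply STRing.ext_ext
  intro u m
  obtain ⟨X, hX⟩ := 𝓗.lft.mkL_surjective (𝓗.lft.Δ h)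
  rw [LinearMap.comp_apply, rtr_em, rot_em, rot_em, 𝓗.Δ_mul_sr a h X hX, ← hX]
  clear hX
  induction X with
  | zero => simp
  | add a b ha hb => simp only [map_add, LinearMap.add_apply, ha, hb, add_mul]
  | tmul x w =>
    rw [Algebra.TensorProduct.tmul_mul_tmul, preRot_mk, preRot_mk, Si_mul_sr, mul_one, mul_assoc]

theorem rot_sr_mul (M : LMod k Ar) (a : Ar) (h : H) (y : (𝓗.rgt.ext M).carrier) :
    𝓗.rot M (𝓗.rgt.s a * h) y = 𝓗.rtr (𝓗.rgt.ext M) a (𝓗.rot M h y) := by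
  refine LinearMap.congr_fun (g := 𝓗.rtr (𝓗.rgt.ext M) a ∘ₗ 𝓗.rot M h) ?_ y
  apply STRing.ext_ext
  intro u m
  obtain ⟨X, hX⟩ := 𝓗.lft.mkL_surjective (𝓗.lft.Δ h)
  rw [LinearMap.comp_apply, rot_em, rot_em, 𝓗.Δ_sr_mul a h X hX, ← hX]
  clear hX
  induction X with
  | zero => simp
  | add a b ha hb => simp only [map_add, LinearMap.add_apply, ha, hb, mul_add]
  | tmul x w =>
    rw [Algebra.TensorProduct.tmul_mul_tmul, preRot_mk, preRot_mk, Si_sr_mul, one_mul, rtr_em,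
      mul_assoc]

/-- Endomorphisms `T` of `H ⊗_{A_r} M` that turn the left action of `a` into right
multiplication by `t_r(a)` on the first factor. -/
def RtrEnd (M : LMod k Ar) : Type u :=
  {T : Module.End k (𝓗.rgt.ext M).carrier //
    ∀ a x, T ((𝓗.rgt.ext M).act a x) = 𝓗.rtr M a (T x)}

/-- The cyclic operator in degree one, `h ↦ S⁻¹(h)`. -/
def tone : 𝓗.RtrEnd (STRing.base k Ar) :=
  ⟨𝓗.rgt.baseLift ((𝓗.rgt.em (STRing.base k Ar)).flip (1 : Ar) ∘ₗ 𝓗.Si),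
    𝓗.rgt.baseLift_act _ (𝓗.rtr (STRing.base k Ar)) (by
      intro a h
      rw [LinearMap.comp_apply, Si_sr_mul]
      rfl)⟩

/-- From `T` on `H ⊗ M`, the operator `h ⊗ x ↦ u S⁻¹(h₂) ⊗ h₁ ⊗ y` on `H ⊗ (H ⊗ M)`, where
`T(x) = u ⊗ y`. -/
def rotStep {M : LMod k Ar} (T : 𝓗.RtrEnd M) : 𝓗.RtrEnd (𝓗.rgt.ext M) :=
  have hb : ∀ (a : Ar) (h : H) (m : (𝓗.rgt.ext M).carrier),
      ((𝓗.rotLin M).compl₂ T.1) (h * 𝓗.rgt.s a) m =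
        ((𝓗.rotLin M).compl₂ T.1) h ((𝓗.rgt.ext M).act a m) := by
    intro a h m
    change 𝓗.rot M _ (T.1 m) = 𝓗.rot M h (T.1 _)
    rw [T.2, rot_mul_sr]
  ⟨𝓗.rgt.elift ((𝓗.rotLin M).compl₂ T.1) hb, by
    intro a x
    refine LinearMap.congr_fun
      (f := 𝓗.rgt.elift ((𝓗.rotLin M).compl₂ T.1) hb ∘ₗ (𝓗.rgt.ext (𝓗.rgt.ext M)).act a)
      (g := 𝓗.rtr (𝓗.rgt.ext M) a ∘ₗ 𝓗.rgt.elift ((𝓗.rotLin M).compl₂ T.1) hb) ?_ x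
    apply STRing.ext_ext
    intro h m
    exact 𝓗.rot_sr_mul M a h (T.1 m)⟩

/-- The cyclic operator in positive degree,
`t_n (h¹ ⊗ ⋯ ⊗ hⁿ) = S⁻¹(h¹₂ ⋯ hⁿ⁻¹₂ hⁿ) ⊗ h¹₁ ⊗ ⋯ ⊗ hⁿ⁻¹₁`. Since `S⁻¹` reverses products, it is
given recursively by `t_{n+1} (h ⊗ x) = u S⁻¹(h₂) ⊗ h₁ ⊗ y` if `t_n (x) = u ⊗ y`. -/
def tsucc : ∀ n : ℕ, 𝓗.RtrEnd (𝓗.Ch n)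
  | 0 => 𝓗.tone
  | n + 1 => 𝓗.rotStep (tsucc n)

/-- The cyclic operator `t_n`, with `t_0 = id`. -/
def cyc : ∀ n : ℕ, Module.End k (𝓗.Ch n).carrier
  | 0 => LinearMap.id
  | n + 1 => (𝓗.tsucc n).1

/-- The signed cyclic operator `(-1)^n t_n`. -/
def signedCyc (n : ℕ) : Module.End k (𝓗.Ch n).carrier := (-1 : k) ^ n • 𝓗.cyc n

/-- The operator `B = (1 - λ) s_{-1} N` on chains, where `λ = (-1)^n t_n`, `N = 1 + λ + ⋯ + λ^n` and
`s_{-1} = t_{n+1} s_n` is the extra degeneracy. -/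
def chB (n : ℕ) : (𝓗.Ch n).carrier →ₗ[k] (𝓗.Ch (n + 1)).carrier :=
  (LinearMap.id - 𝓗.signedCyc (n + 1)) ∘ₗ 𝓗.cyc (n + 1) ∘ₗ (𝓗.rgt.dgn n n).1 ∘ₗ
    (∑ j ∈ Finset.range (n + 1), 𝓗.signedCyc n ^ j)

/-- Dual Hochschild homology `HH_n(H)`. -/
abbrev HH (n : ℕ) : Type _ := ChainHH (C := fun m => (𝓗.Ch m).carrier) 𝓗.bd n

/-- Dual Hopf-cyclic homology `HC_n(H)`. -/
abbrev HC (n : ℕ) : Type _ := ChainHC (C := fun m => (𝓗.Ch m).carrier) 𝓗.bd 𝓗.chB n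

end HopfAlgebroid

end Chains

section Functoriality

variable {k : Type v} [CommRing k]

/-- Morphisms of Hopf algebroids: algebra maps `Al → Al'`, `Ar → Ar'`, `H → H'` compatible with all
structure maps. -/
structure HopfAlgebroid.Hom {Al Ar H Al' Ar' H' : Type u} [Ring Al] [Algebra k Al]
    [Ring Ar] [Algebra k Ar] [Ring H] [Algebra k H] [Ring Al'] [Algebra k Al']
    [Ring Ar'] [Algebra k Ar'] [Ring H'] [Algebra k H']
    (𝓗 : HopfAlgebroid k Al Ar H) (𝓗' : HopfAlgebroid k Al' Ar' H') where
  fl : Al →ₐ[k] Al'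
  fr : Ar →ₐ[k] Ar'
  F : H →ₐ[k] H'
  map_sl : ∀ a, F (𝓗.lft.s a) = 𝓗'.lft.s (fl a)
  map_tl : ∀ a, F (𝓗.lft.t (op a)) = 𝓗'.lft.t (op (fl a))
  map_sr : ∀ a, F (𝓗.rgt.s a) = 𝓗'.rgt.s (fr a)
  map_tr : ∀ a, F (𝓗.rgt.t (op a)) = 𝓗'.rgt.t (op (fr a))
  map_εl : ∀ h, 𝓗'.lft.ε (F h) = fl (𝓗.lft.ε h)
  map_εr : ∀ h, 𝓗'.rgt.ε (F h) = fr (𝓗.rgt.ε h)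
  map_Δl : ∀ h X, 𝓗.lft.mkL X = 𝓗.lft.Δ h →
    𝓗'.lft.Δ (F h) = 𝓗'.lft.mkL (TensorProduct.map F.toLinearMap F.toLinearMap X)
  map_Δr : ∀ h X, 𝓗.rgt.mkR X = 𝓗.rgt.Δ h →
    𝓗'.rgt.Δ (F h) = 𝓗'.rgt.mkR (TensorProduct.map F.toLinearMap F.toLinearMap X)
  map_S : ∀ h, 𝓗'.S (F h) = F (𝓗.S h)

namespace HopfAlgebroid.Hom

variable {Al Ar H Al' Ar' H' : Type u} [Ring Al] [Algebra k Al]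
    [Ring Ar] [Algebra k Ar] [Ring H] [Algebra k H] [Ring Al'] [Algebra k Al']
    [Ring Ar'] [Algebra k Ar'] [Ring H'] [Algebra k H']
    {𝓗 : HopfAlgebroid k Al Ar H} {𝓗' : HopfAlgebroid k Al' Ar' H'} (f : Hom 𝓗 𝓗')

theorem map_Si (h : H) : f.F (𝓗.Si h) = 𝓗'.Si (f.F h) := by
  apply 𝓗'.S.injective
  simp [Si, f.map_S]

/-- `k`-linear maps that are semilinear along `Ar → Ar'`. -/
def SHom (M : LMod k Ar) (M' : LMod k Ar') : Type u :=
  {g : M.carrier →ₗ[k] M'.carrier // ∀ a x, g (M.act a x) = M'.act (f.fr a) (g x)}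

/-- `h ⊗ m ↦ F(h) ⊗ g(m)`. -/
def extMap {M : LMod k Ar} {M' : LMod k Ar'} (g : f.SHom M M') :
    f.SHom (𝓗.rgt.ext M) (𝓗'.rgt.ext M') :=
  have hb : ∀ (a : Ar) (h : H) (m : M.carrier),
      ((𝓗'.rgt.em M').compl₁₂ f.F.toLinearMap g.1) (h * 𝓗.rgt.s a) m =
        ((𝓗'.rgt.em M').compl₁₂ f.F.toLinearMap g.1) h (M.act a m) := by
    intro a h m
    simp [f.map_sr, STRing.em_bal, g.2]
  ⟨𝓗.rgt.elift ((𝓗'.rgt.em M').compl₁₂ f.F.toLinearMap g.1) hb, by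
    intro a x
    refine LinearMap.congr_fun (f := 𝓗.rgt.elift _ hb ∘ₗ (𝓗.rgt.ext M).act a)
      (g := (𝓗'.rgt.ext M').act (f.fr a) ∘ₗ 𝓗.rgt.elift _ hb) ?_ x
    apply STRing.ext_ext
    intro h m
    simp only [LinearMap.comp_apply, STRing.act_em, STRing.elift_em, LinearMap.compl₁₂_apply,
      AlgHom.toLinearMap_apply, map_mul, f.map_sr]⟩

theorem extMap_em {M : LMod k Ar} {M' : LMod k Ar'} (g : f.SHom M M') (h : H) (m : M.carrier) :
    (f.extMap g).1 (𝓗.rgt.em M h m) = 𝓗'.rgt.em M' (f.F h) (g.1 m) := rfl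

/-- The induced map `C_n(H) → C_n(H')`, `h¹ ⊗ ⋯ ⊗ hⁿ ↦ F(h¹) ⊗ ⋯ ⊗ F(hⁿ)`. -/
def chMap : ∀ n, f.SHom (𝓗.Ch n) (𝓗'.Ch n)
  | 0 => ⟨f.fr.toLinearMap, fun a x => map_mul f.fr a x⟩
  | n + 1 => f.extMap (chMap n)

theorem chMap_fzero (n : ℕ) (x : (𝓗.Ch (n + 1)).carrier) :
    (f.chMap n).1 (𝓗.fzero n x) = 𝓗'.fzero n ((f.chMap (n + 1)).1 x) := by
  refine LinearMap.congr_fun (f := (f.chMap n).1 ∘ₗ 𝓗.fzero n)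
    (g := 𝓗'.fzero n ∘ₗ (f.chMap (n + 1)).1) ?_ x
  apply STRing.ext_ext
  intro h m
  change (f.chMap n).1 ((𝓗.Ch n).act (𝓗.rgt.ε h) m) =
    (𝓗'.Ch n).act (𝓗'.rgt.ε (f.F h)) ((f.chMap n).1 m)
  rw [(f.chMap n).2, f.map_εr]

theorem idExt_nat {M N : LMod k Ar} {M' N' : LMod k Ar'} (g : f.SHom M M') (g' : f.SHom N N')
    (p : LHom M N) (p' : LHom M' N') (hp : ∀ x, g'.1 (p.1 x) = p'.1 (g.1 x))
    (x : (𝓗.rgt.ext M).carrier) :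
    (f.extMap g').1 ((𝓗.rgt.idExt p).1 x) = (𝓗'.rgt.idExt p').1 ((f.extMap g).1 x) := by
  refine LinearMap.congr_fun (f := (f.extMap g').1 ∘ₗ (𝓗.rgt.idExt p).1)
    (g := (𝓗'.rgt.idExt p').1 ∘ₗ (f.extMap g).1) ?_ x
  apply STRing.ext_ext
  intro h m
  change 𝓗'.rgt.em N' (f.F h) (g'.1 (p.1 m)) = 𝓗'.rgt.em N' (f.F h) (p'.1 (g.1 m))
  rw [hp]

theorem chMap_fone (x : (𝓗.Ch 1).carrier) :
    (f.chMap 0).1 (𝓗.fone.1 x) = 𝓗'.fone.1 ((f.chMap 1).1 x) := by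
  refine LinearMap.congr_fun (f := (f.chMap 0).1 ∘ₗ 𝓗.fone.1)
    (g := 𝓗'.fone.1 ∘ₗ (f.chMap 1).1) ?_ x
  apply STRing.ext_ext
  intro h m
  have e : ∀ a : Ar, f.fr (𝓗.rgt.ε (𝓗.Si (h * 𝓗.rgt.s a))) =
      𝓗'.rgt.ε (𝓗'.Si (f.F h * 𝓗'.rgt.s (f.fr a))) := by
    intro a
    rw [← f.map_εr, map_Si, map_mul, f.map_sr]
  exact e m

theorem chMap_fsucc : ∀ (n i : ℕ) (x : (𝓗.Ch (n + 1)).carrier),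
    (f.chMap n).1 ((𝓗.fsucc n i).1 x) = (𝓗'.fsucc n i).1 ((f.chMap (n + 1)).1 x)
  | 0, _, x => f.chMap_fone x
  | n + 1, 0, x => by
    refine LinearMap.congr_fun (f := (f.chMap (n + 1)).1 ∘ₗ (𝓗.rgt.mulExt (𝓗.Ch n)).1)
      (g := (𝓗'.rgt.mulExt (𝓗'.Ch n)).1 ∘ₗ (f.extMap (f.extMap (f.chMap n))).1) ?_ x
    apply STRing.ext_ext
    intro h y
    refine LinearMap.congr_fun (f := (f.extMap (f.chMap n)).1 ∘ₗ 𝓗.rgt.lm (𝓗.Ch n) h)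
      (g := 𝓗'.rgt.lm (𝓗'.Ch n) (f.F h) ∘ₗ (f.extMap (f.chMap n)).1) ?_ y
    apply STRing.ext_ext
    intro h' m
    simp only [LinearMap.comp_apply, STRing.lm_em, extMap_em, map_mul]
  | n + 1, i + 1, x => f.idExt_nat _ _ _ _ (chMap_fsucc n i) x

theorem chMap_dgn : ∀ (n i : ℕ) (x : (𝓗.Ch n).carrier),
    (f.chMap (n + 1)).1 ((𝓗.rgt.dgn n i).1 x) = (𝓗'.rgt.dgn n i).1 ((f.chMap n).1 x)
  | 0, 0, x => congrArg (fun z => 𝓗'.rgt.em (𝓗'.Ch 0) z ((f.chMap 0).1 x)) (map_one f.F)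
  | n + 1, 0, x =>
    congrArg (fun z => 𝓗'.rgt.em (𝓗'.Ch (n + 1)) z ((f.chMap (n + 1)).1 x)) (map_one f.F)
  | 0, _ + 1, x => congrArg (fun z => 𝓗'.rgt.em (𝓗'.Ch 0) z ((f.chMap 0).1 x)) (map_one f.F)
  | n + 1, i + 1, x => f.idExt_nat _ _ _ _ (chMap_dgn n i) x

theorem chMap_bd (n : ℕ) (x : (𝓗.Ch (n + 1)).carrier) :
    (f.chMap n).1 (𝓗.bd n x) = 𝓗'.bd n ((f.chMap (n + 1)).1 x) := by
  simp only [bd, LinearMap.sum_apply, map_sum, LinearMap.smul_apply, map_smul]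
  refine Finset.sum_congr rfl fun i _ => ?_
  cases i with
  | zero => exact congrArg _ (f.chMap_fzero n x)
  | succ i => exact congrArg _ (f.chMap_fsucc n i x)

theorem rot_nat {M : LMod k Ar} {M' : LMod k Ar'} (g : f.SHom M M') (h : H)
    (y : (𝓗.rgt.ext M).carrier) :
    (f.extMap (f.extMap g)).1 (𝓗.rot M h y) = 𝓗'.rot M' (f.F h) ((f.extMap g).1 y) := by
  refine LinearMap.congr_fun (f := (f.extMap (f.extMap g)).1 ∘ₗ 𝓗.rot M h)
    (g := 𝓗'.rot M' (f.F h) ∘ₗ (f.extMap g).1) ?_ y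
  apply STRing.ext_ext
  intro u m
  obtain ⟨X, hX⟩ := 𝓗.lft.mkL_surjective (𝓗.lft.Δ h)
  rw [LinearMap.comp_apply, LinearMap.comp_apply, extMap_em, rot_em, rot_em, f.map_Δl h X hX, ← hX]
  clear hX
  induction X with
  | zero => simp
  | add a b ha hb => simp only [map_add, LinearMap.add_apply, ha, hb]
  | tmul x w =>
    rw [preRot_mk, extMap_em, extMap_em, TensorProduct.map_tmul, preRot_mk, map_mul, map_Si]
    rfl

theorem chMap_tsucc : ∀ (n : ℕ) (x : (𝓗.Ch (n + 1)).carrier),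
    (f.chMap (n + 1)).1 ((𝓗.tsucc n).1 x) = (𝓗'.tsucc n).1 ((f.chMap (n + 1)).1 x)
  | 0, x => by
    refine LinearMap.congr_fun (f := (f.chMap 1).1 ∘ₗ 𝓗.tone.1)
      (g := 𝓗'.tone.1 ∘ₗ (f.chMap 1).1) ?_ x
    apply STRing.ext_ext
    intro h m
    have e : ∀ a : Ar, 𝓗'.rgt.em (STRing.base k Ar') (f.F (𝓗.Si (h * 𝓗.rgt.s a))) (f.fr 1) =
        𝓗'.rgt.em (STRing.base k Ar') (𝓗'.Si (f.F h * 𝓗'.rgt.s (f.fr a))) (1 : Ar') := by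
      intro a
      rw [map_Si, map_mul, f.map_sr, map_one]
    exact e m
  | n + 1, x => by
    refine LinearMap.congr_fun (f := (f.chMap (n + 2)).1 ∘ₗ (𝓗.rotStep (𝓗.tsucc n)).1)
      (g := (𝓗'.rotStep (𝓗'.tsucc n)).1 ∘ₗ (f.chMap (n + 2)).1) ?_ x
    apply STRing.ext_ext
    intro h m
    exact (f.rot_nat (f.chMap n) h ((𝓗.tsucc n).1 m)).trans
      (congrArg _ (chMap_tsucc n m))

theorem chMap_cyc (n : ℕ) (x : (𝓗.Ch n).carrier) :
    (f.chMap n).1 (𝓗.cyc n x) = 𝓗'.cyc n ((f.chMap n).1 x) := by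
  cases n with
  | zero => rfl
  | succ n => exact f.chMap_tsucc n x

theorem chMap_signedCyc (n : ℕ) (x : (𝓗.Ch n).carrier) :
    (f.chMap n).1 (𝓗.signedCyc n x) = 𝓗'.signedCyc n ((f.chMap n).1 x) := by
  simp only [signedCyc, LinearMap.smul_apply, map_smul, chMap_cyc]

theorem chMap_signedCyc_pow (n j : ℕ) (x : (𝓗.Ch n).carrier) :
    (f.chMap n).1 ((𝓗.signedCyc n ^ j) x) = (𝓗'.signedCyc n ^ j) ((f.chMap n).1 x) := by
  induction j with
  | zero => rfl
  | succ j ih =>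
    rw [pow_succ', pow_succ', Module.End.mul_apply, Module.End.mul_apply, chMap_signedCyc, ih]

theorem chMap_chB (n : ℕ) (x : (𝓗.Ch n).carrier) :
    (f.chMap (n + 1)).1 (𝓗.chB n x) = 𝓗'.chB n ((f.chMap n).1 x) := by
  simp only [chB, LinearMap.comp_apply, LinearMap.sub_apply, LinearMap.id_apply, map_sub,
    chMap_signedCyc, chMap_cyc, chMap_dgn, LinearMap.sum_apply, map_sum, chMap_signedCyc_pow]

/-- The induced map `HH_n(H) → HH_n(H')`. -/
def HHMap (n : ℕ) : 𝓗.HH n →ₗ[k] 𝓗'.HH n :=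
  chainHHMap (C := fun m => (𝓗.Ch m).carrier) (C' := fun m => (𝓗'.Ch m).carrier) 𝓗.bd 𝓗'.bd
    (fun m => (f.chMap m).1) f.chMap_bd n

/-- The induced map `HC_n(H) → HC_n(H')`. -/
def HCMap (n : ℕ) : 𝓗.HC n →ₗ[k] 𝓗'.HC n :=
  chainHCMap (C := fun m => (𝓗.Ch m).carrier) (C' := fun m => (𝓗'.Ch m).carrier)
    (f := fun m => (f.chMap m).1) f.chMap_bd f.chMap_chB n

end HopfAlgebroid.Hom

end Functoriality

section Conditions

variable {k : Type v} [CommRing k]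

namespace HopfAlgebroid

/-- The antipode is involutive. -/
def Involutive {Al Ar H : Type u} [Ring Al] [Algebra k Al] [Ring Ar] [Algebra k Ar] [Ring H]
    [Algebra k H] (𝓗 : HopfAlgebroid k Al Ar H) : Prop :=
  ∀ h, 𝓗.S (𝓗.S h) = h

/-- For a commutative total algebra and `A_l = A_r`: the right bialgebroid is the left one with
source and target exchanged, `s_l = t_r`, `t_l = s_r`, `Δ_l = Δ_r`, `ε_l = ε_r`. (Under the first two
identities the two tensor squares `H ⊗_{A_l} H` and `H ⊗_{A_r} H` are the same quotient of
`H ⊗_k H`.) -/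
structure IsCommutative {A H : Type u} [CommRing A] [Algebra k A] [CommRing H]
    [Algebra k H] (𝓗 : HopfAlgebroid k A A H) : Prop where
  sl_eq : ∀ a, 𝓗.lft.s a = 𝓗.rgt.t (op a)
  tl_eq : ∀ a, 𝓗.lft.t (op a) = 𝓗.rgt.s a
  Δ_eq : ∀ h X, 𝓗.lft.mkL X = 𝓗.lft.Δ h ↔ 𝓗.rgt.mkR X = 𝓗.rgt.Δ h
  ε_eq : ∀ h, 𝓗.lft.ε h = 𝓗.rgt.ε h

/-- `H` is flat as a right `A_l`-module, `h · a = t_l(a) h`. -/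
def FlatRight {A Ar H : Type u} [CommRing A] [Algebra k A] [Ring Ar] [Algebra k Ar] [CommRing H]
    [Algebra k H] (𝓗 : HopfAlgebroid k A Ar H) : Prop :=
  letI : Module A H := Module.compHom H
    ((𝓗.lft.t : Aᵐᵒᵖ →+* H).comp (RingEquiv.toOpposite A : A →+* Aᵐᵒᵖ))
  Module.Flat A H

/-- Cocommutativity: `s_l = t_l`, `s_r = t_r` (so that the base algebras are commutative) and
`h₁ ⊗ h₂ = h₂ ⊗ h₁` for the left coproduct. -/
structure IsCocommutative {Al Ar H : Type u} [Ring Al] [Algebra k Al] [Ring Ar] [Algebra k Ar]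
    [Ring H] [Algebra k H] (𝓗 : HopfAlgebroid k Al Ar H) : Prop where
  sl_eq_tl : ∀ a, 𝓗.lft.s a = 𝓗.lft.t (op a)
  sr_eq_tr : ∀ a, 𝓗.rgt.s a = 𝓗.rgt.t (op a)
  cocomm : ∀ h X, 𝓗.lft.mkL X = 𝓗.lft.Δ h →
    𝓗.lft.mkL (TensorProduct.comm k H H X) = 𝓗.lft.Δ h

/-- `H` is projective as a left `A_r`-module, `a · h = s_r(a) h`. -/
def ProjectiveLeft {Al Ar H : Type u} [Ring Al] [Algebra k Al] [Ring Ar] [Algebra k Ar]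
    [Ring H] [Algebra k H] (𝓗 : HopfAlgebroid k Al Ar H) : Prop :=
  letI : Module Ar H := Module.compHom H (𝓗.rgt.s : Ar →+* H)
  Module.Projective Ar H

end HopfAlgebroid

end Conditions

end HopfAlgd

/-! Both halves rest on one principle: the mixed complex sits inside, or under, a larger mixed
complex that is a resolution, and on a resolution `B` can be removed.

Take chains. Put `P_n = H ⊗ C_n`. Every face of `C_(n+1) = P_n` except `d_0` is `H`-linear. Their
alternating sum `altd` is a bar differential contracted by `x ↦ 1 ⊗ x`, `H`-linear maps descend
along `d_0 : P_n → C_n`, and `altd` descends to the Hochschild boundary. If the cyclic operator also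
lifts to an `H`-linear cyclic operator on `P`, then so does `B`. Since `P` is acyclic in positive
degrees and an `H`-linear map out of `H ⊗ C_m` may be prescribed on the elements `1 ⊗ x`, one can
solve recursively for `H`-linear maps `Φ n m : P_m → P_n` with `(b + B) Φ = Φ b`. They are the
identity for `n = m` and vanish unless `m ≤ n` with `n - m` even. Descending to `C`, they assemble
to a unitriangular automorphism of families that carries the differential `b` to `b + B`. Without
`B` the total complex is just a sum of shifted copies of `(C, b)`, which gives the decomposition.
Everything is built from canonical operations, hence natural.

Cochains are dual: the `H ⊗ C^n` are cofree comodules, colinear maps replace linear ones, `x ↦ 1 ⊗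
x` embeds `C^n` as coinvariants and `σ_0` is the contraction. Reversing arrows brings this under the
same abstract argument, `LiftingMixed.Φ_b`, followed by `ChainSplit.toHC_bijective` or
`CochainSplit.ofHC_bijective`.

The Hopf-algebraic work is the lifting of the cyclic operator. In the commutative case the lift is
`h ⊗ x ↦ h · (1 ⊗ τ x)`; on a spanning family of elements `spread n v` it merely rotates the entries
of `v`, which gives its order, and the relations with the cofaces are checked on similar elements
(`cycL_δsucc`, `cycL_iterate`). In the cocommutative case iterated Galois maps identify `C_n` with
`C^n`, that is, pass from inhomogeneous to homogeneous coordinates. There the faces other than `d_0`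
delete a tensor factor through the counit, and the lifted cyclic operator is inverse to the rotation
of the factors (`rotC_aL_cycP`), which commutes with the diagonal action by cocommutativity. -/

namespace HopfAlgd

/-! ### Signed cyclic objects in a preadditive category and Connes' relations. -/

section AbstractCyclic

open CategoryTheory

/-- A cyclic object with an extra degeneracy, signs absorbed into the faces `d`, the cyclic
operator `l` and the extra degeneracy `s`. -/
structure SignedCyclic {𝒞 : Type*} [Category 𝒞] [Preadditive 𝒞] (P : ℕ → 𝒞) where
  d : ∀ n : ℕ, ℕ → (P (n + 1) ⟶ P n)
  l : ∀ n, End (P n)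
  s : ∀ n, P n ⟶ P (n + 1)
  l_d_zero : ∀ n, l (n + 1) ≫ d n 0 = d n (n + 1)
  l_d_succ : ∀ n i, i ≤ n → l (n + 1) ≫ d n (i + 1) = d n i ≫ l n
  l_pow : ∀ n, l n ^ (n + 1) = 1
  s_d_zero : ∀ n, s n ≫ d n 0 = 𝟙 _
  s_d_succ : ∀ n i, i ≤ n → s (n + 1) ≫ d (n + 1) (i + 1) = -(d n i ≫ s n)

namespace SignedCyclic

variable {𝒞 : Type*} [Category 𝒞] [Preadditive 𝒞] {P : ℕ → 𝒞} (X : SignedCyclic P)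

/-- The powers of the cyclic operator. -/
def lpow (n j : ℕ) : P n ⟶ P n := X.l n ^ j

theorem lpow_zero (n : ℕ) : X.lpow n 0 = 𝟙 _ := pow_zero (X.l n)

theorem lpow_self (n : ℕ) : X.lpow n (n + 1) = 𝟙 _ := X.l_pow n

/-- The norm operator. -/
def norm (n : ℕ) : P n ⟶ P n := ∑ j ∈ Finset.range (n + 1), X.lpow n j

/-- The Hochschild boundary. -/
def b (n : ℕ) : P (n + 1) ⟶ P n := ∑ i ∈ Finset.range (n + 2), X.d n i

/-- The boundary without the last face. -/
def b' (n : ℕ) : P (n + 1) ⟶ P n := ∑ i ∈ Finset.range (n + 1), X.d n i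

/-- Connes' operator. -/
def B (n : ℕ) : P n ⟶ P (n + 1) := X.norm n ≫ X.s n ≫ (𝟙 _ - X.l (n + 1))

theorem pow_succ_comp (n j : ℕ) :
    X.lpow n (j + 1) = X.l n ≫ X.lpow n j :=
  pow_succ (X.l n) j

theorem pow_succ_comp' (n j : ℕ) :
    X.lpow n (j + 1) = X.lpow n j ≫ X.l n :=
  pow_succ' (X.l n) j

theorem sum_pow_succ (n : ℕ) :
    ∑ j ∈ Finset.range (n + 1), X.lpow n (j + 1) = X.norm n := by
  have h := Finset.sum_range_succ' (fun j => X.lpow n j) (n + 1)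
  rw [Finset.sum_range_succ] at h
  have e : X.lpow n (n + 1) = X.lpow n 0 := by
    rw [lpow_zero, lpow_self]
  rw [e] at h
  exact (add_right_cancel h).symm

theorem l_norm (n : ℕ) : X.l n ≫ X.norm n = X.norm n := by
  conv_rhs => rw [← X.sum_pow_succ]
  rw [norm, Preadditive.comp_sum]
  exact Finset.sum_congr rfl fun j _ => (X.pow_succ_comp n j).symm

theorem norm_l (n : ℕ) : X.norm n ≫ X.l n = X.norm n := by
  conv_rhs => rw [← X.sum_pow_succ]
  rw [norm, Preadditive.sum_comp]
  exact Finset.sum_congr rfl fun j _ => (X.pow_succ_comp' n j).symm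

/-- Rotation turns `d_(i+1)` into `d_i` and `d_0` into the last face, which is exactly the face that
`b'` omits. Composition is in diagram order, so this is the classical `b(1 - λ) = (1 - λ)b'`. -/
theorem one_sub_b (n : ℕ) :
    (𝟙 _ - X.l (n + 1)) ≫ X.b n = X.b' n ≫ (𝟙 _ - X.l n) := by
  have h : X.l (n + 1) ≫ X.b n = X.b' n ≫ X.l n + X.d n (n + 1) := by
    rw [b, Finset.sum_range_succ', Preadditive.comp_add, X.l_d_zero, Preadditive.comp_sum, b',
      Preadditive.sum_comp]
    congr 1
    exact Finset.sum_congr rfl fun i hi => X.l_d_succ n i (by simpa [Nat.lt_succ_iff] using hi)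
  rw [Preadditive.sub_comp, h, Preadditive.comp_sub, Category.id_comp, Category.comp_id, b,
    Finset.sum_range_succ, ← b']
  abel

/-- The norm absorbs rotations, so after it each face can be rotated back to `d_0` at the cost of a
power of `l`. -/
theorem norm_d (n i : ℕ) (hi : i ≤ n) :
    X.norm (n + 1) ≫ X.d n i =
      X.norm (n + 1) ≫ X.d n 0 ≫ X.lpow n i := by
  induction i with
  | zero => rw [lpow_zero, Category.comp_id]
  | succ i ih =>
    rw [pow_succ_comp', ← Category.assoc (X.d n 0), ← Category.assoc (X.norm (n + 1)),
      ← ih (by omega), Category.assoc, ← X.l_d_succ n i (by omega), ← Category.assoc, norm_l]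

/-- The mirror image of `norm_d`. Faces are counted from the last one, because rotation sends `d_0`
to the last face and lowers the other indices. -/
theorem d_norm (n j : ℕ) (hj : j ≤ n + 1) :
    X.d n (n + 1 - j) ≫ X.norm n =
      X.lpow (n + 1) (j + 1) ≫ X.d n 0 ≫ X.norm n := by
  induction j with
  | zero =>
    rw [Nat.sub_zero, ← X.l_d_zero, pow_succ_comp, lpow_zero, Category.comp_id, Category.assoc]
  | succ j ih =>
    obtain ⟨i, hi⟩ : ∃ i, n + 1 - j = i + 1 := ⟨n - j, by omega⟩
    rw [show n + 1 - (j + 1) = i by omega, pow_succ_comp, Category.assoc, ← ih (by omega), hi,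
      ← Category.assoc, X.l_d_succ n i (by omega), Category.assoc, l_norm]

/-- Both sides equal norm, then `d_0`, then norm: on the left the powers of `l` that `norm_d`
produces add up to the second norm, on the right those of `d_norm` add up to the first. -/
theorem norm_b' (n : ℕ) : X.norm (n + 1) ≫ X.b' n = X.b n ≫ X.norm n := by
  have h1 : X.norm (n + 1) ≫ X.b' n = X.norm (n + 1) ≫ X.d n 0 ≫ X.norm n := by
    conv_rhs => rw [norm, norm]
    rw [b', Preadditive.comp_sum, ← norm, Preadditive.comp_sum, Preadditive.comp_sum]
    exact Finset.sum_congr rfl fun i hi => X.norm_d n i (by simpa [Nat.lt_succ_iff] using hi)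
  have h2 : X.b n ≫ X.norm n = X.norm (n + 1) ≫ X.d n 0 ≫ X.norm n := by
    conv_rhs => rw [← X.sum_pow_succ (n + 1), Preadditive.sum_comp]
    rw [b, ← Finset.sum_range_reflect, Preadditive.sum_comp]
    refine Finset.sum_congr rfl fun j hj => ?_
    have hj' : j ≤ n + 1 := by simpa [Nat.lt_succ_iff] using hj
    rw [← X.d_norm n j hj', show n + 2 - 1 - j = n + 1 - j by omega]
  rw [h1, h2]

theorem s_b'_zero : X.s 0 ≫ X.b' 0 = 𝟙 _ := by
  rw [b', Finset.sum_range_one, X.s_d_zero]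

/-- The extra degeneracy contracts the complex with differential `b'`; `s_b'_zero` is the end of
that homotopy. -/
theorem s_b'_succ (n : ℕ) : X.s (n + 1) ≫ X.b' (n + 1) = 𝟙 _ - X.b' n ≫ X.s n := by
  rw [b', Finset.sum_range_succ', Preadditive.comp_add, X.s_d_zero, Preadditive.comp_sum, b',
    Preadditive.sum_comp, sub_eq_neg_add, ← Finset.sum_neg_distrib]
  congr 1
  exact Finset.sum_congr rfl fun i hi => X.s_d_succ n i (by simpa [Nat.lt_succ_iff] using hi)

theorem norm_one_sub (n : ℕ) : X.norm n ≫ (𝟙 _ - X.l n) = 0 := by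
  rw [Preadditive.comp_sub, norm_l, Category.comp_id, sub_self]

theorem one_sub_norm (n : ℕ) : (𝟙 _ - X.l n) ≫ X.norm n = 0 := by
  rw [Preadditive.sub_comp, l_norm, Category.id_comp, sub_self]

theorem B_b_zero : X.B 0 ≫ X.b 0 = 0 := by
  rw [B, Category.assoc, Category.assoc, one_sub_b, ← Category.assoc (X.s 0), s_b'_zero,
    Category.id_comp, norm_one_sub]

/-- Moving `1 - l` past `b` leaves `N s b' (1 - l)` in diagram order. The homotopy replaces `s b'`
by `1 - b' s`; the summand `1` dies because `N (1 - l) = 0`, and `N b' = b N` turns the rest into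
`-b B`. -/
theorem B_b_succ (n : ℕ) : X.B (n + 1) ≫ X.b (n + 1) = -(X.b n ≫ X.B n) := by
  rw [B, Category.assoc, Category.assoc, one_sub_b, ← Category.assoc (X.s (n + 1)), s_b'_succ,
    Preadditive.sub_comp, Preadditive.comp_sub, Category.id_comp, norm_one_sub, zero_sub, B,
    ← Category.assoc (X.b n), ← norm_b']
  simp only [Category.assoc]

theorem B_B (n : ℕ) : X.B n ≫ X.B (n + 1) = 0 := by
  have h : ∀ Y : P (n + 1) ⟶ P (n + 2), (𝟙 _ - X.l (n + 1)) ≫ X.norm (n + 1) ≫ Y = 0 := by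
    intro Y
    rw [← Category.assoc, one_sub_norm, Limits.zero_comp]
  rw [B, B, Category.assoc, Category.assoc, h, Limits.comp_zero, Limits.comp_zero]

end SignedCyclic

/-- A mixed complex whose positive part is acyclic for the lifting operation `lift`. -/
structure LiftingMixed {𝒞 : Type*} [Category 𝒞] [Preadditive 𝒞] (P : ℕ → 𝒞) where
  b : ∀ n, P (n + 1) ⟶ P n
  B : ∀ n, P n ⟶ P (n + 1)
  lift : ∀ {m n : ℕ}, (P m ⟶ P n) → (P m ⟶ P (n + 1))
  b_b : ∀ n, b (n + 1) ≫ b n = 0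
  B_b_zero : B 0 ≫ b 0 = 0
  B_b_succ : ∀ n, B (n + 1) ≫ b (n + 1) = -(b n ≫ B n)
  B_B : ∀ n, B n ≫ B (n + 1) = 0
  lift_zero : ∀ m n, lift (0 : P m ⟶ P n) = 0
  lift_b : ∀ m n (F : P m ⟶ P (n + 1)), F ≫ b n = 0 → lift F ≫ b (n + 1) = F

/-! ### The comparison maps between the differentials `b` and `b + B`. -/

namespace LiftingMixed

variable {𝒞 : Type*} [Category 𝒞] [Preadditive 𝒞] {P : ℕ → 𝒞} (X : LiftingMixed P)

variable (P) in
/-- The identity for equal degrees, zero otherwise. -/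
def incl (m n : ℕ) : P m ⟶ P n := if h : m = n then eqToHom (congrArg P h) else 0

variable (P) in
theorem incl_self (n : ℕ) : incl P n n = 𝟙 _ := by simp [incl]

variable (P) in
theorem incl_ne {m n : ℕ} (h : m ≠ n) : incl P m n = 0 := by simp [incl, h]

/-- The components `P m ⟶ P n` of a map from the complex with differential `b` to the one with
differential `b + B` that extends the identity. -/
def Φ : ∀ n m : ℕ, P m ⟶ P n
  | 0, m => incl P m 0
  | 1, m => incl P m 1
  | n + 2, 0 => X.lift (-(Φ n 0 ≫ X.B n))
  | n + 2, m + 1 =>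
    if m ≤ n then X.lift (X.b m ≫ Φ (n + 1) m - Φ n (m + 1) ≫ X.B n) else incl P (m + 1) (n + 2)

theorem Φ_succ_succ_of_le {m n : ℕ} (h : m ≤ n) : X.Φ (n + 2) (m + 1) =
    X.lift (X.b m ≫ X.Φ (n + 1) m - X.Φ n (m + 1) ≫ X.B n) := by
  rw [Φ, if_pos h]

theorem Φ_of_ge {m n : ℕ} (h : n ≤ m) : X.Φ n m = incl P m n := by
  match n, m, h with
  | 0, m, _ => rw [Φ]
  | 1, m, _ => rw [Φ]
  | n + 2, m + 1, h => rw [Φ, if_neg (by omega)]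

theorem Φ_self (n : ℕ) : X.Φ n n = 𝟙 _ := by rw [Φ_of_ge _ le_rfl, incl_self]

theorem Φ_of_gt {m n : ℕ} (h : n < m) : X.Φ n m = 0 := by
  rw [Φ_of_ge _ h.le, incl_ne P h.ne']

/-- The recursion for the entry `(n, m)` only reads `(n - 1, m - 1)` and `(n - 2, m)`, whose index
sums have the same parity, and `lift` preserves zero. -/
theorem Φ_odd : ∀ n m : ℕ, (n + m) % 2 = 1 → X.Φ n m = 0
  | 0, m, h => by rw [Φ, incl_ne]; omega
  | 1, m, h => by rw [Φ, incl_ne]; omega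
  | n + 2, 0, h => by
    rw [Φ, Φ_odd n 0 (by omega), Limits.zero_comp, neg_zero, X.lift_zero]
  | n + 2, m + 1, h => by
    by_cases hm : m ≤ n
    · rw [Φ_succ_succ_of_le _ hm, Φ_odd (n + 1) m (by omega), Φ_odd n (m + 1) (by omega),
        Limits.zero_comp, Limits.comp_zero, sub_zero, X.lift_zero]
    · rw [Φ_of_gt _ (by omega)]

/-- `Φ` precomposed with `b`. -/
def preΦ (n : ℕ) : ∀ m : ℕ, P m ⟶ P n
  -- No boundary leaves degree zero; the value zero stands for the missing term and lets one formula
  -- cover all degrees. The same holds for `postΦ` and the absent `B` into degree zero.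
  | 0 => 0
  | m + 1 => X.b m ≫ X.Φ n m

/-- `Φ` postcomposed with `B`. -/
def postΦ (m : ℕ) : ∀ n : ℕ, P m ⟶ P n
  | 0 => 0
  | n + 1 => X.Φ n m ≫ X.B n

theorem Φ_succ_succ {m n : ℕ} (h : m ≤ n + 1) :
    X.Φ (n + 2) m = X.lift (X.preΦ (n + 1) m - X.postΦ m (n + 1)) := by
  cases m with
  | zero => rw [Φ, preΦ, postΦ, zero_sub]
  | succ m => rw [Φ_succ_succ_of_le _ (by omega), preΦ, postΦ]

theorem Φ_b_of_gt {m n : ℕ} (h : n < m) :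
    X.Φ (n + 1) m ≫ X.b n + X.postΦ m n = X.preΦ n m := by
  obtain ⟨m, rfl⟩ : ∃ m', m = m' + 1 := ⟨m - 1, by omega⟩
  have h1 : X.postΦ (m + 1) n = 0 := by
    cases n with
    | zero => rfl
    | succ n => rw [postΦ, Φ_of_gt _ (by omega), Limits.zero_comp]
  rw [h1, add_zero, preΦ]
  rcases Nat.eq_or_lt_of_le (Nat.lt_succ_iff.1 h) with rfl | h'
  · rw [Φ_self, Φ_self, Category.id_comp, Category.comp_id]
  · rw [Φ_of_gt _ (by omega), Φ_of_gt _ (by omega), Limits.zero_comp, Limits.comp_zero]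

/-- `Φ` intertwines `b` and `b + B`. -/
theorem Φ_b : ∀ n m : ℕ, X.Φ (n + 1) m ≫ X.b n + X.postΦ m n = X.preΦ n m := by
  intro n
  induction n using Nat.strong_induction_on with
  | _ n ih =>
  intro m
  by_cases hm : n < m
  · exact X.Φ_b_of_gt hm
  cases n with
  | zero =>
    obtain rfl : m = 0 := by omega
    rw [Φ, incl_ne P (by omega), postΦ, preΦ, Limits.zero_comp, add_zero]
  | succ n =>
    -- The equation holds by the choice of the lift once the lifted map is a cycle. That condition
    -- is the goal which remains; it follows from the equation in the lower degrees together with `b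
    -- b = 0`, `B B = 0` and `b B = -B b`.
    rw [X.Φ_succ_succ (by omega), X.lift_b, sub_add_cancel]
    have h1 : X.preΦ (n + 1) m ≫ X.b n =
        -(match (motive := ∀ n : ℕ, P m ⟶ P n) n with
          | 0 => 0
          | n + 1 => X.preΦ n m ≫ X.B n) := by
      cases m with
      | zero => cases n <;> simp [preΦ]
      | succ m =>
        have := ih n (by omega) m
        rw [preΦ, Category.assoc, eq_sub_of_add_eq this, Preadditive.comp_sub]
        have h0 : X.b m ≫ X.preΦ n m = 0 := by
          cases m with
          | zero => simp [preΦ]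
          | succ m => rw [preΦ, ← Category.assoc, X.b_b, Limits.zero_comp]
        rw [h0, zero_sub]
        cases n with
        | zero => simp [postΦ]
        | succ n => simp [postΦ, preΦ]
    rw [Preadditive.sub_comp, h1, postΦ, Category.assoc]
    cases n with
    | zero => simp [X.B_b_zero]
    | succ n =>
      have := ih n (by omega) m
      rw [X.B_b_succ, Preadditive.comp_neg, ← Category.assoc, eq_sub_of_add_eq this,
        Preadditive.sub_comp]
      have h2 : X.postΦ m n ≫ X.B n = 0 := by
        cases n with
        | zero => simp [postΦ]
        | succ n => rw [postΦ, Category.assoc, X.B_B, Limits.comp_zero]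
      rw [h2]
      simp

/-- Relations between the morphisms of two such complexes that are compatible with all operations
relate the maps `Φ`. -/
theorem Φ_rel {𝒞' : Type*} [Category 𝒞'] [Preadditive 𝒞'] {P' : ℕ → 𝒞'} (X' : LiftingMixed P')
    (R : ∀ {m n : ℕ}, (P m ⟶ P n) → (P' m ⟶ P' n) → Prop)
    (hid : ∀ n, R (𝟙 (P n)) (𝟙 (P' n))) (hzero : ∀ m n, R (0 : P m ⟶ P n) 0)
    (hcomp : ∀ {m n p : ℕ} {f : P m ⟶ P n} {g : P n ⟶ P p} {f' : P' m ⟶ P' n} {g' : P' n ⟶ P' p},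
      R f f' → R g g' → R (f ≫ g) (f' ≫ g'))
    (hsub : ∀ {m n : ℕ} {f g : P m ⟶ P n} {f' g' : P' m ⟶ P' n},
      R f f' → R g g' → R (f - g) (f' - g'))
    (hlift : ∀ {m n : ℕ} {f : P m ⟶ P n} {f' : P' m ⟶ P' n}, R f f' → R (X.lift f) (X'.lift f'))
    (hb : ∀ n, R (X.b n) (X'.b n)) (hB : ∀ n, R (X.B n) (X'.B n)) :
    ∀ n m : ℕ, R (X.Φ n m) (X'.Φ n m) := by
  have hincl : ∀ m n, R (incl P m n) (incl P' m n) := by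
    intro m n
    by_cases h : m = n
    · subst h; rw [incl_self, incl_self]; exact hid m
    · rw [incl_ne P h, incl_ne P' h]; exact hzero m n
  intro n
  induction n using Nat.strong_induction_on with
  | _ n ih =>
  intro m
  match n, m, ih with
  | 0, m, _ => rw [Φ, Φ]; exact hincl _ _
  | 1, m, _ => rw [Φ, Φ]; exact hincl _ _
  | n + 2, 0, ih =>
    -- The relation is only assumed to respect subtraction, so negation is written as a difference
    -- from zero.
    rw [Φ, Φ, ← zero_sub, ← zero_sub]
    exact hlift (hsub (hzero _ _) (hcomp (ih n (by omega) 0) (hB n)))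
  | n + 2, m + 1, ih =>
    rw [Φ, Φ]
    split_ifs
    · exact hlift (hsub (hcomp (hb m) (ih (n + 1) (by omega) m))
        (hcomp (ih n (by omega) (m + 1)) (hB n)))
    · exact hincl _ _

end LiftingMixed

/-- The mixed complex of a cyclic object with a lifting operation. -/
def SignedCyclic.toLiftingMixed {𝒞 : Type*} [Category 𝒞] [Preadditive 𝒞] {P : ℕ → 𝒞}
    (X : SignedCyclic P) (lift : ∀ {m n : ℕ}, (P m ⟶ P n) → (P m ⟶ P (n + 1)))
    (b_b : ∀ n, X.b (n + 1) ≫ X.b n = 0)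
    (lift_zero : ∀ m n, lift (0 : P m ⟶ P n) = 0)
    (lift_b : ∀ m n (F : P m ⟶ P (n + 1)), F ≫ X.b n = 0 → lift F ≫ X.b (n + 1) = F) :
    LiftingMixed P where
  b := X.b
  B := X.B
  lift := lift
  b_b := b_b
  B_b_zero := X.B_b_zero
  B_b_succ := X.B_b_succ
  B_B := X.B_B
  lift_zero := lift_zero
  lift_b := lift_b

end AbstractCyclic

end HopfAlgd


namespace HopfAlgd

/-! ### From comparison maps to the decomposition of cyclic (co)homology. -/

section Splitting

variable {k : Type v} [CommRing k]

theorem subquotMap_mk {M N : Type*} [AddCommGroup M] [Module k M] [AddCommGroup N] [Module k N]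
    {Z D : Submodule k M} {Z' D' : Submodule k N} (f : M →ₗ[k] N)
    (hZ : ∀ x ∈ Z, f x ∈ Z') (hD : ∀ x ∈ D, f x ∈ D') (x : M) (hx : x ∈ Z) :
    subquotMap f hZ hD (Submodule.Quotient.mk ⟨x, hx⟩) = Submodule.Quotient.mk ⟨f x, hZ x hx⟩ :=
  rfl

theorem subquot_mk_eq_zero {M : Type*} [AddCommGroup M] [Module k M] {Z D : Submodule k M}
    {x : M} (hx : x ∈ Z) : (Submodule.Quotient.mk ⟨x, hx⟩ : Subquot Z D) = 0 ↔ x ∈ D := by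
  rw [Submodule.Quotient.mk_eq_zero]
  rfl

/-- Injectivity is the reflection of boundaries. Asking that cycles be hit exactly, not just up to
boundaries, costs nothing below, where `f` is invertible on families. -/
theorem subquotMap_bijective {M N : Type*} [AddCommGroup M] [Module k M] [AddCommGroup N]
    [Module k N] {Z D : Submodule k M} {Z' D' : Submodule k N} (f : M →ₗ[k] N)
    (hZ : ∀ x ∈ Z, f x ∈ Z') (hD : ∀ x ∈ D, f x ∈ D')
    (hinj : ∀ x ∈ Z, f x ∈ D' → x ∈ D) (hsurj : ∀ y ∈ Z', ∃ x ∈ Z, f x = y) :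
    Function.Bijective (subquotMap f hZ hD) := by
  constructor
  · rw [injective_iff_map_eq_zero]
    intro x h
    obtain ⟨⟨x, hx⟩, rfl⟩ := Submodule.Quotient.mk_surjective _ x
    rw [subquotMap_mk, subquot_mk_eq_zero] at h
    rw [subquot_mk_eq_zero]
    exact hinj x hx h
  · intro y
    obtain ⟨⟨y, hy⟩, rfl⟩ := Submodule.Quotient.mk_surjective _ y
    obtain ⟨x, hx, rfl⟩ := hsurj y hy
    exact ⟨Submodule.Quotient.mk ⟨x, hx⟩, rfl⟩

variable {C : ℕ → Type*} [∀ n, AddCommGroup (C n)] [∀ n, Module k (C n)]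

/-- An endomorphism of a product over the natural numbers that is unitriangular with respect to a
rank function is bijective. -/
theorem bijective_of_unitriangular (r : ℕ → ℕ) (T : (∀ n, C n) →ₗ[k] (∀ n, C n))
    (hT : ∀ x p, (∀ q, r q < r p → x q = 0) → T x p = x p) : Function.Bijective T := by
  have hT' : ∀ x y p, (∀ q, r q < r p → x q = y q) → T x p - x p = T y p - y p := by
    intro x y p h
    have := hT (x - y) p fun q hq => sub_eq_zero.2 (h q hq)
    rw [map_sub] at this
    change T x p - T y p = x p - y p at this
    rw [sub_eq_sub_iff_sub_eq_sub, this]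
  constructor
  · rw [injective_iff_map_eq_zero]
    intro x hx
    funext p
    induction h : r p using Nat.strong_induction_on generalizing p with
    | _ a ih => rw [← hT x p fun q hq => ih (r q) (h ▸ hq) q rfl, hx]
  · intro y
    -- Successive approximation of a fixed point of `x ↦ y - (T x - x)`. By unitriangularity the
    -- entry at `p` of the correction depends on entries of smaller rank only, so the approximations
    -- at `p` are constant after `r p + 1` steps.
    let z : ℕ → ∀ n, C n := fun j => (fun x => y - (T x - x))^[j] y
    have hz : ∀ j p, z (j + 1) p = y p - (T (z j) p - z j p) := by
      intro j p
      change ((fun x => y - (T x - x))^[j + 1] y) p = _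
      rw [Function.iterate_succ_apply']
      rfl
    have hstab : ∀ p i j, r p < i → r p < j → z i p = z j p := by
      intro p
      induction h : r p using Nat.strong_induction_on generalizing p with
      | _ a ih =>
        subst h
        intro i j hi hj
        obtain ⟨i, rfl⟩ : ∃ i', i = i' + 1 := ⟨i - 1, by omega⟩
        obtain ⟨j, rfl⟩ : ∃ j', j = j' + 1 := ⟨j - 1, by omega⟩
        rw [hz, hz, hT' (z i) (z j) p fun q hq =>
          ih (r q) hq q rfl i j (by omega) (by omega)]
    -- The solution collects the stable value at each place; no single approximation need be stable
    -- everywhere.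
    refine ⟨fun p => z (r p + 1) p, funext fun p => ?_⟩
    have h1 := hT' (fun p => z (r p + 1) p) (z (r p + 1)) p fun q hq =>
      hstab q _ _ (by omega) (by omega)
    have h2 := hz (r p + 1) p
    rw [hstab p (r p + 1 + 1) (r p + 1) (by omega) (by omega), ← h1] at h2
    exact (sub_eq_zero.1 (by
      have h3 : z (r p + 1) p - (y p - (T (fun p => z (r p + 1) p) p - z (r p + 1) p)) = 0 :=
        sub_eq_zero.2 h2
      rw [← h3]
      abel))

/-! ### Chains: the total complexes with and without `B`. -/

section Chains

variable {b : ∀ n, C (n + 1) →ₗ[k] C n} {B : ∀ n, C n →ₗ[k] C (n + 1)}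

theorem totd_zero_apply {n : ℕ} (h : 0 < n) (x : ∀ m, C m) : totd b B n x 0 = b 0 (x 1) := by
  simp [totd, h]

theorem totd_succ_apply {n m : ℕ} (h : m + 1 < n) (x : ∀ m, C m) :
    totd b B n x (m + 1) = b (m + 1) (x (m + 2)) + B m (x m) := by
  simp [totd, h]

theorem totd_of_le {n m : ℕ} (h : n ≤ m) (x : ∀ m, C m) : totd b B n x m = 0 := by
  have : ¬ m < n := by omega
  simp [totd, this]

/-- A natural family of maps intertwining `b` and `b + B`. -/
structure ChainSplit (b : ∀ n, C (n + 1) →ₗ[k] C n) (B : ∀ n, C n →ₗ[k] C (n + 1)) where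
  φ : ∀ n m, C m →ₗ[k] C n
  φ_self : ∀ n x, φ n n x = x
  φ_of_gt : ∀ n m x, n < m → φ n m x = 0
  φ_odd : ∀ n m x, (n + m) % 2 = 1 → φ n m x = 0
  b_φ_zero : ∀ m x, b 0 (φ 1 (m + 1) x) = φ 0 m (b m x)
  b_φ_succ_zero : ∀ n x, b (n + 1) (φ (n + 2) 0 x) + B n (φ n 0 x) = 0
  b_φ_succ_succ : ∀ n m x,
    b (n + 1) (φ (n + 2) (m + 1) x) + B n (φ n (m + 1) x) = φ (n + 1) m (b m x)

namespace ChainSplit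

variable (W : ChainSplit b B)

/-- The unitriangular operator on families given by `φ` in degrees below `N`. -/
def op (N : ℕ) : (∀ m, C m) →ₗ[k] (∀ m, C m) :=
  LinearMap.pi fun p => if p < N then
    ∑ m ∈ Finset.range (p + 1), W.φ p m ∘ₗ LinearMap.proj m else LinearMap.proj p

theorem op_of_lt {N p : ℕ} (h : p < N) (x : ∀ m, C m) :
    W.op N x p = ∑ m ∈ Finset.range (p + 1), W.φ p m (x m) := by
  simp [op, h]

theorem op_of_le {N p : ℕ} (h : N ≤ p) (x : ∀ m, C m) : W.op N x p = x p := by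
  have : ¬ p < N := by omega
  simp [op, this]

theorem op_eq {N p : ℕ} (h : p < N) (x : ∀ m, C m) {M : ℕ} (hM : p < M) :
    W.op N x p = ∑ m ∈ Finset.range M, W.φ p m (x m) := by
  rw [W.op_of_lt h]
  refine Finset.sum_subset (Finset.range_mono hM) fun m _ hm => W.φ_of_gt _ _ _ ?_
  simpa [Nat.lt_succ_iff] using hm

theorem op_bijective (N : ℕ) : Function.Bijective (W.op N) := by
  refine bijective_of_unitriangular id _ fun x p hx => ?_
  by_cases h : p < N
  · rw [W.op_of_lt h, Finset.sum_range_succ, W.φ_self, Finset.sum_eq_zero, zero_add]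
    intro m hm
    rw [hx m (Finset.mem_range.1 hm), map_zero]
  · exact W.op_of_le (by omega) x

/-- The bounds force `p ≤ n`, so a place outside the total degree has the wrong parity, and `φ`
preserves parity. -/
theorem φ_eq_zero {N n p m : ℕ} (hN : N ≤ n + 1) (h : p < N) (hp : ¬ ∃ i, p + 2 * i = n)
    (x : ∀ m, C m) (hx : (¬ ∃ i, m + 2 * i = n) → x m = 0) : W.φ p m (x m) = 0 := by
  by_cases hm' : ∃ i, m + 2 * i = n
  · obtain ⟨i, hi⟩ := hm'
    by_cases ho : (p + m) % 2 = 1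
    · exact W.φ_odd _ _ _ ho
    · exact absurd ⟨(n - p) / 2, by omega⟩ hp
  · rw [hx hm', map_zero]

theorem op_mem_totDeg {N n : ℕ} (hN : N ≤ n + 1) (x : ∀ m, C m) :
    W.op N x ∈ totDeg (k := k) C n ↔ x ∈ totDeg (k := k) C n := by
  constructor
  · intro hx p
    induction p using Nat.strong_induction_on with
    | _ p ih =>
    intro hp
    have h0 := hx p hp
    by_cases h : p < N
    · rw [W.op_of_lt h, Finset.sum_range_succ, W.φ_self, Finset.sum_eq_zero, zero_add] at h0
      · exact h0
      · intro m hm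
        exact W.φ_eq_zero hN h hp x (ih m (Finset.mem_range.1 hm))
    · rwa [W.op_of_le (by omega)] at h0
  · intro hx p hp
    by_cases h : p < N
    · rw [W.op_of_lt h]
      exact Finset.sum_eq_zero fun m _ => W.φ_eq_zero hN h hp x (hx m)
    · rw [W.op_of_le (by omega)]
      exact hx p hp

/-- Place by place this is the intertwining relation for `φ`. The truncation levels differ by one
because entry `p` of the boundary reads entry `p + 1`. -/
theorem totd_op (n : ℕ) (x : ∀ m, C m) :
    totd b B n (W.op (n + 1) x) = W.op n (totd b 0 n x) := by
  funext p
  by_cases h : p < n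
  · rw [W.op_of_lt h]
    have h1 : ∀ m < p + 1, totd b (0 : ∀ n, C n →ₗ[k] C (n + 1)) n x m = b m (x (m + 1)) := by
      intro m hm
      cases m with
      | zero => exact totd_zero_apply (by omega) x
      | succ m =>
        rw [totd_succ_apply (by omega)]
        exact add_zero _
    rw [Finset.sum_congr rfl fun m hm => by rw [h1 m (Finset.mem_range.1 hm)]]
    cases p with
    | zero =>
      rw [totd_zero_apply h, W.op_eq (by omega) x (show 1 < 2 by omega), map_sum]
      simp only [Finset.sum_range_succ, Finset.sum_range_zero, zero_add, W.b_φ_zero]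
      rw [W.φ_odd 1 0 _ rfl, map_zero, zero_add]
    | succ p =>
      -- Both sums are padded with zeros to a common range so that they can be added termwise. The
      -- summand from degree zero, where no `b` starts, is split off and vanishes by itself.
      rw [totd_succ_apply h, W.op_eq (by omega) x (show p + 2 < p + 3 by omega),
        W.op_eq (by omega) x (show p < p + 3 by omega), map_sum, map_sum,
        ← Finset.sum_add_distrib, Finset.sum_range_succ', W.b_φ_succ_zero, add_zero]
      exact Finset.sum_congr rfl fun m _ => W.b_φ_succ_succ p m _
  · rw [totd_of_le (by omega), W.op_of_le (by omega), totd_of_le (by omega)]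

/-- The map from the homology of the total complex without `B` to cyclic homology. -/
def toHC (n : ℕ) : ChainHC b (0 : ∀ n, C n →ₗ[k] C (n + 1)) n →ₗ[k] ChainHC b B n :=
  subquotMap (W.op (n + 1))
    (by
      rintro x ⟨hx, hx'⟩
      refine ⟨(W.op_mem_totDeg le_rfl x).2 hx, ?_⟩
      change totd b B n (W.op (n + 1) x) = 0
      rw [totd_op, show totd b 0 n x = 0 from hx', map_zero])
    (by
      rintro _ ⟨y, hy, rfl⟩
      exact ⟨W.op (n + 2) y, (W.op_mem_totDeg le_rfl y).2 hy, W.totd_op (n + 1) y⟩)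

/-- The operators of levels `n`, `n + 1` and `n + 2` act in total degrees `n - 1`, `n` and `n + 1`.
All are bijective, and membership in `totDeg` is reflected where it is needed, so cycles and
boundaries correspond in both directions. -/
theorem toHC_bijective (n : ℕ) : Function.Bijective (W.toHC n) := by
  apply subquotMap_bijective
  · rintro x ⟨hx, -⟩ ⟨y, hy, hxy⟩
    obtain ⟨z, rfl⟩ := (W.op_bijective (n + 2)).2 y
    refine ⟨z, (W.op_mem_totDeg le_rfl z).1 hy, ?_⟩
    rw [totd_op] at hxy
    exact (W.op_bijective (n + 1)).1 hxy
  · rintro y ⟨hy, hy'⟩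
    obtain ⟨x, rfl⟩ := (W.op_bijective (n + 1)).2 y
    refine ⟨x, ⟨(W.op_mem_totDeg le_rfl x).1 hy, ?_⟩, rfl⟩
    apply (W.op_bijective n).1
    rw [← totd_op, map_zero]
    exact hy'

end ChainSplit

theorem totd_bot_apply {n m : ℕ} (h : m < n) (x : ∀ m, C m) :
    totd b (0 : ∀ n, C n →ₗ[k] C (n + 1)) n x m = b m (x (m + 1)) := by
  cases m with
  | zero => exact totd_zero_apply h x
  | succ m =>
    rw [totd_succ_apply h]
    exact add_zero _

variable (b) in
/-- The components of a class in the homology of the total complex without `B`. -/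
def splitHH (n : ℕ) (i : Fin (n / 2 + 1)) :
    ChainHC b (0 : ∀ n, C n →ₗ[k] C (n + 1)) n →ₗ[k] ChainHH b (n - 2 * i) :=
  subquotMap (LinearMap.proj (n - 2 * i : ℕ))
    (by
      rintro x ⟨-, hx⟩
      change x (n - 2 * i) ∈ _
      rcases h : n - 2 * (i : ℕ) with _ | p
      · trivial
      · change b p (x (p + 1)) = 0
        rw [← totd_bot_apply (show p < n by omega) x, show totd b 0 n x = 0 from hx]
        rfl)
    (by
      rintro _ ⟨y, -, rfl⟩
      exact ⟨y (n - 2 * i + 1), (totd_bot_apply (by omega) y).symm⟩)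

theorem sum_single_apply (n : ℕ) (z : ∀ i : Fin (n / 2 + 1), C (n - 2 * i))
    (i : Fin (n / 2 + 1)) :
    (∑ j : Fin (n / 2 + 1), Pi.single (M := C) (n - 2 * (j : ℕ)) (z j)) (n - 2 * (i : ℕ)) = z i := by
  rw [Finset.sum_apply, Finset.sum_eq_single i]
  · exact Pi.single_eq_same _ _
  · intro j _ hj
    refine Pi.single_eq_of_ne (fun h => hj (Fin.ext ?_)) _
    have := i.2; have := j.2
    omega
  · intro h; exact absurd (Finset.mem_univ i) h

theorem sum_single_mem (n : ℕ) (z : ∀ i : Fin (n / 2 + 1), C (n - 2 * i)) :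
    (∑ j : Fin (n / 2 + 1), Pi.single (M := C) (n - 2 * (j : ℕ)) (z j)) ∈ totDeg (k := k) C n := by
  refine Submodule.sum_mem _ fun j _ => fun m hm => Pi.single_eq_of_ne (fun h => hm ?_) _
  have := j.2
  exact ⟨j, by omega⟩

/-- Without `B` the differential works entry by entry, so a family is a cycle or a boundary exactly
when its entries are. -/
theorem splitHH_bijective (n : ℕ) :
    Function.Bijective (LinearMap.pi fun i => splitHH b n i) := by
  constructor
  · rw [injective_iff_map_eq_zero]
    intro x h
    obtain ⟨⟨x, hx⟩, rfl⟩ := Submodule.Quotient.mk_surjective _ x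
    rw [subquot_mk_eq_zero]
    have h' : ∀ m, ∃ y : C (m + 1), b m y = x m ∧ ((¬ ∃ i, m + 2 * i = n) → y = 0) := by
      intro m
      by_cases hm : ∃ i, m + 2 * i = n
      · obtain ⟨i, hi⟩ := hm
        have h1 := congrFun h ⟨i, by omega⟩
        obtain ⟨y, hy⟩ := (subquot_mk_eq_zero _).1 h1
        obtain rfl : m = n - 2 * i := by omega
        exact ⟨y, hy, fun h => absurd ⟨i, hi⟩ h⟩
      · exact ⟨0, by rw [map_zero, hx.1 m hm], fun _ => rfl⟩
    choose y hy hy0 using h'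
    -- Entry `m + 1` bounds entry `m` of `x`, and entry zero bounds nothing. Choosing `y m = 0`
    -- outside the total degree keeps the family in degree `n + 1`.
    refine ⟨fun m => match m with
      | 0 => 0
      | m + 1 => y m, ?_, ?_⟩
    · rintro (_ | m) hm
      · rfl
      · exact hy0 m fun ⟨i, hi⟩ => hm ⟨i, by omega⟩
    · funext m
      by_cases hm : m < n + 1
      · rw [totd_bot_apply hm]
        exact hy m
      · rw [totd_of_le (by omega)]
        exact (hx.1 m fun ⟨i, hi⟩ => hm (by omega)).symm
  · intro z
    choose w hw using fun i => Submodule.Quotient.mk_surjective _ (z i)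
    have hb : ∀ (p : ℕ), p < n →
        b p ((∑ j : Fin (n / 2 + 1), Pi.single (M := C) (n - 2 * (j : ℕ)) (w j).1) (p + 1)) = 0 := by
      intro p hp
      by_cases h : ∃ i, p + 1 + 2 * i = n
      · obtain ⟨i, hi⟩ := h
        have h2 := sum_single_apply n (fun j => (w j).1) ⟨i, by omega⟩
        have h3 := (w ⟨i, by omega⟩).2
        rw [← h2] at h3
        change _ ∈ cycles b (n - 2 * i) at h3
        obtain h4 : n - 2 * i = p + 1 := by omega
        change (∑ j : Fin (n / 2 + 1), Pi.single (M := C) (n - 2 * (j : ℕ)) (w j).1) (n - 2 * i) ∈ _ at h3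
        rw [h4] at h3
        exact h3
      · rw [(sum_single_mem (k := k) n fun j => (w j).1) (p + 1) h, map_zero]
    refine ⟨Submodule.Quotient.mk ⟨∑ j : Fin (n / 2 + 1), Pi.single (M := C) (n - 2 * (j : ℕ)) (w j).1,
      sum_single_mem n _, ?_⟩, ?_⟩
    · change totd b 0 n _ = 0
      funext p
      by_cases hp : p < n
      · rw [totd_bot_apply hp, hb p hp]
        rfl
      · exact totd_of_le (by omega) _
    · funext i
      rw [← hw i]
      exact congrArg Submodule.Quotient.mk (Subtype.ext (sum_single_apply n _ i))

namespace ChainSplit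

variable (W : ChainSplit b B)

/-- The decomposition of cyclic homology. -/
noncomputable def equiv (n : ℕ) :
    ChainHC b B n ≃ₗ[k] ⨁ i : Fin (n / 2 + 1), ChainHH b (n - 2 * i) :=
  (LinearEquiv.ofBijective _ (W.toHC_bijective n)).symm ≪≫ₗ
    LinearEquiv.ofBijective _ (splitHH_bijective (b := b) n) ≪≫ₗ
    (DirectSum.linearEquivFunOnFintype k (Fin (n / 2 + 1)) fun i => ChainHH b (n - 2 * i)).symm

/-- On classes coming from the complex without `B` the decomposition just takes components. Every
class is of this kind, so naturality can be tested without the inverse of `toHC`. -/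
theorem equiv_toHC (n : ℕ) (y : ChainHC b (0 : ∀ n, C n →ₗ[k] C (n + 1)) n)
    (i : Fin (n / 2 + 1)) : W.equiv n (W.toHC n y) i = splitHH b n i y := by
  have h : (LinearEquiv.ofBijective _ (W.toHC_bijective n)).symm (W.toHC n y) = y :=
    LinearEquiv.ofBijective_symm_apply_apply _ y
  rw [equiv, LinearEquiv.trans_apply, LinearEquiv.trans_apply, h]
  rfl

variable {C' : ℕ → Type*} [∀ n, AddCommGroup (C' n)] [∀ n, Module k (C' n)]
  {b' : ∀ n, C' (n + 1) →ₗ[k] C' n} {B' : ∀ n, C' n →ₗ[k] C' (n + 1)} {f : ∀ n, C n →ₗ[k] C' n}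

/-- A map that commutes with `φ` commutes with the operators `op`, hence with `toHC`; taking
components is natural in any case. -/
theorem equiv_nat (W' : ChainSplit b' B') (hb : ∀ n x, f n (b n x) = b' n (f (n + 1) x))
    (hB : ∀ n x, f (n + 1) (B n x) = B' n (f n x))
    (hφ : ∀ n m x, f n (W.φ n m x) = W'.φ n m (f m x)) (n : ℕ) (x : ChainHC b B n)
    (i : Fin (n / 2 + 1)) :
    W'.equiv n (chainHCMap hb hB n x) i = chainHHMap b b' f hb (n - 2 * i) (W.equiv n x i) := by
  have hop : ∀ N x, famMap f (W.op N x) = W'.op N (famMap f x) := by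
    intro N x
    funext p
    change f p (W.op N x p) = _
    by_cases h : p < N
    · rw [W.op_of_lt h, W'.op_of_lt h, map_sum]
      exact Finset.sum_congr rfl fun m _ => hφ p m (x m)
    · rw [W.op_of_le (by omega), W'.op_of_le (by omega)]
      rfl
  obtain ⟨y, rfl⟩ := (W.toHC_bijective n).2 x
  have h1 : chainHCMap hb hB n (W.toHC n y) = W'.toHC n (chainHCMap hb (fun n x => by simp) n y) := by
    obtain ⟨⟨y, hy⟩, rfl⟩ := Submodule.Quotient.mk_surjective _ y
    exact congrArg Submodule.Quotient.mk (Subtype.ext (hop (n + 1) y))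
  rw [h1, equiv_toHC, equiv_toHC]
  obtain ⟨⟨y, hy⟩, rfl⟩ := Submodule.Quotient.mk_surjective _ y
  rfl

end ChainSplit

end Chains

/-! ### Cochains: the same splitting with maps that lower the degree. -/

section Cochains

variable {b : ∀ n, C n →ₗ[k] C (n + 1)} {B : ∀ n, C (n + 1) →ₗ[k] C n}

theorem totD_zero_apply (x : ∀ m, C m) : totD b B x 0 = B 0 (x 1) := rfl

theorem totD_succ_apply (m : ℕ) (x : ∀ m, C m) :
    totD b B x (m + 1) = b m (x m) + B (m + 1) (x (m + 2)) := rfl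

/-- A family of maps intertwining `b + B` and `b`. -/
structure CochainSplit (b : ∀ n, C n →ₗ[k] C (n + 1)) (B : ∀ n, C (n + 1) →ₗ[k] C n) where
  φ : ∀ n m, C n →ₗ[k] C m
  φ_self : ∀ n x, φ n n x = x
  φ_of_gt : ∀ n m x, n < m → φ n m x = 0
  φ_odd : ∀ n m x, (n + m) % 2 = 1 → φ n m x = 0
  φ_b_zero : ∀ m x, φ 1 (m + 1) (b 0 x) = b m (φ 0 m x)
  φ_b_succ_zero : ∀ n x, φ (n + 2) 0 (b (n + 1) x) + φ n 0 (B n x) = 0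
  φ_b_succ_succ : ∀ n m x,
    φ (n + 2) (m + 1) (b (n + 1) x) + φ n (m + 1) (B n x) = b m (φ (n + 1) m x)

namespace CochainSplit

variable (W : CochainSplit b B)

/-- The unitriangular operator on families given by `φ` in degrees below `N`. -/
def op (N : ℕ) : (∀ m, C m) →ₗ[k] (∀ m, C m) :=
  LinearMap.pi fun p => if p < N then
    ∑ m ∈ Finset.range N, W.φ m p ∘ₗ LinearMap.proj m else LinearMap.proj p

theorem op_of_lt {N p : ℕ} (h : p < N) (x : ∀ m, C m) :
    W.op N x p = ∑ m ∈ Finset.range N, W.φ m p (x m) := by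
  simp [op, h]

theorem op_of_le {N p : ℕ} (h : N ≤ p) (x : ∀ m, C m) : W.op N x p = x p := by
  have : ¬ p < N := by omega
  simp [op, this]

/-- Since `φ` vanishes when it would raise the degree and is the identity on the diagonal, only the
entries above `p` can disturb the entry at `p`. -/
theorem op_eq_self {N p : ℕ} (x : ∀ m, C m)
    (hx : ∀ m, m < N → p < m → W.φ m p (x m) = 0) : W.op N x p = x p := by
  by_cases h : p < N
  · rw [W.op_of_lt h, Finset.sum_eq_single p, W.φ_self]
    · intro m hm hmp
      rcases Nat.lt_or_gt_of_ne hmp with h' | h'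
      · exact W.φ_of_gt _ _ _ h'
      · exact hx m (Finset.mem_range.1 hm) h'
    · intro h'; exact absurd (Finset.mem_range.2 h) h'
  · exact W.op_of_le (by omega) x

theorem op_bijective (N : ℕ) : Function.Bijective (W.op N) := by
  -- Entries now depend on higher ones, so rank decreases with the place. Truncated subtraction
  -- gives rank zero from `N` on, where the operator is the identity.
  refine bijective_of_unitriangular (fun p => N - p) _ fun x p hx => ?_
  refine W.op_eq_self x fun m hm hpm => ?_
  rw [hx m (by omega), map_zero]

theorem φ_eq_zero {n p m : ℕ} (hp : ¬ ∃ i, p + 2 * i = n)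
    (x : ∀ m, C m) (hx : (¬ ∃ i, m + 2 * i = n) → x m = 0) : W.φ m p (x m) = 0 := by
  by_cases hm' : ∃ i, m + 2 * i = n
  · obtain ⟨i, hi⟩ := hm'
    by_cases ho : (m + p) % 2 = 1
    · exact W.φ_odd _ _ _ ho
    · by_cases hmp : m < p
      · exact W.φ_of_gt _ _ _ hmp
      · exact absurd ⟨(n - p) / 2, by omega⟩ hp
  · rw [hx hm', map_zero]

theorem op_mem_totDeg (N n : ℕ) (x : ∀ m, C m) :
    W.op N x ∈ totDeg (k := k) C n ↔ x ∈ totDeg (k := k) C n := by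
  constructor
  · intro hx p
    induction h : N - p using Nat.strong_induction_on generalizing p with
    | _ a ih =>
    intro hp
    rw [← W.op_eq_self (N := N) (p := p) x, hx p hp]
    intro m hm hpm
    exact W.φ_eq_zero hp x (ih (N - m) (by omega) m rfl)
  · intro hx p hp
    rw [W.op_eq_self x fun m hm _ => W.φ_eq_zero hp x (hx m)]
    exact hx p hp

/-- The total degree of `x` is needed here: its entries above `n` vanish, so the terms cut off by
the truncation are zero. What remains is the intertwining relation for `φ`, summed over the places.
-/
theorem totD_op (n : ℕ) (x : ∀ m, C m) (hx : x ∈ totDeg (k := k) C n) :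
    totD b 0 (W.op (n + 1) x) = W.op (n + 2) (totD b B x) := by
  have hx0 : ∀ m, n < m → x m = 0 := fun m hm => hx m fun ⟨i, hi⟩ => by omega
  funext p
  by_cases h : p < n + 2
  · have h1 : W.op (n + 2) (totD b B x) p =
        ∑ m ∈ Finset.range n, (W.φ (m + 2) p (b (m + 1) (x (m + 1))) +
          W.φ m p (B m (x (m + 1)))) + W.φ 1 p (b 0 (x 0)) := by
      have e1 : ∀ m, totD b B x (m + 1) = b m (x m) + B (m + 1) (x (m + 2)) := fun m => rfl
      rw [W.op_of_lt h, Finset.sum_range_succ']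
      simp only [e1, totD_zero_apply, map_add, Finset.sum_add_distrib]
      have e2 := Finset.sum_range_succ' (fun m => W.φ m p (B m (x (m + 1)))) (n + 1)
      rw [add_assoc]
      refine (congrArg _ e2.symm).trans ?_
      rw [Finset.sum_range_succ' (fun m => W.φ (m + 1) p (b m (x m))), Finset.sum_range_succ,
        Finset.sum_range_succ (fun m => W.φ m p (B m (x (m + 1)))), hx0 (n + 1) (by omega),
        hx0 (n + 1 + 1) (by omega)]
      simp only [map_zero, add_zero]
      abel
    rw [h1]
    cases p with
    | zero =>
      rw [W.φ_odd 1 0 _ rfl, Finset.sum_eq_zero fun m _ => W.φ_b_succ_zero m _]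
      exact (add_zero _).symm
    | succ p =>
      rw [W.φ_b_zero, Finset.sum_congr rfl fun m _ => W.φ_b_succ_succ m p _,
        ← Finset.sum_range_succ' (fun m => b p (W.φ m p (x m))), ← map_sum, totD_succ_apply,
        W.op_of_lt (by omega)]
      exact add_zero _
  · obtain ⟨p, rfl⟩ : ∃ q, p = q + 1 := ⟨p - 1, by omega⟩
    rw [W.op_of_le (by omega), totD_succ_apply, totD_succ_apply, W.op_of_le (by omega),
      W.op_of_le (by omega), hx0 p (by omega), hx0 (p + 2) (by omega)]
    simp

/-- The map from cyclic cohomology to the cohomology of the total complex without `B`. -/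
def ofHC (n : ℕ) : CochainHC b B n →ₗ[k] CochainHC b (0 : ∀ n, C (n + 1) →ₗ[k] C n) n :=
  subquotMap (W.op (n + 1))
    (by
      rintro x ⟨hx, hx'⟩
      refine ⟨(W.op_mem_totDeg _ _ x).2 hx, ?_⟩
      change totD b 0 (W.op (n + 1) x) = 0
      rw [totD_op _ _ _ hx, show totD b B x = 0 from hx', map_zero])
    (by
      cases n with
      | zero =>
        rintro x hx
        rw [show x = 0 from hx, map_zero]
        exact Submodule.zero_mem _
      | succ n =>
        rintro _ ⟨y, hy, rfl⟩
        exact ⟨W.op (n + 1) y, (W.op_mem_totDeg _ _ y).2 hy, W.totD_op n y hy⟩)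

theorem ofHC_bijective (n : ℕ) : Function.Bijective (W.ofHC n) := by
  apply subquotMap_bijective
  · rintro x ⟨hx, -⟩ hx'
    cases n with
    | zero =>
      exact (W.op_bijective 1).1 ((show W.op 1 x = 0 from hx').trans (map_zero _).symm)
    | succ n =>
      obtain ⟨y, hy, hxy⟩ := hx'
      obtain ⟨z, rfl⟩ := (W.op_bijective (n + 1)).2 y
      have hz := (W.op_mem_totDeg _ _ z).1 hy
      refine ⟨z, hz, ?_⟩
      rw [totD_op _ _ _ hz] at hxy
      exact (W.op_bijective (n + 2)).1 hxy
  · rintro y ⟨hy, hy'⟩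
    obtain ⟨x, rfl⟩ := (W.op_bijective (n + 1)).2 y
    have hx := (W.op_mem_totDeg _ _ x).1 hy
    refine ⟨x, ⟨hx, ?_⟩, rfl⟩
    apply (W.op_bijective (n + 2)).1
    rw [← totD_op _ _ _ hx, map_zero]
    exact hy'

end CochainSplit

theorem totD_bot_succ_apply (m : ℕ) (x : ∀ m, C m) :
    totD b (0 : ∀ n, C (n + 1) →ₗ[k] C n) x (m + 1) = b m (x m) := add_zero _

variable (b) in
/-- The components of a class in the cohomology of the total complex without `B`. -/
def splitHHco (n : ℕ) (i : Fin (n / 2 + 1)) :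
    CochainHC b (0 : ∀ n, C (n + 1) →ₗ[k] C n) n →ₗ[k] CochainHH b (n - 2 * i) :=
  subquotMap (LinearMap.proj (n - 2 * i : ℕ))
    (by
      rintro x ⟨-, hx⟩
      change b _ (x (n - 2 * i)) = 0
      rw [← totD_bot_succ_apply, show totD b 0 x = 0 from hx]
      rfl)
    (by
      cases n with
      | zero =>
        rintro x hx
        rw [show x = 0 from hx, map_zero]
        exact Submodule.zero_mem _
      | succ n =>
        rintro _ ⟨y, -, rfl⟩
        change totD b 0 y (n + 1 - 2 * i) ∈ _
        rcases n + 1 - 2 * (i : ℕ) with _ | p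
        · exact Submodule.zero_mem _
        · exact ⟨y p, (totD_bot_succ_apply p y).symm⟩)

theorem splitHHco_bijective (n : ℕ) :
    Function.Bijective (LinearMap.pi fun i => splitHHco b n i) := by
  constructor
  · rw [injective_iff_map_eq_zero]
    intro x h
    obtain ⟨⟨x, hx⟩, rfl⟩ := Submodule.Quotient.mk_surjective _ x
    rw [subquot_mk_eq_zero]
    have h' : ∀ m, x m ∈ cobound b m := by
      intro m
      by_cases hm : ∃ i, m + 2 * i = n
      · obtain ⟨i, hi⟩ := hm
        have h1 := (subquot_mk_eq_zero _).1 (congrFun h ⟨i, by omega⟩)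
        obtain rfl : m = n - 2 * i := by omega
        exact h1
      · rw [hx.1 m hm]
        exact Submodule.zero_mem _
    cases n with
    | zero =>
      funext m
      cases m with
      | zero => exact h' 0
      | succ m => exact hx.1 _ fun ⟨i, hi⟩ => by omega
    | succ n =>
      have h2 : ∀ m, ∃ y : C m, b m y = x (m + 1) ∧ ((¬ ∃ i, m + 2 * i = n) → y = 0) := by
        intro m
        by_cases hm : ∃ i, m + 2 * i = n
        · obtain ⟨y, hy⟩ := h' (m + 1)
          exact ⟨y, hy, fun h => absurd hm h⟩
        · exact ⟨0, by rw [map_zero, hx.1 (m + 1) fun ⟨i, hi⟩ => hm ⟨i, by omega⟩], fun _ => rfl⟩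
      choose y hy hy0 using h2
      refine ⟨y, hy0, funext fun m => ?_⟩
      cases m with
      | zero => exact (show x 0 = 0 from h' 0).symm
      | succ m => exact (totD_bot_succ_apply m y).trans (hy m)
  · intro z
    choose w hw using fun i => Submodule.Quotient.mk_surjective _ (z i)
    refine ⟨Submodule.Quotient.mk
      ⟨∑ j : Fin (n / 2 + 1), Pi.single (M := C) (n - 2 * (j : ℕ)) (w j).1,
      sum_single_mem n _, ?_⟩, ?_⟩
    · change totD b 0 _ = 0
      funext p
      cases p with
      | zero => rfl
      | succ p =>
        rw [totD_bot_succ_apply]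
        change _ = 0
        by_cases h : ∃ i, p + 2 * i = n
        · obtain ⟨i, hi⟩ := h
          have h2 := sum_single_apply n (fun j => (w j).1) ⟨i, by omega⟩
          have h3 : b _ _ = 0 := (w ⟨i, by omega⟩).2
          rw [← h2] at h3
          obtain rfl : p = n - 2 * i := by omega
          exact h3
        · rw [(sum_single_mem (k := k) n fun j => (w j).1) p h, map_zero]
    · funext i
      rw [← hw i]
      exact congrArg Submodule.Quotient.mk (Subtype.ext (sum_single_apply n _ i))

/-- The decomposition of cyclic cohomology. -/
noncomputable def CochainSplit.equiv (W : CochainSplit b B) (n : ℕ) :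
    CochainHC b B n ≃ₗ[k] ⨁ i : Fin (n / 2 + 1), CochainHH b (n - 2 * i) :=
  LinearEquiv.ofBijective _ (W.ofHC_bijective n) ≪≫ₗ
    LinearEquiv.ofBijective _ (splitHHco_bijective (b := b) n) ≪≫ₗ
    (DirectSum.linearEquivFunOnFintype k (Fin (n / 2 + 1)) fun i => CochainHH b (n - 2 * i)).symm

end Cochains

end Splitting

end HopfAlgd


namespace HopfAlgd

/-! ### Evaluating identities in triple tensor products. -/

section Balanced

variable {k : Type v} [CommRing k] {A B : Type*}
  {N M P Q R S : Type*} [AddCommGroup N] [Module k N] [AddCommGroup M] [Module k M]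
  [AddCommGroup P] [Module k P] [AddCommGroup Q] [Module k Q] [AddCommGroup R] [Module k R]
  [AddCommGroup S] [Module k S]

/-- An identity in a triple tensor product, applied to a map out of it that is presented in two ways
by a map balanced over `A` and a map balanced over `B`. -/
theorem triple_apply {ρ : A → N →ₗ[k] N} {l : A → M →ₗ[k] M} {ρ' : B → M →ₗ[k] M}
    {l' : B → P →ₗ[k] P} {D : Q →ₗ[k] BalTensor ρ l} {D' : R →ₗ[k] BalTensor ρ' l'}
    {X : Q ⊗[k] P} {Y : N ⊗[k] R} (h : tensorId ρ l ρ' l' D X = idTensor ρ l ρ' l' D' Y)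
    (p : BalTensor ρ l →ₗ[k] P →ₗ[k] S) (q : N →ₗ[k] BalTensor ρ' l' →ₗ[k] S)
    (hpq : ∀ x y z, p ((balRel ρ l).mkQ (x ⊗ₜ y)) z = q x ((balRel ρ' l').mkQ (y ⊗ₜ z))) :
    TensorProduct.lift (p ∘ₗ D) X = TensorProduct.lift (q.compl₂ D') Y := by
  let f : N ⊗[k] (M ⊗[k] P) →ₗ[k] S :=
    TensorProduct.lift (q.compl₂ (balRel ρ' l').mkQ)
  have hf : ∀ x y z, f (x ⊗ₜ (y ⊗ₜ z)) = q x ((balRel ρ' l').mkQ (y ⊗ₜ z)) := fun _ _ _ => rfl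
  have hker : tripleRel ρ l ρ' l' ≤ LinearMap.ker f := by
    refine Submodule.span_le.2 ?_
    rintro _ (⟨a, x, y, z, rfl⟩ | ⟨a, x, y, z, rfl⟩)
    · change f _ = 0
      rw [map_sub, hf, hf, ← hpq, ← hpq, bal_rel, sub_self]
    · change f _ = 0
      rw [map_sub, hf, hf, bal_rel, sub_self]
  have key := congrArg ((tripleRel ρ l ρ' l').liftQ f hker) h
  have e1 : ((tripleRel ρ l ρ' l').liftQ f hker) ∘ₗ tensorId ρ l ρ' l' D =
      TensorProduct.lift (p ∘ₗ D) := by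
    apply TensorProduct.ext'
    intro x z
    change ((tripleRel ρ l ρ' l').liftQ f hker) (triplePost ρ l ρ' l' (D x) z) = p (D x) z
    refine LinearMap.congr_fun (f := ((tripleRel ρ l ρ' l').liftQ f hker) ∘ₗ
      (triplePost ρ l ρ' l').flip z) (g := p.flip z) (bal_ext fun x y => ?_) (D x)
    exact (hpq x y z).symm
  have e2 : ((tripleRel ρ l ρ' l').liftQ f hker) ∘ₗ idTensor ρ l ρ' l' D' =
      TensorProduct.lift (q.compl₂ D') := by
    apply TensorProduct.ext'
    intro x y
    change ((tripleRel ρ l ρ' l').liftQ f hker) (triplePre ρ l ρ' l' x (D' y)) = q x (D' y)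
    refine LinearMap.congr_fun (f := ((tripleRel ρ l ρ' l').liftQ f hker) ∘ₗ
      triplePre ρ l ρ' l' x) (g := q x) (bal_ext fun y z => ?_) (D' y)
    rfl
  rw [← e1, ← e2]
  exact key

theorem tmul_congr (f g : N ⊗[k] M →ₗ[k] P) (h : ∀ x y, f (x ⊗ₜ y) = g (x ⊗ₜ y)) (X : N ⊗[k] M) :
    f X = g X := by
  rw [TensorProduct.ext' h]

end Balanced

/-! ### The comonad `H ⊗_A -` and its compatibility with the diagonal action. -/

namespace LeftBialgebroid

variable {k : Type v} [CommRing k] {A H : Type u} [Ring A] [Algebra k A] [Ring H] [Algebra k H]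
  (B : LeftBialgebroid k A H)

/-- This is what permits Sweedler calculations: an expression in `h₁, h₂, h₃` is written once with
the first two legs merged (`p`) and once with the last two merged (`q`), and the two forms are
compared on elementary tensors only. -/
theorem Δ_coassoc_apply {S : Type*} [AddCommGroup S] [Module k S] {h : H} {X : H ⊗[k] H}
    (hX : B.mkL X = B.Δ h) (p : B.TensL →ₗ[k] H →ₗ[k] S) (q : H →ₗ[k] B.TensL →ₗ[k] S)
    (hpq : ∀ x y z, p (B.mkL (x ⊗ₜ y)) z = q x (B.mkL (y ⊗ₜ z))) :
    TensorProduct.lift (p ∘ₗ B.Δ) X = TensorProduct.lift (q.compl₂ B.Δ) X :=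
  triple_apply (B.coassoc h X hX) p q hpq

theorem TensL_ext {P : Type*} [AddCommGroup P] [Module k P] {f g : B.TensL →ₗ[k] P}
    (h : ∀ x y, f (B.mkL (x ⊗ₜ y)) = g (B.mkL (x ⊗ₜ y))) (z : B.TensL) : f z = g z := by
  rw [show f = g from bal_ext h]

/-- The action on `1 ⊗ m`. -/
theorem act_tm (M : LMod k H) (h z : H) (m : M.carrier) :
    (B.tens M).act h (B.tm M z m) = B.preAct M (B.Δ h) (z ⊗ₜ m) := rfl

theorem preAct_mk' (M : LMod k H) (x y z : H) (m : M.carrier) :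
    B.preAct M (B.mkL (x ⊗ₜ y)) (z ⊗ₜ m) = B.tm M (x * z) (M.act y m) := rfl

/-- Composition of `A`-linear maps. -/
def acomp {M N P : LMod k H} (g : B.AHom N P) (f : B.AHom M N) : B.AHom M P :=
  ⟨g.1 ∘ₗ f.1, fun a x => by rw [LinearMap.comp_apply, f.2, g.2, LinearMap.comp_apply]⟩

@[simp] theorem acomp_apply {M N P : LMod k H} (g : B.AHom N P) (f : B.AHom M N) (x : M.carrier) :
    (B.acomp g f).1 x = g.1 (f.1 x) := rfl

theorem comulTens_tm (M : LMod k H) (h : H) (m : M.carrier) :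
    (B.comulTens M).1 (B.tm M h m) = B.splice M (B.Δ h) m := rfl

theorem counitTens_tm (M : LMod k H) (h : H) (m : M.carrier) :
    (B.counitTens M).1 (B.tm M h m) = M.act (B.s (B.ε h)) m := rfl

theorem idTens_acomp {M N P : LMod k H} (g : B.AHom N P) (f : B.AHom M N)
    (x : (B.tens M).carrier) :
    (B.idTens (B.acomp g f)).1 x = (B.idTens g).1 ((B.idTens f).1 x) := by
  refine LinearMap.congr_fun (g := (B.idTens g).1 ∘ₗ (B.idTens f).1) ?_ x
  exact B.tens_ext fun h m => rfl

theorem counitTens_idTens {M N : LMod k H} (f : B.AHom M N) (x : (B.tens M).carrier) :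
    (B.counitTens N).1 ((B.idTens f).1 x) = f.1 ((B.counitTens M).1 x) := by
  refine LinearMap.congr_fun (f := (B.counitTens N).1 ∘ₗ (B.idTens f).1)
    (g := f.1 ∘ₗ (B.counitTens M).1) (B.tens_ext fun h m => ?_) x
  exact (f.2 _ _).symm

theorem comulTens_idTens {M N : LMod k H} (f : B.AHom M N) (x : (B.tens M).carrier) :
    (B.comulTens N).1 ((B.idTens f).1 x) = (B.idTens (B.idTens f)).1 ((B.comulTens M).1 x) := by
  refine LinearMap.congr_fun (f := (B.comulTens N).1 ∘ₗ (B.idTens f).1)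
    (g := (B.idTens (B.idTens f)).1 ∘ₗ (B.comulTens M).1) (B.tens_ext fun h m => ?_) x
  exact B.TensL_ext (f := (B.splice N).flip (f.1 m))
    (g := (B.idTens (B.idTens f)).1 ∘ₗ (B.splice M).flip m) (fun x y => rfl) (B.Δ h)

theorem comulTens_comulTens (M : LMod k H) (x : (B.tens M).carrier) :
    (B.comulTens (B.tens M)).1 ((B.comulTens M).1 x) =
      (B.idTens (B.comulTens M)).1 ((B.comulTens M).1 x) := by
  refine LinearMap.congr_fun (f := (B.comulTens (B.tens M)).1 ∘ₗ (B.comulTens M).1)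
    (g := (B.idTens (B.comulTens M)).1 ∘ₗ (B.comulTens M).1) (B.tens_ext fun h m => ?_) x
  obtain ⟨X, hX⟩ := B.mkL_surjective (B.Δ h)
  change (B.comulTens (B.tens M)).1 (B.splice M (B.Δ h) m) =
    (B.idTens (B.comulTens M)).1 (B.splice M (B.Δ h) m)
  have key := B.Δ_coassoc_apply hX
    ((B.splice (B.tens M)).compl₂ ((B.tm M).flip m))
    ((B.tm (B.tens (B.tens M))).compl₂ ((B.splice M).flip m)) (fun _ _ _ => rfl)
  rw [← hX]
  refine Eq.trans ?_ (key.trans ?_)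
  · exact tmul_congr ((B.comulTens (B.tens M)).1 ∘ₗ (B.splice M).flip m ∘ₗ B.mkL)
      (TensorProduct.lift ((B.splice (B.tens M)).compl₂ ((B.tm M).flip m) ∘ₗ B.Δ))
      (fun x y => rfl) X
  · exact tmul_congr
      (TensorProduct.lift
        (((B.tm (B.tens (B.tens M))).compl₂ ((B.splice M).flip m)).compl₂ B.Δ))
      ((B.idTens (B.comulTens M)).1 ∘ₗ (B.splice M).flip m ∘ₗ B.mkL) (fun x y => rfl) X

theorem counitTens_comulTens (M : LMod k H) (x : (B.tens M).carrier) :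
    (B.counitTens (B.tens M)).1 ((B.comulTens M).1 x) = x := by
  refine LinearMap.congr_fun (f := (B.counitTens (B.tens M)).1 ∘ₗ (B.comulTens M).1)
    (g := LinearMap.id) (B.tens_ext fun h m => ?_) x
  obtain ⟨X, hX⟩ := B.mkL_surjective (B.Δ h)
  change (B.counitTens (B.tens M)).1 (B.splice M (B.Δ h) m) = B.tm M h m
  conv_rhs => rw [← B.counit_left h X hX]
  rw [← hX]
  refine tmul_congr ((B.counitTens (B.tens M)).1 ∘ₗ (B.splice M).flip m ∘ₗ B.mkL)
    ((B.tm M).flip m ∘ₗ mulMap (B.sLin ∘ₗ B.ε) LinearMap.id) (fun x y => ?_) X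
  exact B.act_s_tm M _ _ _

theorem idTens_counitTens_comulTens (M : LMod k H) (x : (B.tens M).carrier) :
    (B.idTens (B.counitTens M)).1 ((B.comulTens M).1 x) = x := by
  refine LinearMap.congr_fun (f := (B.idTens (B.counitTens M)).1 ∘ₗ (B.comulTens M).1)
    (g := LinearMap.id) (B.tens_ext fun h m => ?_) x
  obtain ⟨X, hX⟩ := B.mkL_surjective (B.Δ h)
  change (B.idTens (B.counitTens M)).1 (B.splice M (B.Δ h) m) = B.tm M h m
  conv_rhs => rw [← B.counit_right h X hX]
  rw [← hX]
  refine tmul_congr ((B.idTens (B.counitTens M)).1 ∘ₗ (B.splice M).flip m ∘ₗ B.mkL)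
    ((B.tm M).flip m ∘ₗ mulOpMap LinearMap.id (B.tLin ∘ₗ B.ε)) (fun x y => ?_) X
  exact (B.tm_bal M _ _ _).symm

/-- `H`-linear maps. -/
def IsHLin {M N : LMod k H} (f : M.carrier →ₗ[k] N.carrier) : Prop :=
  ∀ h x, f (M.act h x) = N.act h (f x)

theorem isHLin_idTens {M N : LMod k H} (f : B.AHom M N) (hf : IsHLin f.1) :
    IsHLin (B.idTens f).1 := by
  intro h x
  refine LinearMap.congr_fun (f := (B.idTens f).1 ∘ₗ (B.tens M).act h)
    (g := (B.tens N).act h ∘ₗ (B.idTens f).1) (B.tens_ext fun z m => ?_) x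
  refine B.TensL_ext (f := (B.idTens f).1 ∘ₗ (B.preAct M).flip (z ⊗ₜ m))
    (g := (B.preAct N).flip (z ⊗ₜ f.1 m)) (fun x y => ?_) (B.Δ h)
  exact congrArg (B.tm N (x * z)) (hf y m)

/-- The left side is `s(ε(h₁ z)) h₂ m`, where `z` may be replaced by `s(ε z)`. As `h₁ s(ε z) ⊗ h₂`
is the coproduct of `h s(ε z)`, the counit axiom returns `h s(ε z) m`. -/
theorem isHLin_counitTens (M : LMod k H) : IsHLin (B.counitTens M).1 := by
  intro h x
  refine LinearMap.congr_fun (f := (B.counitTens M).1 ∘ₗ (B.tens M).act h)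
    (g := M.act h ∘ₗ (B.counitTens M).1) (B.tens_ext fun z m => ?_) x
  obtain ⟨X, hX⟩ := B.mkL_surjective (B.Δ h)
  have hs := B.Δ_mul h (B.s (B.ε z)) X (B.s (B.ε z) ⊗ₜ 1) hX (B.Δ_sa _).symm
  have e := B.counit_left _ _ hs.symm
  change (B.counitTens M).1 (B.preAct M (B.Δ h) (z ⊗ₜ m)) = M.act h (M.act (B.s (B.ε z)) m)
  rw [← Module.End.mul_apply, ← map_mul, ← e, ← hX]
  refine tmul_congr ((B.counitTens M).1 ∘ₗ (B.preAct M).flip (z ⊗ₜ m) ∘ₗ B.mkL)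
    (M.act.toLinearMap.flip m ∘ₗ mulMap (B.sLin ∘ₗ B.ε) LinearMap.id ∘ₗ
      LinearMap.mulRight k (B.s (B.ε z) ⊗ₜ[k] (1 : H))) (fun x y => ?_) X
  change _ = M.act.toLinearMap.flip m (mulMap (B.sLin ∘ₗ B.ε) LinearMap.id
    ((x ⊗ₜ[k] y) * (B.s (B.ε z) ⊗ₜ[k] (1 : H))))
  rw [Algebra.TensorProduct.tmul_mul_tmul, mul_one]
  change M.act (B.s (B.ε (x * z))) (M.act y m) = M.act (B.s (B.ε (x * B.s (B.ε z))) * y) m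
  rw [map_mul M.act, Module.End.mul_apply, B.ε_mul_s x z]

variable (k H) in
/-- The regular module. -/
def reg : LMod k H where
  carrier := H
  act := Algebra.lmul k H

/-- Multiplication of a class in `H ⊗_A H` by an element of `H ⊗_k H` on the right. -/
def rmulTens : B.TensL →ₗ[k] H ⊗[k] H →ₗ[k] B.TensL := B.preAct (reg k H)

theorem rmulTens_mk (x y c d : H) :
    B.rmulTens (B.mkL (x ⊗ₜ y)) (c ⊗ₜ d) = B.mkL ((x * c) ⊗ₜ (y * d)) := rfl

theorem rmulTens_mkL (X Y : H ⊗[k] H) : B.rmulTens (B.mkL X) Y = B.mkL (X * Y) := by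
  induction X with
  | zero => simp
  | add X X' h h' => simp only [map_add, LinearMap.add_apply, add_mul, h, h']
  | tmul x y =>
    refine tmul_congr (B.rmulTens (B.mkL (x ⊗ₜ y))) (B.mkL ∘ₗ LinearMap.mulLeft k (x ⊗ₜ y))
      (fun c d => ?_) Y
    rw [rmulTens_mk, LinearMap.comp_apply, LinearMap.mulLeft_apply,
      Algebra.TensorProduct.tmul_mul_tmul]

/-- Multiplicativity in a form linear in `Δ g`, usable when `g` is itself a leg of a coproduct and
no representative of `Δ g` has been chosen. -/
theorem Δ_mul' (g h : H) (Y : H ⊗[k] H) (hY : B.mkL Y = B.Δ h) :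
    B.Δ (g * h) = B.rmulTens (B.Δ g) Y := by
  obtain ⟨X, hX⟩ := B.mkL_surjective (B.Δ g)
  rw [B.Δ_mul g h X Y hX hY, ← hX, rmulTens_mkL]

/-- Both sides are `h₁ g₁ ⊗ h₂ g₂ ⊗ h₃ m`. Multiplicativity of `Δ` splits the first leg of `h` on
one side, the action on `H ⊗_A M` splits the second leg on the other, and coassociativity compares
them for a fixed representative `Y` of `Δ g`. -/
theorem isHLin_comulTens (M : LMod k H) : IsHLin (B.comulTens M).1 := by
  intro h x
  refine LinearMap.congr_fun (f := (B.comulTens M).1 ∘ₗ (B.tens M).act h)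
    (g := (B.tens (B.tens M)).act h ∘ₗ (B.comulTens M).1) (B.tens_ext fun g m => ?_) x
  obtain ⟨X, hX⟩ := B.mkL_surjective (B.Δ h)
  obtain ⟨Y, hY⟩ := B.mkL_surjective (B.Δ g)
  let T := (B.tens (B.tens M)).carrier
  let p : B.TensL →ₗ[k] H →ₗ[k] H ⊗[k] H →ₗ[k] T :=
    LinearMap.mk₂ k (fun Z z => (B.splice M).flip (M.act z m) ∘ₗ B.rmulTens Z)
      (by intros; ext; simp) (by intros; ext; simp) (by intros; ext; simp) (by intros; ext; simp)
  let q : H →ₗ[k] B.TensL →ₗ[k] H ⊗[k] H →ₗ[k] T :=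
    LinearMap.mk₂ k (fun x Z => TensorProduct.lift (((B.tm (B.tens M)).compl₂
        (B.preAct M Z ∘ₗ (TensorProduct.mk k H M.carrier).flip m)) ∘ₗ LinearMap.mulLeft k x))
      (by intros; ext; simp [add_mul]) (by intros; ext; simp)
      (by
        intro x Z Z'
        apply TensorProduct.ext'
        intro c d
        exact map_add (B.tm (B.tens M) (x * c) ∘ₗ (B.preAct M).flip (d ⊗ₜ m)) Z Z')
      (by
        intro r x Z
        apply TensorProduct.ext'
        intro c d
        exact map_smul (B.tm (B.tens M) (x * c) ∘ₗ (B.preAct M).flip (d ⊗ₜ m)) r Z)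
  have key := LinearMap.congr_fun (B.Δ_coassoc_apply hX p q (by
    intro x y z
    apply TensorProduct.ext'
    intro c d
    change B.tm (B.tens M) (x * c) (B.tm M (y * d) (M.act z m)) =
      B.tm (B.tens M) (x * c) (B.tm M (y * d) (M.act z m))
    rfl)) Y
  change (B.comulTens M).1 (B.preAct M (B.Δ h) (g ⊗ₜ m)) =
    (B.tens (B.tens M)).act h (B.splice M (B.Δ g) m)
  rw [← hX, ← hY]
  refine Eq.trans ?_ (key.trans ?_)
  · refine tmul_congr ((B.comulTens M).1 ∘ₗ (B.preAct M).flip (g ⊗ₜ m) ∘ₗ B.mkL)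
      (LinearMap.applyₗ Y ∘ₗ TensorProduct.lift (p ∘ₗ B.Δ)) (fun x y => ?_) X
    change B.splice M (B.Δ (x * g)) (M.act y m) = B.splice M (B.rmulTens (B.Δ x) Y) (M.act y m)
    rw [B.Δ_mul' x g Y hY]
  · refine tmul_congr (TensorProduct.lift (q.compl₂ B.Δ) X)
      ((B.tens (B.tens M)).act h ∘ₗ (B.splice M).flip m ∘ₗ B.mkL) (fun c d => ?_) Y
    change _ = B.preAct (B.tens M) (B.Δ h) (c ⊗ₜ B.tm M d m)
    rw [← hX]
    exact tmul_congr (LinearMap.applyₗ (c ⊗ₜ d) ∘ₗ TensorProduct.lift (q.compl₂ B.Δ))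
      ((B.preAct (B.tens M)).flip (c ⊗ₜ B.tm M d m) ∘ₗ B.mkL) (fun x y => rfl) X

end LeftBialgebroid
end HopfAlgd


namespace HopfAlgd

/-! ### Colinear maps between cofree comodules. -/

namespace LeftBialgebroid

variable {k : Type v} [CommRing k] {A H : Type u} [Ring A] [Algebra k A] [Ring H] [Algebra k H]
  (B : LeftBialgebroid k A H)

/-- `H`-colinear maps between cofree comodules `H ⊗_A M`. -/
def colin (M N : LMod k H) : Submodule k ((B.tens M).carrier →ₗ[k] (B.tens N).carrier) where
  carrier := {F | ∃ hF : ∀ a x, F ((B.tens M).act (B.s a) x) = (B.tens N).act (B.s a) (F x),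
    ∀ x, (B.comulTens N).1 (F x) = (B.idTens ⟨F, hF⟩).1 ((B.comulTens M).1 x)}
  zero_mem' := by
    refine ⟨fun a x => by simp, fun x => ?_⟩
    generalize (B.comulTens M).1 x = y
    rw [LinearMap.zero_apply, map_zero]
    refine LinearMap.congr_fun (f := 0) (B.tens_ext fun h m => ?_) y
    exact (map_zero (B.tm (B.tens N) h)).symm
  add_mem' := by
    rintro F G ⟨hF, hF'⟩ ⟨hG, hG'⟩
    refine ⟨fun a x => by simp only [LinearMap.add_apply, hF, hG, map_add], fun x => ?_⟩
    rw [LinearMap.add_apply, map_add, hF', hG']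
    generalize (B.comulTens M).1 x = y
    refine LinearMap.congr_fun (f := (B.idTens ⟨F, hF⟩).1 + (B.idTens ⟨G, hG⟩).1)
      (B.tens_ext fun h m => ?_) y
    exact (map_add (B.tm (B.tens N) h) (F m) (G m)).symm
  smul_mem' := by
    rintro c F ⟨hF, hF'⟩
    refine ⟨fun a x => by simp only [LinearMap.smul_apply, hF, map_smul], fun x => ?_⟩
    rw [LinearMap.smul_apply, map_smul, hF']
    generalize (B.comulTens M).1 x = y
    refine LinearMap.congr_fun (f := c • (B.idTens ⟨F, hF⟩).1) (B.tens_ext fun h m => ?_) y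
    exact (map_smul (B.tm (B.tens N) h) c (F m)).symm

variable {B}

/-- The `A`-linear map underlying a colinear map. -/
def colinHom {M N : LMod k H} (F : B.colin M N) : B.AHom (B.tens M) (B.tens N) := ⟨F.1, F.2.1⟩

theorem comulTens_colin {M N : LMod k H} (F : B.colin M N) (x : (B.tens M).carrier) :
    (B.comulTens N).1 (F.1 x) = (B.idTens (colinHom F)).1 ((B.comulTens M).1 x) :=
  F.2.2 x

theorem mem_colin {M N : LMod k H} (F : B.AHom (B.tens M) (B.tens N))
    (h : ∀ x, (B.comulTens N).1 (F.1 x) = (B.idTens F).1 ((B.comulTens M).1 x)) :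
    F.1 ∈ B.colin M N := ⟨F.2, h⟩

variable (B)

theorem id_mem_colin (M : LMod k H) : LinearMap.id ∈ B.colin M M := by
  refine ⟨fun a x => rfl, fun x => ?_⟩
  generalize (B.comulTens M).1 x = y
  refine LinearMap.congr_fun (f := LinearMap.id) (B.tens_ext fun h m => ?_) y
  rfl

variable {B} in
theorem comp_mem_colin {M N P : LMod k H} (G : B.colin N P) (F : B.colin M N) :
    G.1 ∘ₗ F.1 ∈ B.colin M P :=
  mem_colin (B.acomp (colinHom G) (colinHom F)) fun x => by
    rw [acomp_apply, idTens_acomp, ← comulTens_colin, ← comulTens_colin]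
    rfl

theorem idTens_mem_colin {M N : LMod k H} (f : B.AHom M N) : (B.idTens f).1 ∈ B.colin M N :=
  mem_colin _ (B.comulTens_idTens f)

theorem comulTens_mem_colin (M : LMod k H) : (B.comulTens M).1 ∈ B.colin M (B.tens M) :=
  mem_colin _ (B.comulTens_comulTens M)

/-- The colinear map with given composition with the counit. -/
def coext {M N : LMod k H} (g : B.AHom (B.tens M) N) : B.colin M N :=
  ⟨(B.idTens g).1 ∘ₗ (B.comulTens M).1,
    comp_mem_colin ⟨_, B.idTens_mem_colin g⟩ ⟨_, B.comulTens_mem_colin M⟩⟩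

theorem counitTens_coext {M N : LMod k H} (g : B.AHom (B.tens M) N) (x : (B.tens M).carrier) :
    (B.counitTens N).1 ((B.coext g).1 x) = g.1 x := by
  change (B.counitTens N).1 ((B.idTens g).1 _) = _
  rw [counitTens_idTens, counitTens_comulTens]

-- Cofreeness: a colinear `F` equals `(id ⊗ εF)` composed with the comultiplication, so its
-- composite with the counit determines it. Identities of colinear maps will be checked after `σ_0`.
variable {B} in
theorem colin_ext {M N : LMod k H} {F G : B.colin M N}
    (h : ∀ x, (B.counitTens N).1 (F.1 x) = (B.counitTens N).1 (G.1 x)) : F = G := by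
  have key : ∀ (F : B.colin M N) x, F.1 x =
      (B.coext (B.acomp (B.counitTens N) (colinHom F))).1 x := by
    intro F x
    change _ = (B.idTens _).1 ((B.comulTens M).1 x)
    rw [idTens_acomp, ← comulTens_colin, idTens_counitTens_comulTens]
  apply Subtype.ext
  apply LinearMap.ext
  intro x
  rw [key F, key G]
  congr 3
  exact Subtype.ext (LinearMap.ext h)

-- The element `1 ⊗ x` is coinvariant. Colinear maps preserve coinvariants, and the counit axiom
-- rewrites a coinvariant `y` as `1 ⊗ ε(y)`.
variable {B} in
theorem colin_tm_one {M N : LMod k H} (F : B.colin M N) (x : M.carrier) :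
    F.1 (B.tm M 1 x) = B.tm N 1 ((B.counitTens N).1 (F.1 (B.tm M 1 x))) := by
  have h : (B.comulTens M).1 (B.tm M 1 x) = B.tm (B.tens M) 1 (B.tm M 1 x) := by
    rw [comulTens_tm, B.Δ_one, splice_mk]
  have h' : (B.comulTens N).1 (F.1 (B.tm M 1 x)) = B.tm (B.tens N) 1 (F.1 (B.tm M 1 x)) := by
    rw [comulTens_colin, h]
    rfl
  conv_lhs => rw [← B.idTens_counitTens_comulTens N (F.1 (B.tm M 1 x)), h']
  rfl

open CategoryTheory

/-- The degrees, as objects of the category of colinear maps between the comodules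
`H ⊗_A C^n`, with arrows reversed. -/
structure CoDeg (B : LeftBialgebroid k A H) where
  deg : ℕ

/-- Reversing arrows turns cofaces into the faces of a `SignedCyclic`, so that cochains and chains
share one abstract argument. -/
instance : Category B.CoDeg where
  Hom X Y := B.colin (B.C Y.deg) (B.C X.deg)
  id X := ⟨LinearMap.id, B.id_mem_colin _⟩
  comp f g := ⟨f.1 ∘ₗ g.1, comp_mem_colin f g⟩

instance : Preadditive B.CoDeg where
  homGroup X Y := inferInstanceAs (AddCommGroup (B.colin (B.C Y.deg) (B.C X.deg)))
  add_comp _ _ _ f f' g := Subtype.ext (LinearMap.add_comp g.1 f'.1 f.1)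
  comp_add _ _ _ f g g' := Subtype.ext (LinearMap.comp_add g.1 g'.1 f.1)

/-- The colinear map underlying a morphism. -/
def coFun {X Y : B.CoDeg} (f : X ⟶ Y) :
    (B.C (Y.deg + 1)).carrier →ₗ[k] (B.C (X.deg + 1)).carrier :=
  Subtype.val (p := fun F => F ∈ B.colin (B.C Y.deg) (B.C X.deg)) f

variable {B} in
/-- The morphism given by a colinear map. -/
def coHom {m n : ℕ} (F : B.colin (B.C n) (B.C m)) : (⟨m⟩ : B.CoDeg) ⟶ ⟨n⟩ := F

variable {B}

theorem coFun_add {X Y : B.CoDeg} (f g : X ⟶ Y) : B.coFun (f + g) = B.coFun f + B.coFun g := rfl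

theorem coFun_sum {X Y : B.CoDeg} {ι : Type*} (s : Finset ι) (f : ι → (X ⟶ Y)) :
    B.coFun (∑ i ∈ s, f i) = ∑ i ∈ s, B.coFun (f i) := by
  classical
  induction s using Finset.induction_on with
  | empty => rfl
  | insert i s hi ih => rw [Finset.sum_insert hi, Finset.sum_insert hi, coFun_add, ih]

theorem coFun_pow {X : B.CoDeg} (f : End X) (j : ℕ) (x : (B.C (X.deg + 1)).carrier) :
    B.coFun (f ^ j : End X) x = (B.coFun f)^[j] x := by
  induction j generalizing x with
  | zero => rfl
  | succ j ih =>
    rw [Function.iterate_succ_apply, ← ih]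
    exact congrArg (fun g : End X => B.coFun g x) (pow_succ' f j)

theorem coFun_ext {X Y : B.CoDeg} {f g : X ⟶ Y} (h : ∀ x, B.coFun f x = B.coFun g x) : f = g :=
  Subtype.ext (LinearMap.ext h)

end LeftBialgebroid
end HopfAlgd


/-! ### Cofaces, their contraction, and the splitting of cochains. -/

namespace HopfAlgd

theorem sum_neg_one_pow_succ (k : Type*) {M : Type*} [CommRing k] [AddCommGroup M] [Module k M]
    (f : ℕ → M) (n : ℕ) : ∑ i ∈ Finset.range (n + 1), (-1 : k) ^ i • f i =
      f 0 - ∑ i ∈ Finset.range n, (-1 : k) ^ i • f (i + 1) := by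
  rw [Finset.sum_range_succ', pow_zero, one_smul, add_comm, sub_eq_add_neg,
    ← Finset.sum_neg_distrib]
  refine congrArg₂ _ rfl (Finset.sum_congr rfl fun i _ => ?_)
  rw [pow_succ, mul_neg_one, neg_smul]

namespace LeftBialgebroid

variable {k : Type v} [CommRing k] {A H : Type u} [Ring A] [Algebra k A] [Ring H] [Algebra k H]
  (B : LeftBialgebroid k A H)

theorem ε_s_one (a : A) : B.ε (B.s a) = a := by
  simpa [B.ε_one] using B.ε_s a 1

/-- The excluded index `i = n` is the coface that appends a factor `1`, which need not commute with
the diagonal action. -/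
theorem isHLin_δsucc : ∀ n i : ℕ, i < n → IsHLin (B.δsucc n i).1
  | n + 1, 0, _ => B.isHLin_comulTens (B.C n)
  | n + 1, i + 1, h => B.isHLin_idTens _ (isHLin_δsucc n i (by omega))

theorem δsucc_mem_colin (n i : ℕ) : (B.δsucc (n + 1) i).1 ∈ B.colin (B.C n) (B.C (n + 1)) := by
  cases i with
  | zero => exact B.comulTens_mem_colin (B.C n)
  | succ i => exact B.idTens_mem_colin (B.δsucc n i)

theorem comulTens_δsucc (n i : ℕ) (x : (B.C (n + 1)).carrier) :
    (B.comulTens (B.C (n + 1))).1 ((B.δsucc (n + 1) i).1 x) =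
      (B.δsucc (n + 2) (i + 1)).1 ((B.comulTens (B.C n)).1 x) :=
  comulTens_colin ⟨_, B.δsucc_mem_colin n i⟩ x

theorem idTens_congr {M N P Q : LMod k H} {f : B.AHom M N} {g : B.AHom N Q} {f' : B.AHom M P}
    {g' : B.AHom P Q} (h : ∀ x, g.1 (f.1 x) = g'.1 (f'.1 x)) (x : (B.tens M).carrier) :
    (B.idTens g).1 ((B.idTens f).1 x) = (B.idTens g').1 ((B.idTens f').1 x) := by
  have e : B.acomp g f = B.acomp g' f' := Subtype.ext (LinearMap.ext h)
  rw [← idTens_acomp, ← idTens_acomp, e]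

theorem idTens_congr_id {M N : LMod k H} {f : B.AHom M N} {g : B.AHom N M}
    (h : ∀ x, g.1 (f.1 x) = x) (x : (B.tens M).carrier) :
    (B.idTens g).1 ((B.idTens f).1 x) = x := by
  refine LinearMap.congr_fun (f := (B.idTens g).1 ∘ₗ (B.idTens f).1) (g := LinearMap.id)
    (B.tens_ext fun z m => ?_) x
  exact congrArg (B.tm M z) (h m)

theorem δsucc_δsucc_last : ∀ n i : ℕ, i ≤ n → ∀ x : (B.C n).carrier,
    (B.δsucc (n + 1) i).1 ((B.δsucc n n).1 x) =
      (B.δsucc (n + 1) (n + 1)).1 ((B.δsucc n i).1 x)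
  | 0, 0, _, x => by
    have h : ∀ a : A, B.splice B.unit (B.Δ (B.s a)) (1 : A) =
        B.tm (B.tens B.unit) (B.s a) (B.tm B.unit (B.s 1) (1 : A)) := by
      intro a
      rw [Δ_sa, map_one]
      rfl
    exact h x
  | n + 1, 0, _, x => B.comulTens_idTens (B.δsucc n n) x
  | n + 1, i + 1, h, x => B.idTens_congr (δsucc_δsucc_last n i (by omega)) x

theorem σ_δsucc_last : ∀ (n : ℕ) (x : (B.C n).carrier), (B.σ n n).1 ((B.δsucc n n).1 x) = x
  | 0, x => by
    have h : ∀ a : A, B.ε (B.s (B.ε (B.s a)) * B.s 1) = a := by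
      intro a
      rw [map_one, mul_one, ε_s_one, ε_s_one]
    exact h x
  | n + 1, x => B.idTens_congr_id (σ_δsucc_last n) x

theorem σ_last_δsucc : ∀ n i : ℕ, i < n → ∀ x : (B.C (n + 1)).carrier,
    (B.σ (n + 1) (n + 1)).1 ((B.δsucc (n + 1) i).1 x) = (B.δsucc n i).1 ((B.σ n n).1 x)
  | n + 1, 0, _, x => (B.comulTens_idTens (B.σ n n) x).symm
  | n + 1, i + 1, h, x => B.idTens_congr (σ_last_δsucc n i (by omega)) x

theorem σ_zero_eq (n : ℕ) : B.σ n 0 = B.counitTens (B.C n) := by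
  cases n <;> rfl

theorem σ_zero_δsucc_zero (n : ℕ) (x : (B.C (n + 1)).carrier) :
    (B.σ (n + 1) 0).1 ((B.δsucc (n + 1) 0).1 x) = x :=
  B.counitTens_comulTens (B.C n) x

theorem σ_zero_δsucc_succ (n i : ℕ) (x : (B.C (n + 1)).carrier) :
    (B.σ (n + 1) 0).1 ((B.δsucc (n + 1) (i + 1)).1 x) = (B.δsucc n i).1 ((B.σ n 0).1 x) := by
  rw [B.σ_zero_eq n]
  exact B.counitTens_idTens (B.δsucc n i) x

theorem σ_zero_δzero (n : ℕ) (x : (B.C n).carrier) : (B.σ n 0).1 (B.δzero n x) = x := by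
  rw [σ_zero_eq]
  have h : (B.counitTens (B.C n)).1 (B.tm (B.C n) 1 x) = x := by
    rw [counitTens_tm, B.ε_one, map_one, map_one]
    rfl
  exact h

theorem δsucc_zero_δzero (n : ℕ) (x : (B.C n).carrier) :
    (B.δsucc (n + 1) 0).1 (B.δzero n x) = B.δzero (n + 1) (B.δzero n x) := by
  have h : (B.comulTens (B.C n)).1 (B.tm (B.C n) 1 x) =
      B.tm (B.tens (B.C n)) 1 (B.tm (B.C n) 1 x) := by
    rw [comulTens_tm, B.Δ_one, splice_mk]
  exact h

/-- The alternating sum of the cofaces `δ_{i+1}`. -/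
def altδ (n : ℕ) : (B.C n).carrier →ₗ[k] (B.C (n + 1)).carrier :=
  ∑ i ∈ Finset.range (n + 1), (-1 : k) ^ i • (B.δsucc n i).1

theorem altδ_apply (n : ℕ) (x : (B.C n).carrier) :
    B.altδ n x = ∑ i ∈ Finset.range (n + 1), (-1 : k) ^ i • (B.δsucc n i).1 x := by
  rw [altδ, LinearMap.sum_apply]
  rfl

theorem altδ_succ_apply (n : ℕ) (x : (B.C (n + 1)).carrier) :
    B.altδ (n + 1) x = (B.δsucc (n + 1) 0).1 x -
      ∑ i ∈ Finset.range (n + 1), (-1 : k) ^ i • (B.δsucc (n + 1) (i + 1)).1 x := by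
  rw [altδ_apply]
  exact sum_neg_one_pow_succ k (fun i => (B.δsucc (n + 1) i).1 x) (n + 1)

theorem b_eq (n : ℕ) (x : (B.C n).carrier) : B.b n x = B.δzero n x - B.altδ n x := by
  rw [altδ_apply, b, LinearMap.sum_apply]
  exact sum_neg_one_pow_succ k (fun i => B.δ n i x) (n + 1)

/-- Comultiplying the leading `1` supplies the term `δ_0`, and the other cofaces act on `x` alone.
Thus `x ↦ 1 ⊗ x` embeds `(C^n, b)` into the cofree complex. -/
theorem altδ_δzero (n : ℕ) (x : (B.C n).carrier) :
    B.altδ (n + 1) (B.δzero n x) = B.δzero (n + 1) (B.b n x) := by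
  rw [altδ_succ_apply, b_eq, map_sub, δsucc_zero_δzero, altδ_apply, map_sum]
  refine congrArg₂ _ rfl (Finset.sum_congr rfl fun i _ => ?_)
  rw [map_smul]
  rfl

/-- The codegeneracy `σ_0` contracts the cofree complex: it cancels the first coface and slides past
the others with a shift of index. -/
theorem σ_zero_altδ (n : ℕ) (x : (B.C (n + 1)).carrier) :
    (B.σ (n + 1) 0).1 (B.altδ (n + 1) x) = x - B.altδ n ((B.σ n 0).1 x) := by
  rw [altδ_succ_apply, altδ_apply]
  refine (map_sub (B.σ (n + 1) 0).1 _ _).trans ?_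
  refine congrArg₂ _ (B.σ_zero_δsucc_zero n x) ?_
  refine (map_sum (B.σ (n + 1) 0).1 _ _).trans (Finset.sum_congr rfl fun i _ => ?_)
  exact (map_smul (B.σ (n + 1) 0).1 _ _).trans (congrArg _ (B.σ_zero_δsucc_succ n i x))

theorem altδ_mem_colin (n : ℕ) : B.altδ (n + 1) ∈ B.colin (B.C n) (B.C (n + 1)) :=
  Submodule.sum_mem _ fun i _ => Submodule.smul_mem _ _ (B.δsucc_mem_colin n i)

/-- By colinearity it is enough to apply `σ_0`. Two uses of the contraction turn `σ_0 δ δ` into `δ δ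
σ_0`, one degree lower, so only degree zero needs a cosimplicial identity. -/
theorem altδ_altδ : ∀ (n : ℕ) (x : (B.C n).carrier), B.altδ (n + 1) (B.altδ n x) = 0
  | 0, x => by
    have h := B.δsucc_δsucc_last 0 0 le_rfl x
    simp [altδ_apply, Finset.sum_range_succ, h]
  | n + 1, x => by
    let F : B.colin (B.C n) (B.C (n + 2)) := ⟨_, comp_mem_colin
      ⟨_, B.altδ_mem_colin (n + 1)⟩ ⟨_, B.altδ_mem_colin n⟩⟩
    have h : ∀ x : (B.C (n + 1)).carrier,
        (B.σ (n + 2) 0).1 (B.altδ (n + 2) (B.altδ (n + 1) x)) = (B.σ (n + 2) 0).1 0 := by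
      intro x
      rw [σ_zero_altδ, σ_zero_altδ, map_sub, altδ_altδ n]
      exact (sub_eq_zero.2 (sub_zero _).symm).trans (map_zero (B.σ (n + 2) 0).1).symm
    have hF : F = 0 := colin_ext h
    exact LinearMap.congr_fun (congrArg Subtype.val hF) x

open CategoryTheory

/-- Lifting of colinear maps along the acyclic complex of the `C^(n+1)`. -/
def coLift {m n : ℕ} (F : (⟨m⟩ : B.CoDeg) ⟶ ⟨n⟩) : (⟨m⟩ : B.CoDeg) ⟶ ⟨n + 1⟩ :=
  coHom (B.coext (B.acomp (B.counitTens (B.C m)) (B.acomp (colinHom F)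
    (B.counitTens (B.C (n + 1))))))

theorem σ_coLift {m n : ℕ} (F : (⟨m⟩ : B.CoDeg) ⟶ ⟨n⟩) (x : (B.C (n + 2)).carrier) :
    (B.σ m 0).1 (B.coFun (B.coLift F) x) = (B.σ m 0).1 (B.coFun F ((B.σ (n + 1) 0).1 x)) := by
  rw [B.σ_zero_eq m]
  exact B.counitTens_coext _ x

theorem coFun_ext_σ {m n : ℕ} {f g : (⟨m⟩ : B.CoDeg) ⟶ ⟨n⟩}
    (h : ∀ x, (B.σ m 0).1 (B.coFun f x) = (B.σ m 0).1 (B.coFun g x)) : f = g := by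
  rw [σ_zero_eq] at h
  exact colin_ext h

theorem coFun_δzero {m n : ℕ} (f : (⟨m⟩ : B.CoDeg) ⟶ ⟨n⟩) (x : (B.C n).carrier) :
    B.coFun f (B.δzero n x) = B.δzero m ((B.σ m 0).1 (B.coFun f (B.δzero n x))) := by
  rw [σ_zero_eq]
  exact colin_tm_one f x

/-- The mixed complex of colinear maps of a cyclic structure that extends the cofaces. -/
def coLifting (X : SignedCyclic (fun n => (⟨n⟩ : B.CoDeg)))
    (hX : ∀ n x, B.coFun (X.b n) x = B.altδ (n + 1) x) :
    LiftingMixed (fun n => (⟨n⟩ : B.CoDeg)) :=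
  X.toLiftingMixed B.coLift
    (fun n => coFun_ext fun x =>
      (hX (n + 1) _).trans ((congrArg _ (hX n x)).trans (B.altδ_altδ (n + 1) x)))
    (fun m n => B.coFun_ext_σ fun x => B.σ_coLift _ x)
    (fun m n F hF => B.coFun_ext_σ fun x => by
      have h0 : ∀ y : (B.C (n + 1)).carrier, B.coFun F (B.altδ (n + 1) y) = 0 := fun y =>
        (congrArg (B.coFun F) (hX n y)).symm.trans (LinearMap.congr_fun (congrArg B.coFun hF) y)
      -- With `δ` for `altδ`: `σ_0 F σ_0 δ = σ_0 F (1 - δ σ_0) = σ_0 F`, because `F` annihilates the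
      -- image of `δ`.
      refine (congrArg (fun y => (B.σ m 0).1 (B.coFun (B.coLift F) y)) (hX (n + 1) x)).trans ?_
      refine (B.σ_coLift F _).trans (congrArg (B.σ m 0).1 ?_)
      refine (congrArg (B.coFun F) (B.σ_zero_altδ (n + 1) x)).trans ?_
      refine (map_sub (B.coFun F) _ _).trans ?_
      exact (congrArg (_ - ·) (h0 _)).trans (sub_zero _))

/-- The splitting of the mixed complex `C^•` given by a cyclic structure in the category of colinear
maps that extends the cofaces. -/
def cochainSplit (X : SignedCyclic (fun n => (⟨n⟩ : B.CoDeg)))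
    (hX : ∀ n x, B.coFun (X.b n) x = B.altδ (n + 1) x)
    (coB : ∀ n, (B.C (n + 1)).carrier →ₗ[k] (B.C n).carrier)
    (hB : ∀ n x, B.coFun (X.B n) (B.δzero (n + 1) x) = B.δzero n (coB n x)) :
    CochainSplit (C := fun n => (B.C n).carrier) B.b coB :=
  let L := B.coLifting X hX
  -- Arrows being reversed, `Φ n m` is a colinear map from `H ⊗ C^n` to `H ⊗ C^m`. It preserves the
  -- coinvariants `1 ⊗ x`, and `σ_0` reads off its restriction to them.
  let φ : ∀ n m, (B.C n).carrier →ₗ[k] (B.C m).carrier := fun n m =>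
    (B.σ m 0).1 ∘ₗ B.coFun (L.Φ n m) ∘ₗ B.δzero n
  have key : ∀ n m x, B.coFun (L.Φ n m) (B.δzero n x) = B.δzero m (φ n m x) :=
    fun n m x => B.coFun_δzero _ x
  have hinj : ∀ m (x y : (B.C m).carrier), B.δzero m x = B.δzero m y → x = y := by
    intro m x y h
    rw [← B.σ_zero_δzero m x, h, σ_zero_δzero]
  have hb : ∀ n x, B.coFun (X.b n) (B.δzero n x) = B.δzero (n + 1) (B.b n x) :=
    fun n x => (hX n _).trans (B.altδ_δzero n x)
  have hpre : ∀ n m x, B.coFun (X.b m) (B.coFun (L.Φ n m) (B.δzero n x)) =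
      B.δzero (m + 1) (B.b m (φ n m x)) :=
    fun n m x => (congrArg _ (key n m x)).trans (hb m _)
  have hpost : ∀ n m x, B.coFun (L.Φ n m) (B.coFun (X.B n) (B.δzero (n + 1) x)) =
      B.δzero m (φ n m (coB n x)) :=
    fun n m x => (congrArg _ (hB n x)).trans (key n m _)
  have hbb : ∀ n m x, B.coFun (L.Φ (n + 1) m) (B.coFun (X.b n) (B.δzero n x)) =
      B.δzero m (φ (n + 1) m (B.b n x)) :=
    fun n m x => (congrArg _ (hb n x)).trans (key (n + 1) m _)
  have hΦ : ∀ n m x, B.coFun (L.Φ (n + 1) m) (B.coFun (X.b n) x) + B.coFun (L.postΦ m n) x =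
      B.coFun (L.preΦ n m) x := fun n m x => LinearMap.congr_fun (congrArg B.coFun (L.Φ_b n m)) x
  { φ := φ
    φ_self := fun n x => hinj _ _ _ <| by
      rw [← key, L.Φ_self]
      rfl
    φ_of_gt := fun n m x h => hinj _ _ _ <| by
      rw [← key, L.Φ_of_gt h, map_zero]
      rfl
    φ_odd := fun n m x h => hinj _ _ _ <| by
      rw [← key, L.Φ_odd n m h, map_zero]
      rfl
    φ_b_zero := fun m x => hinj _ _ _ <|
      ((hbb 0 (m + 1) x).symm.trans ((add_zero _).symm.trans (hΦ 0 (m + 1) _))).trans (hpre 0 m x)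
    φ_b_succ_zero := fun n x => hinj _ _ _ <| by
      rw [map_add, map_zero, ← hpost, ← hbb]
      exact hΦ (n + 1) 0 _
    φ_b_succ_succ := fun n m x => hinj _ _ _ <| by
      rw [map_add, ← hpost, ← hbb, ← hpre]
      exact hΦ (n + 1) (m + 1) _ }

end LeftBialgebroid
end HopfAlgd


namespace HopfAlgd

/-! ### Commutative case: lifting the cyclic operator to the cofree comodules. -/

namespace LeftBialgebroid

variable {k : Type v} [CommRing k] {A H : Type u} [Ring A] [Algebra k A] [CommRing H] [Algebra k H]
  (B : LeftBialgebroid k A H)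

/-- Multiplication `w, v ↦ v · w` on the first factor of `H ⊗_A M`, for commutative `H`. -/
def mulFst (M : LMod k H) : (B.tens M).carrier →ₗ[k] H →ₗ[k] (B.tens M).carrier :=
  B.tlift (LinearMap.mk₂ k (fun h m => (B.tm M).flip m ∘ₗ LinearMap.mulRight k h)
      (by intros; ext; simp [mul_add]) (by intros; ext; simp)
      (by intros; ext; simp) (by intros; ext; simp))
    (by
      intro a h m
      ext v
      simp only [LinearMap.mk₂_apply, LinearMap.comp_apply, LinearMap.flip_apply,
        LinearMap.mulRight_apply]
      rw [← tm_bal, mul_left_comm])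

theorem idTens_mulFst {M N : LMod k H} (f : B.AHom M N) (w : (B.tens M).carrier) (v : H) :
    (B.idTens f).1 (B.mulFst M w v) = B.mulFst N ((B.idTens f).1 w) v := by
  refine LinearMap.congr_fun (f := (B.idTens f).1 ∘ₗ (B.mulFst M).flip v)
    (g := (B.mulFst N).flip v ∘ₗ (B.idTens f).1) (B.tens_ext fun z m => ?_) w
  rfl

/-- The diagonal action multiplies the first factor by a leg of `h`, which commutes with `v`. -/
theorem act_mulFst (M : LMod k H) (h : H) (w : (B.tens M).carrier) (v : H) :
    (B.tens M).act h (B.mulFst M w v) = B.mulFst M ((B.tens M).act h w) v := by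
  refine LinearMap.congr_fun (f := (B.tens M).act h ∘ₗ (B.mulFst M).flip v)
    (g := (B.mulFst M).flip v ∘ₗ (B.tens M).act h) (B.tens_ext fun z m => ?_) w
  refine B.TensL_ext (f := (B.preAct M).flip ((v * z) ⊗ₜ m))
    (g := (B.mulFst M).flip v ∘ₗ (B.preAct M).flip (z ⊗ₜ m)) (fun x y => ?_) (B.Δ h)
  exact congrArg (fun c => B.tm M c (M.act y m)) (mul_left_comm x v z)

end LeftBialgebroid

namespace HopfAlgebroid

section Antipode

variable {k : Type v} [CommRing k] {Al Ar H : Type u} [Ring Al] [Algebra k Al] [Ring Ar]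
  [Algebra k Ar] [Ring H] [Algebra k H] (𝓗 : HopfAlgebroid k Al Ar H)

/-- `x ⊗ y ↦ S(x) y` on `H ⊗_{A_l} H`. -/
def Smul : 𝓗.lft.TensL →ₗ[k] H :=
  balLift _ _ (mulMap 𝓗.S.toLinearMap LinearMap.id) (by
    intro a x y
    simp only [STRing.tL_apply, STRing.sL_apply, mulMap_tmul, LinearMap.id_apply,
      LinearEquiv.coe_coe, S_tl_mul, mul_assoc])

theorem Smul_mk (x y : H) : Smul 𝓗 (𝓗.lft.mkL (x ⊗ₜ y)) = 𝓗.S x * y := rfl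

theorem Smul_Δ (h : H) : Smul 𝓗 (𝓗.lft.Δ h) = 𝓗.rgt.s (𝓗.rgt.ε h) := by
  obtain ⟨X, hX⟩ := 𝓗.lft.mkL_surjective (𝓗.lft.Δ h)
  rw [← 𝓗.antipode_left h X hX, ← hX]
  rfl

theorem S_one : 𝓗.S 1 = 1 := by
  have h := 𝓗.Smul_Δ 1
  rw [𝓗.lft.Δ_one, Smul_mk, 𝓗.rgt.ε_one] at h
  simpa using h

end Antipode

variable {k : Type v} [CommRing k] {A H : Type u} [CommRing A] [Algebra k A] [CommRing H]
  [Algebra k H] {𝓗 : HopfAlgebroid k A A H}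

namespace IsCommutative

theorem S_sl_mul (hc : 𝓗.IsCommutative) (a : A) (h : H) :
    𝓗.S (𝓗.lft.s a * h) = 𝓗.lft.t (op a) * 𝓗.S h := by
  rw [mul_comm, hc.sl_eq, S_mul_tr, hc.tl_eq]

/-- `x ⊗ y ↦ x S(y)`. -/
def mulS (hc : 𝓗.IsCommutative) : 𝓗.lft.TensL →ₗ[k] H :=
  balLift _ _ (mulMap LinearMap.id 𝓗.S.toLinearMap) (by
    intro a x y
    simp only [STRing.tL_apply, STRing.sL_apply, mulMap_tmul, LinearMap.id_apply,
      LinearEquiv.coe_coe, hc.S_sl_mul]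
    ring)

theorem mulS_Δ (hc : 𝓗.IsCommutative) (h : H) :
    hc.mulS (𝓗.lft.Δ h) = 𝓗.lft.s (𝓗.lft.ε h) := by
  obtain ⟨X, hX⟩ := 𝓗.lft.mkL_surjective (𝓗.lft.Δ h)
  rw [← 𝓗.antipode_right h X ((hc.Δ_eq h X).1 hX), ← hX]
  rfl

/-- The antipode exchanges source and target. This is what makes `h ⊗ x ↦ h · τ(x)` balanced over
`A`. -/
theorem τ_act (hc : 𝓗.IsCommutative) : ∀ (n : ℕ) (a : A) (x : (𝓗.lft.C n).carrier),
    𝓗.τ n ((𝓗.lft.C n).act (𝓗.lft.s a) x) = (𝓗.lft.C n).act (𝓗.lft.t (op a)) (𝓗.τ n x)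
  | 0, a, x => by
    have h : ∀ c : A, 𝓗.lft.ε (𝓗.lft.s a * 𝓗.lft.s c) =
        𝓗.lft.ε (𝓗.lft.t (op a) * 𝓗.lft.s c) := by
      intro c
      rw [𝓗.lft.ε_s, 𝓗.lft.ε_t, mul_comm]
    exact h x
  | n + 1, a, x => by
    refine LinearMap.congr_fun (f := 𝓗.τ (n + 1) ∘ₗ (𝓗.lft.C (n + 1)).act (𝓗.lft.s a))
      (g := (𝓗.lft.C (n + 1)).act (𝓗.lft.t (op a)) ∘ₗ 𝓗.τ (n + 1))
      (𝓗.lft.tens_ext fun h m => ?_) x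
    have e : 𝓗.τ (n + 1) ((𝓗.lft.tens (𝓗.lft.C n)).act (𝓗.lft.s a) (𝓗.lft.tm _ h m)) =
        (𝓗.lft.C (n + 1)).act (𝓗.S (𝓗.lft.s a * h)) ((𝓗.lft.δsucc n n).1 m) := by
      rw [LeftBialgebroid.act_s_tm]
      rfl
    refine e.trans ?_
    rw [hc.S_sl_mul, map_mul]
    rfl

/-- The map `h ⊗ x ↦ h · τ(x)`. -/
def actτ (hc : 𝓗.IsCommutative) (n : ℕ) :
    𝓗.lft.AHom (𝓗.lft.tens (𝓗.lft.C n)) (𝓗.lft.C n) :=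
  𝓗.lft.mkAHom ((𝓗.lft.C n).act.toLinearMap.compl₂ (𝓗.τ n))
    (by
      intro a h m
      rw [LinearMap.compl₂_apply, LinearMap.compl₂_apply, hc.τ_act, mul_comm]
      exact LinearMap.congr_fun (map_mul (𝓗.lft.C n).act h _) _)
    (by
      intro a h m
      exact LinearMap.congr_fun (map_mul (𝓗.lft.C n).act _ h) _)

/-- The cyclic operator on the cofree comodules `H ⊗_A C^n`. -/
def cyc (hc : 𝓗.IsCommutative) (n : ℕ) : 𝓗.lft.colin (𝓗.lft.C n) (𝓗.lft.C n) :=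
  𝓗.lft.coext (hc.actτ n)

/-- The cyclic operator as a linear map. -/
def cycL (hc : 𝓗.IsCommutative) (n : ℕ) : Module.End k (𝓗.lft.C (n + 1)).carrier :=
  (hc.cyc n).1

/-- The colinear extension is `h₁ ⊗ h₂ τ(x)`, which is the diagonal action of `h` on `1 ⊗ τ(x)`. -/
theorem cycL_tm (hc : 𝓗.IsCommutative) (n : ℕ) (h : H) (x : (𝓗.lft.C n).carrier) :
    hc.cycL n (𝓗.lft.tm (𝓗.lft.C n) h x) =
      (𝓗.lft.tens (𝓗.lft.C n)).act h (𝓗.lft.tm (𝓗.lft.C n) 1 (𝓗.τ n x)) := by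
  refine 𝓗.lft.TensL_ext (f := (𝓗.lft.idTens (hc.actτ n)).1 ∘ₗ (𝓗.lft.splice _).flip x)
    (g := (𝓗.lft.preAct _).flip (1 ⊗ₜ 𝓗.τ n x)) (fun y z => ?_) (𝓗.lft.Δ h)
  exact congrArg (fun c => 𝓗.lft.tm (𝓗.lft.C n) c ((𝓗.lft.C n).act z (𝓗.τ n x)))
    (mul_one y).symm

theorem cycL_δzero (hc : 𝓗.IsCommutative) (n : ℕ) (x : (𝓗.lft.C n).carrier) :
    hc.cycL n (𝓗.lft.δzero n x) = 𝓗.lft.δzero n (𝓗.τ n x) := by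
  refine (hc.cycL_tm n 1 x).trans ?_
  rw [map_one]
  rfl

theorem cycL_mulFst (hc : 𝓗.IsCommutative) (n : ℕ) (v : H)
    (w : (𝓗.lft.tens (𝓗.lft.C n)).carrier) :
    hc.cycL n (𝓗.lft.mulFst _ w v) = (𝓗.lft.C (n + 1)).act v (hc.cycL n w) := by
  refine LinearMap.congr_fun (f := hc.cycL n ∘ₗ (𝓗.lft.mulFst (𝓗.lft.C n)).flip v)
    (g := (𝓗.lft.C (n + 1)).act v ∘ₗ hc.cycL n) (𝓗.lft.tens_ext fun z m => ?_) w
  refine (hc.cycL_tm n (v * z) m).trans ?_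
  refine Eq.trans ?_ (congrArg ((𝓗.lft.C (n + 1)).act v) (hc.cycL_tm n z m).symm)
  exact LinearMap.congr_fun (map_mul (𝓗.lft.tens (𝓗.lft.C n)).act v z) _

variable (𝓗) in
/-- `x, y ↦ x · (1 ⊗ S(y) · W)`. -/
def actS (M : LMod k H) (W : M.carrier) : H →ₗ[k] H →ₗ[k] (𝓗.lft.tens M).carrier :=
  (𝓗.lft.tens M).act.toLinearMap.compl₂ (𝓗.lft.tm M 1 ∘ₗ M.act.toLinearMap.flip W ∘ₗ
    𝓗.S.toLinearMap)

/-- In Sweedler notation, `h₁ · (1 ⊗ S(h₂) W) = h₁ ⊗ h₂ S(h₃) W = h₁ ⊗ s(ε(h₂)) W`; moving the base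
element across the tensor sign, the counit axiom leaves `h ⊗ W`. -/
theorem actS_Δ (hc : 𝓗.IsCommutative) (M : LMod k H) {h : H} {X : H ⊗[k] H}
    (hX : 𝓗.lft.mkL X = 𝓗.lft.Δ h) (W : M.carrier) :
    TensorProduct.lift (actS 𝓗 M W) X = 𝓗.lft.tm M h W := by
  let p : 𝓗.lft.TensL →ₗ[k] H →ₗ[k] (𝓗.lft.tens M).carrier :=
    (𝓗.lft.preAct M).compl₂ (TensorProduct.mk k H M.carrier 1 ∘ₗ
      M.act.toLinearMap.flip W ∘ₗ 𝓗.S.toLinearMap)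
  let q : H →ₗ[k] 𝓗.lft.TensL →ₗ[k] (𝓗.lft.tens M).carrier :=
    (𝓗.lft.tm M).compl₂ (M.act.toLinearMap.flip W ∘ₗ hc.mulS)
  have key := 𝓗.lft.Δ_coassoc_apply hX p q (by
    intro x y z
    change 𝓗.lft.tm M (x * 1) (M.act y (M.act (𝓗.S z) W)) = 𝓗.lft.tm M x (M.act (y * 𝓗.S z) W)
    rw [mul_one, map_mul]
    rfl)
  refine Eq.trans ?_ (key.trans ?_)
  · exact tmul_congr (TensorProduct.lift (actS 𝓗 M W)) (TensorProduct.lift (p ∘ₗ 𝓗.lft.Δ))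
      (fun x y => rfl) X
  · conv_rhs => rw [← 𝓗.lft.counit_right h X hX]
    refine tmul_congr (TensorProduct.lift (q.compl₂ 𝓗.lft.Δ))
      ((𝓗.lft.tm M).flip W ∘ₗ mulOpMap LinearMap.id (𝓗.lft.tLin ∘ₗ 𝓗.lft.ε)) (fun x y => ?_) X
    change 𝓗.lft.tm M x (M.act (hc.mulS (𝓗.lft.Δ y)) W) =
      𝓗.lft.tm M (𝓗.lft.t (op (𝓗.lft.ε y)) * x) W
    rw [mulS_Δ, 𝓗.lft.tm_bal]

/-- On `h₁ ⊗ h₂ ⊗ m` the operator gives `h₁ · (1 ⊗ S(h₂) · (m ⊗ 1))`, and the antipode cancels by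
`actS_Δ`: the first coface is rotated to the last. -/
theorem cycL_comulTens (hc : 𝓗.IsCommutative) (n : ℕ) (z : (𝓗.lft.C (n + 1)).carrier) :
    hc.cycL (n + 1) ((𝓗.lft.δsucc (n + 1) 0).1 z) = (𝓗.lft.δsucc (n + 1) (n + 1)).1 z := by
  have key : ∀ (h : H) (m : (𝓗.lft.C n).carrier),
      hc.cycL (n + 1) (𝓗.lft.splice (𝓗.lft.C n) (𝓗.lft.Δ h) m) =
        𝓗.lft.tm (𝓗.lft.C (n + 1)) h ((𝓗.lft.δsucc n n).1 m) := by
    intro h m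
    obtain ⟨X, hX⟩ := 𝓗.lft.mkL_surjective (𝓗.lft.Δ h)
    rw [← hX]
    refine Eq.trans ?_ (hc.actS_Δ (𝓗.lft.C (n + 1)) hX ((𝓗.lft.δsucc n n).1 m))
    refine tmul_congr (hc.cycL (n + 1) ∘ₗ (𝓗.lft.splice (𝓗.lft.C n)).flip m ∘ₗ 𝓗.lft.mkL)
      (TensorProduct.lift (actS 𝓗 (𝓗.lft.C (n + 1)) ((𝓗.lft.δsucc n n).1 m))) (fun x y => ?_) X
    exact hc.cycL_tm (n + 1) x (𝓗.lft.tm (𝓗.lft.C n) y m)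
  exact LinearMap.congr_fun (f := hc.cycL (n + 1) ∘ₗ (𝓗.lft.δsucc (n + 1) 0).1)
    (g := (𝓗.lft.δsucc (n + 1) (n + 1)).1) (𝓗.lft.tens_ext key) z

/-- `v ↦ S(v) h · (h₁ ⊗ h₂ ⊗ m)`. -/
def spreadMap (M : LMod k H) (h : H) (m : M.carrier) :
    H →ₗ[k] 𝓗.lft.TensL →ₗ[k] (𝓗.lft.tens (𝓗.lft.tens M)).carrier :=
  (𝓗.lft.mulFst (𝓗.lft.tens M) ∘ₗ (𝓗.lft.splice M).flip m).flip ∘ₗ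
    LinearMap.mulLeft k h ∘ₗ 𝓗.S.toLinearMap

/-- The computation is `h S(h'₁) h'₂ ⊗ h'₃ ⊗ m = h ⊗ h' ⊗ m`. It writes an arbitrary tensor as a sum
of elements `v g₁ ⊗ g₂ ⊗ m`, on which the cyclic operator is easy to evaluate. -/
theorem spreadMap_Δ (hc : 𝓗.IsCommutative) (M : LMod k H) (h : H) (m : M.carrier) {h' : H}
    {X : H ⊗[k] H} (hX : 𝓗.lft.mkL X = 𝓗.lft.Δ h') :
    TensorProduct.lift ((spreadMap M h m).compl₂ 𝓗.lft.Δ) X =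
      𝓗.lft.tm (𝓗.lft.tens M) h (𝓗.lft.tm M h' m) := by
  let p : 𝓗.lft.TensL →ₗ[k] H →ₗ[k] (𝓗.lft.tens (𝓗.lft.tens M)).carrier :=
    ((𝓗.lft.tm (𝓗.lft.tens M)).compl₂ ((𝓗.lft.tm M).flip m)) ∘ₗ
      LinearMap.mulLeft k h ∘ₗ Smul 𝓗
  have key := 𝓗.lft.Δ_coassoc_apply hX p (spreadMap M h m) (by
    intro x y z
    change 𝓗.lft.tm (𝓗.lft.tens M) (h * (𝓗.S x * y)) (𝓗.lft.tm M z m) =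
      𝓗.lft.tm (𝓗.lft.tens M) (h * 𝓗.S x * y) (𝓗.lft.tm M z m)
    rw [mul_assoc])
  refine key.symm.trans ?_
  conv_rhs => rw [← 𝓗.lft.counit_left h' X hX]
  refine tmul_congr (TensorProduct.lift (p ∘ₗ 𝓗.lft.Δ))
    (𝓗.lft.tm (𝓗.lft.tens M) h ∘ₗ (𝓗.lft.tm M).flip m ∘ₗ
      mulMap (𝓗.lft.sLin ∘ₗ 𝓗.lft.ε) LinearMap.id) (fun x y => ?_) X
  change 𝓗.lft.tm (𝓗.lft.tens M) (h * Smul 𝓗 (𝓗.lft.Δ x)) (𝓗.lft.tm M y m) =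
    𝓗.lft.tm (𝓗.lft.tens M) h (𝓗.lft.tm M (𝓗.lft.s (𝓗.lft.ε x) * y) m)
  rw [𝓗.Smul_Δ, ← hc.ε_eq, ← hc.tl_eq, mul_comm, 𝓗.lft.tm_bal, 𝓗.lft.act_s_tm]

/-- `H ⊗_A H ⊗_A M` is spanned by the elements `v h₁ ⊗ h₂ ⊗ m`. -/
theorem mulFst_comulTens_ext (hc : 𝓗.IsCommutative) (M : LMod k H) {P : Type*} [AddCommGroup P]
    [Module k P] {f g : (𝓗.lft.tens (𝓗.lft.tens M)).carrier →ₗ[k] P}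
    (hfg : ∀ v z, f (𝓗.lft.mulFst _ ((𝓗.lft.comulTens M).1 z) v) =
      g (𝓗.lft.mulFst _ ((𝓗.lft.comulTens M).1 z) v)) : f = g := by
  refine 𝓗.lft.tens_ext fun h w => ?_
  refine LinearMap.congr_fun (f := f ∘ₗ 𝓗.lft.tm _ h) (g := g ∘ₗ 𝓗.lft.tm _ h)
    (𝓗.lft.tens_ext fun h' m => ?_) w
  obtain ⟨X, hX⟩ := 𝓗.lft.mkL_surjective (𝓗.lft.Δ h')
  have e := hc.spreadMap_Δ M h m hX
  refine (congrArg f e).symm.trans (Eq.trans ?_ (congrArg g e))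
  refine tmul_congr (f ∘ₗ TensorProduct.lift ((spreadMap M h m).compl₂ 𝓗.lft.Δ))
    (g ∘ₗ TensorProduct.lift ((spreadMap M h m).compl₂ 𝓗.lft.Δ)) (fun x y => ?_) X
  exact hfg (h * 𝓗.S x) (𝓗.lft.tm M y m)

end IsCommutative
end HopfAlgebroid
end HopfAlgd


namespace HopfAlgd

/-! ### Commutative case: coface relations and the order of the cyclic operator. -/

namespace HopfAlgebroid

variable {k : Type v} [CommRing k] {A H : Type u} [CommRing A] [Algebra k A] [CommRing H]
  [Algebra k H] {𝓗 : HopfAlgebroid k A A H}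

namespace IsCommutative

variable (𝓗) in
/-- Multiplication on the first factor of `C^(n+1)`. -/
def mulC (n : ℕ) : (𝓗.lft.C (n + 1)).carrier →ₗ[k] H →ₗ[k] (𝓗.lft.C (n + 1)).carrier :=
  𝓗.lft.mulFst (𝓗.lft.C n)

theorem δsucc_mulC (n i : ℕ) (w : (𝓗.lft.C (n + 1)).carrier) (v : H) :
    (𝓗.lft.δsucc (n + 1) (i + 1)).1 (mulC 𝓗 n w v) =
      mulC 𝓗 (n + 1) ((𝓗.lft.δsucc (n + 1) (i + 1)).1 w) v :=
  𝓗.lft.idTens_mulFst (𝓗.lft.δsucc n i) w v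

theorem act_mulC (n : ℕ) (h : H) (w : (𝓗.lft.C (n + 1)).carrier) (v : H) :
    (𝓗.lft.C (n + 1)).act h (mulC 𝓗 n w v) = mulC 𝓗 n ((𝓗.lft.C (n + 1)).act h w) v :=
  𝓗.lft.act_mulFst (𝓗.lft.C n) h w v

theorem cycL_mulC (hc : 𝓗.IsCommutative) (n : ℕ) (w : (𝓗.lft.C (n + 1)).carrier) (v : H) :
    hc.cycL n (mulC 𝓗 n w v) = (𝓗.lft.C (n + 1)).act v (hc.cycL n w) :=
  hc.cycL_mulFst n v w

theorem mulC_ext (hc : 𝓗.IsCommutative) (n : ℕ) {P : Type*} [AddCommGroup P]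
    [Module k P] {f g : (𝓗.lft.C (n + 2)).carrier →ₗ[k] P}
    (hfg : ∀ v z, f (mulC 𝓗 (n + 1) ((𝓗.lft.δsucc (n + 1) 0).1 z) v) =
      g (mulC 𝓗 (n + 1) ((𝓗.lft.δsucc (n + 1) 0).1 z) v)) : f = g :=
  hc.mulFst_comulTens_ext (𝓗.lft.C n) hfg

/-- The element `1 ⊗ 1` of `C^1 = H ⊗_A A`. -/
def unitOne (𝓗 : HopfAlgebroid k A A H) : (𝓗.lft.C 1).carrier := 𝓗.lft.tm 𝓗.lft.unit 1 (1 : A)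

theorem act_unitOne (h : H) :
    (𝓗.lft.C 1).act h (unitOne 𝓗) = 𝓗.lft.tm 𝓗.lft.unit h (1 : A) := by
  obtain ⟨X, hX⟩ := 𝓗.lft.mkL_surjective (𝓗.lft.Δ h)
  change 𝓗.lft.preAct 𝓗.lft.unit (𝓗.lft.Δ h) ((1 : H) ⊗ₜ (1 : A)) = _
  conv_rhs => rw [← 𝓗.lft.counit_right h X hX]
  rw [← hX]
  refine tmul_congr
    ((𝓗.lft.preAct 𝓗.lft.unit).flip ((1 : H) ⊗ₜ[k] (1 : A)) ∘ₗ 𝓗.lft.mkL)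
    ((𝓗.lft.tm 𝓗.lft.unit).flip (1 : A) ∘ₗ
      mulOpMap LinearMap.id (𝓗.lft.tLin ∘ₗ 𝓗.lft.ε)) (fun x y => ?_) X
  have e : 𝓗.lft.ε (y * 𝓗.lft.s 1) = 𝓗.lft.ε (𝓗.lft.s (𝓗.lft.ε y) * 𝓗.lft.s 1) := by
    rw [map_one, mul_one, mul_one, 𝓗.lft.ε_s_one]
  change 𝓗.lft.tm 𝓗.lft.unit (x * 1) (𝓗.lft.ε (y * 𝓗.lft.s 1) : A) =
    𝓗.lft.tm 𝓗.lft.unit (𝓗.lft.t (op (𝓗.lft.ε y)) * x) (1 : A)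
  rw [mul_one, e]
  exact (𝓗.lft.tm_bal 𝓗.lft.unit (𝓗.lft.ε y) x (1 : A)).symm

/-- Since `S(s(a)) = t(a)`, the operator `τ_1` carries the coface `a ↦ s(a)` to the coface `a ↦
t(a)`, which is `1 ⊗ a`. -/
theorem τ_sUnit (hc : 𝓗.IsCommutative) (a : (𝓗.lft.C 0).carrier) :
    𝓗.τ 1 ((𝓗.lft.δsucc 0 0).1 a) = 𝓗.lft.δzero 0 a := by
  have key : ∀ a : A, (𝓗.lft.C 1).act (𝓗.S (𝓗.lft.s a)) (𝓗.lft.tm 𝓗.lft.unit (𝓗.lft.s 1) (1 : A)) =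
      𝓗.lft.tm 𝓗.lft.unit 1 a := by
    intro a
    have h := hc.S_sl_mul a 1
    rw [mul_one, 𝓗.S_one, mul_one] at h
    rw [h, map_one]
    refine (act_unitOne _).trans ?_
    have e := 𝓗.lft.tm_bal 𝓗.lft.unit a 1 (1 : A)
    rw [mul_one] at e
    refine e.trans (congrArg (𝓗.lft.tm 𝓗.lft.unit 1) ?_)
    have e' : 𝓗.lft.ε (𝓗.lft.s a * 𝓗.lft.s 1) = a := by
      rw [map_one, mul_one, 𝓗.lft.ε_s_one]
    exact e'
  exact key a

/-- Above degree zero it is enough to test on `v g₁ ⊗ g₂ ⊗ m`, which the operator sends to `v · (g ⊗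
m ⊗ 1)`. The claim becomes the commutation of a coface with the last one, together with
`H`-linearity of the cofaces before the last. -/
theorem cycL_δsucc (hc : 𝓗.IsCommutative) : ∀ n i : ℕ, i ≤ n → ∀ x : (𝓗.lft.C (n + 1)).carrier,
    hc.cycL (n + 1) ((𝓗.lft.δsucc (n + 1) (i + 1)).1 x) =
      (𝓗.lft.δsucc (n + 1) i).1 (hc.cycL n x)
  | 0, 0, _, x => by
    have key : ∀ (h : H) (a : (𝓗.lft.C 0).carrier),
        hc.cycL 1 (𝓗.lft.tm (𝓗.lft.C 1) h ((𝓗.lft.δsucc 0 0).1 a)) =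
          (𝓗.lft.δsucc 1 0).1 (hc.cycL 0 (𝓗.lft.tm (𝓗.lft.C 0) h a)) := by
      intro h a
      rw [cycL_tm, cycL_tm, hc.τ_sUnit]
      exact (congrArg ((𝓗.lft.C 2).act h) (𝓗.lft.δsucc_zero_δzero 0 a)).symm.trans
        (𝓗.lft.isHLin_δsucc 1 0 (by omega) h _).symm
    exact LinearMap.congr_fun (f := hc.cycL 1 ∘ₗ (𝓗.lft.δsucc 1 1).1)
      (g := (𝓗.lft.δsucc 1 0).1 ∘ₗ hc.cycL 0) (𝓗.lft.tens_ext key) x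
  | n + 1, i, hi, x => by
    refine LinearMap.congr_fun (f := hc.cycL (n + 2) ∘ₗ (𝓗.lft.δsucc (n + 2) (i + 1)).1)
      (g := (𝓗.lft.δsucc (n + 2) i).1 ∘ₗ hc.cycL (n + 1)) (hc.mulC_ext n fun v z => ?_) x
    change hc.cycL (n + 2) ((𝓗.lft.δsucc (n + 2) (i + 1)).1 (mulC 𝓗 (n + 1) _ v)) =
      (𝓗.lft.δsucc (n + 2) i).1 (hc.cycL (n + 1) (mulC 𝓗 (n + 1) _ v))
    rw [δsucc_mulC, cycL_mulC, cycL_mulC]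
    have h1 : (𝓗.lft.δsucc (n + 2) (i + 1)).1 ((𝓗.lft.δsucc (n + 1) 0).1 z) =
        (𝓗.lft.δsucc (n + 2) 0).1 ((𝓗.lft.δsucc (n + 1) i).1 z) :=
      (𝓗.lft.comulTens_δsucc n i z).symm
    rw [h1, cycL_comulTens, cycL_comulTens]
    refine Eq.trans ?_ (𝓗.lft.isHLin_δsucc (n + 2) i (by omega) v _).symm
    exact congrArg _ (𝓗.lft.δsucc_δsucc_last (n + 1) i hi z).symm

/-- The element `v₀ (h₁ ⊗ h₂ ⊗ ⋯)` of `C^(n+1)` built from `v₀, …, v_n` by iterated comultiplication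
and multiplication. -/
def spread (𝓗 : HopfAlgebroid k A A H) : ∀ n : ℕ, (ℕ → H) → (𝓗.lft.C (n + 1)).carrier
  | 0, v => 𝓗.lft.tm 𝓗.lft.unit (v 0) (1 : A)
  | n + 1, v => mulC 𝓗 (n + 1) ((𝓗.lft.δsucc (n + 1) 0).1 (spread 𝓗 n fun i => v (i + 1))) (v 0)

theorem spread_congr : ∀ (n : ℕ) {v w : ℕ → H}, (∀ i ≤ n, v i = w i) → spread 𝓗 n v = spread 𝓗 n w
  | 0, v, w, h => by rw [spread, spread, h 0 le_rfl]
  | n + 1, v, w, h => by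
    rw [spread, spread, h 0 (Nat.zero_le _),
      spread_congr n (v := fun i => v (i + 1)) (w := fun i => w (i + 1))
        fun i hi => h (i + 1) (by omega)]

theorem spread_ext (hc : 𝓗.IsCommutative) : ∀ (n : ℕ) {P : Type u} [AddCommGroup P]
    [Module k P] {f g : (𝓗.lft.C (n + 1)).carrier →ₗ[k] P},
    (∀ v, f (spread 𝓗 n v) = g (spread 𝓗 n v)) → f = g
  | 0, P, _, _, f, g, h => by
    refine 𝓗.lft.tens_ext (M := 𝓗.lft.unit) fun x a => ?_
    have e : ∀ a : A, 𝓗.lft.tm 𝓗.lft.unit x a =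
        𝓗.lft.tm 𝓗.lft.unit (𝓗.lft.t (op a) * x) (1 : A) := by
      intro a
      refine Eq.trans ?_ (𝓗.lft.tm_bal 𝓗.lft.unit a x (1 : A)).symm
      refine congrArg (𝓗.lft.tm 𝓗.lft.unit x) ?_
      have e' : 𝓗.lft.ε (𝓗.lft.s a * 𝓗.lft.s 1) = a := by
        rw [map_one, mul_one, 𝓗.lft.ε_s_one]
      exact e'.symm
    exact (congrArg f (e a)).trans ((h fun _ => 𝓗.lft.t (op (show A from a)) * x).trans
      (congrArg g (e a)).symm)
  | n + 1, P, _, _, f, g, h => by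
    refine hc.mulC_ext n fun v z => ?_
    refine LinearMap.congr_fun
      (f := f ∘ₗ (mulC 𝓗 (n + 1)).flip v ∘ₗ (𝓗.lft.δsucc (n + 1) 0).1)
      (g := g ∘ₗ (mulC 𝓗 (n + 1)).flip v ∘ₗ (𝓗.lft.δsucc (n + 1) 0).1)
      (spread_ext hc n fun w => ?_) z
    exact h fun i => Nat.casesOn i v w

/-- The action commutes with the outer multiplications and comultiplications, so it reaches the
innermost place, where it turns the appended `1` into the new entry. -/
theorem act_δsucc_last_spread : ∀ (n : ℕ) (v : ℕ → H),
    (𝓗.lft.C (n + 2)).act (v (n + 1)) ((𝓗.lft.δsucc (n + 1) (n + 1)).1 (spread 𝓗 n v)) =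
      spread 𝓗 (n + 1) v
  | 0, v => by
    have e : (𝓗.lft.δsucc 1 1).1 (spread 𝓗 0 v) =
        mulC 𝓗 1 ((𝓗.lft.δsucc 1 0).1 (unitOne 𝓗)) (v 0) := by
      have e1 : (𝓗.lft.δsucc 1 0).1 (unitOne 𝓗) = 𝓗.lft.tm (𝓗.lft.C 1) 1 (unitOne 𝓗) :=
        𝓗.lft.δsucc_zero_δzero 0 (1 : A)
      have e2 : 𝓗.lft.tm 𝓗.lft.unit (𝓗.lft.s (1 : A)) (1 : A) = unitOne 𝓗 := by
        rw [map_one]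
        rfl
      rw [e1]
      refine (congrArg (𝓗.lft.tm (𝓗.lft.C 1) (v 0)) e2).trans ?_
      exact congrArg (fun c => 𝓗.lft.tm (𝓗.lft.C 1) c (unitOne 𝓗)) (mul_one (v 0)).symm
    rw [e, act_mulC, spread]
    refine congrArg (fun y => mulC 𝓗 1 y (v 0)) ?_
    refine (𝓗.lft.isHLin_δsucc 1 0 (by omega) (v 1) _).symm.trans (congrArg _ ?_)
    exact act_unitOne (v 1)
  | n + 1, v => by
    rw [spread, δsucc_mulC, act_mulC, spread]
    refine congrArg (fun y => mulC 𝓗 (n + 2) y (v 0)) ?_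
    have h1 : (𝓗.lft.δsucc (n + 2) (n + 2)).1
        ((𝓗.lft.δsucc (n + 1) 0).1 (spread 𝓗 n fun i => v (i + 1))) =
        (𝓗.lft.δsucc (n + 2) 0).1
          ((𝓗.lft.δsucc (n + 1) (n + 1)).1 (spread 𝓗 n fun i => v (i + 1))) :=
      (𝓗.lft.comulTens_δsucc n (n + 1) _).symm
    rw [h1]
    refine (𝓗.lft.isHLin_δsucc (n + 2) 0 (by omega) (v (n + 2)) _).symm.trans (congrArg _ ?_)
    exact act_δsucc_last_spread n fun i => v (i + 1)

/-- The outermost multiplication by `v 0` becomes the diagonal action and the outermost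
comultiplication becomes the appending of `1`. Together they reinsert `v 0` at the innermost place:
a rotation. -/
theorem cycL_spread (hc : 𝓗.IsCommutative) (n : ℕ) (v : ℕ → H) (hv : v (n + 1) = v 0) :
    hc.cycL n (spread 𝓗 n v) = spread 𝓗 n fun i => v (i + 1) := by
  cases n with
  | zero =>
    refine (hc.cycL_tm 0 (v 0) (1 : A)).trans ((act_unitOne (v 0)).trans ?_)
    rw [spread, hv]
  | succ n =>
    rw [spread, cycL_mulC, cycL_comulTens, ← act_δsucc_last_spread, hv]

theorem cycL_iterate (hc : 𝓗.IsCommutative) (n : ℕ) (x : (𝓗.lft.C (n + 1)).carrier) :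
    (hc.cycL n)^[n + 1] x = x := by
  have h1 : ∀ (j : ℕ) (v : ℕ → H), (∀ i, v (i + (n + 1)) = v i) →
      (hc.cycL n)^[j] (spread 𝓗 n v) = spread 𝓗 n fun i => v (i + j) := by
    intro j
    induction j with
    | zero => intro v _; rfl
    | succ j ih =>
      intro v hv
      rw [Function.iterate_succ_apply, hc.cycL_spread n v (by simpa using hv 0),
        ih (fun i => v (i + 1)) fun i => by
          have := hv (i + 1)
          rwa [add_right_comm] at this]
      exact spread_congr n fun i _ => congrArg v (by omega)
  have h2 : hc.cycL n ^ (n + 1) = 1 := by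
    refine hc.spread_ext n fun v => ?_
    -- Only the entries up to `n` matter, so `v` may be made periodic; rotation then shifts the
    -- sequence, and `n + 1` shifts are the identity.
    have e : spread 𝓗 n v = spread 𝓗 n fun i => v (i % (n + 1)) :=
      spread_congr n fun i hi => by rw [Nat.mod_eq_of_lt (by omega)]
    rw [e, Module.End.pow_apply, h1 _ _ fun i => by simp]
    simp
  rw [← Module.End.pow_apply, h2]
  rfl

end IsCommutative
end HopfAlgebroid
end HopfAlgd


namespace HopfAlgd

/-! ### Commutative case: the signed cyclic structure and the decomposition. -/

namespace HopfAlgebroid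

variable {k : Type v} [CommRing k] {A H : Type u} [CommRing A] [Algebra k A] [CommRing H]
  [Algebra k H] {𝓗 : HopfAlgebroid k A A H}

namespace IsCommutative

open CategoryTheory LeftBialgebroid

variable (𝓗) in
/-- The signed cofaces, without `δ_0`, on the cofree comodules `H ⊗_A C^n`. -/
def coD (n i : ℕ) : 𝓗.lft.colin (𝓗.lft.C n) (𝓗.lft.C (n + 1)) :=
  ⟨(-1 : k) ^ i • (𝓗.lft.δsucc (n + 1) i).1,
    Submodule.smul_mem _ _ (𝓗.lft.δsucc_mem_colin n i)⟩

/-- The signed cyclic operators. -/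
def coL (hc : 𝓗.IsCommutative) (n : ℕ) : 𝓗.lft.colin (𝓗.lft.C n) (𝓗.lft.C n) :=
  ⟨(-1 : k) ^ n • hc.cycL n, Submodule.smul_mem _ _ (hc.cyc n).2⟩

/-- The extra codegeneracies. -/
def coS (hc : 𝓗.IsCommutative) (n : ℕ) : 𝓗.lft.colin (𝓗.lft.C (n + 1)) (𝓗.lft.C n) :=
  ⟨(𝓗.lft.σ (n + 1) (n + 1)).1 ∘ₗ hc.cycL (n + 1),
    comp_mem_colin ⟨_, 𝓗.lft.idTens_mem_colin (𝓗.lft.σ n n)⟩ (hc.cyc (n + 1))⟩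

theorem neg_one_pow_smul_iterate {M : Type*} [AddCommGroup M] [Module k M] (T : Module.End k M)
    (n j : ℕ) (x : M) : ((-1 : k) ^ n • T)^[j] x = (-1 : k) ^ (n * j) • T^[j] x := by
  rw [← Module.End.pow_apply, smul_pow, ← pow_mul, LinearMap.smul_apply, Module.End.pow_apply]

/-- The cyclic structure on the cofree comodules `H ⊗_A C^n`. -/
def signedCyclic (hc : 𝓗.IsCommutative) :
    SignedCyclic (fun n => (⟨n⟩ : 𝓗.lft.CoDeg)) where
  d n i := coHom (coD 𝓗 n i)
  l n := coHom (hc.coL n)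
  s n := coHom (hc.coS n)
  l_d_zero n := coFun_ext fun x => by
    have h := hc.cycL_comulTens n x
    change (-1 : k) ^ (n + 1) • hc.cycL (n + 1)
      ((-1 : k) ^ 0 • (𝓗.lft.δsucc (n + 1) 0).1 x) =
      (-1 : k) ^ (n + 1) • (𝓗.lft.δsucc (n + 1) (n + 1)).1 x
    rw [pow_zero, one_smul, h]
  l_d_succ n i hi := coFun_ext fun x => by
    have h := hc.cycL_δsucc n i hi x
    change (-1 : k) ^ (n + 1) • hc.cycL (n + 1)
      ((-1 : k) ^ (i + 1) • (𝓗.lft.δsucc (n + 1) (i + 1)).1 x) =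
      (-1 : k) ^ i • (𝓗.lft.δsucc (n + 1) i).1 ((-1 : k) ^ n • hc.cycL n x)
    rw [map_smul, h]
    refine Eq.trans ?_ (congrArg _ (map_smul (𝓗.lft.δsucc (n + 1) i).1 _ _).symm)
    rw [smul_smul, smul_smul]
    congr 1
    ring
  l_pow n := coFun_ext fun x => by
    refine (coFun_pow _ (n + 1) x).trans ?_
    change ((-1 : k) ^ n • hc.cycL n)^[n + 1] x = x
    -- The accumulated sign is `(-1)^(n(n+1)) = 1`.
    rw [neg_one_pow_smul_iterate, hc.cycL_iterate, (Nat.even_mul_succ_self n).neg_one_pow, one_smul]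
  s_d_zero n := coFun_ext fun x => by
    change (𝓗.lft.σ (n + 1) (n + 1)).1 (hc.cycL (n + 1)
      ((-1 : k) ^ 0 • (𝓗.lft.δsucc (n + 1) 0).1 x)) = x
    rw [pow_zero, one_smul, hc.cycL_comulTens, 𝓗.lft.σ_δsucc_last]
  s_d_succ n i hi := coFun_ext fun x => by
    have h := hc.cycL_δsucc (n + 1) i (by omega) x
    have h' := 𝓗.lft.σ_last_δsucc (n + 1) i (by omega) (hc.cycL (n + 1) x)
    change (𝓗.lft.σ (n + 2) (n + 2)).1 (hc.cycL (n + 2)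
      ((-1 : k) ^ (i + 1) • (𝓗.lft.δsucc (n + 2) (i + 1)).1 x)) =
      -((-1 : k) ^ i • (𝓗.lft.δsucc (n + 1) i).1
        ((𝓗.lft.σ (n + 1) (n + 1)).1 (hc.cycL (n + 1) x)))
    rw [map_smul, h, ← h']
    refine (map_smul (𝓗.lft.σ (n + 2) (n + 2)).1 _ _).trans ?_
    rw [pow_succ, mul_neg_one, neg_smul]

theorem coFun_b (hc : 𝓗.IsCommutative) (n : ℕ) (x : (𝓗.lft.C (n + 1)).carrier) :
    𝓗.lft.coFun (hc.signedCyclic.b n) x = 𝓗.lft.altδ (n + 1) x := by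
  rw [altδ_apply]
  refine (LinearMap.congr_fun (coFun_sum _ _) x).trans ?_
  exact LinearMap.sum_apply _ _ _

theorem σ_last_δzero (n : ℕ) (x : (𝓗.lft.C (n + 1)).carrier) :
    (𝓗.lft.σ (n + 1) (n + 1)).1 (𝓗.lft.δzero (n + 1) x) =
      𝓗.lft.δzero n ((𝓗.lft.σ n n).1 x) := rfl

theorem signed_cycL_δzero (hc : 𝓗.IsCommutative) (n : ℕ) (x : (𝓗.lft.C n).carrier) :
    ((-1 : k) ^ n • hc.cycL n) (𝓗.lft.δzero n x) = 𝓗.lft.δzero n (𝓗.signedτ n x) := by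
  rw [signedτ, LinearMap.smul_apply, LinearMap.smul_apply, map_smul, hc.cycL_δzero]

theorem signed_cycL_iterate_δzero (hc : 𝓗.IsCommutative) (n j : ℕ) (x : (𝓗.lft.C n).carrier) :
    ((-1 : k) ^ n • hc.cycL n)^[j] (𝓗.lft.δzero n x) =
      𝓗.lft.δzero n ((𝓗.signedτ n ^ j) x) := by
  induction j generalizing x with
  | zero => rfl
  | succ j ih =>
    rw [Function.iterate_succ_apply, signed_cycL_δzero, ih, pow_succ]
    rfl

/-- Norm, extra codegeneracy and `1 - λ` each restrict along `x ↦ 1 ⊗ x` to their counterparts on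
`C^n`. Reversal of arrows accounts for the order of the factors. -/
theorem coFun_B (hc : 𝓗.IsCommutative) (n : ℕ) (x : (𝓗.lft.C (n + 1)).carrier) :
    𝓗.lft.coFun (hc.signedCyclic.B n) (𝓗.lft.δzero (n + 1) x) =
      𝓗.lft.δzero n (𝓗.coB n x) := by
  have h1 : ∀ y : (𝓗.lft.C n).carrier, 𝓗.lft.coFun (hc.signedCyclic.norm n) (𝓗.lft.δzero n y) =
      𝓗.lft.δzero n ((∑ j ∈ Finset.range (n + 1), 𝓗.signedτ n ^ j) y) := by
    intro y
    rw [LinearMap.sum_apply, map_sum]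
    refine (LinearMap.congr_fun (coFun_sum _ _) _).trans ((LinearMap.sum_apply _ _ _).trans ?_)
    refine Finset.sum_congr rfl fun j _ => ?_
    exact (coFun_pow _ j _).trans (hc.signed_cycL_iterate_δzero n j y)
  have h2 : 𝓗.lft.δzero (n + 1) x - ((-1 : k) ^ (n + 1) • hc.cycL (n + 1)) (𝓗.lft.δzero (n + 1) x) =
      𝓗.lft.δzero (n + 1) (x - 𝓗.signedτ (n + 1) x) := by
    rw [signed_cycL_δzero, map_sub]
  have h3 : ∀ y, (𝓗.lft.σ (n + 1) (n + 1)).1 (hc.cycL (n + 1) (𝓗.lft.δzero (n + 1) y)) =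
      𝓗.lft.δzero n ((𝓗.lft.σ n n).1 (𝓗.τ (n + 1) y)) := by
    intro y
    rw [hc.cycL_δzero, σ_last_δzero]
  refine Eq.trans ?_ (h1 _)
  refine congrArg (𝓗.lft.coFun (hc.signedCyclic.norm n)) ?_
  exact (congrArg (fun y => (𝓗.lft.σ (n + 1) (n + 1)).1 (hc.cycL (n + 1) y)) h2).trans (h3 _)

/-- For a commutative Hopf algebroid cyclic cohomology is a sum of Hochschild cohomologies. -/
noncomputable def equiv (hc : 𝓗.IsCommutative) (n : ℕ) :
    𝓗.HCco n ≃ₗ[k] ⨁ i : Fin (n / 2 + 1), 𝓗.HHco (n - 2 * i) :=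
  (𝓗.lft.cochainSplit hc.signedCyclic hc.coFun_b 𝓗.coB hc.coFun_B).equiv n

end IsCommutative
end HopfAlgebroid
end HopfAlgd


namespace HopfAlgd

/-! ### The Galois map, and the antipode as an anti-homomorphism. -/

namespace HopfAlgebroid

variable {k : Type v} [CommRing k] {Al Ar H : Type u} [Ring Al] [Algebra k Al] [Ring Ar]
  [Algebra k Ar] [Ring H] [Algebra k H] (𝓗 : HopfAlgebroid k Al Ar H)

/-- `x ⊗ y ↦ x S(y)` on `H ⊗_{A_r} H`. -/
def mulS : 𝓗.rgt.TensR →ₗ[k] H :=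
  balLift _ _ (mulMap LinearMap.id 𝓗.S.toLinearMap) (by
    intro a x y
    simp only [STRing.sR_apply, STRing.tR_apply, mulMap_tmul, LinearMap.id_apply,
      LinearEquiv.coe_coe, S_mul_tr, mul_assoc])

theorem mulS_Δ (h : H) : 𝓗.mulS (𝓗.rgt.Δ h) = 𝓗.lft.s (𝓗.lft.ε h) := by
  obtain ⟨X, hX⟩ := 𝓗.rgt.mkR_surjective (𝓗.rgt.Δ h)
  rw [← 𝓗.antipode_right h X hX, ← hX]
  rfl

theorem Δr_sr_mul (a : Ar) (h : H) (X : H ⊗[k] H) (hX : 𝓗.rgt.mkR X = 𝓗.rgt.Δ h) :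
    𝓗.rgt.Δ (𝓗.rgt.s a * h) = 𝓗.rgt.mkR ((1 ⊗ₜ 𝓗.rgt.s a) * X) := by
  refine 𝓗.rgt.Δ_mul _ _ _ _ ?_ hX
  have := 𝓗.rgt.Δ_s a 1 (1 ⊗ₜ 1) 𝓗.rgt.Δ_one.symm
  simpa using this.symm

/-- As `s_r(a)` lies in the image of `t_l`, its left coproduct is `1 ⊗ s_r(a)`, so only the second
factor is affected. -/
theorem act_sr_tm (N : LMod k H) (a : Ar) (z : H) (m : N.carrier) :
    (𝓗.lft.tens N).act (𝓗.rgt.s a) (𝓗.lft.tm N z m) = 𝓗.lft.tm N z (N.act (𝓗.rgt.s a) m) := by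
  have h := 𝓗.Δ_sr_mul a 1 (1 ⊗ₜ 1) 𝓗.lft.Δ_one.symm
  rw [mul_one, Algebra.TensorProduct.tmul_mul_tmul, mul_one, mul_one] at h
  rw [LeftBialgebroid.act_tm, h, LeftBialgebroid.preAct_mk', one_mul]

/-- Restriction along `s_r : A_r → H`. -/
def res (N : LMod k H) : LMod k Ar where
  carrier := N.carrier
  act := N.act.comp 𝓗.rgt.s

/-- The class `h ⊗ m` in `H ⊗_{A_r} N`. -/
def rem (N : LMod k H) : H →ₗ[k] N.carrier →ₗ[k] (𝓗.rgt.ext (𝓗.res N)).carrier :=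
  𝓗.rgt.em (𝓗.res N)

theorem rem_bal (N : LMod k H) (a : Ar) (h : H) (m : N.carrier) :
    𝓗.rem N (h * 𝓗.rgt.s a) m = 𝓗.rem N h (N.act (𝓗.rgt.s a) m) :=
  𝓗.rgt.em_bal (𝓗.res N) a h m

theorem act_tm_one_bal (N : LMod k H) (a : Ar) (h : H) (m : (𝓗.res N).carrier) :
    (𝓗.lft.tens N).act.toLinearMap.compl₂ (𝓗.lft.tm N 1) (h * 𝓗.rgt.s a) m =
      (𝓗.lft.tens N).act.toLinearMap.compl₂ (𝓗.lft.tm N 1) h ((𝓗.res N).act a m) := by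
  have e : ∀ m : N.carrier, (𝓗.lft.tens N).act (h * 𝓗.rgt.s a) (𝓗.lft.tm N 1 m) =
      (𝓗.lft.tens N).act h (𝓗.lft.tm N 1 (N.act (𝓗.rgt.s a) m)) := by
    intro m
    rw [map_mul (𝓗.lft.tens N).act, Module.End.mul_apply, act_sr_tm]
  exact e m

/-- The Galois map `h ⊗ m ↦ h₁ ⊗ h₂ m` from `H ⊗_{A_r} N` to `H ⊗_{A_l} N`. -/
def gal (N : LMod k H) : (𝓗.rgt.ext (𝓗.res N)).carrier →ₗ[k] (𝓗.lft.tens N).carrier :=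
  𝓗.rgt.elift (M := 𝓗.res N) ((𝓗.lft.tens N).act.toLinearMap.compl₂ (𝓗.lft.tm N 1))
    (𝓗.act_tm_one_bal N)

theorem gal_em (N : LMod k H) (h : H) (m : N.carrier) :
    𝓗.gal N (𝓗.rem N h m) = (𝓗.lft.tens N).act h (𝓗.lft.tm N 1 m) :=
  𝓗.rgt.elift_em (M := 𝓗.res N)
    ((𝓗.lft.tens N).act.toLinearMap.compl₂ (𝓗.lft.tm N 1)) (𝓗.act_tm_one_bal N) h m

theorem gal_lm (N : LMod k H) (g : H) (y : (𝓗.rgt.ext (𝓗.res N)).carrier) :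
    𝓗.gal N (𝓗.rgt.lm (𝓗.res N) g y) = (𝓗.lft.tens N).act g (𝓗.gal N y) := by
  have e : ∀ (h : H) (m : N.carrier),
      𝓗.gal N (𝓗.rem N (g * h) m) = (𝓗.lft.tens N).act g (𝓗.gal N (𝓗.rem N h m)) := by
    intro h m
    rw [gal_em, gal_em, map_mul (𝓗.lft.tens N).act, Module.End.mul_apply]
  exact LinearMap.congr_fun (f := 𝓗.gal N ∘ₗ 𝓗.rgt.lm (𝓗.res N) g)
    (g := (𝓗.lft.tens N).act g ∘ₗ 𝓗.gal N) (STRing.ext_ext _ e) y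

/-- `x ⊗ y ↦ (m ↦ x ⊗ S(y) m)`. -/
def spliceS (N : LMod k H) :
    𝓗.rgt.TensR →ₗ[k] N.carrier →ₗ[k] (𝓗.rgt.ext (𝓗.res N)).carrier :=
  balLift 𝓗.rgt.sR 𝓗.rgt.tR
    (TensorProduct.lift (LinearMap.mk₂ k
      (fun x y => 𝓗.rem N x ∘ₗ N.act (𝓗.S y))
      (by intro x x' y; ext; simp) (by intro c x y; ext; simp)
      (by
        intro x y y'
        rw [map_add, map_add]
        exact LinearMap.comp_add (N.act (𝓗.S y)) (N.act (𝓗.S y')) (𝓗.rem N x))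
      (by
        intro c x y
        rw [map_smul, map_smul]
        exact LinearMap.comp_smul (𝓗.rem N x) c (N.act (𝓗.S y)))))
    (by
      intro a x y
      refine LinearMap.ext fun m => ?_
      have h : N.act (𝓗.S (y * 𝓗.rgt.t (op a))) m = N.act (𝓗.rgt.s a) (N.act (𝓗.S y) m) := by
        rw [S_mul_tr, map_mul]
        rfl
      exact (𝓗.rem_bal N a x (N.act (𝓗.S y) m)).trans
        (congrArg (𝓗.rem N x) h).symm)

/-- The inverse `h ⊗ m ↦ h^(1) ⊗ S(h^(2)) m` of the Galois map. -/
def galInv (N : LMod k H) : (𝓗.lft.tens N).carrier →ₗ[k] (𝓗.rgt.ext (𝓗.res N)).carrier :=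
  𝓗.lft.tlift (𝓗.spliceS N ∘ₗ 𝓗.rgt.Δ) (by
    intro a h m
    obtain ⟨X, hX⟩ := 𝓗.rgt.mkR_surjective (𝓗.rgt.Δ h)
    have e := 𝓗.Δr_sr_mul (𝓗.rgt.ε (𝓗.lft.t (op a))) h X hX
    rw [𝓗.srεr_tl] at e
    rw [LinearMap.comp_apply, LinearMap.comp_apply, e, ← hX]
    refine tmul_congr ((𝓗.spliceS N).flip m ∘ₗ 𝓗.rgt.mkR ∘ₗ
        LinearMap.mulLeft k (1 ⊗ₜ 𝓗.lft.t (op a)))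
      ((𝓗.spliceS N).flip (N.act (𝓗.lft.s a) m) ∘ₗ 𝓗.rgt.mkR) (fun x y => ?_) X
    refine (congrArg (fun Z => 𝓗.spliceS N (𝓗.rgt.mkR Z) m)
      (Algebra.TensorProduct.tmul_mul_tmul 1 x (𝓗.lft.t (op a)) y)).trans ?_
    change 𝓗.rem N (1 * x) (N.act (𝓗.S (𝓗.lft.t (op a) * y)) m) =
      𝓗.rem N x (N.act (𝓗.S y) (N.act (𝓗.lft.s a) m))
    rw [one_mul, S_tl_mul, map_mul]
    rfl)

theorem galInv_tm (N : LMod k H) (h : H) (m : N.carrier) :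
    𝓗.galInv N (𝓗.lft.tm N h m) = 𝓗.spliceS N (𝓗.rgt.Δ h) m := rfl

/-- Twisted coassociativity rewrites `(h₁)^(1) ⊗ S((h₁)^(2)) h₂ m` as `h^(1) ⊗ S((h^(2))₁) (h^(2))₂
m`. The antipode axiom yields `h^(1) ⊗ s_r(ε_r(h^(2))) m`, and the right counit finishes. -/
theorem galInv_gal (N : LMod k H) (y : (𝓗.rgt.ext (𝓗.res N)).carrier) :
    𝓗.galInv N (𝓗.gal N y) = y := by
  refine LinearMap.congr_fun (f := 𝓗.galInv N ∘ₗ 𝓗.gal N) (g := LinearMap.id)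
    (STRing.ext_ext _ fun h m => ?_) y
  obtain ⟨X, hX⟩ := 𝓗.lft.mkL_surjective (𝓗.lft.Δ h)
  obtain ⟨Y, hY⟩ := 𝓗.rgt.mkR_surjective (𝓗.rgt.Δ h)
  let p : 𝓗.rgt.TensR →ₗ[k] H →ₗ[k] (𝓗.rgt.ext (𝓗.res N)).carrier :=
    (𝓗.spliceS N).compl₂ (N.act.toLinearMap.flip m)
  let q : H →ₗ[k] 𝓗.lft.TensL →ₗ[k] (𝓗.rgt.ext (𝓗.res N)).carrier :=
    (𝓗.rem N).compl₂ (N.act.toLinearMap.flip m ∘ₗ Smul 𝓗)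
  have key := triple_apply (𝓗.twisted_rl h X Y hX hY) p q (fun x y z =>
    congrArg (𝓗.rem N x)
      (LinearMap.congr_fun (map_mul N.act (𝓗.S y) z) m).symm)
  change 𝓗.galInv N (𝓗.lft.preAct N (𝓗.lft.Δ h) ((1 : H) ⊗ₜ m)) = 𝓗.rem N h m
  conv_rhs => rw [← 𝓗.rgt.counit_right h Y hY]
  rw [← hX]
  refine Eq.trans ?_ (key.trans ?_)
  · refine tmul_congr (𝓗.galInv N ∘ₗ (𝓗.lft.preAct N).flip ((1 : H) ⊗ₜ m) ∘ₗ 𝓗.lft.mkL)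
      (TensorProduct.lift (p ∘ₗ 𝓗.rgt.Δ)) (fun x y => ?_) X
    change 𝓗.spliceS N (𝓗.rgt.Δ (x * 1)) (N.act y m) = 𝓗.spliceS N (𝓗.rgt.Δ x) (N.act y m)
    rw [mul_one]
  · refine tmul_congr (TensorProduct.lift (q.compl₂ 𝓗.lft.Δ))
      ((𝓗.rem N).flip m ∘ₗ mulMap LinearMap.id (𝓗.rgt.sLin ∘ₗ 𝓗.rgt.ε))
      (fun x y => ?_) Y
    change 𝓗.rem N x (N.act (Smul 𝓗 (𝓗.lft.Δ y)) m) =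
      𝓗.rem N (x * 𝓗.rgt.s (𝓗.rgt.ε y)) m
    rw [Smul_Δ]
    exact (𝓗.rem_bal N (𝓗.rgt.ε y) x m).symm

/-- The mirror computation, with the other twisted coassociativity, the axiom `h^(1) S(h^(2)) =
s_l(ε_l(h))` and the left counit. -/
theorem gal_galInv (N : LMod k H) (y : (𝓗.lft.tens N).carrier) :
    𝓗.gal N (𝓗.galInv N y) = y := by
  refine LinearMap.congr_fun (f := 𝓗.gal N ∘ₗ 𝓗.galInv N) (g := LinearMap.id)
    (𝓗.lft.tens_ext fun h m => ?_) y
  obtain ⟨X, hX⟩ := 𝓗.lft.mkL_surjective (𝓗.lft.Δ h)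
  obtain ⟨Y, hY⟩ := 𝓗.rgt.mkR_surjective (𝓗.rgt.Δ h)
  let p : 𝓗.lft.TensL →ₗ[k] H →ₗ[k] (𝓗.lft.tens N).carrier :=
    (𝓗.lft.preAct N).compl₂ (TensorProduct.mk k H N.carrier 1 ∘ₗ
      N.act.toLinearMap.flip m ∘ₗ 𝓗.S.toLinearMap)
  let q : H →ₗ[k] 𝓗.rgt.TensR →ₗ[k] (𝓗.lft.tens N).carrier :=
    (𝓗.lft.tm N).compl₂ (N.act.toLinearMap.flip m ∘ₗ 𝓗.mulS)
  have key := triple_apply (𝓗.twisted_lr h X Y hX hY) p q (by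
    intro x y z
    change 𝓗.lft.tm N (x * 1) (N.act y (N.act (𝓗.S z) m)) = 𝓗.lft.tm N x (N.act (y * 𝓗.S z) m)
    rw [mul_one, map_mul]
    rfl)
  change 𝓗.gal N (𝓗.spliceS N (𝓗.rgt.Δ h) m) = 𝓗.lft.tm N h m
  conv_rhs => rw [← 𝓗.lft.counit_right h X hX]
  rw [← hY]
  refine Eq.trans ?_ (key.trans ?_)
  · exact tmul_congr (𝓗.gal N ∘ₗ (𝓗.spliceS N).flip m ∘ₗ 𝓗.rgt.mkR)
      (TensorProduct.lift (p ∘ₗ 𝓗.lft.Δ)) (fun x y => rfl) Y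
  · refine tmul_congr (TensorProduct.lift (q.compl₂ 𝓗.rgt.Δ))
      ((𝓗.lft.tm N).flip m ∘ₗ mulOpMap LinearMap.id (𝓗.lft.tLin ∘ₗ 𝓗.lft.ε))
      (fun x y => ?_) X
    change 𝓗.lft.tm N x (N.act (𝓗.mulS (𝓗.rgt.Δ y)) m) =
      𝓗.lft.tm N (𝓗.lft.t (op (𝓗.lft.ε y)) * x) m
    rw [mulS_Δ, 𝓗.lft.tm_bal]

theorem galInv_act (N : LMod k H) (g : H) (w : (𝓗.lft.tens N).carrier) :
    𝓗.galInv N ((𝓗.lft.tens N).act g w) = 𝓗.rgt.lm (𝓗.res N) g (𝓗.galInv N w) := by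
  conv_lhs => rw [← 𝓗.gal_galInv N w, ← gal_lm, galInv_gal]

/-- `h ⊗ m ↦ s_r(ε_r(h)) m`. -/
def counitExt (N : LMod k H) : (𝓗.rgt.ext (𝓗.res N)).carrier →ₗ[k] N.carrier :=
  𝓗.rgt.elift (M := 𝓗.res N) (N.act.toLinearMap ∘ₗ 𝓗.rgt.sLin ∘ₗ 𝓗.rgt.ε) (by
    intro a h m
    change N.act (𝓗.rgt.s (𝓗.rgt.ε (h * 𝓗.rgt.s a))) m =
      N.act (𝓗.rgt.s (𝓗.rgt.ε h)) (N.act (𝓗.rgt.s a) m)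
    rw [𝓗.rgt.ε_s, map_mul, map_mul]
    rfl)

theorem counitExt_lm (N : LMod k H) (g : H) (y : (𝓗.rgt.ext (𝓗.res N)).carrier) :
    𝓗.counitExt N (𝓗.rgt.lm (𝓗.res N) g y) =
      𝓗.counitExt N (𝓗.rgt.lm (𝓗.res N) (𝓗.rgt.s (𝓗.rgt.ε g)) y) := by
  refine LinearMap.congr_fun (f := 𝓗.counitExt N ∘ₗ 𝓗.rgt.lm (𝓗.res N) g)
    (g := 𝓗.counitExt N ∘ₗ 𝓗.rgt.lm (𝓗.res N) (𝓗.rgt.s (𝓗.rgt.ε g)))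
    (STRing.ext_ext _ fun h m => ?_) y
  exact congrArg (fun a => N.act (𝓗.rgt.s a) m) (𝓗.rgt.ε_mul_s g h)

/-- The antipode is the inverse Galois map followed by the right counit; properties of `S` can
therefore be deduced from linearity of the Galois map. -/
theorem counitExt_galInv (N : LMod k H) (h : H) (m : N.carrier) :
    𝓗.counitExt N (𝓗.galInv N (𝓗.lft.tm N h m)) = N.act (𝓗.S h) m := by
  obtain ⟨Y, hY⟩ := 𝓗.rgt.mkR_surjective (𝓗.rgt.Δ h)
  rw [galInv_tm]
  conv_rhs => rw [← 𝓗.rgt.counit_left h Y hY]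
  rw [← hY]
  refine tmul_congr (𝓗.counitExt N ∘ₗ (𝓗.spliceS N).flip m ∘ₗ 𝓗.rgt.mkR)
    (N.act.toLinearMap.flip m ∘ₗ 𝓗.S.toLinearMap ∘ₗ
      mulOpMap (𝓗.rgt.tLin ∘ₗ 𝓗.rgt.ε) LinearMap.id) (fun x y => ?_) Y
  change N.act (𝓗.rgt.s (𝓗.rgt.ε x)) (N.act (𝓗.S y) m) =
    N.act (𝓗.S (y * 𝓗.rgt.t (op (𝓗.rgt.ε x)))) m
  rw [S_mul_tr, map_mul]
  rfl

/-- Apply the inverse Galois map and the counit to `g · (h ⊗ 1)` in the regular module. Expanding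
the diagonal action gives the left side; by linearity and `counitExt_lm`, `g` may be replaced by
`s_r(ε_r(g))`, which gives the right side. -/
theorem S_mul_comul (h g : H) (X : H ⊗[k] H) (hX : 𝓗.lft.mkL X = 𝓗.lft.Δ g) :
    mulMap (𝓗.S.toLinearMap ∘ₗ LinearMap.mulRight k h) LinearMap.id X =
      𝓗.S h * 𝓗.rgt.s (𝓗.rgt.ε g) := by
  have e0 : ∀ (N : LMod k H) (m : N.carrier),
      𝓗.counitExt N (𝓗.galInv N ((𝓗.lft.tens N).act g (𝓗.lft.tm N h m))) =
        N.act (𝓗.S h) (N.act (𝓗.rgt.s (𝓗.rgt.ε g)) m) := by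
    intro N m
    rw [galInv_act, counitExt_lm, ← galInv_act, act_sr_tm, counitExt_galInv]
  let N := LeftBialgebroid.reg k H
  have e1 := e0 N (1 : H)
  have e2 : 𝓗.S h * (𝓗.rgt.s (𝓗.rgt.ε g) * 1) = 𝓗.S h * 𝓗.rgt.s (𝓗.rgt.ε g) := by rw [mul_one]
  refine Eq.trans ?_ (e1.trans e2)
  change _ = 𝓗.counitExt N (𝓗.galInv N (𝓗.lft.preAct N (𝓗.lft.Δ g) (h ⊗ₜ (1 : H))))
  rw [← hX]
  refine tmul_congr (mulMap (𝓗.S.toLinearMap ∘ₗ LinearMap.mulRight k h) LinearMap.id)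
    (𝓗.counitExt N ∘ₗ 𝓗.galInv N ∘ₗ (𝓗.lft.preAct N).flip (h ⊗ₜ (1 : H)) ∘ₗ 𝓗.lft.mkL)
    (fun x y => ?_) X
  refine Eq.trans ?_ (𝓗.counitExt_galInv N (x * h) (y * 1 : H)).symm
  exact congrArg (fun c => 𝓗.S (x * h) * c) (mul_one y).symm

/-- The antipode reverses products. -/
theorem S_mul (g h : H) : 𝓗.S (g * h) = 𝓗.S h * 𝓗.S g := by
  obtain ⟨X, hX⟩ := 𝓗.lft.mkL_surjective (𝓗.lft.Δ g)
  obtain ⟨Y, hY⟩ := 𝓗.rgt.mkR_surjective (𝓗.rgt.Δ g)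
  -- Evaluate `S(x h) y S(z)` on the iterated mixed coproduct of `g`. Merging `x, y` by
  -- `S_mul_comul` leads to `S(h) S(g)`; merging `y, z` by the antipode axiom leads to `S(g h)`.
  have I := 𝓗.twisted_aux
    (tripleMul (𝓗.S.toLinearMap ∘ₗ LinearMap.mulRight k h) 𝓗.S.toLinearMap)
    (by intro a x y z; simp [tripleMul_tmul, S_tl_mul, mul_assoc])
    (by intro a x y z; simp [tripleMul_tmul, S_mul_tr, mul_assoc])
    (LinearMap.mulLeft k (𝓗.S h) ∘ₗ 𝓗.S.toLinearMap ∘ₗ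
      mulOpMap (𝓗.rgt.tLin ∘ₗ 𝓗.rgt.ε) LinearMap.id)
    (𝓗.S.toLinearMap ∘ₗ LinearMap.mulRight k h ∘ₗ
      mulOpMap LinearMap.id (𝓗.lft.tLin ∘ₗ 𝓗.lft.ε))
    (by
      intro x z Z hZ
      rw [tripleMul_assoc, 𝓗.S_mul_comul h x Z hZ]
      simp [S_mul_tr, mul_assoc])
    (by
      intro x y Z hZ
      rw [tripleMul_tmul', 𝓗.antipode_right y Z hZ]
      simp [S_tl_mul, mul_assoc])
    g X Y hX hY
  simp only [LinearMap.comp_apply, 𝓗.lft.counit_right g X hX, 𝓗.rgt.counit_left g Y hY,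
    LinearMap.mulRight_apply, LinearMap.mulLeft_apply, LinearEquiv.coe_coe] at I
  exact I.symm

/-- `ε_r S = ε_r s_l ε_l`. -/
theorem εr_S (h : H) : 𝓗.rgt.ε (𝓗.S h) = 𝓗.rgt.ε (𝓗.lft.s (𝓗.lft.ε h)) := by
  obtain ⟨Y, hY⟩ := 𝓗.rgt.mkR_surjective (𝓗.rgt.Δ h)
  rw [← 𝓗.antipode_right h Y hY]
  conv_lhs => rw [← 𝓗.rgt.counit_left h Y hY]
  refine tmul_congr (𝓗.rgt.ε ∘ₗ 𝓗.S.toLinearMap ∘ₗ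
      mulOpMap (𝓗.rgt.tLin ∘ₗ 𝓗.rgt.ε) LinearMap.id)
    (𝓗.rgt.ε ∘ₗ mulMap LinearMap.id 𝓗.S.toLinearMap) (fun x y => ?_) Y
  change 𝓗.rgt.ε (𝓗.S (y * 𝓗.rgt.t (op (𝓗.rgt.ε x)))) = 𝓗.rgt.ε (x * 𝓗.S y)
  rw [S_mul_tr, ← 𝓗.rgt.ε_mul_s]

end HopfAlgebroid
end HopfAlgd


namespace HopfAlgd

/-! ### Rotation of the factors of `C^n` when source and target coincide. -/

namespace LeftBialgebroid

variable {k : Type v} [CommRing k] {A H : Type u} [Ring A] [Algebra k A] [Ring H] [Algebra k H]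
  (B : LeftBialgebroid k A H)

theorem isHLin_σ : ∀ n i : ℕ, IsHLin (B.σ n i).1
  | n, 0 => by
    rw [σ_zero_eq]
    exact B.isHLin_counitTens (B.C n)
  | 0, _ + 1 => B.isHLin_counitTens (B.C 0)
  | n + 1, i + 1 => B.isHLin_idTens _ (isHLin_σ n i)

/-- The element `1` of `C^0 = A`. -/
def unitOne : B.unit.carrier := (1 : A)

theorem act_s_unitOne (a : A) : B.unit.act (B.s a) B.unitOne = (show B.unit.carrier from a) := by
  have e : B.ε (B.s a * B.s 1) = a := by rw [map_one, mul_one, ε_s_one]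
  exact e

theorem act_unitOne (h : H) : B.unit.act h B.unitOne = (show B.unit.carrier from B.ε h) := by
  have e : B.ε (h * B.s 1) = B.ε h := by rw [map_one, mul_one]
  exact e

theorem tm_unit (h : H) (a : A) : B.tm B.unit h a = B.tm B.unit (B.t (op a) * h) B.unitOne := by
  rw [tm_bal, act_s_unitOne]

theorem act_tm_unitOne (g z : H) :
    (B.tens B.unit).act g (B.tm B.unit z B.unitOne) = B.tm B.unit (g * z) B.unitOne := by
  obtain ⟨X, hX⟩ := B.mkL_surjective (B.Δ g)
  rw [act_tm]
  conv_rhs => rw [← B.counit_right g X hX]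
  rw [← hX]
  refine tmul_congr ((B.preAct B.unit).flip (z ⊗ₜ B.unitOne) ∘ₗ B.mkL)
    ((B.tm B.unit).flip B.unitOne ∘ₗ LinearMap.mulRight k z ∘ₗ
      mulOpMap LinearMap.id (B.tLin ∘ₗ B.ε)) (fun x y => ?_) X
  change B.tm B.unit (x * z) (B.unit.act y B.unitOne) =
    B.tm B.unit (B.t (op (B.ε y)) * x * z) B.unitOne
  rw [act_unitOne, mul_assoc]
  exact B.tm_unit _ _

/-- The maps `x, h ↦ x ⊗ h` appending a factor. -/
def appAux : ∀ n : ℕ, {f : (B.C n).carrier →ₗ[k] H →ₗ[k] (B.C (n + 1)).carrier //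
    ∀ a x h, f ((B.C n).act (B.s a) x) h = (B.C (n + 1)).act (B.s a) (f x h)}
  | 0 => ⟨((LinearMap.mul k H ∘ₗ B.sLin).compr₂ ((B.tm B.unit).flip B.unitOne) :
        A →ₗ[k] H →ₗ[k] (B.tens B.unit).carrier), by
      have key : ∀ (a x : A) (h : H), B.tm B.unit (B.s (B.ε (B.s a * B.s x)) * h) B.unitOne =
          (B.tens B.unit).act (B.s a) (B.tm B.unit (B.s x * h) B.unitOne) := by
        intro a x h
        rw [act_tm_unitOne, B.ε_s, ε_s_one, map_mul B.s, mul_assoc]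
      exact key⟩
  | n + 1 =>
    -- Balancedness at this stage needs `A`-linearity of the previous one, which is why the
    -- recursion carries that property.
    have hb : ∀ (a : A) (h : H) (m : (B.C n).carrier),
        (LinearMap.llcomp k H _ _ ∘ₗ B.tm (B.C (n + 1))).compl₂ (appAux n).1 (B.t (op a) * h) m =
          (LinearMap.llcomp k H _ _ ∘ₗ B.tm (B.C (n + 1))).compl₂ (appAux n).1 h
            ((B.C n).act (B.s a) m) := by
      intro a h m
      refine LinearMap.ext fun v => ?_
      exact (B.tm_bal (B.C (n + 1)) a h ((appAux n).1 m v)).trans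
        (congrArg (B.tm (B.C (n + 1)) h) ((appAux n).2 a m v)).symm
    ⟨B.tlift ((LinearMap.llcomp k H _ _ ∘ₗ B.tm (B.C (n + 1))).compl₂ (appAux n).1) hb, by
      intro a x v
      refine LinearMap.congr_fun
        (f := (B.tlift ((LinearMap.llcomp k H _ _ ∘ₗ B.tm (B.C (n + 1))).compl₂
          (appAux n).1) hb).flip v ∘ₗ (B.tens (B.C n)).act (B.s a))
        (g := (B.tens (B.C (n + 1))).act (B.s a) ∘ₗ
          (B.tlift ((LinearMap.llcomp k H _ _ ∘ₗ B.tm (B.C (n + 1))).compl₂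
            (appAux n).1) hb).flip v) (B.tens_ext fun h m => ?_) x
      refine (congrArg (fun z => (B.tlift ((LinearMap.llcomp k H _ _ ∘ₗ
        B.tm (B.C (n + 1))).compl₂ (appAux n).1) hb).flip v z) (B.act_s_tm (B.C n) a h m)).trans ?_
      exact (B.act_s_tm (B.C (n + 1)) a h ((appAux n).1 m v)).symm⟩

/-- `x, h ↦ x ⊗ h`. -/
def app (n : ℕ) : (B.C n).carrier →ₗ[k] H →ₗ[k] (B.C (n + 1)).carrier := (B.appAux n).1

theorem app_s (n : ℕ) (a : A) (x : (B.C n).carrier) (h : H) :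
    B.app n ((B.C n).act (B.s a) x) h = (B.C (n + 1)).act (B.s a) (B.app n x h) :=
  (B.appAux n).2 a x h

variable {B}

/-- When `s = t`, a base element may travel from the last factor to the first through every tensor
sign. This makes the rotation `h ⊗ x ↦ x ⊗ h` well defined. -/
theorem app_t (hst : ∀ a, B.s a = B.t (op a)) : ∀ (n : ℕ) (a : A) (x : (B.C n).carrier) (h : H),
    B.app n x (B.t (op a) * h) = B.app n ((B.C n).act (B.s a) x) h
  | 0, a, x, h => by
    have key : ∀ x : A, B.tm B.unit (B.s x * (B.t (op a) * h)) B.unitOne =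
        B.tm B.unit (B.s (B.ε (B.s a * B.s x)) * h) B.unitOne := by
      intro x
      rw [B.ε_s, ε_s_one, map_mul B.s, ← mul_assoc, B.comm, ← hst a]
    exact key x
  | n + 1, a, x, h => by
    refine LinearMap.congr_fun (f := (B.app (n + 1)).flip (B.t (op a) * h))
      (g := (B.app (n + 1)).flip h ∘ₗ (B.C (n + 1)).act (B.s a)) (B.tens_ext fun g m => ?_) x
    have e : B.tm (B.C (n + 1)) g (B.app n m (B.t (op a) * h)) =
        B.tm (B.C (n + 1)) (B.s a * g) (B.app n m h) := by
      rw [app_t hst n, app_s, hst a, tm_bal, ← hst a]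
    exact e.trans (congrArg (fun z => B.app (n + 1) z h) (B.act_s_tm (B.C n) a g m)).symm

/-- The rotation `h ⊗ x ↦ x ⊗ h`. -/
def rotC (hst : ∀ a, B.s a = B.t (op a)) (n : ℕ) : Module.End k (B.C (n + 1)).carrier :=
  B.tlift (B.app n).flip fun a h m => app_t hst n a m h

/-- `g' ⊗ g'' ↦ g' x ⊗ g'' h`. -/
def actApp (hst : ∀ a, B.s a = B.t (op a)) (n : ℕ) (x : (B.C n).carrier) (h : H) :
    B.TensL →ₗ[k] (B.C (n + 1)).carrier :=
  balLift _ _ (TensorProduct.lift (((B.app n).compl₂ (LinearMap.mulRight k h)) ∘ₗ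
      (B.C n).act.toLinearMap.flip x)) (by
    intro a y z
    change B.app n ((B.C n).act (B.t (op a) * y) x) (z * h) =
      B.app n ((B.C n).act y x) (B.s a * z * h)
    rw [mul_assoc, hst a, app_t hst, ← hst a, map_mul (B.C n).act]
    rfl)

theorem actApp_mk (hst : ∀ a, B.s a = B.t (op a)) (n : ℕ) (x : (B.C n).carrier) (h y z : H) :
    actApp hst n x h (B.mkL (y ⊗ₜ z)) = B.app n ((B.C n).act y x) (z * h) := rfl

/-- The action was defined by splitting off the first factor; coassociativity, applied factor by
factor, shows that splitting off the last one gives the same, `g₁ x ⊗ g₂ h`. -/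
theorem act_app (hst : ∀ a, B.s a = B.t (op a)) : ∀ (n : ℕ) (x : (B.C n).carrier) (g h : H),
    (B.C (n + 1)).act g (B.app n x h) = actApp hst n x h (B.Δ g)
  | 0, x, g, h => by
    obtain ⟨X, hX⟩ := B.mkL_surjective (B.Δ g)
    have key : ∀ a : A, (B.tens B.unit).act g (B.tm B.unit (B.s a * h) B.unitOne) =
        actApp hst 0 a h (B.Δ g) := by
      intro a
      have e := B.counit_left _ _ (B.Δ_mul g (B.s a) X (B.s a ⊗ₜ 1) hX (B.Δ_sa a).symm).symm
      rw [act_tm_unitOne, ← mul_assoc]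
      conv_lhs => rw [← e]
      rw [← hX]
      refine tmul_congr ((B.tm B.unit).flip B.unitOne ∘ₗ LinearMap.mulRight k h ∘ₗ
        mulMap (B.sLin ∘ₗ B.ε) LinearMap.id ∘ₗ LinearMap.mulRight k (B.s a ⊗ₜ[k] (1 : H)))
        (actApp hst 0 a h ∘ₗ B.mkL) (fun y z => ?_) X
      have e1 : mulMap (B.sLin ∘ₗ B.ε) LinearMap.id
          ((y ⊗ₜ[k] z) * (B.s a ⊗ₜ[k] (1 : H))) * h = B.s (B.ε (y * B.s a)) * (z * h) := by
        rw [Algebra.TensorProduct.tmul_mul_tmul, mul_one, ← mul_assoc]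
        rfl
      exact congrArg (fun c => B.tm B.unit c B.unitOne) e1
    exact key x
  | n + 1, x, g, h => by
    have key : ∀ (z : H) (m : (B.C n).carrier),
        (B.C (n + 2)).act g (B.app (n + 1) (B.tm (B.C n) z m) h) =
          actApp hst (n + 1) (B.tm (B.C n) z m) h (B.Δ g) := by
      intro z m
      obtain ⟨X, hX⟩ := B.mkL_surjective (B.Δ g)
      let p : B.TensL →ₗ[k] H →ₗ[k] (B.C (n + 2)).carrier :=
        ((B.app (n + 1)).compl₂ (LinearMap.mulRight k h)) ∘ₗ (B.preAct (B.C n)).flip (z ⊗ₜ m)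
      let q : H →ₗ[k] B.TensL →ₗ[k] (B.C (n + 2)).carrier :=
        (B.tm (B.C (n + 1)) ∘ₗ LinearMap.mulRight k z).compl₂ (actApp hst n m h)
      have e := B.Δ_coassoc_apply hX p q (fun _ _ _ => rfl)
      refine Eq.trans ?_ (e.symm.trans ?_)
      · change B.preAct (B.C (n + 1)) (B.Δ g) (z ⊗ₜ B.app n m h) = _
        rw [← hX]
        refine tmul_congr ((B.preAct (B.C (n + 1))).flip (z ⊗ₜ B.app n m h) ∘ₗ B.mkL)
          (TensorProduct.lift (q.compl₂ B.Δ)) (fun x y => ?_) X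
        exact congrArg (B.tm (B.C (n + 1)) (x * z)) (act_app hst n m y h)
      · rw [← hX]
        exact tmul_congr (TensorProduct.lift (p ∘ₗ B.Δ))
          (actApp hst (n + 1) (B.tm (B.C n) z m) h ∘ₗ B.mkL) (fun x y => rfl) X
    let F : (B.C (n + 1)).carrier →ₗ[k] (B.C (n + 2)).carrier :=
      { toFun := fun x => actApp hst (n + 1) x h (B.Δ g)
        map_add' := fun x x' => by
          refine B.TensL_ext (f := actApp hst (n + 1) (x + x') h)
            (g := actApp hst (n + 1) x h + actApp hst (n + 1) x' h) (fun y z => ?_) _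
          rw [LinearMap.add_apply, actApp_mk, actApp_mk, actApp_mk, map_add, map_add]
          rfl
        map_smul' := fun c x => by
          refine B.TensL_ext (f := actApp hst (n + 1) (c • x) h)
            (g := c • actApp hst (n + 1) x h) (fun y z => ?_) _
          rw [LinearMap.smul_apply, actApp_mk, actApp_mk, map_smul, map_smul]
          rfl }
    exact LinearMap.congr_fun (f := (B.C (n + 2)).act g ∘ₗ (B.app (n + 1)).flip h)
      (g := F) (B.tens_ext key) x

/-- Rotating before or after the action gives `g₂ m ⊗ g₁ z` or `g₁ m ⊗ g₂ z`; these agree by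
cocommutativity. -/
theorem rotC_act (hst : ∀ a, B.s a = B.t (op a))
    (hcc : ∀ h X, B.mkL X = B.Δ h → B.mkL (TensorProduct.comm k H H X) = B.Δ h)
    (n : ℕ) (g : H) (w : (B.C (n + 1)).carrier) :
    rotC hst n ((B.C (n + 1)).act g w) = (B.C (n + 1)).act g (rotC hst n w) := by
  have key : ∀ (z : H) (m : (B.C n).carrier), rotC hst n (B.preAct (B.C n) (B.Δ g) (z ⊗ₜ m)) =
      (B.C (n + 1)).act g (B.app n m z) := by
    intro z m
    obtain ⟨X, hX⟩ := B.mkL_surjective (B.Δ g)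
    have e := hcc g X hX
    rw [act_app hst]
    refine (congrArg (fun Z => rotC hst n (B.preAct (B.C n) Z (z ⊗ₜ m))) hX).symm.trans
      (Eq.trans ?_ (congrArg (actApp hst n m z) e))
    refine tmul_congr (rotC hst n ∘ₗ (B.preAct (B.C n)).flip (z ⊗ₜ m) ∘ₗ B.mkL)
      (actApp hst n m z ∘ₗ B.mkL ∘ₗ (TensorProduct.comm k H H).toLinearMap) (fun x y => rfl) X
  exact LinearMap.congr_fun (f := rotC hst n ∘ₗ (B.tens (B.C n)).act g)
    (g := (B.C (n + 1)).act g ∘ₗ rotC hst n) (B.tens_ext key) w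

/-- `v₀ ⊗ v₁ ⊗ ⋯ ⊗ v_{n-1}` in `C^n`. -/
def pure (B : LeftBialgebroid k A H) : ∀ n : ℕ, (ℕ → H) → (B.C n).carrier
  | 0, _ => B.unitOne
  | n + 1, v => B.tm (B.C n) (v 0) (pure B n fun i => v (i + 1))

theorem pure_congr : ∀ (n : ℕ) {v w : ℕ → H}, (∀ i < n, v i = w i) → B.pure n v = B.pure n w
  | 0, _, _, _ => rfl
  | n + 1, v, w, h => by
    rw [pure, pure, h 0 (Nat.succ_pos _),
      pure_congr n (v := fun i => v (i + 1)) (w := fun i => w (i + 1))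
        fun i hi => h (i + 1) (by omega)]

theorem pure_ext : ∀ (n : ℕ) {P : Type u} [AddCommGroup P] [Module k P]
    {f g : (B.C (n + 1)).carrier →ₗ[k] P},
    (∀ v, f (B.pure (n + 1) v) = g (B.pure (n + 1) v)) → f = g
  | 0, P, _, _, f, g, h => by
    have key : ∀ (x : H) (a : A), f (B.tm B.unit x a) = g (B.tm B.unit x a) := by
      intro x a
      rw [tm_unit]
      exact h fun _ => B.t (op a) * x
    exact B.tens_ext key
  | n + 1, P, _, _, f, g, h => by
    refine B.tens_ext fun x m => ?_
    refine LinearMap.congr_fun (f := f ∘ₗ B.tm (B.C (n + 1)) x) (g := g ∘ₗ B.tm (B.C (n + 1)) x)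
      (pure_ext n fun v => ?_) m
    exact h fun i => Nat.casesOn i x v

theorem app_pure : ∀ (n : ℕ) (v : ℕ → H), B.app n (B.pure n v) (v n) = B.pure (n + 1) v
  | 0, v => by
    have e : B.tm B.unit (B.s 1 * v 0) B.unitOne = B.tm B.unit (v 0) B.unitOne := by
      rw [map_one, one_mul]
    exact e
  | n + 1, v => congrArg (B.tm (B.C (n + 1)) (v 0)) (app_pure n fun i => v (i + 1))

theorem rotC_pure (hst : ∀ a, B.s a = B.t (op a)) (n : ℕ) (v : ℕ → H) (hv : v (n + 1) = v 0) :
    rotC hst n (B.pure (n + 1) v) = B.pure (n + 1) fun i => v (i + 1) := by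
  refine Eq.trans ?_ (app_pure n fun i => v (i + 1))
  exact congrArg (B.app n (B.pure n fun i => v (i + 1))) hv.symm

theorem rotC_iterate (hst : ∀ a, B.s a = B.t (op a)) (n : ℕ) (x : (B.C (n + 1)).carrier) :
    (rotC hst n)^[n + 1] x = x := by
  have h1 : ∀ (j : ℕ) (v : ℕ → H), (∀ i, v (i + (n + 1)) = v i) →
      (rotC hst n)^[j] (B.pure (n + 1) v) = B.pure (n + 1) fun i => v (i + j) := by
    intro j
    induction j with
    | zero => intro v _; rfl
    | succ j ih =>
      intro v hv
      rw [Function.iterate_succ_apply, rotC_pure hst n v (by simpa using hv 0),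
        ih (fun i => v (i + 1)) fun i => by
          have := hv (i + 1)
          rwa [add_right_comm] at this]
      exact pure_congr (n + 1) fun i _ => congrArg v (by omega)
  have h2 : rotC hst n ^ (n + 1) = 1 := by
    refine pure_ext n fun v => ?_
    have e : B.pure (n + 1) v = B.pure (n + 1) fun i => v (i % (n + 1)) :=
      pure_congr (n + 1) fun i hi => by rw [Nat.mod_eq_of_lt hi]
    rw [e, Module.End.pow_apply, h1 _ _ fun i => by simp]
    simp
  rw [← Module.End.pow_apply, h2]
  rfl

theorem σ_app : ∀ (n i : ℕ), i ≤ n → ∀ (x : (B.C (n + 1)).carrier) (h : H),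
    (B.σ (n + 1) i).1 (B.app (n + 1) x h) = B.app n ((B.σ n i).1 x) h
  | n, 0, _, x, h => by
    rw [B.σ_zero_eq n]
    refine LinearMap.congr_fun (f := (B.σ (n + 1) 0).1 ∘ₗ (B.app (n + 1)).flip h)
      (g := (B.app n).flip h ∘ₗ (B.counitTens (B.C n)).1) (B.tens_ext fun z m => ?_) x
    exact (B.app_s n (B.ε z) m h).symm
  | n + 1, i + 1, hi, x, h => by
    refine LinearMap.congr_fun (f := (B.σ (n + 2) (i + 1)).1 ∘ₗ (B.app (n + 2)).flip h)
      (g := (B.app (n + 1)).flip h ∘ₗ (B.σ (n + 1) (i + 1)).1) (B.tens_ext fun z m => ?_) x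
    exact congrArg (B.tm (B.C (n + 1)) z) (σ_app n i (by omega) m h)

theorem σ_last_app (hst : ∀ a, B.s a = B.t (op a)) : ∀ (n : ℕ) (x : (B.C n).carrier) (h : H),
    (B.σ n n).1 (B.app n x h) = (B.C n).act (B.s (B.ε h)) x
  | 0, x, h => by
    have key : ∀ a : A, B.ε (B.s (B.ε (B.s a * h)) * B.s 1) = B.ε (B.s (B.ε h) * B.s a) := by
      intro a
      rw [map_one, mul_one, ε_s_one, hst a, B.ε_t, B.ε_s, ← hst a, ε_s_one]
    exact key x
  | n + 1, x, h => by
    refine LinearMap.congr_fun (f := (B.σ (n + 1) (n + 1)).1 ∘ₗ (B.app (n + 1)).flip h)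
      (g := (B.C (n + 1)).act (B.s (B.ε h))) (B.tens_ext fun z m => ?_) x
    refine (congrArg (B.tm (B.C n) z) (σ_last_app hst n m h)).trans ?_
    refine Eq.trans ?_ (B.act_s_tm (B.C n) (B.ε h) z m).symm
    rw [← tm_bal, hst]

theorem σ_last_rotC (hst : ∀ a, B.s a = B.t (op a)) (n : ℕ) (w : (B.C (n + 1)).carrier) :
    (B.σ n n).1 (rotC hst n w) = (B.σ n 0).1 w := by
  rw [B.σ_zero_eq n]
  exact LinearMap.congr_fun (f := (B.σ n n).1 ∘ₗ rotC hst n) (g := (B.counitTens (B.C n)).1)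
    (B.tens_ext fun h x => σ_last_app hst n x h) w

theorem rotC_σ (hst : ∀ a, B.s a = B.t (op a)) (n i : ℕ) (hi : i ≤ n)
    (w : (B.C (n + 2)).carrier) :
    rotC hst n ((B.σ (n + 1) (i + 1)).1 w) = (B.σ (n + 1) i).1 (rotC hst (n + 1) w) :=
  LinearMap.congr_fun (f := rotC hst n ∘ₗ (B.σ (n + 1) (i + 1)).1)
    (g := (B.σ (n + 1) i).1 ∘ₗ rotC hst (n + 1))
    (B.tens_ext fun h x => (σ_app n i hi x h).symm) w

end LeftBialgebroid
end HopfAlgd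


namespace HopfAlgd

/-! ### Cocommutative case: homogeneous coordinates and the lifted cyclic operator. -/

namespace STRing

variable {k : Type v} [CommRing k] {A H : Type u} [Ring A] [Algebra k A] [Ring H] [Algebra k H]
  (R : STRing k A H)

theorem idExt_lm {M N : LMod k A} (f : LHom M N) (h : H) (y : (R.ext M).carrier) :
    (R.idExt f).1 (R.lm M h y) = R.lm N h ((R.idExt f).1 y) := by
  refine LinearMap.congr_fun (f := (R.idExt f).1 ∘ₗ R.lm M h) (g := R.lm N h ∘ₗ (R.idExt f).1)
    (ext_ext _ fun g m => rfl) y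

theorem idExt_em {M N : LMod k A} (f : LHom M N) (h : H) (m : M.carrier) :
    (R.idExt f).1 (R.em M h m) = R.em N h (f.1 m) := rfl

theorem mulExt_lm (M : LMod k A) (h : H) (y : (R.ext (R.ext M)).carrier) :
    (R.mulExt M).1 (R.lm (R.ext M) h y) = R.lm M h ((R.mulExt M).1 y) := by
  refine LinearMap.congr_fun (f := (R.mulExt M).1 ∘ₗ R.lm (R.ext M) h)
    (g := R.lm M h ∘ₗ (R.mulExt M).1) (ext_ext _ fun g m => ?_) y
  exact LinearMap.congr_fun (map_mul (R.lm M) h g) m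

theorem idExt_congr {M N P Q : LMod k A} {f : LHom M N} {g : LHom N Q} {f' : LHom M P}
    {g' : LHom P Q} (h : ∀ x, g.1 (f.1 x) = g'.1 (f'.1 x)) (x : (R.ext M).carrier) :
    (R.idExt g).1 ((R.idExt f).1 x) = (R.idExt g').1 ((R.idExt f').1 x) := by
  refine LinearMap.congr_fun (f := (R.idExt g).1 ∘ₗ (R.idExt f).1)
    (g := (R.idExt g').1 ∘ₗ (R.idExt f').1) (ext_ext _ fun z m => ?_) x
  exact congrArg (R.em Q z) (h m)

theorem idExt_congr_id {M N : LMod k A} {f : LHom M N} {g : LHom N M}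
    (h : ∀ x, g.1 (f.1 x) = x) (x : (R.ext M).carrier) :
    (R.idExt g).1 ((R.idExt f).1 x) = x := by
  refine LinearMap.congr_fun (f := (R.idExt g).1 ∘ₗ (R.idExt f).1) (g := LinearMap.id)
    (ext_ext _ fun z m => ?_) x
  exact congrArg (R.em M z) (h m)

theorem idExt_bijective {M N : LMod k A} (f : LHom M N) (hf : Function.Bijective f.1) :
    Function.Bijective (R.idExt f).1 := by
  let e := LinearEquiv.ofBijective f.1 hf
  let g : LHom N M := ⟨e.symm.toLinearMap, fun a x => by
    apply hf.1
    refine (e.apply_symm_apply _).trans ?_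
    exact (congrArg (N.act a) (e.apply_symm_apply x)).symm.trans (f.2 a _).symm⟩
  exact Function.bijective_iff_has_inverse.2 ⟨(R.idExt g).1,
    R.idExt_congr_id fun x => e.symm_apply_apply x, R.idExt_congr_id fun x => e.apply_symm_apply x⟩

theorem dgn_lm (n : ℕ) (h : H) (y : (R.Ch (n + 1)).carrier) :
    (R.dgn (n + 1) (n + 1)).1 (R.lm (R.Ch n) h y) =
      R.lm (R.Ch (n + 1)) h ((R.dgn (n + 1) (n + 1)).1 y) :=
  R.idExt_lm (R.dgn n n) h y

end STRing

namespace HopfAlgebroid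

open LeftBialgebroid

variable {k : Type v} [CommRing k] {Al Ar H : Type u} [Ring Al] [Algebra k Al] [Ring Ar]
  [Algebra k Ar] [Ring H] [Algebra k H] (𝓗 : HopfAlgebroid k Al Ar H)

theorem fsucc_lm (n i : ℕ) (h : H) (y : (𝓗.Ch (n + 2)).carrier) :
    (𝓗.fsucc (n + 1) i).1 (𝓗.rgt.lm (𝓗.Ch (n + 1)) h y) =
      𝓗.rgt.lm (𝓗.Ch n) h ((𝓗.fsucc (n + 1) i).1 y) := by
  cases i with
  | zero => exact 𝓗.rgt.mulExt_lm (𝓗.Ch n) h y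
  | succ i => exact 𝓗.rgt.idExt_lm (𝓗.fsucc n i) h y

theorem Si_one : 𝓗.Si 1 = 1 := by
  apply 𝓗.S.injective
  rw [𝓗.S_one]
  exact 𝓗.S.apply_symm_apply 1

theorem fsucc_last_dgn : ∀ (n : ℕ) (x : (𝓗.Ch n).carrier),
    (𝓗.fsucc n n).1 ((𝓗.rgt.dgn n n).1 x) = x
  | 0, x => by
    have e : ∀ a : Ar, 𝓗.rgt.ε (𝓗.Si (1 * 𝓗.rgt.s a)) = a := by
      intro a
      rw [one_mul, ← mul_one (𝓗.rgt.s a), Si_sr_mul, 𝓗.rgt.ε_t, Si_one, 𝓗.rgt.ε_one, mul_one]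
    exact e x
  | n + 1, x => 𝓗.rgt.idExt_congr_id (fsucc_last_dgn n) x

theorem fsucc_dgn_last : ∀ n i : ℕ, i < n → ∀ x : (𝓗.Ch (n + 1)).carrier,
    (𝓗.fsucc (n + 1) i).1 ((𝓗.rgt.dgn (n + 1) (n + 1)).1 x) =
      (𝓗.rgt.dgn n n).1 ((𝓗.fsucc n i).1 x)
  | n + 1, 0, _, x => by
    refine LinearMap.congr_fun (f := (𝓗.rgt.mulExt (𝓗.Ch (n + 1))).1 ∘ₗ
      (𝓗.rgt.idExt (𝓗.rgt.dgn (n + 1) (n + 1))).1)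
      (g := (𝓗.rgt.dgn (n + 1) (n + 1)).1 ∘ₗ (𝓗.rgt.mulExt (𝓗.Ch n)).1)
      (STRing.ext_ext _ fun h m => ?_) x
    exact (𝓗.rgt.dgn_lm n h m).symm
  | n + 1, i + 1, hi, x => 𝓗.rgt.idExt_congr (fsucc_dgn_last n i (by omega)) x

/-- The comparison `C_n → C^n`, given by `h ⊗ x ↦ h · (1 ⊗ x)`. -/
def alpha : ∀ n : ℕ, LHom (𝓗.Ch n) (𝓗.res (𝓗.lft.C n))
  | 0 => ⟨(𝓗.lft.ε ∘ₗ 𝓗.rgt.sLin : Ar →ₗ[k] Al), by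
      have e : ∀ a x : Ar, 𝓗.lft.ε (𝓗.rgt.s (a * x)) =
          𝓗.lft.ε (𝓗.rgt.s a * 𝓗.lft.s (𝓗.lft.ε (𝓗.rgt.s x))) := by
        intro a x
        rw [map_mul 𝓗.rgt.s, 𝓗.lft.ε_mul_s]
      exact e⟩
  | n + 1 => ⟨𝓗.gal (𝓗.lft.C n) ∘ₗ (𝓗.rgt.idExt (alpha n)).1, fun a x =>
      (congrArg (𝓗.gal (𝓗.lft.C n)) (𝓗.rgt.idExt_lm (alpha n) (𝓗.rgt.s a) x)).trans
        (𝓗.gal_lm (𝓗.lft.C n) (𝓗.rgt.s a) _)⟩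

/-- The comparison `C_n → C^n` as a linear map. -/
def aL (n : ℕ) : (𝓗.Ch n).carrier →ₗ[k] (𝓗.lft.C n).carrier := (𝓗.alpha n).1

theorem aL_em (n : ℕ) (h : H) (x : (𝓗.Ch n).carrier) : 𝓗.aL (n + 1) (𝓗.rgt.em (𝓗.Ch n) h x) =
    (𝓗.lft.C (n + 1)).act h (𝓗.lft.tm (𝓗.lft.C n) 1 (𝓗.aL n x)) :=
  (congrArg (𝓗.gal (𝓗.lft.C n)) (𝓗.rgt.idExt_em (𝓗.alpha n) h x)).trans
    (𝓗.gal_em (𝓗.lft.C n) h (𝓗.aL n x))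

theorem aL_act (n : ℕ) (a : Ar) (x : (𝓗.Ch n).carrier) :
    𝓗.aL n ((𝓗.Ch n).act a x) = (𝓗.lft.C n).act (𝓗.rgt.s a) (𝓗.aL n x) := (𝓗.alpha n).2 a x

theorem aL_lm (n : ℕ) (h : H) (y : (𝓗.Ch (n + 1)).carrier) :
    𝓗.aL (n + 1) (𝓗.rgt.lm (𝓗.Ch n) h y) = (𝓗.lft.C (n + 1)).act h (𝓗.aL (n + 1) y) :=
  (congrArg (𝓗.gal (𝓗.lft.C n)) (𝓗.rgt.idExt_lm (𝓗.alpha n) h y)).trans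
    (𝓗.gal_lm (𝓗.lft.C n) h _)

theorem gal_bijective (N : LMod k H) : Function.Bijective (𝓗.gal N) :=
  Function.bijective_iff_has_inverse.2 ⟨𝓗.galInv N, 𝓗.galInv_gal N, 𝓗.gal_galInv N⟩

namespace IsCocommutative

variable {𝓗}

theorem sl_εl_sr (hc : 𝓗.IsCocommutative) (a : Ar) :
    𝓗.lft.s (𝓗.lft.ε (𝓗.rgt.s a)) = 𝓗.rgt.s a := by
  rw [hc.sl_eq_tl, 𝓗.tlεl_sr]

theorem sr_εr_sl (hc : 𝓗.IsCocommutative) (a : Al) :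
    𝓗.rgt.s (𝓗.rgt.ε (𝓗.lft.s a)) = 𝓗.lft.s a := by
  rw [hc.sl_eq_tl, 𝓗.srεr_tl]

theorem sr_εr_S (hc : 𝓗.IsCocommutative) (h : H) :
    𝓗.rgt.s (𝓗.rgt.ε (𝓗.S h)) = 𝓗.lft.s (𝓗.lft.ε h) := by
  rw [εr_S, hc.sr_εr_sl]

/-- Each stage is a Galois isomorphism after the previous one. At the bottom `ε_l s_r` and `ε_r s_l`
are mutually inverse, because source and target agree on each side. -/
theorem aL_bijective (hc : 𝓗.IsCocommutative) : ∀ n : ℕ, Function.Bijective (𝓗.aL n)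
  | 0 => by
    have e1 : ∀ a : Ar, 𝓗.rgt.ε (𝓗.lft.s (𝓗.lft.ε (𝓗.rgt.s a))) = a := by
      intro a
      rw [hc.sl_εl_sr]
      simpa [𝓗.rgt.ε_one] using 𝓗.rgt.ε_s a 1
    have e2 : ∀ a : Al, 𝓗.lft.ε (𝓗.rgt.s (𝓗.rgt.ε (𝓗.lft.s a))) = a := by
      intro a
      rw [hc.sr_εr_sl, ε_s_one]
    exact Function.bijective_iff_has_inverse.2 ⟨fun a : Al => 𝓗.rgt.ε (𝓗.lft.s a), e1, e2⟩
  | n + 1 => (𝓗.gal_bijective (𝓗.lft.C n)).comp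
      (𝓗.rgt.idExt_bijective (𝓗.alpha n) (aL_bijective hc n))

/-- The comparison nests actions, `h · (1 ⊗ ⋯)`. Deleting a factor `1` through the counit is
`H`-linear and lets two consecutive actions merge into a product, as the inner faces prescribe. -/
theorem aL_fsucc (hc : 𝓗.IsCocommutative) (hS : 𝓗.Involutive) :
    ∀ n i : ℕ, i ≤ n → ∀ y : (𝓗.Ch (n + 1)).carrier,
      𝓗.aL n ((𝓗.fsucc n i).1 y) = (𝓗.lft.σ n i).1 (𝓗.aL (n + 1) y)
  | 0, 0, _, y => by
    refine LinearMap.congr_fun (f := 𝓗.aL 0 ∘ₗ 𝓗.fone.1)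
      (g := (𝓗.lft.σ 0 0).1 ∘ₗ 𝓗.aL 1) (STRing.ext_ext _ fun h m => ?_) y
    have e : ∀ a : Ar, 𝓗.lft.ε (𝓗.rgt.s (𝓗.rgt.ε (𝓗.Si (h * 𝓗.rgt.s a)))) =
        𝓗.lft.ε (h * 𝓗.lft.s (𝓗.lft.ε (𝓗.rgt.s a))) := by
      intro a
      -- Involutivity identifies the last face `ε_r S⁻¹` with `ε_r S`, which corresponds to `ε_l`
      -- under the identification of the bases.
      have hSi : ∀ g, 𝓗.Si g = 𝓗.S g := fun g => 𝓗.S.injective <|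
        (𝓗.S.apply_symm_apply g).trans (hS g).symm
      rw [hSi, hc.sr_εr_S, ε_s_one, 𝓗.lft.ε_mul_s]
    refine (e m).trans ?_
    refine Eq.trans ?_ (congrArg (𝓗.lft.σ 0 0).1 (𝓗.aL_em 0 h m)).symm
    refine Eq.trans ?_ (𝓗.lft.isHLin_σ 0 0 h (𝓗.lft.tm (𝓗.lft.C 0) 1 (𝓗.aL 0 m))).symm
    exact congrArg (𝓗.lft.unit.act h) (𝓗.lft.σ_zero_δzero 0 (𝓗.aL 0 m)).symm
  | n + 1, 0, _, y => by
    refine LinearMap.congr_fun (f := 𝓗.aL (n + 1) ∘ₗ (𝓗.rgt.mulExt (𝓗.Ch n)).1)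
      (g := (𝓗.lft.σ (n + 1) 0).1 ∘ₗ 𝓗.aL (n + 2)) (STRing.ext_ext _ fun h m => ?_) y
    refine (𝓗.aL_lm n h m).trans ?_
    refine Eq.trans ?_ (congrArg (𝓗.lft.σ (n + 1) 0).1 (𝓗.aL_em (n + 1) h m)).symm
    refine Eq.trans ?_ (𝓗.lft.isHLin_σ (n + 1) 0 h
      (𝓗.lft.tm (𝓗.lft.C (n + 1)) 1 (𝓗.aL (n + 1) m))).symm
    exact congrArg ((𝓗.lft.C (n + 1)).act h) (𝓗.lft.σ_zero_δzero (n + 1) (𝓗.aL (n + 1) m)).symm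
  | n + 1, i + 1, hi, y => by
    refine LinearMap.congr_fun (f := 𝓗.aL (n + 1) ∘ₗ (𝓗.rgt.idExt (𝓗.fsucc n i)).1)
      (g := (𝓗.lft.σ (n + 1) (i + 1)).1 ∘ₗ 𝓗.aL (n + 2)) (STRing.ext_ext _ fun h m => ?_) y
    refine Eq.trans ?_ (congrArg (𝓗.lft.σ (n + 1) (i + 1)).1 (𝓗.aL_em (n + 1) h m)).symm
    refine (𝓗.aL_em n h ((𝓗.fsucc n i).1 m)).trans ?_
    refine (congrArg (fun z => (𝓗.lft.C (n + 1)).act h (𝓗.lft.tm (𝓗.lft.C n) 1 z))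
      (aL_fsucc hc hS n i (by omega) m)).trans ?_
    exact (𝓗.lft.isHLin_σ (n + 1) (i + 1) h
      (𝓗.lft.tm (𝓗.lft.C (n + 1)) 1 (𝓗.aL (n + 1) m))).symm

/-- `u ⊗ y ↦ y ⊗ S(u)`. -/
def appS (hc : 𝓗.IsCocommutative) (n : ℕ) :
    (𝓗.Ch (n + 1)).carrier →ₗ[k] (𝓗.lft.C (n + 1)).carrier :=
  𝓗.rgt.elift ((𝓗.lft.app n).flip.compl₁₂ 𝓗.S.toLinearMap (𝓗.aL n)) (by
    intro a u y
    change 𝓗.lft.app n (𝓗.aL n y) (𝓗.S (u * 𝓗.rgt.s a)) =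
      𝓗.lft.app n (𝓗.aL n ((𝓗.Ch n).act a y)) (𝓗.S u)
    rw [hc.sr_eq_tr, S_mul_tr, aL_act, ← 𝓗.tlεl_sr a, app_t hc.sl_eq_tl, hc.sl_eq_tl])

/-- For `w = u ⊗ m` the last factor is `S(u S⁻¹(h₂)) = h₂ S(u)`, so the legs of `h` recombine into a
diagonal action. -/
theorem appS_rot (hc : 𝓗.IsCocommutative) (n : ℕ) (h : H) (w : (𝓗.Ch (n + 1)).carrier) :
    hc.appS (n + 1) (𝓗.rot (𝓗.Ch n) h w) =
      (𝓗.lft.C (n + 2)).act h (𝓗.lft.tm (𝓗.lft.C (n + 1)) 1 (hc.appS n w)) := by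
  refine LinearMap.congr_fun (f := hc.appS (n + 1) ∘ₗ 𝓗.rot (𝓗.Ch n) h)
    (g := (𝓗.lft.C (n + 2)).act h ∘ₗ 𝓗.lft.tm (𝓗.lft.C (n + 1)) 1 ∘ₗ hc.appS n)
    (STRing.ext_ext _ fun u m => ?_) w
  refine Eq.trans ?_ (act_app hc.sl_eq_tl (n + 1)
    (𝓗.lft.tm (𝓗.lft.C n) 1 (𝓗.aL n m)) h (𝓗.S u)).symm
  refine 𝓗.lft.TensL_ext (f := hc.appS (n + 1) ∘ₗ (𝓗.preRot (𝓗.Ch n)).flip (u ⊗ₜ m))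
    (g := actApp hc.sl_eq_tl (n + 1) (𝓗.lft.tm (𝓗.lft.C n) 1 (𝓗.aL n m)) (𝓗.S u))
    (fun x y => ?_) (𝓗.lft.Δ h)
  have e : 𝓗.S (u * 𝓗.Si y) = y * 𝓗.S u := by
    rw [S_mul]
    exact congrArg (· * 𝓗.S u) (𝓗.S.apply_symm_apply y)
  exact congrArg₂ (fun z g => 𝓗.lft.app (n + 1) z g) (𝓗.aL_em n x m) e

/-- In homogeneous coordinates: if `t(x) = u ⊗ y`, then `x` is `y` followed by the factor `S(u)`. By
`appS_rot` the recursion of `tsucc` is that of the comparison. -/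
theorem appS_tsucc (hc : 𝓗.IsCocommutative) : ∀ (n : ℕ) (x : (𝓗.Ch (n + 1)).carrier),
    hc.appS n ((𝓗.tsucc n).1 x) = 𝓗.aL (n + 1) x
  | 0, x => by
    refine LinearMap.congr_fun (f := hc.appS 0 ∘ₗ 𝓗.tone.1) (g := 𝓗.aL 1)
      (STRing.ext_ext _ fun h m => ?_) x
    have key : ∀ a : Ar, 𝓗.lft.tm 𝓗.lft.unit (𝓗.lft.s (𝓗.lft.ε (𝓗.rgt.s 1)) *
        𝓗.S (𝓗.Si (h * 𝓗.rgt.s a))) 𝓗.lft.unitOne = (𝓗.lft.tens 𝓗.lft.unit).act h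
          (𝓗.lft.tm 𝓗.lft.unit 1 (show Al from 𝓗.lft.ε (𝓗.rgt.s a))) := by
      intro a
      rw [tm_unit, act_tm_unitOne, map_one 𝓗.rgt.s, 𝓗.lft.ε_one, map_one 𝓗.lft.s, one_mul, mul_one,
        𝓗.tlεl_sr]
      exact congrArg (fun z => 𝓗.lft.tm 𝓗.lft.unit z 𝓗.lft.unitOne) (𝓗.S.apply_symm_apply _)
    exact (key m).trans (𝓗.aL_em 0 h m).symm
  | n + 1, x => by
    refine LinearMap.congr_fun (f := hc.appS (n + 1) ∘ₗ (𝓗.tsucc (n + 1)).1) (g := 𝓗.aL (n + 2))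
      (STRing.ext_ext _ fun h m => ?_) x
    refine (hc.appS_rot n h ((𝓗.tsucc n).1 m)).trans (Eq.trans ?_ (𝓗.aL_em (n + 1) h m).symm)
    exact congrArg (fun z => (𝓗.lft.C (n + 2)).act h (𝓗.lft.tm (𝓗.lft.C (n + 1)) 1 z))
      (appS_tsucc hc n m)

/-- `x ⊗ y ↦ x · (S(y) ⊗ z)`. -/
def actTmS (hc : 𝓗.IsCocommutative) (N : LMod k H) (z : N.carrier) :
    𝓗.rgt.TensR →ₗ[k] (𝓗.lft.tens N).carrier :=
  balLift _ _ (TensorProduct.lift ((𝓗.lft.tens N).act.toLinearMap.compl₂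
    ((𝓗.lft.tm N).flip z ∘ₗ 𝓗.S.toLinearMap))) (by
    intro a x y
    change (𝓗.lft.tens N).act (x * 𝓗.rgt.s a) (𝓗.lft.tm N (𝓗.S y) z) =
      (𝓗.lft.tens N).act x (𝓗.lft.tm N (𝓗.S (y * 𝓗.rgt.t (op a))) z)
    rw [map_mul (𝓗.lft.tens N).act, Module.End.mul_apply, act_sr_tm, S_mul_tr, ← 𝓗.tlεl_sr a,
      tm_bal, hc.sl_eq_tl])

/-- After exchanging the legs of `u^(1)` by cocommutativity, the antipode meets the second leg.
Twisted coassociativity leaves `s_l(ε_l(u₂)) ⊗ u₁ z`, and the base element moves over to complete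
`u`. -/
theorem actTmS_Δ (hc : 𝓗.IsCocommutative) (N : LMod k H) (z : N.carrier) (u : H) :
    hc.actTmS N z (𝓗.rgt.Δ u) = 𝓗.lft.tm N 1 (N.act u z) := by
  obtain ⟨X, hX⟩ := 𝓗.lft.mkL_surjective (𝓗.lft.Δ u)
  obtain ⟨Y, hY⟩ := 𝓗.rgt.mkR_surjective (𝓗.rgt.Δ u)
  let p : 𝓗.lft.TensL →ₗ[k] H →ₗ[k] (𝓗.lft.tens N).carrier :=
    balLift _ _ (TensorProduct.lift (LinearMap.mk₂ k
      (fun x y => (𝓗.lft.tm N).flip (N.act x z) ∘ₗ LinearMap.mulLeft k y ∘ₗ 𝓗.S.toLinearMap)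
      (by intro x x' y; ext; simp) (by intro c x y; ext; simp)
      (by intro x y y'; ext; simp [add_mul]) (by intro c x y; ext; simp))) (by
        intro a x y
        refine LinearMap.ext fun w => ?_
        change 𝓗.lft.tm N (y * 𝓗.S w) (N.act (𝓗.lft.t (op a) * x) z) =
          𝓗.lft.tm N (𝓗.lft.s a * y * 𝓗.S w) (N.act x z)
        rw [map_mul N.act, Module.End.mul_apply, ← hc.sl_eq_tl, ← tm_bal, ← hc.sl_eq_tl, mul_assoc])
  let q : H →ₗ[k] 𝓗.rgt.TensR →ₗ[k] (𝓗.lft.tens N).carrier :=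
    ((𝓗.lft.tm N).flip ∘ₗ N.act.toLinearMap.flip z).compl₂ 𝓗.mulS
  have key := triple_apply (𝓗.twisted_lr u X Y hX hY) p q (fun _ _ _ => rfl)
  rw [← hY]
  refine Eq.trans ?_ (key.trans ?_)
  · refine tmul_congr (hc.actTmS N z ∘ₗ 𝓗.rgt.mkR) (TensorProduct.lift (p ∘ₗ 𝓗.lft.Δ))
      (fun x y => ?_) Y
    obtain ⟨Z, hZ⟩ := 𝓗.lft.mkL_surjective (𝓗.lft.Δ x)
    change 𝓗.lft.preAct N (𝓗.lft.Δ x) (𝓗.S y ⊗ₜ z) = p (𝓗.lft.Δ x) y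
    have e := hc.cocomm x Z hZ
    refine (congrArg (fun W => 𝓗.lft.preAct N W (𝓗.S y ⊗ₜ z)) e).symm.trans
      (Eq.trans ?_ (congrArg (fun W => p W y) hZ))
    exact tmul_congr ((𝓗.lft.preAct N).flip (𝓗.S y ⊗ₜ z) ∘ₗ 𝓗.lft.mkL ∘ₗ
      (TensorProduct.comm k H H).toLinearMap) (p.flip y ∘ₗ 𝓗.lft.mkL) (fun _ _ => rfl) Z
  · conv_rhs => rw [← 𝓗.lft.counit_right u X hX]
    refine tmul_congr (TensorProduct.lift (q.compl₂ 𝓗.rgt.Δ))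
      (𝓗.lft.tm N 1 ∘ₗ N.act.toLinearMap.flip z ∘ₗ
        mulOpMap LinearMap.id (𝓗.lft.tLin ∘ₗ 𝓗.lft.ε)) (fun x y => ?_) X
    change 𝓗.lft.tm N (𝓗.mulS (𝓗.rgt.Δ y)) (N.act x z) =
      𝓗.lft.tm N 1 (N.act (𝓗.lft.t (op (𝓗.lft.ε y)) * x) z)
    rw [mulS_Δ, hc.sl_eq_tl, ← mul_one (𝓗.lft.t (op (𝓗.lft.ε y))), tm_bal, mul_one,
      map_mul N.act, ← hc.sl_eq_tl]
    rfl

/-- `x ⊗ y ↦ S(x) · (1 ⊗ y z)`. -/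
def SactTm (hc : 𝓗.IsCocommutative) (N : LMod k H) (z : N.carrier) : 𝓗.lft.TensL →ₗ[k] (𝓗.lft.tens N).carrier :=
  balLift _ _ (TensorProduct.lift (((𝓗.lft.tens N).act.toLinearMap ∘ₗ 𝓗.S.toLinearMap).compl₂
    (𝓗.lft.tm N 1 ∘ₗ N.act.toLinearMap.flip z))) (by
    intro a x y
    change (𝓗.lft.tens N).act (𝓗.S (𝓗.lft.t (op a) * x)) (𝓗.lft.tm N 1 (N.act y z)) =
      (𝓗.lft.tens N).act (𝓗.S x) (𝓗.lft.tm N 1 (N.act (𝓗.lft.s a * y) z))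
    rw [S_tl_mul, map_mul (𝓗.lft.tens N).act, Module.End.mul_apply, act_s_tm, map_mul N.act,
      Module.End.mul_apply, ← tm_bal, hc.sl_eq_tl])

/-- Expand `1 ⊗ v₂ z` by `actTmS_Δ`. Twisted coassociativity brings `S` of one leg next to the
following leg, where it collapses to `s_r ε_r`, and the right counit leaves `S(v) ⊗ z`. -/
theorem SactTm_Δ (hc : 𝓗.IsCocommutative) (N : LMod k H) (z : N.carrier) (v : H) :
    hc.SactTm N z (𝓗.lft.Δ v) = 𝓗.lft.tm N (𝓗.S v) z := by
  obtain ⟨X, hX⟩ := 𝓗.lft.mkL_surjective (𝓗.lft.Δ v)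
  obtain ⟨Y, hY⟩ := 𝓗.rgt.mkR_surjective (𝓗.rgt.Δ v)
  let p : 𝓗.lft.TensL →ₗ[k] H →ₗ[k] (𝓗.lft.tens N).carrier :=
    ((𝓗.lft.tens N).act.toLinearMap ∘ₗ Smul 𝓗).compl₂ ((𝓗.lft.tm N).flip z ∘ₗ 𝓗.S.toLinearMap)
  let q : H →ₗ[k] 𝓗.rgt.TensR →ₗ[k] (𝓗.lft.tens N).carrier :=
    ((𝓗.lft.tens N).act.toLinearMap ∘ₗ 𝓗.S.toLinearMap).compl₂ (hc.actTmS N z)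
  have key := triple_apply (𝓗.twisted_lr v X Y hX hY) p q (fun x y w =>
    LinearMap.congr_fun (map_mul (𝓗.lft.tens N).act (𝓗.S x) y) (𝓗.lft.tm N (𝓗.S w) z))
  rw [← hX]
  refine Eq.trans ?_ (key.symm.trans ?_)
  · refine tmul_congr (hc.SactTm N z ∘ₗ 𝓗.lft.mkL) (TensorProduct.lift (q.compl₂ 𝓗.rgt.Δ))
      (fun x y => ?_) X
    exact congrArg ((𝓗.lft.tens N).act (𝓗.S x)) (hc.actTmS_Δ N z y).symm
  · conv_rhs => rw [← 𝓗.rgt.counit_left v Y hY]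
    refine tmul_congr (TensorProduct.lift (p ∘ₗ 𝓗.lft.Δ)) ((𝓗.lft.tm N).flip z ∘ₗ
      𝓗.S.toLinearMap ∘ₗ mulOpMap (𝓗.rgt.tLin ∘ₗ 𝓗.rgt.ε) LinearMap.id) (fun x y => ?_) Y
    change (𝓗.lft.tens N).act (Smul 𝓗 (𝓗.lft.Δ x)) (𝓗.lft.tm N (𝓗.S y) z) =
      𝓗.lft.tm N (𝓗.S (y * 𝓗.rgt.t (op (𝓗.rgt.ε x)))) z
    rw [Smul_Δ, act_sr_tm, S_mul_tr, ← 𝓗.tlεl_sr, tm_bal, hc.sl_eq_tl]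

/-- `x ⊗ y ↦ (m ↦ S(x) ⊗ y ⊗ m)`. -/
def spliceSl (hc : 𝓗.IsCocommutative) (M : LMod k Ar) :
    𝓗.lft.TensL →ₗ[k] M.carrier →ₗ[k] (𝓗.rgt.ext (𝓗.rgt.ext M)).carrier :=
  balLift _ _ (TensorProduct.lift (LinearMap.mk₂ k
      (fun x y => 𝓗.rgt.em (𝓗.rgt.ext M) (𝓗.S x) ∘ₗ 𝓗.rgt.em M y)
      (by intro x x' y; ext; simp) (by intro c x y; ext; simp)
      (by intro x y y'; ext; simp) (by intro c x y; ext; simp))) (by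
    intro a x y
    refine LinearMap.ext fun m => ?_
    change 𝓗.rgt.em (𝓗.rgt.ext M) (𝓗.S (𝓗.lft.t (op a) * x)) (𝓗.rgt.em M y m) =
      𝓗.rgt.em (𝓗.rgt.ext M) (𝓗.S x) (𝓗.rgt.em M (𝓗.lft.s a * y) m)
    rw [S_tl_mul, ← hc.sr_εr_sl, STRing.em_bal, STRing.act_em])

theorem spliceSl_mk (hc : 𝓗.IsCocommutative) (M : LMod k Ar) (x y : H) (m : M.carrier) :
    hc.spliceSl M (𝓗.lft.mkL (x ⊗ₜ y)) m =
      𝓗.rgt.em (𝓗.rgt.ext M) (𝓗.S x) (𝓗.rgt.em M y m) := rfl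

/-- `u ⊗ m ↦ S(u₁) ⊗ u₂ ⊗ m`. -/
def comulS (hc : 𝓗.IsCocommutative) (M : LMod k Ar) :
    (𝓗.rgt.ext M).carrier →ₗ[k] (𝓗.rgt.ext (𝓗.rgt.ext M)).carrier :=
  𝓗.rgt.elift (hc.spliceSl M ∘ₗ 𝓗.lft.Δ) (by
    intro a h m
    obtain ⟨X, hX⟩ := 𝓗.lft.mkL_surjective (𝓗.lft.Δ h)
    rw [LinearMap.comp_apply, LinearMap.comp_apply, 𝓗.Δ_mul_sr a h X hX, ← hX]
    refine tmul_congr ((hc.spliceSl M).flip m ∘ₗ 𝓗.lft.mkL ∘ₗ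
        LinearMap.mulRight k (1 ⊗ₜ 𝓗.rgt.s a))
      ((hc.spliceSl M).flip (M.act a m) ∘ₗ 𝓗.lft.mkL) (fun x y => ?_) X
    refine (congrArg (fun Z => hc.spliceSl M (𝓗.lft.mkL Z) m)
      (Algebra.TensorProduct.tmul_mul_tmul x 1 y (𝓗.rgt.s a))).trans ?_
    rw [mul_one, spliceSl_mk, STRing.em_bal]
    rfl)

theorem comulS_em (hc : 𝓗.IsCocommutative) (M : LMod k Ar) (u : H) (m : M.carrier) :
    hc.comulS M (𝓗.rgt.em M u m) = hc.spliceSl M (𝓗.lft.Δ u) m := rfl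

theorem comulS_rtr (hc : 𝓗.IsCocommutative) (M : LMod k Ar) (a : Ar)
    (w : (𝓗.rgt.ext M).carrier) :
    hc.comulS M (𝓗.rtr M a w) = 𝓗.rgt.lm (𝓗.rgt.ext M) (𝓗.rgt.s a) (hc.comulS M w) := by
  refine LinearMap.congr_fun (f := hc.comulS M ∘ₗ 𝓗.rtr M a)
    (g := 𝓗.rgt.lm (𝓗.rgt.ext M) (𝓗.rgt.s a) ∘ₗ hc.comulS M)
    (STRing.ext_ext _ fun u m => ?_) w
  obtain ⟨X, hX⟩ := 𝓗.lft.mkL_surjective (𝓗.lft.Δ u)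
  have e := 𝓗.lft.Δ_mul u (𝓗.lft.s (𝓗.lft.ε (𝓗.rgt.t (op a)))) X
    (𝓗.lft.s (𝓗.lft.ε (𝓗.rgt.t (op a))) ⊗ₜ 1) hX (𝓗.lft.Δ_sa _).symm
  rw [𝓗.slεl_tr] at e
  rw [LinearMap.comp_apply, LinearMap.comp_apply, rtr_em, comulS_em, comulS_em, e, ← hX]
  refine tmul_congr ((hc.spliceSl M).flip m ∘ₗ 𝓗.lft.mkL ∘ₗ
      LinearMap.mulRight k (𝓗.rgt.t (op a) ⊗ₜ 1))
    (𝓗.rgt.lm (𝓗.rgt.ext M) (𝓗.rgt.s a) ∘ₗ (hc.spliceSl M).flip m ∘ₗ 𝓗.lft.mkL)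
    (fun x y => ?_) X
  refine (congrArg (fun Z => hc.spliceSl M (𝓗.lft.mkL Z) m)
    (Algebra.TensorProduct.tmul_mul_tmul x (𝓗.rgt.t (op a)) y 1)).trans ?_
  rw [mul_one, spliceSl_mk, S_mul_tr]
  rfl

/-- Since `s_r ε_r S = s_l ε_l`, this is the left counit axiom. It makes the lifted operator cover
`t_n`. -/
theorem fzero_comulS (hc : 𝓗.IsCocommutative) (n : ℕ) (w : (𝓗.Ch (n + 1)).carrier) :
    𝓗.fzero (n + 1) (hc.comulS (𝓗.Ch n) w) = w := by
  refine LinearMap.congr_fun (f := 𝓗.fzero (n + 1) ∘ₗ hc.comulS (𝓗.Ch n)) (g := LinearMap.id)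
    (STRing.ext_ext _ fun u m => ?_) w
  obtain ⟨X, hX⟩ := 𝓗.lft.mkL_surjective (𝓗.lft.Δ u)
  change 𝓗.fzero (n + 1) (hc.spliceSl (𝓗.Ch n) (𝓗.lft.Δ u) m) = 𝓗.rgt.em (𝓗.Ch n) u m
  conv_rhs => rw [← 𝓗.lft.counit_left u X hX]
  rw [← hX]
  refine tmul_congr (𝓗.fzero (n + 1) ∘ₗ (hc.spliceSl (𝓗.Ch n)).flip m ∘ₗ 𝓗.lft.mkL)
    ((𝓗.rgt.em (𝓗.Ch n)).flip m ∘ₗ mulMap (𝓗.lft.sLin ∘ₗ 𝓗.lft.ε) LinearMap.id)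
    (fun x y => ?_) X
  exact congrArg (fun z => 𝓗.rgt.em (𝓗.Ch n) (z * y) m) (hc.sr_εr_S x)

/-- By `SactTm_Δ` the comparison sends `S(u₁) ⊗ u₂ ⊗ m` to `S(u) ⊗ 1 ⊗ m`; rotation moves `S(u)` to
the end. -/
theorem rotC_aL_comulS (hc : 𝓗.IsCocommutative) (n : ℕ) (w : (𝓗.Ch (n + 1)).carrier) :
    rotC hc.sl_eq_tl (n + 1) (𝓗.aL (n + 2) (hc.comulS (𝓗.Ch n) w)) =
      𝓗.lft.tm (𝓗.lft.C (n + 1)) 1 (hc.appS n w) := by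
  refine LinearMap.congr_fun
    (f := rotC hc.sl_eq_tl (n + 1) ∘ₗ 𝓗.aL (n + 2) ∘ₗ hc.comulS (𝓗.Ch n))
    (g := 𝓗.lft.tm (𝓗.lft.C (n + 1)) 1 ∘ₗ hc.appS n) (STRing.ext_ext _ fun u m => ?_) w
  have e : 𝓗.aL (n + 2) (hc.spliceSl (𝓗.Ch n) (𝓗.lft.Δ u) m) =
      𝓗.lft.tm (𝓗.lft.C (n + 1)) (𝓗.S u) (𝓗.lft.tm (𝓗.lft.C n) 1 (𝓗.aL n m)) := by
    refine Eq.trans ?_ (hc.SactTm_Δ (𝓗.lft.C (n + 1)) (𝓗.lft.tm (𝓗.lft.C n) 1 (𝓗.aL n m)) u)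
    exact 𝓗.lft.TensL_ext (f := 𝓗.aL (n + 2) ∘ₗ (hc.spliceSl (𝓗.Ch n)).flip m)
      (g := hc.SactTm (𝓗.lft.C (n + 1)) (𝓗.lft.tm (𝓗.lft.C n) 1 (𝓗.aL n m)))
      (fun x y => (𝓗.aL_em (n + 1) (𝓗.S x) (𝓗.rgt.em (𝓗.Ch n) y m)).trans
        (congrArg (fun z => (𝓗.lft.C (n + 2)).act (𝓗.S x) (𝓗.lft.tm (𝓗.lft.C (n + 1)) 1 z))
          (𝓗.aL_em n y m))) (𝓗.lft.Δ u)
  exact congrArg (rotC hc.sl_eq_tl (n + 1)) e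

/-- The cyclic operators on `H ⊗_{A_r} C_n`. -/
def cycP (hc : 𝓗.IsCocommutative) : ∀ n : ℕ, Module.End k (𝓗.Ch (n + 1)).carrier
  | 0 => LinearMap.id
  | n + 1 => 𝓗.rgt.elift ((𝓗.rgt.lm (𝓗.Ch (n + 1))).toLinearMap.compl₂
      (hc.comulS (𝓗.Ch n) ∘ₗ (𝓗.tsucc n).1)) (by
    intro a h x
    refine Eq.trans ?_ (congrArg (fun z => 𝓗.rgt.lm (𝓗.Ch (n + 1)) h (hc.comulS (𝓗.Ch n) z))
      ((𝓗.tsucc n).2 a x)).symm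
    refine Eq.trans ?_ (congrArg (𝓗.rgt.lm (𝓗.Ch (n + 1)) h)
      (hc.comulS_rtr (𝓗.Ch n) a ((𝓗.tsucc n).1 x))).symm
    exact LinearMap.congr_fun (map_mul (𝓗.rgt.lm (𝓗.Ch (n + 1))) h (𝓗.rgt.s a)) _)

theorem cycP_em (hc : 𝓗.IsCocommutative) (n : ℕ) (h : H) (x : (𝓗.Ch (n + 1)).carrier) :
    hc.cycP (n + 1) (𝓗.rgt.em (𝓗.Ch (n + 1)) h x) =
      𝓗.rgt.lm (𝓗.Ch (n + 1)) h (hc.comulS (𝓗.Ch n) ((𝓗.tsucc n).1 x)) := rfl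

theorem cycP_lm (hc : 𝓗.IsCocommutative) : ∀ (n : ℕ) (h : H) (y : (𝓗.Ch (n + 1)).carrier),
    hc.cycP n (𝓗.rgt.lm (𝓗.Ch n) h y) = 𝓗.rgt.lm (𝓗.Ch n) h (hc.cycP n y)
  | 0, _, _ => rfl
  | n + 1, h, y => by
    refine LinearMap.congr_fun (f := hc.cycP (n + 1) ∘ₗ 𝓗.rgt.lm (𝓗.Ch (n + 1)) h)
      (g := 𝓗.rgt.lm (𝓗.Ch (n + 1)) h ∘ₗ hc.cycP (n + 1)) (STRing.ext_ext _ fun g m => ?_) y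
    exact LinearMap.congr_fun (map_mul (𝓗.rgt.lm (𝓗.Ch (n + 1))) h g) _

/-- Linearity of the rotation reduces to `1 ⊗ x`, where `rotC_aL_comulS` and `appS_tsucc` apply.
Hence the lifted cyclic operator is inverse to a rotation, and its order and its relations with the
faces are inherited from the rotation. -/
theorem rotC_aL_cycP (hc : 𝓗.IsCocommutative) : ∀ (n : ℕ) (y : (𝓗.Ch (n + 1)).carrier),
    rotC hc.sl_eq_tl n (𝓗.aL (n + 1) (hc.cycP n y)) = 𝓗.aL (n + 1) y
  | 0, y => rotC_iterate hc.sl_eq_tl 0 (𝓗.aL 1 y)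
  | n + 1, y => by
    refine LinearMap.congr_fun
      (f := rotC hc.sl_eq_tl (n + 1) ∘ₗ 𝓗.aL (n + 2) ∘ₗ hc.cycP (n + 1)) (g := 𝓗.aL (n + 2))
      (STRing.ext_ext _ fun h m => ?_) y
    refine (congrArg (rotC hc.sl_eq_tl (n + 1)) (𝓗.aL_lm (n + 1) h _)).trans ?_
    refine (rotC_act hc.sl_eq_tl hc.cocomm (n + 1) h _).trans ?_
    refine Eq.trans ?_ (𝓗.aL_em (n + 1) h m).symm
    exact congrArg ((𝓗.lft.C (n + 2)).act h) ((hc.rotC_aL_comulS n ((𝓗.tsucc n).1 m)).trans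
      (congrArg (𝓗.lft.tm (𝓗.lft.C (n + 1)) 1) (hc.appS_tsucc n m)))

theorem cycP_iterate (hc : 𝓗.IsCocommutative) (n : ℕ) (y : (𝓗.Ch (n + 1)).carrier) :
    (hc.cycP n)^[n + 1] y = y := by
  have h : ∀ (j : ℕ) (y : (𝓗.Ch (n + 1)).carrier),
      (rotC hc.sl_eq_tl n)^[j] (𝓗.aL (n + 1) ((hc.cycP n)^[j] y)) = 𝓗.aL (n + 1) y := by
    intro j
    induction j with
    | zero => intro y; rfl
    | succ j ih =>
      intro y
      rw [Function.iterate_succ_apply, Function.iterate_succ_apply', rotC_aL_cycP, ih]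
  apply (hc.aL_bijective (n + 1)).1
  rw [← h (n + 1) y, rotC_iterate]

theorem rotC_injective (hc : 𝓗.IsCocommutative) (n : ℕ) :
    Function.Injective (rotC hc.sl_eq_tl n) := by
  intro x y h
  rw [← rotC_iterate hc.sl_eq_tl n x, Function.iterate_succ_apply, h, ← Function.iterate_succ_apply,
    rotC_iterate]

theorem fsucc_zero_cycP (hc : 𝓗.IsCocommutative) (hS : 𝓗.Involutive) (n : ℕ)
    (y : (𝓗.Ch (n + 2)).carrier) :
    (𝓗.fsucc (n + 1) 0).1 (hc.cycP (n + 1) y) = (𝓗.fsucc (n + 1) (n + 1)).1 y := by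
  apply (hc.aL_bijective (n + 1)).1
  rw [hc.aL_fsucc hS _ _ (by omega), hc.aL_fsucc hS _ _ le_rfl, ← σ_last_rotC hc.sl_eq_tl,
    rotC_aL_cycP]

theorem fsucc_succ_cycP (hc : 𝓗.IsCocommutative) (hS : 𝓗.Involutive) (n i : ℕ) (hi : i ≤ n)
    (y : (𝓗.Ch (n + 2)).carrier) :
    (𝓗.fsucc (n + 1) (i + 1)).1 (hc.cycP (n + 1) y) = hc.cycP n ((𝓗.fsucc (n + 1) i).1 y) := by
  apply (hc.aL_bijective (n + 1)).1
  apply hc.rotC_injective n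
  rw [hc.aL_fsucc hS _ _ (by omega), rotC_aL_cycP, hc.aL_fsucc hS _ _ (by omega),
    rotC_σ hc.sl_eq_tl n i hi, rotC_aL_cycP]

theorem fzero_cycP (hc : 𝓗.IsCocommutative) (n : ℕ) (x : (𝓗.Ch n).carrier) :
    𝓗.fzero n (hc.cycP n (𝓗.rgt.em (𝓗.Ch n) 1 x)) = 𝓗.cyc n x := by
  cases n with
  | zero =>
    have e : (𝓗.Ch 0).act (𝓗.rgt.ε 1) x = x := by rw [𝓗.rgt.ε_one, map_one]; rfl
    exact e
  | succ n =>
    rw [cycP_em, map_one]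
    exact hc.fzero_comulS n _

end IsCocommutative
end HopfAlgebroid
end HopfAlgd


namespace HopfAlgd

/-! ### Cocommutative case: `H`-linear maps, acyclicity and the splitting of chains. -/

namespace HopfAlgebroid

variable {k : Type v} [CommRing k] {Al Ar H : Type u} [Ring Al] [Algebra k Al] [Ring Ar]
  [Algebra k Ar] [Ring H] [Algebra k H] (𝓗 : HopfAlgebroid k Al Ar H)

/-- `1 ⊗ x`. -/
def oneCh (n : ℕ) : (𝓗.Ch n).carrier →ₗ[k] (𝓗.Ch (n + 1)).carrier := 𝓗.rgt.em (𝓗.Ch n) 1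

/-- The action of `H` on `C_{n+1} = H ⊗_{A_r} C_n`. -/
def chAct (n : ℕ) : H →ₐ[k] Module.End k (𝓗.Ch (n + 1)).carrier := 𝓗.rgt.lm (𝓗.Ch n)

theorem oneCh_act (n : ℕ) (a : Ar) (x : (𝓗.Ch n).carrier) :
    𝓗.oneCh n ((𝓗.Ch n).act a x) = 𝓗.chAct n (𝓗.rgt.s a) (𝓗.oneCh n x) :=
  ((𝓗.rgt.em_bal (𝓗.Ch n) a 1 x).symm.trans
    (congrArg (fun h => 𝓗.rgt.em (𝓗.Ch n) h x) (one_mul _))).trans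
    (congrArg (fun h => 𝓗.rgt.em (𝓗.Ch n) h x) (mul_one _)).symm

theorem chAct_one (n : ℕ) (y : (𝓗.Ch (n + 1)).carrier) : 𝓗.chAct n 1 y = y :=
  LinearMap.congr_fun (map_one (𝓗.chAct n)) y

theorem chAct_mul (n : ℕ) (g h : H) (y : (𝓗.Ch (n + 1)).carrier) :
    𝓗.chAct n (g * h) y = 𝓗.chAct n g (𝓗.chAct n h y) :=
  LinearMap.congr_fun (map_mul (𝓗.chAct n) g h) y

theorem Ch_ext {n : ℕ} {P : Type*} [AddCommGroup P] [Module k P]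
    {f g : (𝓗.Ch (n + 1)).carrier →ₗ[k] P}
    (h : ∀ g' x, f (𝓗.chAct n g' (𝓗.oneCh n x)) = g (𝓗.chAct n g' (𝓗.oneCh n x))) : f = g := by
  refine STRing.ext_ext _ fun z m => ?_
  have e : 𝓗.chAct n z (𝓗.oneCh n m) = 𝓗.rgt.em (𝓗.Ch n) z m :=
    congrArg (fun h => 𝓗.rgt.em (𝓗.Ch n) h m) (mul_one z)
  have := h z m
  rwa [e] at this

/-- `H`-linear maps `C_{m+1} → C_{n+1}`. -/
def hlin (m n : ℕ) : Submodule k ((𝓗.Ch (m + 1)).carrier →ₗ[k] (𝓗.Ch (n + 1)).carrier) where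
  carrier := {F | ∀ h y, F (𝓗.chAct m h y) = 𝓗.chAct n h (F y)}
  zero_mem' := fun h y => (map_zero (𝓗.chAct n h)).symm
  add_mem' := fun {F G} hF hG h y => by
    rw [LinearMap.add_apply, LinearMap.add_apply, hF, hG, map_add]
  smul_mem' := fun c F hF h y => by
    rw [LinearMap.smul_apply, LinearMap.smul_apply, hF, map_smul]

-- The elements `1 ⊗ x` generate `H ⊗ C_m` over `H`.
variable {𝓗} in
theorem hlin_ext {m n : ℕ} {F G : 𝓗.hlin m n}
    (h : ∀ x, F.1 (𝓗.oneCh m x) = G.1 (𝓗.oneCh m x)) : F = G := by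
  refine Subtype.ext (𝓗.Ch_ext fun g x => ?_)
  rw [F.2, G.2, h]

theorem fzero_oneCh (n : ℕ) (x : (𝓗.Ch n).carrier) : 𝓗.fzero n (𝓗.oneCh n x) = x := by
  have e : (𝓗.Ch n).act (𝓗.rgt.ε 1) x = x := by rw [𝓗.rgt.ε_one, map_one]; rfl
  exact e

theorem fzero_chAct (n : ℕ) (h : H) (y : (𝓗.Ch (n + 1)).carrier) :
    𝓗.fzero n (𝓗.chAct n h y) = 𝓗.fzero n (𝓗.chAct n (𝓗.rgt.s (𝓗.rgt.ε h)) y) := by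
  refine LinearMap.congr_fun (f := 𝓗.fzero n ∘ₗ 𝓗.chAct n h)
    (g := 𝓗.fzero n ∘ₗ 𝓗.chAct n (𝓗.rgt.s (𝓗.rgt.ε h))) (STRing.ext_ext _ fun g m => ?_) y
  exact congrArg (fun a => (𝓗.Ch n).act a m) (𝓗.rgt.ε_mul_s h g)

theorem fzero_chAct_oneCh (n : ℕ) (h : H) (x : (𝓗.Ch n).carrier) :
    𝓗.fzero n (𝓗.chAct n h (𝓗.oneCh n x)) = (𝓗.Ch n).act (𝓗.rgt.ε h) x := by
  have e : (𝓗.Ch n).act (𝓗.rgt.ε (h * 1)) x = (𝓗.Ch n).act (𝓗.rgt.ε h) x := by rw [mul_one]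
  exact e

variable {𝓗} in
/-- `H`-linear maps descend along `d_0`. -/
theorem fzero_hlin {m n : ℕ} (F : 𝓗.hlin m n) (y : (𝓗.Ch (m + 1)).carrier) :
    𝓗.fzero n (F.1 y) = 𝓗.fzero n (F.1 (𝓗.oneCh m (𝓗.fzero m y))) := by
  refine LinearMap.congr_fun (f := 𝓗.fzero n ∘ₗ F.1)
    (g := 𝓗.fzero n ∘ₗ F.1 ∘ₗ 𝓗.oneCh m ∘ₗ 𝓗.fzero m) (𝓗.Ch_ext fun g x => ?_) y
  rw [LinearMap.comp_apply, LinearMap.comp_apply, LinearMap.comp_apply, LinearMap.comp_apply,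
    fzero_chAct_oneCh, oneCh_act, F.2, F.2, fzero_chAct]

theorem fzero_dgn (n : ℕ) (y : (𝓗.Ch (n + 1)).carrier) :
    𝓗.fzero (n + 1) ((𝓗.rgt.dgn (n + 1) (n + 1)).1 y) = (𝓗.rgt.dgn n n).1 (𝓗.fzero n y) := by
  refine LinearMap.congr_fun (f := 𝓗.fzero (n + 1) ∘ₗ (𝓗.rgt.idExt (𝓗.rgt.dgn n n)).1)
    (g := (𝓗.rgt.dgn n n).1 ∘ₗ 𝓗.fzero n) (STRing.ext_ext _ fun g m => ?_) y
  exact ((𝓗.rgt.dgn n n).2 (𝓗.rgt.ε g) m).symm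

/-- The alternating sum of the faces `d_{i+1}`. -/
def altd (n : ℕ) : (𝓗.Ch (n + 1)).carrier →ₗ[k] (𝓗.Ch n).carrier :=
  ∑ i ∈ Finset.range (n + 1), (-1 : k) ^ i • (𝓗.fsucc n i).1

theorem altd_apply (n : ℕ) (x : (𝓗.Ch (n + 1)).carrier) :
    𝓗.altd n x = ∑ i ∈ Finset.range (n + 1), (-1 : k) ^ i • (𝓗.fsucc n i).1 x := by
  rw [altd, LinearMap.sum_apply]
  rfl

theorem bd_eq (n : ℕ) (x : (𝓗.Ch (n + 1)).carrier) : 𝓗.bd n x = 𝓗.fzero n x - 𝓗.altd n x := by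
  rw [altd_apply, bd, LinearMap.sum_apply]
  exact sum_neg_one_pow_succ k (fun i => 𝓗.face n i x) (n + 1)

theorem altd_mem_hlin (n : ℕ) : 𝓗.altd (n + 1) ∈ 𝓗.hlin (n + 1) n :=
  Submodule.sum_mem _ fun i _ => Submodule.smul_mem _ _ (𝓗.fsucc_lm n i)

/-- The contraction of the bar complex: the first product absorbs the leading `1`, and the other
faces act behind it. -/
theorem altd_oneCh (n : ℕ) (y : (𝓗.Ch (n + 1)).carrier) :
    𝓗.altd (n + 1) (𝓗.oneCh (n + 1) y) = y - 𝓗.oneCh n (𝓗.altd n y) := by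
  rw [altd_apply, altd_apply, map_sum]
  refine (sum_neg_one_pow_succ k (fun i => (𝓗.fsucc (n + 1) i).1 (𝓗.oneCh (n + 1) y))
    (n + 1)).trans ?_
  refine congrArg₂ _ (𝓗.chAct_one n y) (Finset.sum_congr rfl fun i _ => ?_)
  rw [map_smul]
  rfl

/-- Because `altd` descends along `d_0`, it may be tested on `1 ⊗ x`, where the contraction exhibits
the difference `d_0 - altd` defining the boundary. -/
theorem bd_fzero (n : ℕ) (y : (𝓗.Ch (n + 2)).carrier) :
    𝓗.bd n (𝓗.fzero (n + 1) y) = 𝓗.fzero n (𝓗.altd (n + 1) y) := by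
  rw [fzero_hlin ⟨_, 𝓗.altd_mem_hlin n⟩ y, altd_oneCh, map_sub, fzero_oneCh, bd_eq]

open CategoryTheory

/-- The degrees, as objects of the category of `H`-linear maps between the modules
`C_{n+1} = H ⊗_{A_r} C_n`. -/
structure ChDeg (𝓗 : HopfAlgebroid k Al Ar H) where
  deg : ℕ

variable {𝓗} in
theorem comp_mem_hlin {m n p : ℕ} (G : 𝓗.hlin n p) (F : 𝓗.hlin m n) :
    G.1 ∘ₗ F.1 ∈ 𝓗.hlin m p := fun h y => by
  rw [LinearMap.comp_apply, F.2, G.2, LinearMap.comp_apply]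

instance : Category 𝓗.ChDeg where
  Hom X Y := 𝓗.hlin X.deg Y.deg
  id X := ⟨LinearMap.id, fun _ _ => rfl⟩
  comp f g := ⟨g.1 ∘ₗ f.1, comp_mem_hlin g f⟩

instance : Preadditive 𝓗.ChDeg where
  homGroup X Y := inferInstanceAs (AddCommGroup (𝓗.hlin X.deg Y.deg))
  add_comp _ _ _ f f' g := Subtype.ext (LinearMap.comp_add f.1 f'.1 g.1)
  comp_add _ _ _ f g g' := Subtype.ext (LinearMap.add_comp f.1 g'.1 g.1)

/-- The `H`-linear map underlying a morphism. -/
def chFun {X Y : 𝓗.ChDeg} (f : X ⟶ Y) :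
    (𝓗.Ch (X.deg + 1)).carrier →ₗ[k] (𝓗.Ch (Y.deg + 1)).carrier :=
  Subtype.val (p := fun F => F ∈ 𝓗.hlin X.deg Y.deg) f

variable {𝓗}

/-- The morphism given by an `H`-linear map. -/
def chHom {m n : ℕ} (F : 𝓗.hlin m n) : (⟨m⟩ : 𝓗.ChDeg) ⟶ ⟨n⟩ := F

theorem chFun_sum {X Y : 𝓗.ChDeg} {ι : Type*} (s : Finset ι) (f : ι → (X ⟶ Y)) :
    𝓗.chFun (∑ i ∈ s, f i) = ∑ i ∈ s, 𝓗.chFun (f i) := by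
  classical
  induction s using Finset.induction_on with
  | empty => rfl
  | insert i s hi ih =>
    rw [Finset.sum_insert hi, Finset.sum_insert hi, ← ih]
    rfl

theorem chFun_pow {X : 𝓗.ChDeg} (f : End X) (j : ℕ) (x : (𝓗.Ch (X.deg + 1)).carrier) :
    𝓗.chFun (f ^ j : End X) x = (𝓗.chFun f)^[j] x := by
  induction j generalizing x with
  | zero => rfl
  | succ j ih =>
    rw [Function.iterate_succ_apply, ← ih]
    exact congrArg (fun g : End X => 𝓗.chFun g x) (pow_succ f j)

theorem chFun_ext {X Y : 𝓗.ChDeg} {f g : X ⟶ Y} (h : ∀ x, 𝓗.chFun f x = 𝓗.chFun g x) : f = g :=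
  Subtype.ext (LinearMap.ext h)

theorem fzero_chFun {m n : ℕ} (f : (⟨m⟩ : 𝓗.ChDeg) ⟶ ⟨n⟩) (y : (𝓗.Ch (m + 1)).carrier) :
    𝓗.fzero n (𝓗.chFun f y) = 𝓗.fzero n (𝓗.chFun f (𝓗.oneCh m (𝓗.fzero m y))) :=
  fzero_hlin f y

/-- `h ⊗ x ↦ h ⊗ F(1 ⊗ x)`. -/
def hlift {m n : ℕ} (F : 𝓗.hlin m n) :
    (𝓗.Ch (m + 1)).carrier →ₗ[k] (𝓗.Ch (n + 2)).carrier :=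
  𝓗.rgt.elift (M := 𝓗.Ch m) ((𝓗.chAct (n + 1)).toLinearMap.compl₂
      (𝓗.oneCh (n + 1) ∘ₗ F.1 ∘ₗ 𝓗.oneCh m)) (by
    intro a h x
    have e1 : F.1 (𝓗.oneCh m ((𝓗.Ch m).act a x)) =
        (𝓗.Ch (n + 1)).act a (F.1 (𝓗.oneCh m x)) :=
      (congrArg F.1 (𝓗.oneCh_act m a x)).trans (F.2 (𝓗.rgt.s a) (𝓗.oneCh m x))
    have e2 : 𝓗.chAct (n + 1) (h * 𝓗.rgt.s a) (𝓗.oneCh (n + 1) (F.1 (𝓗.oneCh m x))) =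
        𝓗.chAct (n + 1) h (𝓗.oneCh (n + 1) (F.1 (𝓗.oneCh m ((𝓗.Ch m).act a x)))) := by
      rw [chAct_mul, e1, oneCh_act]
    exact e2)

theorem hlift_em {m n : ℕ} (F : 𝓗.hlin m n) (h : H) (x : (𝓗.Ch m).carrier) :
    hlift F (𝓗.rgt.em (𝓗.Ch m) h x) =
      𝓗.chAct (n + 1) h (𝓗.oneCh (n + 1) (F.1 (𝓗.oneCh m x))) := rfl

theorem hlift_mem_hlin {m n : ℕ} (F : 𝓗.hlin m n) : hlift F ∈ 𝓗.hlin m (n + 1) := fun h y => by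
  refine LinearMap.congr_fun (f := hlift F ∘ₗ 𝓗.chAct m h)
    (g := 𝓗.chAct (n + 1) h ∘ₗ hlift F) (STRing.ext_ext _ fun g x => ?_) y
  exact 𝓗.chAct_mul (n + 1) h g (𝓗.oneCh (n + 1) (F.1 (𝓗.oneCh m x)))

/-- Lifting of `H`-linear maps along the acyclic complex of the `C_{n+1}`. -/
def chLift {m n : ℕ} (F : (⟨m⟩ : 𝓗.ChDeg) ⟶ ⟨n⟩) : (⟨m⟩ : 𝓗.ChDeg) ⟶ ⟨n + 1⟩ :=
  chHom ⟨hlift F, hlift_mem_hlin F⟩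

theorem chLift_oneCh {m n : ℕ} (F : (⟨m⟩ : 𝓗.ChDeg) ⟶ ⟨n⟩) (x : (𝓗.Ch m).carrier) :
    𝓗.chFun (chLift F) (𝓗.oneCh m x) = 𝓗.oneCh (n + 1) (𝓗.chFun F (𝓗.oneCh m x)) :=
  (hlift_em F 1 x).trans (𝓗.chAct_one (n + 1) _)

theorem chFun_ext_oneCh {m n : ℕ} {f g : (⟨m⟩ : 𝓗.ChDeg) ⟶ ⟨n⟩}
    (h : ∀ x, 𝓗.chFun f (𝓗.oneCh m x) = 𝓗.chFun g (𝓗.oneCh m x)) : f = g :=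
  hlin_ext h

namespace IsCocommutative

open LeftBialgebroid

/-- As for cochains: `H`-linearity and the contraction reduce to the lowest degree. -/
theorem altd_altd (hc : 𝓗.IsCocommutative) (hS : 𝓗.Involutive) :
    ∀ (n : ℕ) (y : (𝓗.Ch (n + 2)).carrier), 𝓗.altd n (𝓗.altd (n + 1) y) = 0
  | 0, y => by
    -- In homogeneous coordinates both sides delete the two factors through the counit, in different
    -- order.
    have e : (𝓗.fsucc 0 0).1 ((𝓗.fsucc 1 0).1 y) = (𝓗.fsucc 0 0).1 ((𝓗.fsucc 1 1).1 y) := by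
      apply (hc.aL_bijective 0).1
      rw [hc.aL_fsucc hS 0 0 le_rfl, hc.aL_fsucc hS 0 0 le_rfl, hc.aL_fsucc hS 1 0 (by omega),
        hc.aL_fsucc hS 1 1 le_rfl]
      exact (𝓗.lft.counitTens_idTens (𝓗.lft.σ 0 0) (𝓗.aL 2 y)).symm
    rw [altd_apply, altd_apply]
    simp [Finset.sum_range_succ, e]
  | n + 1, y => by
    refine LinearMap.congr_fun (f := 𝓗.altd (n + 1) ∘ₗ 𝓗.altd (n + 2)) (g := 0)
      (𝓗.Ch_ext fun h x => ?_) y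
    rw [LinearMap.comp_apply, 𝓗.altd_mem_hlin (n + 1), 𝓗.altd_mem_hlin n, altd_oneCh, map_sub,
      altd_oneCh, altd_altd hc hS n, map_zero, sub_zero, sub_self, map_zero]
    rfl

variable (𝓗) in
/-- The signed faces, without `d_0`, on the modules `C_{n+1}`. -/
def chD (n i : ℕ) : 𝓗.hlin (n + 1) n :=
  ⟨(-1 : k) ^ i • (𝓗.fsucc (n + 1) i).1, Submodule.smul_mem _ _ (𝓗.fsucc_lm n i)⟩

/-- The signed cyclic operators. -/
def chL (hc : 𝓗.IsCocommutative) (n : ℕ) : 𝓗.hlin n n :=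
  ⟨(-1 : k) ^ n • hc.cycP n, Submodule.smul_mem _ _ (hc.cycP_lm n)⟩

/-- The extra degeneracies. -/
def chS (hc : 𝓗.IsCocommutative) (n : ℕ) : 𝓗.hlin n (n + 1) :=
  ⟨hc.cycP (n + 1) ∘ₗ (𝓗.rgt.dgn (n + 1) (n + 1)).1,
    comp_mem_hlin ⟨_, hc.cycP_lm (n + 1)⟩ ⟨_, 𝓗.rgt.dgn_lm n⟩⟩

/-- The cyclic structure on the modules `C_{n+1}`. -/
def signedCyclic (hc : 𝓗.IsCocommutative) (hS : 𝓗.Involutive) :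
    SignedCyclic (fun n => (⟨n⟩ : 𝓗.ChDeg)) where
  d n i := chHom (chD 𝓗 n i)
  l n := chHom (hc.chL n)
  s n := chHom (hc.chS n)
  l_d_zero n := chFun_ext fun x => by
    change (-1 : k) ^ 0 • (𝓗.fsucc (n + 1) 0).1 ((-1 : k) ^ (n + 1) • hc.cycP (n + 1) x) =
      (-1 : k) ^ (n + 1) • (𝓗.fsucc (n + 1) (n + 1)).1 x
    rw [pow_zero, one_smul, map_smul, hc.fsucc_zero_cycP hS]
  l_d_succ n i hi := chFun_ext fun x => by
    change (-1 : k) ^ (i + 1) • (𝓗.fsucc (n + 1) (i + 1)).1 ((-1 : k) ^ (n + 1) •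
      hc.cycP (n + 1) x) =
      (-1 : k) ^ n • hc.cycP n ((-1 : k) ^ i • (𝓗.fsucc (n + 1) i).1 x)
    rw [map_smul, map_smul, hc.fsucc_succ_cycP hS n i hi, smul_smul, smul_smul]
    congr 1
    ring
  l_pow n := chFun_ext fun x => by
    refine (chFun_pow _ (n + 1) x).trans ?_
    change ((-1 : k) ^ n • hc.cycP n)^[n + 1] x = x
    rw [IsCommutative.neg_one_pow_smul_iterate, hc.cycP_iterate,
      (Nat.even_mul_succ_self n).neg_one_pow, one_smul]
  s_d_zero n := chFun_ext fun x => by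
    change (-1 : k) ^ 0 • (𝓗.fsucc (n + 1) 0).1
      (hc.cycP (n + 1) ((𝓗.rgt.dgn (n + 1) (n + 1)).1 x)) = x
    rw [pow_zero, one_smul, hc.fsucc_zero_cycP hS, 𝓗.fsucc_last_dgn]
  s_d_succ n i hi := chFun_ext fun x => by
    change (-1 : k) ^ (i + 1) • (𝓗.fsucc (n + 2) (i + 1)).1
      (hc.cycP (n + 2) ((𝓗.rgt.dgn (n + 2) (n + 2)).1 x)) =
      -(hc.cycP (n + 1) ((𝓗.rgt.dgn (n + 1) (n + 1)).1
        ((-1 : k) ^ i • (𝓗.fsucc (n + 1) i).1 x)))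
    rw [hc.fsucc_succ_cycP hS (n + 1) i (by omega), 𝓗.fsucc_dgn_last (n + 1) i (by omega), map_smul,
      map_smul, pow_succ, mul_neg_one, neg_smul]

variable (hc : 𝓗.IsCocommutative) (hS : 𝓗.Involutive)

theorem chFun_b (n : ℕ) (x : (𝓗.Ch (n + 2)).carrier) :
    𝓗.chFun ((hc.signedCyclic hS).b n) x = 𝓗.altd (n + 1) x := by
  rw [altd_apply]
  refine (LinearMap.congr_fun (chFun_sum _ _) x).trans ?_
  exact LinearMap.sum_apply _ _ _

theorem chFun_norm (n : ℕ) (x : (𝓗.Ch (n + 1)).carrier) :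
    𝓗.chFun ((hc.signedCyclic hS).norm n) x =
      ∑ j ∈ Finset.range (n + 1), ((-1 : k) ^ n • hc.cycP n)^[j] x := by
  refine (LinearMap.congr_fun (chFun_sum _ _) x).trans ((LinearMap.sum_apply _ _ _).trans ?_)
  exact Finset.sum_congr rfl fun j _ => chFun_pow _ j x

/-- The operators `1 - (-1)^(n+1) t`. -/
def oneSubCyc (n : ℕ) : Module.End k (𝓗.Ch (n + 2)).carrier :=
  LinearMap.id - (-1 : k) ^ (n + 1) • hc.cycP (n + 1)

theorem oneSubCyc_apply (n : ℕ) (y : (𝓗.Ch (n + 2)).carrier) :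
    hc.oneSubCyc n y = y - ((-1 : k) ^ (n + 1) • hc.cycP (n + 1)) y := rfl

theorem chFun_B (n : ℕ) (x : (𝓗.Ch (n + 1)).carrier) :
    𝓗.chFun ((hc.signedCyclic hS).B n) x =
      hc.oneSubCyc n (hc.cycP (n + 1)
        ((𝓗.rgt.dgn (n + 1) (n + 1)).1
          (∑ j ∈ Finset.range (n + 1), ((-1 : k) ^ n • hc.cycP n)^[j] x))) :=
  congrArg (fun y => hc.oneSubCyc n (hc.cycP (n + 1)
    ((𝓗.rgt.dgn (n + 1) (n + 1)).1 y))) (hc.chFun_norm hS n x)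

theorem fzero_cycP' (n : ℕ) (y : (𝓗.Ch (n + 1)).carrier) :
    𝓗.fzero n (hc.cycP n y) = 𝓗.cyc n (𝓗.fzero n y) :=
  (fzero_hlin ⟨_, hc.cycP_lm n⟩ y).trans (hc.fzero_cycP n _)

theorem fzero_signed_cycP (n : ℕ) (y : (𝓗.Ch (n + 1)).carrier) :
    𝓗.fzero n (((-1 : k) ^ n • hc.cycP n) y) = 𝓗.signedCyc n (𝓗.fzero n y) := by
  rw [LinearMap.smul_apply, map_smul, fzero_cycP', signedCyc, LinearMap.smul_apply]

theorem fzero_signed_cycP_iterate (n j : ℕ) (y : (𝓗.Ch (n + 1)).carrier) :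
    𝓗.fzero n (((-1 : k) ^ n • hc.cycP n)^[j] y) = (𝓗.signedCyc n ^ j) (𝓗.fzero n y) := by
  induction j generalizing y with
  | zero => rfl
  | succ j ih =>
    rw [Function.iterate_succ_apply, ih, fzero_signed_cycP, pow_succ]
    rfl

/-- The cyclic operator and the last degeneracy both descend along `d_0`, hence so does each factor
of `B`. -/
theorem fzero_chFun_B (n : ℕ) (y : (𝓗.Ch (n + 1)).carrier) :
    𝓗.fzero (n + 1) (𝓗.chFun ((hc.signedCyclic hS).B n) y) = 𝓗.chB n (𝓗.fzero n y) := by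
  have h1 : 𝓗.fzero n (∑ j ∈ Finset.range (n + 1), ((-1 : k) ^ n • hc.cycP n)^[j] y) =
      (∑ j ∈ Finset.range (n + 1), 𝓗.signedCyc n ^ j) (𝓗.fzero n y) := by
    rw [map_sum, LinearMap.sum_apply]
    exact Finset.sum_congr rfl fun j _ => hc.fzero_signed_cycP_iterate n j y
  have h2 : ∀ z, 𝓗.fzero (n + 1) (hc.oneSubCyc n z) =
      𝓗.fzero (n + 1) z - 𝓗.signedCyc (n + 1) (𝓗.fzero (n + 1) z) := by
    intro z
    rw [oneSubCyc_apply, map_sub, fzero_signed_cycP]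
  rw [chFun_B, h2, fzero_cycP', fzero_dgn, h1]
  rfl

/-- The mixed complex of the modules `C_{n+1}`. -/
def lifting : LiftingMixed (fun n => (⟨n⟩ : 𝓗.ChDeg)) :=
  (hc.signedCyclic hS).toLiftingMixed chLift
    (fun n => chFun_ext fun x =>
      (hc.chFun_b hS n _).trans ((congrArg _ (hc.chFun_b hS (n + 1) x)).trans
        (hc.altd_altd hS (n + 1) x)))
    (fun m n => chFun_ext_oneCh fun x => (chLift_oneCh _ x).trans (map_zero (𝓗.oneCh (n + 1))))
    (fun m n F hF => chFun_ext_oneCh fun x => by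
      -- With `F(1 ⊗ x)` a cycle, the contraction makes `1 ⊗ F(1 ⊗ x)` a preimage of it under
      -- `altd`.
      have h0 : 𝓗.altd (n + 1) (𝓗.chFun F (𝓗.oneCh m x)) = 0 :=
        (hc.chFun_b hS n _).symm.trans (LinearMap.congr_fun (congrArg 𝓗.chFun hF) (𝓗.oneCh m x))
      refine (hc.chFun_b hS (n + 1) (𝓗.chFun (chLift F) (𝓗.oneCh m x))).trans ?_
      rw [chLift_oneCh, altd_oneCh, h0, map_zero, sub_zero])

/-- The components of the splitting of the mixed complex `C_•`. -/
def chφ (n m : ℕ) : (𝓗.Ch m).carrier →ₗ[k] (𝓗.Ch n).carrier :=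
  𝓗.fzero n ∘ₗ 𝓗.chFun ((hc.lifting hS).Φ n m) ∘ₗ 𝓗.oneCh m

theorem bd_chφ (n m : ℕ) (x : (𝓗.Ch m).carrier) : 𝓗.bd n (hc.chφ hS (n + 1) m x) =
    𝓗.fzero n (𝓗.chFun ((hc.lifting hS).b n)
      (𝓗.chFun ((hc.lifting hS).Φ (n + 1) m) (𝓗.oneCh m x))) :=
  (𝓗.bd_fzero n _).trans (congrArg (𝓗.fzero n) (hc.chFun_b hS n _).symm)

theorem chB_chφ (n m : ℕ) (x : (𝓗.Ch m).carrier) : 𝓗.chB n (hc.chφ hS n m x) =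
    𝓗.fzero (n + 1) (𝓗.chFun ((hc.lifting hS).B n)
      (𝓗.chFun ((hc.lifting hS).Φ n m) (𝓗.oneCh m x))) :=
  (hc.fzero_chFun_B hS n _).symm

theorem chφ_bd (n m : ℕ) (x : (𝓗.Ch (m + 1)).carrier) : hc.chφ hS n m (𝓗.bd m x) =
    𝓗.fzero n (𝓗.chFun ((hc.lifting hS).Φ n m)
      (𝓗.chFun ((hc.lifting hS).b m) (𝓗.oneCh (m + 1) x))) := by
  refine Eq.trans ?_ (fzero_chFun ((hc.lifting hS).Φ n m) _).symm
  refine congrArg (hc.chφ hS n m) (Eq.trans ?_ (congrArg (𝓗.fzero m) (hc.chFun_b hS m _).symm))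
  rw [← bd_fzero, fzero_oneCh]

/-- The splitting of the mixed complex `C_•`. -/
def chainSplit : ChainSplit (C := fun n => (𝓗.Ch n).carrier) 𝓗.bd 𝓗.chB :=
  have hΦ : ∀ n m x, 𝓗.chFun ((hc.lifting hS).b n) (𝓗.chFun ((hc.lifting hS).Φ (n + 1) m) x) +
      𝓗.chFun ((hc.lifting hS).postΦ m n) x = 𝓗.chFun ((hc.lifting hS).preΦ n m) x :=
    fun n m x => LinearMap.congr_fun (congrArg 𝓗.chFun ((hc.lifting hS).Φ_b n m)) x
  { φ := hc.chφ hS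
    φ_self := fun n x => by
      have e : 𝓗.fzero n (𝓗.chFun ((hc.lifting hS).Φ n n) (𝓗.oneCh n x)) = x := by
        rw [(hc.lifting hS).Φ_self]
        exact 𝓗.fzero_oneCh n x
      exact e
    φ_of_gt := fun n m x h => by
      have e : 𝓗.fzero n (𝓗.chFun ((hc.lifting hS).Φ n m) (𝓗.oneCh m x)) = 0 := by
        rw [(hc.lifting hS).Φ_of_gt h]
        exact map_zero _
      exact e
    φ_odd := fun n m x h => by
      have e : 𝓗.fzero n (𝓗.chFun ((hc.lifting hS).Φ n m) (𝓗.oneCh m x)) = 0 := by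
        rw [(hc.lifting hS).Φ_odd n m h]
        exact map_zero _
      exact e
    b_φ_zero := fun m x => by
      rw [bd_chφ, chφ_bd]
      exact congrArg (𝓗.fzero 0) ((add_zero _).symm.trans (hΦ 0 (m + 1) (𝓗.oneCh (m + 1) x)))
    b_φ_succ_zero := fun n x => by
      rw [bd_chφ, chB_chφ, ← map_add]
      exact (congrArg (𝓗.fzero (n + 1)) (hΦ (n + 1) 0 (𝓗.oneCh 0 x))).trans (map_zero _)
    b_φ_succ_succ := fun n m x => by
      rw [bd_chφ, chB_chφ, ← map_add, chφ_bd]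
      exact congrArg (𝓗.fzero (n + 1)) (hΦ (n + 1) (m + 1) (𝓗.oneCh (m + 1) x)) }

end IsCocommutative

/-! ### Naturality of the splitting of chains. -/

namespace Hom

variable {Al' Ar' H' : Type u} [Ring Al'] [Algebra k Al'] [Ring Ar'] [Algebra k Ar'] [Ring H']
  [Algebra k H'] {𝓗' : HopfAlgebroid k Al' Ar' H'} (f : 𝓗.Hom 𝓗')

theorem extMap_lm {M : LMod k Ar} {M' : LMod k Ar'} (g : f.SHom M M') (h : H)
    (y : (𝓗.rgt.ext M).carrier) :
    (f.extMap g).1 (𝓗.rgt.lm M h y) = 𝓗'.rgt.lm M' (f.F h) ((f.extMap g).1 y) := by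
  refine LinearMap.congr_fun (f := (f.extMap g).1 ∘ₗ 𝓗.rgt.lm M h)
    (g := 𝓗'.rgt.lm M' (f.F h) ∘ₗ (f.extMap g).1) (STRing.ext_ext _ fun u m => ?_) y
  exact congrArg (fun z => 𝓗'.rgt.em M' z (g.1 m)) (map_mul f.F h u)

theorem chMap_chAct (n : ℕ) (h : H) (y : (𝓗.Ch (n + 1)).carrier) :
    (f.chMap (n + 1)).1 (𝓗.chAct n h y) = 𝓗'.chAct n (f.F h) ((f.chMap (n + 1)).1 y) :=
  f.extMap_lm (f.chMap n) h y

theorem chMap_oneCh (n : ℕ) (x : (𝓗.Ch n).carrier) :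
    (f.chMap (n + 1)).1 (𝓗.oneCh n x) = 𝓗'.oneCh n ((f.chMap n).1 x) :=
  congrArg (fun z => 𝓗'.rgt.em (𝓗'.Ch n) z ((f.chMap n).1 x)) (map_one f.F)

theorem chMap_altd (n : ℕ) (x : (𝓗.Ch (n + 1)).carrier) :
    (f.chMap n).1 (𝓗.altd n x) = 𝓗'.altd n ((f.chMap (n + 1)).1 x) := by
  rw [altd_apply, altd_apply, map_sum]
  refine Finset.sum_congr rfl fun i _ => ?_
  rw [map_smul, chMap_fsucc]

variable (hc : 𝓗.IsCocommutative) (hS : 𝓗.Involutive) (hc' : 𝓗'.IsCocommutative)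
  (hS' : 𝓗'.Involutive)

theorem extMap_comulS {M : LMod k Ar} {M' : LMod k Ar'} (g : f.SHom M M')
    (y : (𝓗.rgt.ext M).carrier) :
    (f.extMap (f.extMap g)).1 (hc.comulS M y) = hc'.comulS M' ((f.extMap g).1 y) := by
  refine LinearMap.congr_fun (f := (f.extMap (f.extMap g)).1 ∘ₗ hc.comulS M)
    (g := hc'.comulS M' ∘ₗ (f.extMap g).1) (STRing.ext_ext _ fun u m => ?_) y
  obtain ⟨X, hX⟩ := 𝓗.lft.mkL_surjective (𝓗.lft.Δ u)
  change (f.extMap (f.extMap g)).1 (hc.spliceSl M (𝓗.lft.Δ u) m) =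
    hc'.spliceSl M' (𝓗'.lft.Δ (f.F u)) (g.1 m)
  rw [f.map_Δl u X hX, ← hX]
  refine tmul_congr ((f.extMap (f.extMap g)).1 ∘ₗ (hc.spliceSl M).flip m ∘ₗ 𝓗.lft.mkL)
    ((hc'.spliceSl M').flip (g.1 m) ∘ₗ 𝓗'.lft.mkL ∘ₗ
      TensorProduct.map f.F.toLinearMap f.F.toLinearMap) (fun x y => ?_) X
  exact congrArg (fun z => 𝓗'.rgt.em (𝓗'.rgt.ext M') z (𝓗'.rgt.em M' (f.F y) (g.1 m)))
    (f.map_S x).symm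

theorem chMap_cycP : ∀ (n : ℕ) (y : (𝓗.Ch (n + 1)).carrier),
    (f.chMap (n + 1)).1 (hc.cycP n y) = hc'.cycP n ((f.chMap (n + 1)).1 y)
  | 0, _ => rfl
  | n + 1, y => by
    refine LinearMap.congr_fun (f := (f.chMap (n + 2)).1 ∘ₗ hc.cycP (n + 1))
      (g := hc'.cycP (n + 1) ∘ₗ (f.chMap (n + 2)).1) (STRing.ext_ext _ fun u m => ?_) y
    refine (f.chMap_chAct (n + 1) u _).trans (congrArg (𝓗'.chAct (n + 1) (f.F u)) ?_)
    refine (f.extMap_comulS hc hc' (f.chMap n) ((𝓗.tsucc n).1 m)).trans ?_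
    exact congrArg (hc'.comulS (𝓗'.Ch n)) (f.chMap_tsucc n m)

theorem chMap_signed_cycP_iterate (n j : ℕ) (y : (𝓗.Ch (n + 1)).carrier) :
    (f.chMap (n + 1)).1 (((-1 : k) ^ n • hc.cycP n)^[j] y) =
      ((-1 : k) ^ n • hc'.cycP n)^[j] ((f.chMap (n + 1)).1 y) := by
  induction j generalizing y with
  | zero => rfl
  | succ j ih =>
    rw [Function.iterate_succ_apply, Function.iterate_succ_apply, ih, LinearMap.smul_apply,
      LinearMap.smul_apply, map_smul, f.chMap_cycP hc hc']

theorem chMap_chFun_B (n : ℕ) (y : (𝓗.Ch (n + 1)).carrier) :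
    (f.chMap (n + 2)).1 (𝓗.chFun ((hc.signedCyclic hS).B n) y) =
      𝓗'.chFun ((hc'.signedCyclic hS').B n) ((f.chMap (n + 1)).1 y) := by
  have h1 : ∀ z, (f.chMap (n + 2)).1 (hc.oneSubCyc n z) =
      hc'.oneSubCyc n ((f.chMap (n + 2)).1 z) := by
    intro z
    rw [IsCocommutative.oneSubCyc_apply, IsCocommutative.oneSubCyc_apply, map_sub,
      LinearMap.smul_apply, LinearMap.smul_apply, map_smul, f.chMap_cycP hc hc']
  rw [hc.chFun_B, hc'.chFun_B, h1, f.chMap_cycP hc hc', chMap_dgn, map_sum]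
  simp only [f.chMap_signed_cycP_iterate hc hc']

open IsCocommutative in
theorem chMap_chLift {m n : ℕ} {F : (⟨m⟩ : 𝓗.ChDeg) ⟶ ⟨n⟩} {F' : (⟨m⟩ : 𝓗'.ChDeg) ⟶ ⟨n⟩}
    (h : ∀ y, (f.chMap (n + 1)).1 (𝓗.chFun F y) = 𝓗'.chFun F' ((f.chMap (m + 1)).1 y))
    (y : (𝓗.Ch (m + 1)).carrier) :
    (f.chMap (n + 2)).1 (𝓗.chFun (chLift F) y) =
      𝓗'.chFun (chLift F') ((f.chMap (m + 1)).1 y) := by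
  refine LinearMap.congr_fun (f := (f.chMap (n + 2)).1 ∘ₗ 𝓗.chFun (chLift F))
    (g := 𝓗'.chFun (chLift F') ∘ₗ (f.chMap (m + 1)).1) (STRing.ext_ext _ fun u x => ?_) y
  have e : (f.chMap (n + 2)).1
      (𝓗.chAct (n + 1) u (𝓗.oneCh (n + 1) (𝓗.chFun F (𝓗.oneCh m x)))) =
      𝓗'.chAct (n + 1) (f.F u) (𝓗'.oneCh (n + 1) (𝓗'.chFun F' (𝓗'.oneCh m ((f.chMap m).1 x)))) := by
    refine (f.chMap_chAct (n + 1) u _).trans (congrArg (𝓗'.chAct (n + 1) (f.F u)) ?_)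
    refine (f.chMap_oneCh (n + 1) _).trans (congrArg (𝓗'.oneCh (n + 1)) ?_)
    exact (h _).trans (congrArg (𝓗'.chFun F') (f.chMap_oneCh m x))
  exact e

/-- No choices enter `Φ`: it is built from `b`, `B`, composition, subtraction and the canonical lift
`1 ⊗ x ↦ 1 ⊗ F(1 ⊗ x)`. The relation of commuting with the induced maps is preserved by each of
these. -/
theorem chMap_chFun_Φ (n m : ℕ) (y : (𝓗.Ch (m + 1)).carrier) :
    (f.chMap (n + 1)).1 (𝓗.chFun ((hc.lifting hS).Φ n m) y) =
      𝓗'.chFun ((hc'.lifting hS').Φ n m) ((f.chMap (m + 1)).1 y) := by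
  refine (hc.lifting hS).Φ_rel (hc'.lifting hS')
    (fun {m n} F F' => ∀ y, (f.chMap (n + 1)).1 (𝓗.chFun F y) =
      𝓗'.chFun F' ((f.chMap (m + 1)).1 y))
    (fun n y => rfl) (fun m n y => map_zero (f.chMap (n + 1)).1) ?_ ?_ ?_ ?_ ?_ n m y
  · intro m n p F G F' G' hF hG y
    exact (hG _).trans (congrArg (𝓗'.chFun G') (hF y))
  · intro m n F G F' G' hF hG y
    exact (map_sub (f.chMap (n + 1)).1 _ _).trans (congrArg₂ _ (hF y) (hG y))
  · intro m n F F' hF y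
    exact f.chMap_chLift hF y
  · intro n y
    exact (congrArg (f.chMap (n + 1)).1 (hc.chFun_b hS n y)).trans
      ((f.chMap_altd (n + 1) y).trans (hc'.chFun_b hS' n _).symm)
  · intro n y
    exact f.chMap_chFun_B hc hS hc' hS' n y

theorem chMap_chφ (n m : ℕ) (x : (𝓗.Ch m).carrier) :
    (f.chMap n).1 (hc.chφ hS n m x) = hc'.chφ hS' n m ((f.chMap m).1 x) := by
  refine (f.chMap_fzero n _).trans (congrArg (𝓗'.fzero n) ?_)
  exact (f.chMap_chFun_Φ hc hS hc' hS' n m _).trans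
    (congrArg (𝓗'.chFun ((hc'.lifting hS').Φ n m)) (f.chMap_oneCh m x))

end Hom

namespace IsCocommutative

/-- For a cocommutative Hopf algebroid cyclic homology is a sum of Hochschild homologies. -/
noncomputable def equiv (hc : 𝓗.IsCocommutative) (hS : 𝓗.Involutive) (n : ℕ) :
    𝓗.HC n ≃ₗ[k] ⨁ i : Fin (n / 2 + 1), 𝓗.HH (n - 2 * i) :=
  (hc.chainSplit hS).equiv n

theorem equiv_HCMap {Al' Ar' H' : Type u} [Ring Al'] [Algebra k Al'] [Ring Ar'] [Algebra k Ar']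
    [Ring H'] [Algebra k H'] {𝓗' : HopfAlgebroid k Al' Ar' H'} (f : 𝓗.Hom 𝓗')
    (hc : 𝓗.IsCocommutative) (hS : 𝓗.Involutive) (hc' : 𝓗'.IsCocommutative)
    (hS' : 𝓗'.Involutive) (n : ℕ) (x : 𝓗.HC n) (i : Fin (n / 2 + 1)) :
    hc'.equiv hS' n (f.HCMap n x) i = f.HHMap (n - 2 * i) (hc.equiv hS n x i) :=
  (hc.chainSplit hS).equiv_nat (hc'.chainSplit hS') f.chMap_bd f.chMap_chB
    (f.chMap_chφ hc hS hc' hS') n x i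

end IsCocommutative
end HopfAlgebroid
end HopfAlgd

theorem theorem2p10 {k : Type v} [CommRing k] :
    (∀ (A H : Type u) [CommRing A] [Algebra k A] [CommRing H] [Algebra k H]
      (𝓗 : HopfAlgd.HopfAlgebroid k A A H),
      𝓗.Involutive → 𝓗.IsCommutative → 𝓗.FlatRight →
      ∀ n : ℕ, Nonempty (𝓗.HCco n ≃ₗ[k] ⨁ i : Fin (n / 2 + 1), 𝓗.HHco (n - 2 * i))) ∧
    (∃ Φ : ∀ (Al Ar H : Type u) [Ring Al] [Algebra k Al] [Ring Ar] [Algebra k Ar]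
        [Ring H] [Algebra k H] (𝓗 : HopfAlgd.HopfAlgebroid k Al Ar H),
        𝓗.Involutive → 𝓗.IsCocommutative → 𝓗.ProjectiveLeft →
        ∀ n : ℕ, 𝓗.HC n ≃ₗ[k] ⨁ i : Fin (n / 2 + 1), 𝓗.HH (n - 2 * i),
      ∀ (Al Ar H Al' Ar' H' : Type u) [Ring Al] [Algebra k Al] [Ring Ar] [Algebra k Ar]
        [Ring H] [Algebra k H] [Ring Al'] [Algebra k Al'] [Ring Ar'] [Algebra k Ar']
        [Ring H'] [Algebra k H']
        (𝓗 : HopfAlgd.HopfAlgebroid k Al Ar H) (𝓗' : HopfAlgd.HopfAlgebroid k Al' Ar' H')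
        (hS : 𝓗.Involutive) (hc : 𝓗.IsCocommutative) (hp : 𝓗.ProjectiveLeft)
        (hS' : 𝓗'.Involutive) (hc' : 𝓗'.IsCocommutative) (hp' : 𝓗'.ProjectiveLeft)
        (f : 𝓗.Hom 𝓗') (n : ℕ) (x : 𝓗.HC n) (i : Fin (n / 2 + 1)),
        Φ Al' Ar' H' 𝓗' hS' hc' hp' n (f.HCMap n x) i =
          f.HHMap (n - 2 * i) (Φ Al Ar H 𝓗 hS hc hp n x i)) :=
  ⟨fun _ _ _ _ _ _ _ _ hc _ n => ⟨hc.equiv n⟩,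
    fun _ _ _ _ _ _ _ _ _ _ hS hc _ n => hc.equiv hS n,
    fun _ _ _ _ _ _ _ _ _ _ _ _ _ _ _ _ _ _ _ _ hS hc _ hS' hc' _ f n x i =>
      HopfAlgd.HopfAlgebroid.IsCocommutative.equiv_HCMap f hc hS hc' hS' n x i⟩
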